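/- **Corollary (The Jacobian of the Exponential Map).** Let $M$ be a complete smooth Riemannian manifold and let $x, y \in M$ be points that are joined by a unique length minimizing geodesic $\gamma = \gamma_{xy} : [0,1] \to M$, $\gamma(0) = x$, $\gamma(1) = y$ (parametrized by $[0,1]$ with constant speed). Let $T_\gamma H_{xy}(M) = H^1_0([0,1], \gamma^*TM)$ be the Hilbert space of absolutely continuous vector fields $X$ along $\gamma$ with $X(0) = 0$, $X(1) = 0$ and $\int_0^1 |\nabla_s X|^2\,ds < \infty$, with the $H^1$ metric $$(X, Y)_{H^1} = \int_0^1 \langle \nabla_s X(s), \nabla_s Y(s)\rangle \, ds .$$ Let $S(c) = \frac12 \int_0^1 |\dot c(s)|^2\, ds$ be the action, and let $\nabla^2 S|_\gamma$ be its Hessian at $\gamma$ on paths with fixed end points: the bounded bilinear form on $H^1_0([0,1], \gamma^*TM)$ with $$\nabla^2 S|_\gamma[X, Y] = \frac{\partial^2}{\partial u\, \partial v}\Big|_{u=v=0} S(\alpha_{u,v})$$ for each smooth two-parameter variation $\alpha_{u,v}$ of $\gamma = \alpha_{0,0}$ with fixed end points and variation fields $X = \partial_u \alpha|_{u=v=0}$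 and $Y = \partial_v \alpha|_{u=v=0}$. Then there is exactly one bounded operator $T$ on $H^1_0([0,1], \gamma^*TM)$ that represents the Hessian with respect to the $H^1$ metric, $\nabla^2 S|_\gamma[X, Y] = (X, TY)_{H^1}$. It is symmetric, $T - \mathrm{id}$ is trace-class, and its Fredholm determinant $$\det(\nabla^2 S|_\gamma) := \det(T) = \prod_j (1 + \lambda_j),$$ where $\lambda_j$ are the eigenvalues of $T - \mathrm{id}$ repeated with multiplicity, satisfies $$\det(\nabla^2 S|_{\gamma}) = J(x, y),$$ where $J(x,y) = \det\bigl(d\exp_x|_{\dot\gamma(0)} : T_xM \to T_yM\bigr)$ is the Jacobian determinant of the Riemannian exponential map; here the determinant of a linear map $A$ between two Euclidean vector spaces of the same dimension is formed with the metrics, i.e. $\sqrt{\det(A^*A)}$. -/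

import Mathlib

open Set MeasureTheory Filter Manifold Bundle
open scoped ContDiff Topology

noncomputable section

namespace PathGeometry

/-! ### Riemannian geometry in charts -/

section Charts

variable (n : ℕ) {M : Type*} [TopologicalSpace M] [ChartedSpace (EuclideanSpace ℝ (Fin n)) M]

/-- The velocity vector `γ'(s)` of a curve. -/
def velocity (γ : ℝ → M) (s : ℝ) : TangentSpace (𝓡 n) (γ s) :=
  mfderiv 𝓘(ℝ, ℝ) (𝓡 n) γ s (1 : ℝ)

/-- A smooth curve in `M`, defined on the whole real line. -/
abbrev SmoothCurve (M : Type*) [TopologicalSpace M] [ChartedSpace (EuclideanSpace ℝ (Fin n)) M] :=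
  ContMDiffMap 𝓘(ℝ, ℝ) (𝓡 n) ℝ M ∞

variable [IsManifold (𝓡 n) ∞ M]

/-- The components of a tangent vector `v` at `q` in the coordinates given by the preferred chart
at `p` (meaningful for `q` in the domain of that chart, zero otherwise). -/
def coord (p q : M) : TangentSpace (𝓡 n) q →L[ℝ] EuclideanSpace ℝ (Fin n) :=
  (trivializationAt (EuclideanSpace ℝ (Fin n)) (TangentSpace (𝓡 n)) p).continuousLinearMapAt ℝ q

/-- The coordinate vector field `∂ᵢ` of the preferred chart at `p`, evaluated at `q`
(meaningful for `q` in the domain of that chart, zero otherwise). -/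
def coordField (p : M) (i : Fin n) (q : M) : TangentSpace (𝓡 n) q :=
  (trivializationAt (EuclideanSpace ℝ (Fin n)) (TangentSpace (𝓡 n)) p).symmL ℝ q
    (EuclideanSpace.single i (1 : ℝ))

lemma eq_sum_coord {p q : M}
    (hq : q ∈ (trivializationAt (EuclideanSpace ℝ (Fin n)) (TangentSpace (𝓡 n)) p).baseSet)
    (v : TangentSpace (𝓡 n) q) : v = ∑ i, coord n p q v i • coordField n p i q := by
  have h1 : (trivializationAt (EuclideanSpace ℝ (Fin n)) (TangentSpace (𝓡 n)) p).symmL ℝ q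
      (coord n p q v) = v :=
    Bundle.Trivialization.symmL_continuousLinearMapAt _ hq v
  have h2 : coord n p q v = ∑ i, coord n p q v i • EuclideanSpace.single i (1 : ℝ) := by
    ext j
    simp [Finset.sum_apply, Pi.single_apply]
  conv_lhs => rw [← h1, h2]
  simp only [map_sum, map_smul]
  rfl

variable [RiemannianBundle (fun x : M => TangentSpace (𝓡 n) x)]

/-- The matrix `g_{ij}` of the metric in the preferred chart at `p`, as a function of the
coordinates `z`. -/
def metricCoeff (p : M) (z : EuclideanSpace ℝ (Fin n)) : Matrix (Fin n) (Fin n) ℝ :=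
  Matrix.of fun i j =>
    inner ℝ (coordField n p i ((extChartAt (𝓡 n) p).symm z))
      (coordField n p j ((extChartAt (𝓡 n) p).symm z))

/-- The partial derivative `∂_l g_{ij}` in the preferred chart at `p`. -/
def metricPartial (p : M) (l i j : Fin n) (z : EuclideanSpace ℝ (Fin n)) : ℝ :=
  fderiv ℝ (fun w => metricCoeff n p w i j) z (EuclideanSpace.single l (1 : ℝ))

/-- The Christoffel symbols `Γ^k_{ij}` of the Levi-Civita connection in the preferred chart
at `p`. -/
def christoffel (p : M) (k i j : Fin n) (z : EuclideanSpace ℝ (Fin n)) : ℝ :=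
  (1 / 2) * ∑ l, (metricCoeff n p z)⁻¹ k l *
    (metricPartial n p i j l z + metricPartial n p j i l z - metricPartial n p l i j z)

/-- The covariant derivative `∇_s X` of a vector field `X` along a curve `γ`; at the time `s` it is
computed in the preferred chart at `γ(s)`:
`(∇_s X)^k = dX^k/ds + Γ^k_{ij} (γ')^i X^j`. -/
def covDeriv (γ : ℝ → M) (X : ∀ s, TangentSpace (𝓡 n) (γ s)) (s : ℝ) :
    TangentSpace (𝓡 n) (γ s) :=
  ∑ k, (deriv (fun t => coord n (γ s) (γ t) (X t)) s k +
      ∑ i, ∑ j, christoffel n (γ s) k i j (extChartAt (𝓡 n) (γ s) (γ s)) *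
        coord n (γ s) (γ s) (velocity n γ s) i * coord n (γ s) (γ s) (X s) j) •
    coordField n (γ s) k (γ s)

/-- A smooth curve `γ` is a geodesic if `∇_s γ' = 0`. -/
def IsGeodesic (γ : ℝ → M) : Prop := ∀ s, covDeriv n γ (velocity n γ) s = 0

/-- `γ` is a length minimizing geodesic from `x` to `y` in time one. -/
structure IsMinimizingGeodesic (x y : M) (γ : SmoothCurve n M) : Prop where
  geodesic : IsGeodesic n γ
  source : γ 0 = x
  target : γ 1 = y
  minimizing : pathELength (𝓡 n) γ 0 1 = riemannianEDist (𝓡 n) x y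

open Classical in
/-- The Riemannian exponential map: `exp_x(v) = c(1)`, where `c` is the geodesic with `c(0) = x`
and `c'(0) = v`. (On a complete manifold such a geodesic `c : ℝ → M` exists and is unique.) -/
def riemannianExp (x : M) (v : TangentSpace (𝓡 n) x) : M :=
  if h : ∃ c : SmoothCurve n M, IsGeodesic n c ∧
      (⟨c 0, velocity n c 0⟩ : TangentBundle (𝓡 n) M) = ⟨x, v⟩
  then h.choose 1 else x

instance (x : M) : FiniteDimensional ℝ (TangentSpace (𝓡 n) x) :=
  inferInstanceAs (FiniteDimensional ℝ (EuclideanSpace ℝ (Fin n)))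

/-- The differential `d exp_x|_v : T_xM → T_{exp_x(v)}M`. -/
def dExp (x : M) (v : TangentSpace (𝓡 n) x) :
    TangentSpace (𝓡 n) x →L[ℝ] TangentSpace (𝓡 n) (riemannianExp n x v) :=
  mfderiv 𝓘(ℝ, TangentSpace (𝓡 n) x) (𝓡 n) (fun w : TangentSpace (𝓡 n) x => riemannianExp n x w) v

/-- The Jacobian determinant of the exponential map at `v ∈ T_xM`: the determinant of
`d exp_x|_v : T_xM → T_{exp_x(v)}M` formed with the metric, i.e. `√det (A^* A)` for
`A = d exp_x|_v`. -/
def expJacobian (x : M) (v : TangentSpace (𝓡 n) x) : ℝ :=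
  (dExp n x v : TangentSpace (𝓡 n) x →ₗ[ℝ] TangentSpace (𝓡 n) (riemannianExp n x v)).normDet

/-- The action `S(c) = ½ ∫₀¹ |c'(s)|² ds`. -/
def action (c : ℝ → M) : ℝ := (1 / 2) * ∫ s in (0 : ℝ)..1, ‖velocity n c s‖ ^ 2

end Charts

/-! ### The tangent space of the path space -/

section Sobolev

variable {n : ℕ} {M : Type*} [TopologicalSpace M] [ChartedSpace (EuclideanSpace ℝ (Fin n)) M]
  [IsManifold (𝓡 n) ∞ M] [RiemannianBundle (fun x : M => TangentSpace (𝓡 n) x)]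

/-- `X` belongs to `H¹₀([0,1], γ^*TM)`: it is absolutely continuous (in local trivializations of
the tangent bundle), vanishes at `0` and at `1`, and has a square integrable covariant derivative.
A field on `[0,1]` that vanishes at the end points is extended to `ℝ` by zero, so that it is
determined by its values on `[0,1]`. -/
structure IsH10 (γ : ℝ → M) (X : ∀ s, TangentSpace (𝓡 n) (γ s)) : Prop where
  support : ∀ s, s ∉ Ioo (0 : ℝ) 1 → X s = 0
  absCont : ∀ s₀, ∃ ε > 0,
    AbsolutelyContinuousOnInterval (fun s => coord n (γ s₀) (γ s) (X s)) (s₀ - ε) (s₀ + ε)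
  ae_differentiable : ∀ᵐ s : ℝ, DifferentiableAt ℝ (fun t => coord n (γ s) (γ t) (X t)) s
  memLp : ∀ s₀, ∃ ε > 0,
    MemLp (fun s => coord n (γ s₀) (γ s) (covDeriv n γ X s)) 2
      (volume.restrict (Ioo (s₀ - ε) (s₀ + ε)))

lemma covDeriv_add {γ : ℝ → M} {X Y : ∀ s, TangentSpace (𝓡 n) (γ s)} {s : ℝ}
    (hX : DifferentiableAt ℝ (fun t => coord n (γ s) (γ t) (X t)) s)
    (hY : DifferentiableAt ℝ (fun t => coord n (γ s) (γ t) (Y t)) s) :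
    covDeriv n γ (X + Y) s = covDeriv n γ X s + covDeriv n γ Y s := by
  have h : deriv (fun t => coord n (γ s) (γ t) ((X + Y) t)) s =
      deriv (fun t => coord n (γ s) (γ t) (X t)) s +
        deriv (fun t => coord n (γ s) (γ t) (Y t)) s := by
    rw [← deriv_fun_add hX hY]
    simp only [Pi.add_apply, map_add]
  unfold covDeriv
  rw [h, ← Finset.sum_add_distrib]
  refine Finset.sum_congr rfl fun k _ => ?_
  rw [← add_smul]
  congr 1
  simp only [Pi.add_apply, map_add, PiLp.add_apply, mul_add, Finset.sum_add_distrib]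
  ring

lemma covDeriv_smul {γ : ℝ → M} (a : ℝ) (X : ∀ s, TangentSpace (𝓡 n) (γ s)) (s : ℝ) :
    covDeriv n γ (a • X) s = a • covDeriv n γ X s := by
  have h : deriv (fun t => coord n (γ s) (γ t) ((a • X) t)) s =
      a • deriv (fun t => coord n (γ s) (γ t) (X t)) s := by
    rw [← deriv_fun_const_smul_field]
    simp only [Pi.smul_apply, map_smul]
  unfold covDeriv
  rw [h, Finset.smul_sum]
  refine Finset.sum_congr rfl fun k _ => ?_
  rw [smul_smul]
  congr 1
  simp only [Pi.smul_apply, map_smul, PiLp.smul_apply, smul_eq_mul, mul_add, Finset.mul_sum]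
  congr 1
  refine Finset.sum_congr rfl fun i _ => Finset.sum_congr rfl fun j _ => ?_
  ring

lemma IsH10.add {γ : ℝ → M} {X Y : ∀ s, TangentSpace (𝓡 n) (γ s)}
    (hX : IsH10 γ X) (hY : IsH10 γ Y) : IsH10 γ (X + Y) where
  support s hs := by simp [hX.support s hs, hY.support s hs]
  absCont s₀ := by
    obtain ⟨ε, hε, h⟩ := hX.absCont s₀
    obtain ⟨δ, hδ, k⟩ := hY.absCont s₀
    have hm := lt_min hε hδ
    refine ⟨min ε δ, hm, ?_⟩
    have e1 := min_le_left ε δ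
    have e2 := min_le_right ε δ
    have h' := h.mono (c := s₀ - min ε δ) (d := s₀ + min ε δ) (by
      rw [uIcc_of_le (by linarith), uIcc_of_le (by linarith)]
      exact Icc_subset_Icc (by linarith) (by linarith))
    have k' := k.mono (c := s₀ - min ε δ) (d := s₀ + min ε δ) (by
      rw [uIcc_of_le (by linarith), uIcc_of_le (by linarith)]
      exact Icc_subset_Icc (by linarith) (by linarith))
    have e : (fun s => coord n (γ s₀) (γ s) ((X + Y) s)) =
        (fun s => coord n (γ s₀) (γ s) (X s)) + fun s => coord n (γ s₀) (γ s) (Y s) := by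
      ext1 s
      simp
    rw [e]
    exact h'.add k'
  ae_differentiable := by
    filter_upwards [hX.ae_differentiable, hY.ae_differentiable] with s h k
    simpa using h.fun_add k
  memLp s₀ := by
    obtain ⟨ε, hε, h⟩ := hX.memLp s₀
    obtain ⟨δ, hδ, k⟩ := hY.memLp s₀
    refine ⟨min ε δ, lt_min hε hδ, ?_⟩
    have e1 := min_le_left ε δ
    have e2 := min_le_right ε δ
    have h' := h.mono_measure (Measure.restrict_mono
      (Ioo_subset_Ioo (by linarith) (by linarith) :
        Ioo (s₀ - min ε δ) (s₀ + min ε δ) ⊆ Ioo (s₀ - ε) (s₀ + ε)) le_rfl)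
    have k' := k.mono_measure (Measure.restrict_mono
      (Ioo_subset_Ioo (by linarith) (by linarith) :
        Ioo (s₀ - min ε δ) (s₀ + min ε δ) ⊆ Ioo (s₀ - δ) (s₀ + δ)) le_rfl)
    refine (h'.add k').ae_eq (ae_restrict_of_ae ?_)
    filter_upwards [hX.ae_differentiable, hY.ae_differentiable] with s h k
    simp [covDeriv_add h k]

lemma IsH10.smul {γ : ℝ → M} {X : ∀ s, TangentSpace (𝓡 n) (γ s)}
    (hX : IsH10 γ X) (a : ℝ) : IsH10 γ (a • X) where
  support s hs := by simp [hX.support s hs]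
  absCont s₀ := by
    obtain ⟨ε, hε, h⟩ := hX.absCont s₀
    refine ⟨ε, hε, ?_⟩
    have e : (fun s => coord n (γ s₀) (γ s) ((a • X) s)) =
        a • fun s => coord n (γ s₀) (γ s) (X s) := by
      ext1 s
      simp
    rw [e]
    exact h.const_smul a
  ae_differentiable := by
    filter_upwards [hX.ae_differentiable] with s h
    simpa using h.fun_const_smul a
  memLp s₀ := by
    obtain ⟨ε, hε, h⟩ := hX.memLp s₀
    refine ⟨ε, hε, ?_⟩
    have e : (fun s => coord n (γ s₀) (γ s) (covDeriv n γ (a • X) s)) =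
        a • fun s => coord n (γ s₀) (γ s) (covDeriv n γ X s) := by
      ext1 s
      simp [covDeriv_smul]
    rw [e]
    exact h.const_smul a

lemma IsH10.zero (γ : ℝ → M) : IsH10 γ (0 : ∀ s, TangentSpace (𝓡 n) (γ s)) where
  support s hs := rfl
  absCont s₀ := ⟨1, one_pos, by
    have h : AbsolutelyContinuousOnInterval (fun _ : ℝ => (0 : EuclideanSpace ℝ (Fin n)))
        (s₀ - 1) (s₀ + 1) :=
      (LipschitzWith.const (0 : EuclideanSpace ℝ (Fin n))).lipschitzOnWith
        |>.absolutelyContinuousOnInterval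
    simpa using h⟩
  ae_differentiable := by simp
  memLp s₀ := ⟨1, one_pos, by
    have h : covDeriv n γ (0 : ∀ s, TangentSpace (𝓡 n) (γ s)) = 0 := by
      have := covDeriv_smul (γ := γ) 0 (0 : ∀ s, TangentSpace (𝓡 n) (γ s))
      ext1 s
      simpa using this s
    simp [h]⟩

/-- The tangent space `T_γ H_{xy}(M) = H¹₀([0,1], γ^*TM)` of the space of finite energy paths, as
a linear space. -/
def h10Submodule (γ : SmoothCurve n M) : Submodule ℝ (∀ s, TangentSpace (𝓡 n) (γ s)) where
  carrier := {X | IsH10 γ X}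
  add_mem' := IsH10.add
  zero_mem' := IsH10.zero γ
  smul_mem' a _ hX := hX.smul a

/-- The space `T_γ H_{xy}(M) = H¹₀([0,1], γ^*TM)`; it carries the `H¹` metric, see below. -/
def PathTangent (γ : SmoothCurve n M) : Type _ := h10Submodule γ

namespace PathTangent

instance (γ : SmoothCurve n M) : AddCommGroup (PathTangent γ) :=
  inferInstanceAs (AddCommGroup (h10Submodule γ))

instance (γ : SmoothCurve n M) : Module ℝ (PathTangent γ) :=
  inferInstanceAs (Module ℝ (h10Submodule γ))

/-- The vector field along `γ` given by an element of `T_γ H_{xy}(M)`. -/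
def field {γ : SmoothCurve n M} (X : PathTangent γ) : ∀ s, TangentSpace (𝓡 n) (γ s) := X.1

lemma isH10 {γ : SmoothCurve n M} (X : PathTangent γ) : IsH10 γ X.field := X.2

/-- The `H¹` metric `(X, Y)_{H¹} = ∫₀¹ ⟨∇_s X, ∇_s Y⟩ ds`. -/
def h1Inner {γ : SmoothCurve n M} (X Y : PathTangent γ) : ℝ :=
  ∫ s in Icc (0 : ℝ) 1, inner ℝ (covDeriv n γ X.field s) (covDeriv n γ Y.field s)

section Metric

variable [IsContMDiffRiemannianBundle (𝓡 n) ∞ (EuclideanSpace ℝ (Fin n))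
  (fun x : M => TangentSpace (𝓡 n) x)]

lemma continuousOn_metric (γ : SmoothCurve n M) (p : M) (i j : Fin n) :
    ContinuousOn (fun s => (inner ℝ (coordField n p i (γ s)) (coordField n p j (γ s)) : ℝ))
      (γ ⁻¹' (trivializationAt (EuclideanSpace ℝ (Fin n)) (TangentSpace (𝓡 n)) p).baseSet) := by
  have hγ : Continuous γ := γ.contMDiff.continuous
  have key : ∀ i, ContinuousOn (fun s => (⟨γ s, coordField n p i (γ s)⟩ : TangentBundle (𝓡 n) M))
      (γ ⁻¹' (trivializationAt (EuclideanSpace ℝ (Fin n)) (TangentSpace (𝓡 n)) p).baseSet) := by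
    intro i
    have := (trivializationAt (EuclideanSpace ℝ (Fin n)) (TangentSpace (𝓡 n) (M := M)) p)
      |>.continuousOn_symm
    have h2 := this.comp (f := fun s => (γ s, EuclideanSpace.single i (1 : ℝ)))
      (s := γ ⁻¹' (trivializationAt (EuclideanSpace ℝ (Fin n)) (TangentSpace (𝓡 n)) p).baseSet)
      (hγ.prodMk continuous_const).continuousOn (fun s hs => ⟨hs, mem_univ _⟩)
    refine h2.congr fun s hs => ?_
    simp only [Function.comp_apply, coordField]
    rw [Bundle.Trivialization.symmL_apply _ hs]
  have : IsContinuousRiemannianBundle (EuclideanSpace ℝ (Fin n))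
      (fun x : M => TangentSpace (𝓡 n) x) := by
    obtain ⟨g, hg, hg'⟩ := IsContMDiffRiemannianBundle.exists_contMDiff (IB := 𝓡 n) (n := ∞)
      (F := EuclideanSpace ℝ (Fin n)) (E := fun x : M => TangentSpace (𝓡 n) x)
    exact ⟨g, hg.continuous, hg'⟩
  exact (key i).inner_bundle (key j)

lemma locallyIntegrable_inner {γ : SmoothCurve n M} (X Y : PathTangent γ) :
    LocallyIntegrable (fun s => (inner ℝ (covDeriv n γ X.field s) (covDeriv n γ Y.field s) : ℝ))
      volume := by
  intro s₀
  have hγ : Continuous γ := γ.contMDiff.continuous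
  set B := (trivializationAt (EuclideanSpace ℝ (Fin n)) (TangentSpace (𝓡 n)) (γ s₀)).baseSet
    with hB
  have hBo : IsOpen B := Bundle.Trivialization.open_baseSet _
  have hm : γ s₀ ∈ B := FiberBundle.mem_baseSet_trivializationAt' (γ s₀)
  have hmem : γ ⁻¹' B ∈ 𝓝 s₀ := (hBo.preimage hγ).mem_nhds hm
  obtain ⟨η, hη, hsub⟩ := Metric.mem_nhds_iff.1 hmem
  obtain ⟨ε, hε, h⟩ := X.isH10.memLp s₀
  obtain ⟨δ, hδ, k⟩ := Y.isH10.memLp s₀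
  obtain ⟨r, hr, hr'⟩ : ∃ r > 0, r < min η (min ε δ) :=
    exists_between (lt_min hη (lt_min hε hδ))
  have r1 : r < η := hr'.trans_le (min_le_left _ _)
  have r2 : r < ε := hr'.trans_le ((min_le_right _ _).trans (min_le_left _ _))
  have r3 : r < δ := hr'.trans_le ((min_le_right _ _).trans (min_le_right _ _))
  refine ⟨Icc (s₀ - r) (s₀ + r), Icc_mem_nhds (by linarith) (by linarith), ?_⟩
  have hK : Icc (s₀ - r) (s₀ + r) ⊆ γ ⁻¹' B := by
    intro s hs
    apply hsub
    rw [Metric.mem_ball, Real.dist_eq, abs_lt]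
    constructor <;> linarith [hs.1, hs.2]
  have h' := h.mono_measure (Measure.restrict_mono
    (Icc_subset_Ioo (by linarith) (by linarith) :
      Icc (s₀ - r) (s₀ + r) ⊆ Ioo (s₀ - ε) (s₀ + ε)) le_rfl)
  have k' := k.mono_measure (Measure.restrict_mono
    (Icc_subset_Ioo (by linarith) (by linarith) :
      Icc (s₀ - r) (s₀ + r) ⊆ Ioo (s₀ - δ) (s₀ + δ)) le_rfl)
  have hint : IntegrableOn (fun s => ∑ i, ∑ j,
      (inner ℝ (coordField n (γ s₀) i (γ s)) (coordField n (γ s₀) j (γ s)) : ℝ) *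
        (coord n (γ s₀) (γ s) (covDeriv n γ X.field s) i *
          coord n (γ s₀) (γ s) (covDeriv n γ Y.field s) j)) (Icc (s₀ - r) (s₀ + r)) := by
    refine integrable_finsetSum _ fun i _ => integrable_finsetSum _ fun j _ => ?_
    have hx := (EuclideanSpace.proj (𝕜 := ℝ) i).comp_memLp' h'
    have hy := (EuclideanSpace.proj (𝕜 := ℝ) j).comp_memLp' k'
    have hxy := hx.integrable_mul hy
    exact IntegrableOn.continuousOn_mul ((continuousOn_metric γ (γ s₀) i j).mono hK)
      hxy isCompact_Icc
  refine hint.congr_fun (fun s hs => ?_) measurableSet_Icc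
  conv_rhs => rw [eq_sum_coord n (hK hs) (covDeriv n γ X.field s),
    eq_sum_coord n (hK hs) (covDeriv n γ Y.field s)]
  simp only [sum_inner, inner_sum, real_inner_smul_left, real_inner_smul_right]
  rw [Finset.sum_comm]
  refine Finset.sum_congr rfl fun i _ => Finset.sum_congr rfl fun j _ => ?_
  ring

/-- The inner product space structure of `T_γ H_{xy}(M)` given by the `H¹` metric. (The `H¹` metric
is positive definite, since a field with `∇_s X = 0` that vanishes at `0` is zero; this is not
needed in order to set up the structure.) -/
@[reducible]
def core (γ : SmoothCurve n M) : PreInnerProductSpace.Core ℝ (PathTangent γ) where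
  inner X Y := h1Inner X Y
  conj_inner_symm X Y := by
    simp only [h1Inner, conj_trivial]
    exact integral_congr_ae (.of_forall fun s => real_inner_comm _ _)
  re_inner_nonneg X := by
    simp only [h1Inner, RCLike.re_to_real]
    exact integral_nonneg fun s => real_inner_self_nonneg
  add_left X Y Z := by
    have hX := (locallyIntegrable_inner X Z).integrableOn_isCompact (isCompact_Icc (a := 0) (b := 1))
    have hY := (locallyIntegrable_inner Y Z).integrableOn_isCompact (isCompact_Icc (a := 0) (b := 1))
    unfold h1Inner
    rw [← integral_add hX hY]
    refine integral_congr_ae (ae_restrict_of_ae ?_)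
    filter_upwards [X.isH10.ae_differentiable, Y.isH10.ae_differentiable] with s h k
    have : covDeriv n γ (X + Y).field s = covDeriv n γ X.field s + covDeriv n γ Y.field s :=
      covDeriv_add h k
    rw [this, inner_add_left]
  smul_left X Y a := by
    unfold h1Inner
    rw [conj_trivial, ← integral_const_mul]
    refine integral_congr_ae (.of_forall fun s => ?_)
    have : covDeriv n γ (a • X).field s = a • covDeriv n γ X.field s := covDeriv_smul a _ s
    simp only [this, real_inner_smul_left]

instance (γ : SmoothCurve n M) : SeminormedAddCommGroup (PathTangent γ) :=
  @InnerProductSpace.Core.toSeminormedAddCommGroup ℝ _ _ _ _ (core γ)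

instance (γ : SmoothCurve n M) : InnerProductSpace ℝ (PathTangent γ) :=
  InnerProductSpace.ofCore (core γ)

end Metric

end PathTangent

end Sobolev

/-! ### The Hessian of the action -/

section Hessian

variable {n : ℕ} {M : Type*} [TopologicalSpace M] [ChartedSpace (EuclideanSpace ℝ (Fin n)) M]
  [IsManifold (𝓡 n) ∞ M] [RiemannianBundle (fun x : M => TangentSpace (𝓡 n) x)]
  [IsContMDiffRiemannianBundle (𝓡 n) ∞ (EuclideanSpace ℝ (Fin n))
    (fun x : M => TangentSpace (𝓡 n) x)]

/-- `α = α(u, v, s)` is a smooth two-parameter variation of `γ|_{[0,1]}` with fixed end points and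
with variation fields `X = ∂α/∂u` and `Y = ∂α/∂v` at `u = v = 0`. -/
structure IsVariation (γ : SmoothCurve n M) (α : ℝ → ℝ → ℝ → M) (X Y : PathTangent γ) : Prop where
  smooth : ContMDiff 𝓘(ℝ, ℝ × ℝ × ℝ) (𝓡 n) ∞ (fun q : ℝ × ℝ × ℝ => α q.1 q.2.1 q.2.2)
  base : ∀ s ∈ Icc (0 : ℝ) 1, α 0 0 s = γ s
  source : ∀ u v, α u v 0 = γ 0
  target : ∀ u v, α u v 1 = γ 1
  fst : ∀ s ∈ Icc (0 : ℝ) 1, (⟨α 0 0 s, velocity n (fun u => α u 0 s) 0⟩ : TangentBundle (𝓡 n) M) =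
    ⟨γ s, X.field s⟩
  snd : ∀ s ∈ Icc (0 : ℝ) 1, (⟨α 0 0 s, velocity n (fun v => α 0 v s) 0⟩ : TangentBundle (𝓡 n) M) =
    ⟨γ s, Y.field s⟩

/-- The bounded operator `T` on `T_γ H_{xy}(M)` represents the Hessian `∇²S|_γ` of the action at
the geodesic `γ` with respect to the `H¹` metric: `(X, T Y)_{H¹} = ∇²S|_γ[X, Y]`, where the Hessian
of `S` at the critical point `γ` is the second derivative
`∇²S|_γ[X, Y] = ∂²/∂u∂v S(α(u, v, ·))` at `u = v = 0`, for every smooth two-parameter variation `α`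
of `γ` with fixed end points and variation fields `X` and `Y`. As the smooth fields are dense in
`H¹₀([0,1], γ^*TM)`, this determines `T`. -/
def IsActionHessian (γ : SmoothCurve n M) (T : PathTangent γ →L[ℝ] PathTangent γ) : Prop :=
  ∀ (X Y : PathTangent γ) (α : ℝ → ℝ → ℝ → M), IsVariation γ α X Y →
    HasDerivAt (fun u => deriv (fun v => action n (α u v)) 0) (inner ℝ X (T Y)) 0

end Hessian

/-! ### Fredholm determinants -/

section Fredholm

variable {H : Type*} [SeminormedAddCommGroup H] [InnerProductSpace ℝ H]

/-- `W` is a trace-class (equivalently, nuclear) operator on the Hilbert space `H`: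
`W = ∑_k ⟨a_k, ·⟩ b_k` with `∑_k ‖a_k‖ ‖b_k‖ < ∞`. -/
def IsTraceClass (W : H →L[ℝ] H) : Prop :=
  ∃ a b : ℕ → H, Summable (fun k => ‖a k‖ * ‖b k‖) ∧
    ∀ x, HasSum (fun k => (inner ℝ (a k) x : ℝ) • b k) (W x)

/-- `T = id + W` is a symmetric determinant-class operator, i.e. `W` is trace-class, and its
Fredholm determinant `∏_j (1 + λ_j)` is `d`, where `λ_j` are the eigenvalues of `W`, repeated
with algebraic multiplicity. In the product below, `μ` runs through all real numbers and a number
that is not an eigenvalue contributes the factor `1`, as does `μ = 0`. (The eigenvalues of a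
symmetric operator are real.) -/
structure HasFredholmDet (T : H →L[ℝ] H) (d : ℝ) : Prop where
  symmetric : (T : H →ₗ[ℝ] H).IsSymmetric
  traceClass : IsTraceClass (T - ContinuousLinearMap.id ℝ H)
  hasProd : HasProd (fun μ : ℝ => (1 + μ) ^ Module.finrank ℝ
    (Module.End.maxGenEigenspace ((T - ContinuousLinearMap.id ℝ H : H →L[ℝ] H) : H →ₗ[ℝ] H) μ)) d

end Fredholm

end PathGeometry

end

/-!
Fix a minimizing geodesic `γ`. Everything is computed in time dependent coordinates `(s, y) ↦ Φ (s, y)`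
on a neighbourhood of the graph of `γ` (a `Tube`) that are adapted to `γ`: the curve `γ` is `y = 0`,
and the coordinate vector fields along `γ` form a parallel orthonormal frame (`exists_adapted_tube`).
The derivatives of the components in this frame identify `H¹₀([0,1], γ^*TM)` isometrically with the
space `MeanZero` of square integrable functions on `[0,1]` with mean zero (`Tube.IsAdapted.isometry`).

*The operator.* The second variation formula (`Tube.IsAdapted.hasDerivAt_deriv_action`) says that the
Hessian of the action is `∫ ⟨x', y'⟩ - ∫ ⟨R x, y⟩`, where `R(s)` is the curvature operator
`x ↦ R(x, γ')γ'` in the frame. It is represented by `1 + K` with the operator `K = jacobiOp R`. The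
formula is known for smooth variations only, but their fields are dense, which gives uniqueness
(`Tube.IsAdapted.eq_hessian`). As `γ` minimizes the action, `1 + K` is nonnegative
(`Tube.IsAdapted.inner_jacobiOp_nonneg`).

*The determinant.* Let `Y_z` solve the Jacobi equation `Y'' + z R Y = 0` with `Y(0) = 0` and
`Y'(0) = 1`, and let `D(z) = det Y_z(1)`. The operator `K` is the integral `-∫ κ(s) R(s) κ(s)^* ds`,
where `κ(s)^*` evaluates an `H¹` function at `s`, and therefore it is trace-class. For `0 < z < 1` the
operator `1 + z K` is positive, and its inverse, compressed by `κ(s)`, is the value at the pole of the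
Green's function of the boundary value problem, which is made of Jacobi fields (`exists_green`). The
Wronskian identity and Jacobi's formula for the derivative of a determinant then give
`D'(z) / D(z) = tr (K (1 + z K)⁻¹)`, which is also the logarithmic derivative of `∏ (1 + z λ_j)`. Both
functions are `1` at `z = 0`, so they agree for `z < 1`, and by continuity at `z = 1`, where both may
vanish (`hasFredholmDet_of_hasDerivAt`, `hasFredholmDet_model`). Hence `det (1 + K) = det Y_1(1)`.

*The exponential map.* The geodesic equation in the tube is a second order equation with the solution
`y = 0`, whose linearization there is the Jacobi equation. Differentiability of solutions in the
initial value (`hasFDerivAt_solution`) shows that the differential of the exponential map at `γ'(0)` is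
`Y_1(1)` in the orthonormal frames at both ends, so that the Jacobian of the exponential map is
`|det Y_1(1)|` (`Tube.IsAdapted.exists_expJacobian_eq`). The absolute value is harmless because the
determinant of a nonnegative operator is nonnegative (`HasFredholmDet.nonneg`).
-/


namespace PathGeometry

set_option linter.unusedSectionVars false

/-! ### Ordinary differential equations -/

section ODE

open scoped NNReal

/-- A vector field that is bounded and Lipschitz in space has solutions on any compact interval. -/
lemma exists_solution_of_bounded_lipschitz {F : Type*} [NormedAddCommGroup F] [NormedSpace ℝ F]
    [CompleteSpace F] {f : ℝ → F → F} {a b t₀ : ℝ} (ht₀ : t₀ ∈ Icc a b) (x₀ : F) {L K : ℝ≥0}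
    (lip : ∀ t ∈ Icc a b, LipschitzWith K (f t))
    (cont : ∀ x, ContinuousOn (fun t => f t x) (Icc a b))
    (bdd : ∀ t ∈ Icc a b, ∀ x, ‖f t x‖ ≤ L) :
    ∃ y : ℝ → F, y t₀ = x₀ ∧ ∀ t ∈ Icc a b, HasDerivWithinAt y (f t (y t)) (Icc a b) t := by
  have hab : 0 ≤ b - a := by linarith [ht₀.1, ht₀.2]
  have h : IsPicardLindelof f (⟨t₀, ht₀⟩ : Icc a b) x₀ (L * (b - a).toNNReal) 0 L K :=
    { lipschitzOnWith := fun t ht => (lip t ht).lipschitzOnWith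
      continuousOn := fun x _ => cont x
      norm_le := fun t ht x _ => bdd t ht x
      mul_max_le := by
        have h1 : max (b - t₀) (t₀ - a) ≤ b - a :=
          max_le (by linarith [ht₀.1]) (by linarith [ht₀.2])
        simpa [Real.coe_toNNReal _ hab] using mul_le_mul_of_nonneg_left h1 L.2 }
  exact h.exists_eq_forall_mem_Icc_hasDerivWithinAt₀

/-- Grönwall's inequality, forwards and backwards in time from `t₀`. -/
lemma norm_le_mul_exp_of_norm_deriv_le {F : Type*} [NormedAddCommGroup F] [NormedSpace ℝ F]
    {y y' : ℝ → F} {a b t₀ C : ℝ} (hC : 0 ≤ C) (ht₀ : t₀ ∈ Icc a b)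
    (hy : ∀ t ∈ Icc a b, HasDerivWithinAt y (y' t) (Icc a b) t)
    (bound : ∀ t ∈ Icc a b, ‖y' t‖ ≤ C * ‖y t‖) {t : ℝ} (ht : t ∈ Icc a b) :
    ‖y t‖ ≤ ‖y t₀‖ * Real.exp (C * (b - a)) := by
  have hc : ContinuousOn y (Icc a b) := fun t ht => (hy t ht).continuousWithinAt
  have hmono : ∀ r, r ≤ b - a → ‖y t₀‖ * Real.exp (C * r) ≤ ‖y t₀‖ * Real.exp (C * (b - a)) := by
    intro r hr
    gcongr
  rcases le_total t₀ t with h | h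
  · have := norm_le_gronwallBound_of_norm_deriv_right_le (f := y) (f' := y') (δ := ‖y t₀‖) (K := C)
      (ε := 0) (a := t₀) (b := t) (hc.mono (Icc_subset_Icc ht₀.1 ht.2))
      (fun x hx => (hy x ⟨ht₀.1.trans hx.1, hx.2.le.trans ht.2⟩).mono_of_mem_nhdsWithin
        (mem_of_superset (Icc_mem_nhdsGE (hx.2.trans_le ht.2))
          (Icc_subset_Icc_left (ht₀.1.trans hx.1)))) le_rfl
      (fun x hx => by simpa using bound x ⟨ht₀.1.trans hx.1, hx.2.le.trans ht.2⟩) t ⟨h, le_rfl⟩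
    rw [gronwallBound_ε0] at this
    exact this.trans (hmono _ (by linarith [ht₀.1, ht.2]))
  · have := norm_le_gronwallBound_of_norm_deriv_right_le (f := fun τ => y (-τ))
      (f' := fun τ => -y' (-τ)) (δ := ‖y t₀‖) (K := C)
      (ε := 0) (a := -t₀) (b := -t) (hc.comp continuousOn_neg
        (fun x hx => ⟨by linarith [ht.1, hx.2], by linarith [ht₀.2, hx.1]⟩))
      (fun x hx => by
        have hx' : -x ∈ Icc a b := ⟨by linarith [ht.1, hx.2], by linarith [ht₀.2, hx.1]⟩
        have h1 : HasDerivWithinAt y (y' (-x)) (Iic (-x)) (-x) :=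
          (hy _ hx').mono_of_mem_nhdsWithin
            (mem_of_superset (Icc_mem_nhdsLE (by linarith [ht.1, hx.2] : a < -x))
              (Icc_subset_Icc_right hx'.2))
        have h2 := h1.scomp x (hasDerivAt_neg x).hasDerivWithinAt (s := Ici x)
          (fun z hz => by simpa using hz)
        simpa [Function.comp_def] using h2) (by simp)
      (fun x hx => by
        simpa using bound (-x) ⟨by linarith [ht.1, hx.2], by linarith [ht₀.2, hx.1]⟩) (-t)
      ⟨by linarith, le_rfl⟩
    rw [gronwallBound_ε0] at this
    simp only [neg_neg] at this
    exact this.trans (hmono _ (by linarith [ht₀.2, ht.1]))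

/-- Linear equations with continuous coefficients have solutions on any compact interval. -/
lemma exists_solution_linear {F : Type*} [NormedAddCommGroup F] [NormedSpace ℝ F]
    [FiniteDimensional ℝ F] {L : ℝ → F →L[ℝ] F} {a b t₀ : ℝ} (hL : ContinuousOn L (Icc a b))
    (ht₀ : t₀ ∈ Icc a b) (x₀ : F) :
    ∃ y : ℝ → F, y t₀ = x₀ ∧ ∀ t ∈ Icc a b, HasDerivWithinAt y (L t (y t)) (Icc a b) t := by
  have : CompleteSpace F := FiniteDimensional.complete ℝ F
  obtain ⟨C, hC⟩ := isCompact_Icc.exists_bound_of_continuousOn hL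
  have hC0 : 0 ≤ C := (norm_nonneg _).trans (hC t₀ ht₀)
  set M := ‖x₀‖ * Real.exp (C * (b - a)) with hM
  have hM0 : 0 ≤ M := by positivity
  -- Outside a ball that no solution can leave, the equation is cut off to a bounded one.
  let χ : ContDiffBump (0 : F) := ⟨M + 1, M + 2, by linarith, by linarith⟩
  let φ : F → F := fun y => χ y • y
  have hφ : ContDiff ℝ 1 φ := χ.contDiff.smul contDiff_id
  have hφs : HasCompactSupport φ := χ.hasCompactSupport.smul_right
  obtain ⟨K, hK⟩ := hφ.lipschitzWith_of_hasCompactSupport hφs one_ne_zero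
  obtain ⟨B, hB⟩ := hφ.continuous.bounded_above_of_compact_support hφs
  have hB0 : 0 ≤ B := (norm_nonneg _).trans (hB 0)
  obtain ⟨y, hy0, hy⟩ := exists_solution_of_bounded_lipschitz (f := fun t y => L t (φ y)) ht₀ x₀
    (L := (C * B).toNNReal) (K := C.toNNReal * K)
    (fun t ht => by
      have h1 : LipschitzWith C.toNNReal (L t) :=
        (L t).lipschitz.weaken (by
          rw [← NNReal.coe_le_coe, Real.coe_toNNReal _ hC0]; exact hC t ht)
      exact h1.comp hK)
    (fun x => hL.clm_apply continuousOn_const)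
    (fun t ht x => by
      rw [Real.coe_toNNReal _ (by positivity)]
      exact ((L t).le_opNorm _).trans (mul_le_mul (hC t ht) (hB x) (norm_nonneg _) hC0))
  have hle : ∀ t ∈ Icc a b, ‖y t‖ ≤ M := by
    intro t ht
    have := norm_le_mul_exp_of_norm_deriv_le hC0 ht₀ hy (fun t ht => by
      refine ((L t).le_opNorm _).trans (mul_le_mul (hC t ht) ?_ (norm_nonneg _) hC0)
      simp only [φ, norm_smul]
      refine mul_le_of_le_one_left (norm_nonneg _) ?_
      rw [Real.norm_of_nonneg χ.nonneg]
      exact χ.le_one) ht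
    rwa [hy0] at this
  refine ⟨y, hy0, fun t ht => ?_⟩
  have h1 : φ (y t) = y t := by
    have : χ (y t) = 1 := χ.one_of_mem_closedBall (by
      rw [mem_closedBall_zero_iff]
      exact (hle t ht).trans (by simp [χ]))
    simp [φ, this]
  simpa [h1] using hy t ht

end ODE

/-! ### Fredholm determinants of symmetric operators -/

section Spectral

variable {H : Type*} [NormedAddCommGroup H] [InnerProductSpace ℝ H]

/-- A compact symmetric operator has a Hilbert basis of eigenvectors. The basis is indexed by pairs
consisting of an eigenvalue and an index within the eigenspace. -/
lemma exists_hilbertBasis_eigenvectors [CompleteSpace H] {K : H →L[ℝ] H} (hK : IsCompactOperator K)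
    (hs : (K : H →ₗ[ℝ] H).IsSymmetric) :
    ∃ (w : ∀ μ : ℝ, Set (Module.End.eigenspace (K : Module.End ℝ H) μ))
      (e : HilbertBasis (Σ μ, w μ) ℝ H), (∀ i, K (e i) = i.1 • e i) ∧
      ∀ μ : ℝ, μ ≠ 0 → Finite (w μ) ∧
        Nat.card (w μ) = Module.finrank ℝ (Module.End.eigenspace (K : Module.End ℝ H) μ) := by
  classical
  have hclosed : ∀ μ : ℝ,
      IsClosed (Module.End.eigenspace (K : Module.End ℝ H) μ : Set H) := by
    intro μ
    have : (Module.End.eigenspace (K : Module.End ℝ H) μ : Set H) = {x | K x = μ • x} := by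
      ext x
      simp
    rw [this]
    exact isClosed_eq K.continuous (continuous_const_smul μ)
  have hcomp : ∀ μ : ℝ, CompleteSpace (Module.End.eigenspace (K : Module.End ℝ H) μ) :=
    fun μ => (hclosed μ).completeSpace_coe
  choose w b hb using fun μ : ℝ =>
    exists_hilbertBasis ℝ (Module.End.eigenspace (K : Module.End ℝ H) μ)
  have hon : Orthonormal ℝ (fun i : Σ μ, w μ => (b i.1 i.2 : H)) :=
    hs.orthogonalFamily_eigenspaces.orthonormal_sigma_orthonormal
      (v_family := fun μ i => b μ i) fun μ => (b μ).orthonormal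
  have hsp : (Submodule.span ℝ (range fun i : Σ μ, w μ => (b i.1 i.2 : H)))ᗮ = ⊥ := by
    rw [eq_bot_iff, ← K.orthogonalComplement_iSup_eigenspaces_eq_bot hK hs]
    rw [← Submodule.orthogonal_closure]
    refine Submodule.orthogonal_le (iSup_le fun μ x hx => ?_)
    have h1 := (b μ).hasSum_repr ⟨x, hx⟩
    have h2 := (Submodule.subtypeL _).hasSum h1
    refine (Submodule.isClosed_topologicalClosure _).mem_of_tendsto h2
      (Eventually.of_forall fun t => ?_)
    refine Submodule.sum_mem _ fun i _ => ?_
    simp only [Submodule.subtypeL_apply, map_smul]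
    exact Submodule.smul_mem _ _ (Submodule.le_topologicalClosure _
      (Submodule.subset_span ⟨⟨μ, i⟩, rfl⟩))
  refine ⟨w, HilbertBasis.mkOfOrthogonalEqBot hon hsp, fun i => ?_, fun μ hμ => ?_⟩
  · rw [HilbertBasis.coe_mkOfOrthogonalEqBot]
    exact Module.End.mem_eigenspace_iff.1 (b i.1 i.2).2
  · have : FiniteDimensional ℝ (Module.End.eigenspace (K : Module.End ℝ H) μ) :=
      K.finite_dimensional_eigenspace hK μ hμ
    have hfin : Finite (w μ) := (b μ).orthonormal.linearIndependent.finite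
    have := Fintype.ofFinite (w μ)
    exact ⟨hfin, by
      rw [Nat.card_eq_fintype_card, Module.finrank_eq_card_basis (b μ).toOrthonormalBasis.toBasis]⟩

/-- The rank one operators `λᵢ eᵢ ⊗ eᵢ` exhibit a diagonal operator as trace-class. -/
lemma isTraceClass_of_summable_eigenvalues {ι : Type*} {K : H →L[ℝ] H} (e : HilbertBasis ι ℝ H)
    {l : ι → ℝ} (hl : ∀ i, K (e i) = l i • e i) (hsum : Summable fun i => |l i|) :
    IsTraceClass K := by
  classical
  have hc : (Function.support fun i => |l i|).Countable := hsum.countable_support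
  have : Countable (Function.support fun i => |l i|) := hc.to_subtype
  set J := Function.support fun i => |l i|
  obtain ⟨f, hf⟩ := exists_injective_nat J
  -- The nonzero eigenvalues are numbered by `f`; the remaining terms are zero.
  refine ⟨Function.extend f (fun i => e i) 0, Function.extend f (fun i => l i • e i) 0, ?_, ?_⟩
  · have : (fun k => ‖Function.extend f (fun i : J => e i) 0 k‖ *
        ‖Function.extend f (fun i : J => l i • e i) 0 k‖) =
        Function.extend f (fun i : J => |l i|) 0 := by
      ext k
      by_cases hk : ∃ i, f i = k
      · obtain ⟨i, rfl⟩ := hk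
        simp [hf.extend_apply, norm_smul, e.orthonormal.1]
      · simp [Function.extend_apply' _ _ _ hk]
    rw [this, summable_extend_zero hf]
    exact hsum.subtype _
  · intro x
    have : (fun k => (inner ℝ (Function.extend f (fun i : J => e i) 0 k) x : ℝ) •
        Function.extend f (fun i : J => l i • e i) 0 k) =
        Function.extend f (fun i : J => (inner ℝ (e i) x : ℝ) • l i • e i) 0 := by
      ext1 k
      by_cases hk : ∃ i, f i = k
      · obtain ⟨i, rfl⟩ := hk
        simp [hf.extend_apply]
      · simp [Function.extend_apply' _ _ _ hk]
    rw [this, hasSum_extend_zero hf]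
    have h1 := K.hasSum (e.hasSum_repr x)
    have h2 : (fun i => K (e.repr x i • e i)) = fun i => (inner ℝ (e i) x : ℝ) • l i • e i := by
      ext1 i
      rw [map_smul, hl, e.repr_apply_apply]
    rw [h2] at h1
    refine (hasSum_subtype_iff_of_support_subset (f := fun i => (inner ℝ (e i) x : ℝ) • l i • e i)
      ?_).2 h1
    intro i hi
    simp only [Function.mem_support, ne_eq, smul_eq_zero, not_or] at hi
    simpa [J] using hi.2.1

/-- The product of `1 + μ` over an eigenbasis, grouped by eigenvalues. -/
lemma hasProd_finrank_eigenspace {K : H →L[ℝ] H} (hs : (K : H →ₗ[ℝ] H).IsSymmetric)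
    {w : ∀ μ : ℝ, Set (Module.End.eigenspace (K : Module.End ℝ H) μ)}
    (hw : ∀ μ : ℝ, μ ≠ 0 → Finite (w μ) ∧
        Nat.card (w μ) = Module.finrank ℝ (Module.End.eigenspace (K : Module.End ℝ H) μ))
    {d : ℝ} (hd : HasProd (fun i : Σ μ, w μ => 1 + i.1) d) :
    HasProd (fun μ : ℝ => (1 + μ) ^ Module.finrank ℝ
      (Module.End.maxGenEigenspace (K : H →ₗ[ℝ] H) μ)) d := by
  refine hd.sigma fun μ => ?_
  rw [hs.isFinitelySemisimple.maxGenEigenspace_eq_eigenspace]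
  by_cases hμ : μ = 0
  · subst hμ
    simp only [add_zero, one_pow]
    exact hasProd_one
  · obtain ⟨hfin, hcard⟩ := hw μ hμ
    have := Fintype.ofFinite (w μ)
    rw [← hcard, Nat.card_eq_fintype_card]
    simpa using hasProd_fintype (fun _ : w μ => 1 + μ)

/-- A function that satisfies the same first order equation in `z` as `∏ (1 + z λᵢ)` on `(0, 1)`
agrees with that product at `z = 1`. -/
lemma hasProd_of_hasDerivAt {ι : Type*} {l : ι → ℝ} (hsum : Summable fun i => |l i|)
    (hl : ∀ i, -1 ≤ l i) {D : ℝ → ℝ} (hD : ContinuousOn D (Icc 0 1)) (hD0 : D 0 = 1)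
    (hne : ∀ z ∈ Ioo (0 : ℝ) 1, D z ≠ 0)
    (hderiv : ∀ z ∈ Ioo (0 : ℝ) 1, HasDerivAt D (D z * ∑' i, l i / (1 + z * l i)) z) :
    HasProd (fun i => 1 + l i) (D 1) := by
  have hpos : ∀ z ∈ Ioo (0 : ℝ) 1, ∀ i, 1 - z ≤ 1 + z * l i := fun z hz i => by
    nlinarith [hl i, hz.1]
  set f : ℝ → ℝ := fun z => ∏' i, (1 + z * l i) with hf
  have hbd : ∀ z ∈ Icc (0 : ℝ) 1, ∀ i, ‖z * l i‖ ≤ |l i| := fun z hz i => by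
    rw [norm_mul, Real.norm_of_nonneg hz.1]
    exact mul_le_of_le_one_left (abs_nonneg _) hz.2
  have hfc : ContinuousOn f (Icc 0 1) := by
    have h := (hsum.hasProdUniformlyOn_one_add (f := fun i z => z * l i) (K := Icc (0 : ℝ) 1)
      isCompact_Icc (Eventually.of_forall fun i z hz => hbd z hz i)
      (fun i => by fun_prop)).tendstoUniformlyOn
    exact h.continuousOn (Frequently.of_forall fun t => by fun_prop)
  have hfd : ∀ z ∈ Ioo (0 : ℝ) 1, HasDerivAt f (f z * ∑' i, l i / (1 + z * l i)) z := by
    intro z hz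
    obtain ⟨c, hc1, hc2⟩ := exists_between hz.2
    -- For `t < 1` the factors are positive, and the logarithm of the product is a convergent series.
    have hlog : ∀ t ∈ Ioo (0 : ℝ) 1, f t = Real.exp (∑' i, Real.log (1 + t * l i)) := by
      intro t ht
      rw [Real.rexp_tsum_eq_tprod (fun i => by linarith [hpos t ht i, ht.2])]
      refine Real.summable_log_one_add_of_summable (.of_norm ?_)
      exact hsum.of_nonneg_of_le (fun _ => norm_nonneg _) (hbd t ⟨ht.1.le, ht.2.le⟩)
    have h1 : HasDerivAt (fun t => ∑' i, Real.log (1 + t * l i)) (∑' i, l i / (1 + z * l i)) z := by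
      refine hasDerivAt_tsum_of_isPreconnected (𝕜 := ℝ) (g := fun i t => Real.log (1 + t * l i))
        (g' := fun i t => l i / (1 + t * l i)) (u := fun i => (1 - c)⁻¹ * |l i|) (t := Ioo 0 c)
        (y₀ := z) (hsum.mul_left _) isOpen_Ioo isPreconnected_Ioo (fun i t ht => ?_)
        (fun i t ht => ?_) ⟨hz.1, hc1⟩ ?_ ⟨hz.1, hc1⟩
      · have := hpos t ⟨ht.1, ht.2.trans hc2⟩ i
        have h2 : HasDerivAt (fun t => 1 + t * l i) (l i) t := by
          simpa using ((hasDerivAt_id t).mul_const (l i)).const_add 1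
        exact h2.log (by linarith [ht.2])
      · have := hpos t ⟨ht.1, ht.2.trans hc2⟩ i
        have h3 : 0 < 1 + t * l i := by linarith [ht.2]
        rw [norm_div, Real.norm_of_nonneg h3.le, div_eq_inv_mul, Real.norm_eq_abs]
        refine mul_le_mul_of_nonneg_right ?_ (abs_nonneg _)
        exact inv_anti₀ (by linarith) (by linarith [ht.2])
      · refine Real.summable_log_one_add_of_summable (.of_norm ?_)
        exact hsum.of_nonneg_of_le (fun _ => norm_nonneg _) (hbd z ⟨hz.1.le, hz.2.le⟩)
    have h2 := h1.exp
    rw [← hlog z hz] at h2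
    exact h2.congr_of_eventuallyEq
      (eventually_of_mem (Ioo_mem_nhds hz.1 hz.2) fun t ht => hlog t ht)
  have heq : ∀ z ∈ Ioo (0 : ℝ) 1, f z = D z := by
    intro z hz
    have hne' : ∀ t ∈ Icc 0 z, D t ≠ 0 := by
      intro t ht
      rcases eq_or_lt_of_le ht.1 with h | h
      · simp [← h, hD0]
      · exact hne t ⟨h, ht.2.trans_lt hz.2⟩
    have hsub : Icc 0 z ⊆ Icc (0 : ℝ) 1 := Icc_subset_Icc_right hz.2.le
    -- The quotient `f / D` has vanishing derivative.
    obtain ⟨c, hc, hc'⟩ := exists_hasDerivAt_eq_slope (fun t => f t / D t) (fun _ => 0) hz.1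
      ((hfc.mono hsub).div (hD.mono hsub) hne') (fun t ht => by
        have ht' : t ∈ Ioo (0 : ℝ) 1 := ⟨ht.1, ht.2.trans hz.2⟩
        convert! (hfd t ht').div (hderiv t ht') (hne t ht') using 1
        rw [eq_comm, div_eq_zero_iff]
        left
        ring)
    have h0 : f 0 = 1 := by simp [hf]
    rw [hD0, h0, eq_comm, div_eq_zero_iff] at hc'
    have h3 : f z / D z = 1 := by
      rcases hc' with h | h
      · linarith
      · linarith [hz.1]
    rwa [div_eq_one_iff_eq (hne z hz)] at h3
  -- At `z = 1` factors may vanish, and only continuity is available.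
  have h1 : f 1 = D 1 := by
    have hcl : (1 : ℝ) ∈ closure (Ioo (0 : ℝ) 1) := by
      rw [closure_Ioo zero_ne_one]
      exact ⟨zero_le_one, le_rfl⟩
    have hm : (1 : ℝ) ∈ Icc (0 : ℝ) 1 := ⟨zero_le_one, le_rfl⟩
    have : (𝓝[Ioo (0 : ℝ) 1] (1 : ℝ)).NeBot := mem_closure_iff_nhdsWithin_neBot.1 hcl
    refine tendsto_nhds_unique ((hfc 1 hm).mono_left (nhdsWithin_mono _ Ioo_subset_Icc_self)) ?_
    refine Tendsto.congr' ?_ ((hD 1 hm).mono_left (nhdsWithin_mono _ Ioo_subset_Icc_self))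
    exact eventually_of_mem self_mem_nhdsWithin fun z hz => (heq z hz).symm
  have h2 : Multipliable fun i => 1 + l i := multipliable_one_add_of_summable hsum
  have := h2.hasProd
  rw [← h1]
  simpa [hf] using this

end Spectral

section Trace

variable {H : Type*} [NormedAddCommGroup H] [InnerProductSpace ℝ H] [CompleteSpace H]
variable {E : Type*} [NormedAddCommGroup E] [InnerProductSpace ℝ E] [FiniteDimensional ℝ E]

open ContinuousLinearMap (adjoint)

/-- The operator `-∫₀¹ κ(s) R(s) κ(s)^* ds`. -/
noncomputable def integralOp (κ : ℝ → E →L[ℝ] H) (R : ℝ → E →L[ℝ] E) : H →L[ℝ] H :=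
  -∫ s in Icc (0 : ℝ) 1, κ s ∘L R s ∘L adjoint (κ s)

variable {κ : ℝ → E →L[ℝ] H} {R : ℝ → E →L[ℝ] E}

lemma continuousOn_integrand (hκ : ContinuousOn κ (Icc 0 1)) (hR : ContinuousOn R (Icc 0 1)) :
    ContinuousOn (fun s => κ s ∘L R s ∘L adjoint (κ s)) (Icc 0 1) :=
  hκ.clm_comp (hR.clm_comp
    ((adjoint (𝕜 := ℝ) (E := E) (F := H)).continuous.comp_continuousOn hκ))

lemma inner_integralOp (hκ : ContinuousOn κ (Icc 0 1)) (hR : ContinuousOn R (Icc 0 1)) (x y : H) :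
    inner ℝ x (integralOp κ R y) =
      -∫ s in Icc (0 : ℝ) 1, inner ℝ (adjoint (κ s) x) (R s (adjoint (κ s) y)) := by
  have hi : IntegrableOn (fun s => κ s ∘L R s ∘L adjoint (κ s)) (Icc (0 : ℝ) 1) :=
    (continuousOn_integrand hκ hR).integrableOn_compact isCompact_Icc
  have h1 : inner ℝ x (integralOp κ R y) = -∫ s in Icc (0 : ℝ) 1,
      (innerSL ℝ x ∘L ContinuousLinearMap.apply ℝ H y) (κ s ∘L R s ∘L adjoint (κ s)) := by
    rw [ContinuousLinearMap.integral_comp_comm _ hi]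
    simp [integralOp]
  rw [h1]
  congr 1
  refine integral_congr_ae (.of_forall fun s => ?_)
  simp [ContinuousLinearMap.adjoint_inner_left]

lemma isCompactOperator_integralOp (hκ : ContinuousOn κ (Icc 0 1))
    (hR : ContinuousOn R (Icc 0 1)) : IsCompactOperator (integralOp κ R) := by
  have hi : IntegrableOn (fun s => κ s ∘L R s ∘L adjoint (κ s)) (Icc (0 : ℝ) 1) :=
    (continuousOn_integrand hκ hR).integrableOn_compact isCompact_Icc
  have : IsProbabilityMeasure (volume.restrict (Icc (0 : ℝ) 1)) := ⟨by simp⟩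
  have hc : IsClosed {f : H →L[ℝ] H | IsCompactOperator f} :=
    isClosed_setOfPred_isCompactOperator
  have hv : Convex ℝ {f : H →L[ℝ] H | IsCompactOperator f} :=
    (compactOperator (RingHom.id ℝ) H H).convex
  have h := hv.integral_mem hc (f := fun s => κ s ∘L R s ∘L adjoint (κ s))
    (μ := volume.restrict (Icc (0 : ℝ) 1)) (.of_forall fun s => ?_) hi
  · exact IsCompactOperator.neg h
  · have h1 : IsCompactOperator (R s ∘L adjoint (κ s)) :=
      isCompactOperator_of_locallyCompactSpace_dom _
    exact h1.clm_comp (κ s)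

lemma isSymmetric_integralOp (hκ : ContinuousOn κ (Icc 0 1)) (hR : ContinuousOn R (Icc 0 1))
    (hs : ∀ s ∈ Icc (0 : ℝ) 1, (R s : E →ₗ[ℝ] E).IsSymmetric) :
    (integralOp κ R : H →ₗ[ℝ] H).IsSymmetric := by
  intro x y
  change inner ℝ (integralOp κ R x) y = inner ℝ x (integralOp κ R y)
  rw [real_inner_comm, inner_integralOp hκ hR, inner_integralOp hκ hR]
  congr 1
  refine setIntegral_congr_fun measurableSet_Icc fun s hs' => ?_
  have h : inner ℝ (R s (adjoint (κ s) x)) (adjoint (κ s) y) =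
      inner ℝ (adjoint (κ s) x) (R s (adjoint (κ s) y)) := hs s hs' _ _
  rw [← h, real_inner_comm]

/-- If `S` is diagonal in an eigenbasis of `K = -∫ κ R κ^*`, then the trace of `K S`, computed in
the eigenbasis, is the integral of the pointwise traces. -/
lemma summable_and_hasSum_trace [TopologicalSpace.SeparableSpace H]
    (hκ : ContinuousOn κ (Icc 0 1)) (hR : ContinuousOn R (Icc 0 1))
    (hs : ∀ s ∈ Icc (0 : ℝ) 1, (R s : E →ₗ[ℝ] E).IsSymmetric)
    {ι : Type*} (e : HilbertBasis ι ℝ H) {l c : ι → ℝ} (hl : ∀ i, integralOp κ R (e i) = l i • e i)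
    {S : H →L[ℝ] H} (hS : (S : H →ₗ[ℝ] H).IsSymmetric) (hc : ∀ i, S (e i) = c i • e i)
    {C : ℝ} (hC : ∀ i, |c i| ≤ C) :
    (Summable fun i => |l i * c i|) ∧
    HasSum (fun i => l i * c i)
      (-∫ s in Icc (0 : ℝ) 1,
        LinearMap.trace ℝ E ((adjoint (κ s) ∘L S ∘L κ s ∘L R s : E →L[ℝ] E) : E →ₗ[ℝ] E)) := by
  -- Distinct basis vectors have distance `√2`, so a basis of a separable space is countable.
  have hcount : Countable ι := by
    refine Pairwise.countable_of_isOpen_disjoint (s := fun i => Metric.ball (e i) (1 / 2))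
      (fun i j hij => Metric.ball_disjoint_ball ?_) (fun i => Metric.isOpen_ball)
      (fun i => ⟨e i, Metric.mem_ball_self (by norm_num)⟩)
    have h1 : ‖e i - e j‖ ^ 2 = 2 := by
      rw [norm_sub_sq_real, e.orthonormal.1, e.orthonormal.1, e.orthonormal.2 hij]
      norm_num
    rw [dist_eq_norm]
    nlinarith [norm_nonneg (e i - e j)]
  have hC0 : ∀ i, 0 ≤ C := fun i => (abs_nonneg _).trans (hC i)
  have hκ' : ContinuousOn (fun s => adjoint (κ s)) (Icc 0 1) :=
    (adjoint (𝕜 := ℝ) (E := E) (F := H)).continuous.comp_continuousOn hκ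
  set b := stdOrthonormalBasis ℝ E with hb
  obtain ⟨B, hB⟩ := isCompact_Icc.exists_bound_of_continuousOn hR
  have hB0 : 0 ≤ B := (norm_nonneg _).trans (hB 0 ⟨le_rfl, zero_le_one⟩)
  set F : ι → ℝ → ℝ := fun i s => c i * inner ℝ (adjoint (κ s) (e i)) (R s (adjoint (κ s) (e i)))
    with hF
  have hFc : ∀ i, ContinuousOn (F i) (Icc 0 1) := fun i =>
    continuousOn_const.mul ((hκ'.clm_apply continuousOn_const).inner
      (hR.clm_apply (hκ'.clm_apply continuousOn_const)))
  have hFi : ∀ i, IntegrableOn (F i) (Icc 0 1) := fun i =>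
    (hFc i).integrableOn_compact isCompact_Icc
  have hlc : ∀ i, l i * c i = -∫ s in Icc (0 : ℝ) 1, F i s := by
    intro i
    have h1 : inner ℝ (e i) (integralOp κ R (e i)) = l i := by
      rw [hl, inner_smul_right, real_inner_self_eq_norm_sq, e.orthonormal.1]
      simp
    rw [inner_integralOp hκ hR] at h1
    rw [← h1, hF, integral_const_mul]
    ring
  -- Bessel's inequality bounds the sum of the integrals of `‖κ^* eᵢ‖²`.
  have hg : Summable fun i => ∫ s in Icc (0 : ℝ) 1, ‖adjoint (κ s) (e i)‖ ^ 2 := by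
    have hgi : ∀ i, IntegrableOn (fun s => ‖adjoint (κ s) (e i)‖ ^ 2) (Icc 0 1) := fun i =>
      ((hκ'.clm_apply continuousOn_const).norm.pow 2).integrableOn_compact isCompact_Icc
    refine summable_of_sum_le (fun i => integral_nonneg fun s => by positivity)
      (c := ∫ s in Icc (0 : ℝ) 1, ∑ k, ‖κ s (b k)‖ ^ 2) fun u => ?_
    rw [← integral_finsetSum _ fun i _ => hgi i]
    refine setIntegral_mono_on (integrable_finsetSum _ fun i _ => hgi i) ?_ measurableSet_Icc
      fun s hs' => ?_
    · refine ContinuousOn.integrableOn_compact isCompact_Icc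
        (continuousOn_finsetSum _ fun k _ => ?_)
      exact (hκ.clm_apply continuousOn_const).norm.pow 2
    · have h1 : ∀ i, ‖adjoint (κ s) (e i)‖ ^ 2 = ∑ k, ‖inner ℝ (e i) (κ s (b k))‖ ^ 2 := by
        intro i
        rw [← b.sum_sq_norm_inner_right]
        refine Finset.sum_congr rfl fun k _ => ?_
        rw [ContinuousLinearMap.adjoint_inner_right, real_inner_comm]
      simp only [h1]
      rw [Finset.sum_comm]
      exact Finset.sum_le_sum fun k _ =>
        e.orthonormal.sum_inner_products_le (κ s (b k))
  -- This bound justifies exchanging the sum over `i` with the integral over `s`.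
  have hFn : Summable fun i => ∫ s in Icc (0 : ℝ) 1, ‖F i s‖ := by
    refine (hg.mul_left (C * B)).of_nonneg_of_le
      (fun i => integral_nonneg fun s => norm_nonneg _) fun i => ?_
    rw [← integral_const_mul]
    refine setIntegral_mono_on (hFi i).norm ?_ measurableSet_Icc fun s hs' => ?_
    · exact (continuousOn_const.mul
        ((hκ'.clm_apply continuousOn_const).norm.pow 2)).integrableOn_compact isCompact_Icc
    · rw [hF]
      simp only [norm_mul]
      rw [mul_assoc]
      refine mul_le_mul (hC i) ?_ (norm_nonneg _) (hC0 i)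
      refine (norm_inner_le_norm _ _).trans ?_
      have h2 : ‖R s (adjoint (κ s) (e i))‖ ≤ B * ‖adjoint (κ s) (e i)‖ :=
        ((R s).le_opNorm _).trans (mul_le_mul_of_nonneg_right (hB s hs') (norm_nonneg _))
      nlinarith [norm_nonneg (adjoint (κ s) (e i))]
  constructor
  · refine hFn.of_nonneg_of_le (fun i => abs_nonneg _) fun i => ?_
    rw [hlc, abs_neg]
    exact norm_integral_le_integral_norm (F i)
  · have h1 := (hasSum_integral_of_summable_integral_norm hFi hFn).neg
    simp only [hlc]
    convert! h1 using 2
    refine setIntegral_congr_fun measurableSet_Icc fun s hs' => ?_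
    -- Pointwise in `s`, Parseval's identity turns the sum over the eigenbasis into a trace on `E`.
    rw [LinearMap.trace_eq_sum_inner _ b]
    refine HasSum.tsum_eq ?_ |>.symm
    have h2 : ∀ i, F i s = ∑ k, inner ℝ (κ s (b k)) (e i) * inner ℝ (e i) (S (κ s (R s (b k)))) := by
      intro i
      have h3 : F i s = inner ℝ (adjoint (κ s) (e i)) (R s (adjoint (κ s) (S (e i)))) := by
        rw [hc, map_smul, map_smul, inner_smul_right]
      rw [h3, ← b.sum_inner_mul_inner]
      refine Finset.sum_congr rfl fun k _ => ?_
      have h4 : inner ℝ (R s (b k)) (adjoint (κ s) (S (e i))) =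
          inner ℝ (b k) (R s (adjoint (κ s) (S (e i)))) := hs s hs' _ _
      have h5 : inner ℝ (S (e i)) (κ s (R s (b k))) = inner ℝ (e i) (S (κ s (R s (b k)))) :=
        hS _ _
      rw [ContinuousLinearMap.adjoint_inner_left, ← h4, ContinuousLinearMap.adjoint_inner_right,
        ← h5, real_inner_comm (κ s (b k)), real_inner_comm (S (e i))]
    rw [funext h2]
    refine hasSum_sum fun k _ => ?_
    have h6 := e.hasSum_inner_mul_inner (κ s (b k)) (S (κ s (R s (b k))))
    rwa [← ContinuousLinearMap.adjoint_inner_right] at h6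

/-- The Fredholm determinant of `1 + K` for `K = -∫₀¹ κ R κ^*`, if `1 + K` is nonnegative: it is the
value at `z = 1` of the solution of the first order equation satisfied by `det (1 + z K)`. -/
theorem hasFredholmDet_of_hasDerivAt [TopologicalSpace.SeparableSpace H]
    (hκ : ContinuousOn κ (Icc 0 1)) (hR : ContinuousOn R (Icc 0 1))
    (hs : ∀ s ∈ Icc (0 : ℝ) 1, (R s : E →ₗ[ℝ] E).IsSymmetric)
    (hpos : ∀ x, 0 ≤ inner ℝ x (x + integralOp κ R x)) {D : ℝ → ℝ}
    (hD : ContinuousOn D (Icc 0 1)) (hD0 : D 0 = 1) (hne : ∀ z ∈ Ioo (0 : ℝ) 1, D z ≠ 0)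
    (hderiv : ∀ z ∈ Ioo (0 : ℝ) 1, ∀ S : H →L[ℝ] H,
      (∀ x, S (x + z • integralOp κ R x) = x) → HasDerivAt D (D z * -∫ s in Icc (0 : ℝ) 1,
        LinearMap.trace ℝ E ((adjoint (κ s) ∘L S ∘L κ s ∘L R s : E →L[ℝ] E) : E →ₗ[ℝ] E)) z) :
    HasFredholmDet (ContinuousLinearMap.id ℝ H + integralOp κ R) (D 1) := by
  set K := integralOp κ R with hK
  have hcpt := isCompactOperator_integralOp hκ hR
  have hsym := isSymmetric_integralOp hκ hR hs
  obtain ⟨w, e, he, hw⟩ := exists_hilbertBasis_eigenvectors hcpt hsym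
  have hsum : Summable fun i : Σ μ, w μ => |i.1| := by
    simpa using (summable_and_hasSum_trace hκ hR hs e (c := fun _ => 1)
      (S := ContinuousLinearMap.id ℝ H) he (fun _ _ => rfl) (by simp) (C := 1) (by simp)).1
  -- The eigenvalues of `K` are at least `-1`, so that `1 + z K` has no kernel for `z < 1`.
  have hl : ∀ i : Σ μ, w μ, -1 ≤ i.1 := by
    intro i
    have h1 := hpos (e i)
    rw [he, inner_add_right, inner_smul_right, real_inner_self_eq_norm_sq, e.orthonormal.1] at h1
    linarith
  have hid : ContinuousLinearMap.id ℝ H + K - ContinuousLinearMap.id ℝ H = K := by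
    abel
  refine ⟨?_, ?_, ?_⟩
  · intro x y
    have := hsym x y
    change inner ℝ (K x) y = inner ℝ x (K y) at this
    simp [inner_add_left, inner_add_right, this]
  · rw [hid]
    exact isTraceClass_of_summable_eigenvalues e he hsum
  · rw [hid]
    refine hasProd_finrank_eigenspace hsym hw (hasProd_of_hasDerivAt hsum hl hD hD0 hne ?_)
    intro z hz
    have hz1 : 0 < 1 - z := by linarith [hz.2]
    -- As `1 + z K = (1 - z) + z (1 + K)`, it is coercive with constant `1 - z`.
    have hU : IsUnit (ContinuousLinearMap.id ℝ H + z • K) := by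
      refine ContinuousLinearMap.isUnit_of_forall_le_norm_inner_map _
        (c := (1 - z).toNNReal) (by simpa using hz.2) fun x => ?_
      rw [Real.coe_toNNReal _ hz1.le]
      refine le_trans ?_ (le_abs_self _)
      have h1 := hpos x
      rw [inner_add_right, real_inner_self_eq_norm_sq] at h1
      simp only [_root_.add_apply, _root_.smul_apply, inner_add_left,
        inner_smul_left, ContinuousLinearMap.id_apply, conj_trivial, real_inner_self_eq_norm_sq]
      rw [real_inner_comm] at h1
      nlinarith [hz.1]
    obtain ⟨S, hS1, hS2⟩ := isUnit_iff_exists.1 hU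
    have hS1' : ∀ x, S x + z • K (S x) = x := fun x => by
      simpa using congrArg (fun T : H →L[ℝ] H => T x) hS1
    have hS2' : ∀ x, S (x + z • K x) = x := fun x => by
      simpa using congrArg (fun T : H →L[ℝ] H => T x) hS2
    have hpos' : ∀ i : Σ μ, w μ, 1 - z ≤ 1 + z * i.1 := fun i => by nlinarith [hl i, hz.1]
    have hSe : ∀ i, S (e i) = (1 + z * i.1)⁻¹ • e i := by
      intro i
      have h1 := hS2' (e i)
      have h2 : e i + z • i.1 • e i = (1 + z * i.1) • e i := by module
      rw [he, h2, map_smul] at h1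
      rw [← h1, smul_smul, inv_mul_cancel₀ (by linarith [hpos' i]), one_smul, h1]
    have hSs : (S : H →ₗ[ℝ] H).IsSymmetric := by
      intro x y
      simp only [ContinuousLinearMap.coe_coe]
      conv_lhs => rw [← hS1' y]
      conv_rhs => rw [← hS1' x]
      have := hsym (S x) (S y)
      simp only [ContinuousLinearMap.coe_coe] at this
      simp only [inner_add_left, inner_add_right, inner_smul_left, inner_smul_right, conj_trivial]
      rw [← hK] at this
      rw [this]
    have h := (summable_and_hasSum_trace hκ hR hs e he hSs hSe (C := (1 - z)⁻¹) (fun i => by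
      rw [abs_inv, abs_of_pos (by linarith [hpos' i])]
      exact inv_anti₀ hz1 (hpos' i))).2.tsum_eq
    have := hderiv z hz S hS2'
    rw [← h] at this
    simpa [div_eq_mul_inv] using this

end Trace

/-! ### Absolutely continuous functions with values in a Euclidean space -/

section AbsCont

variable {E : Type*} [NormedAddCommGroup E] [InnerProductSpace ℝ E] [FiniteDimensional ℝ E]

lemma ac_const {X : Type*} [PseudoMetricSpace X] (c : X) (a b : ℝ) :
    AbsolutelyContinuousOnInterval (fun _ => c) a b :=
  (LipschitzWith.const c).lipschitzOnWith.absolutelyContinuousOnInterval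

lemma ac_sum {F : Type*} [NormedAddCommGroup F] [NormedSpace ℝ F] {ι : Type*} (u : Finset ι)
    {f : ι → ℝ → F} {a b : ℝ} (h : ∀ i ∈ u, AbsolutelyContinuousOnInterval (f i) a b) :
    AbsolutelyContinuousOnInterval (fun t => ∑ i ∈ u, f i t) a b := by
  classical
  induction u using Finset.induction_on with
  | empty => simpa using ac_const (0 : F) a b
  | insert i u hi ih =>
    simp only [Finset.sum_insert hi]
    exact (h i (by simp)).fun_add (ih fun j hj => h j (by simp [hj]))

lemma ac_clm_comp {F G : Type*} [NormedAddCommGroup F] [NormedSpace ℝ F] [NormedAddCommGroup G]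
    [NormedSpace ℝ G] (L : F →L[ℝ] G) {f : ℝ → F} {a b : ℝ}
    (h : AbsolutelyContinuousOnInterval f a b) :
    AbsolutelyContinuousOnInterval (fun t => L (f t)) a b := by
  unfold AbsolutelyContinuousOnInterval at h ⊢
  refine squeeze_zero (fun t => Finset.sum_nonneg fun _ _ => dist_nonneg) (fun t => ?_)
    (by simpa using h.const_mul ‖L‖)
  rw [Finset.mul_sum]
  refine Finset.sum_le_sum fun i _ => ?_
  rw [dist_eq_norm, dist_eq_norm, ← map_sub]
  exact L.le_opNorm _

/-- The product of an absolutely continuous family of linear maps and an absolutely continuous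
function is absolutely continuous. -/
lemma ac_clm_apply {F : Type*} [NormedAddCommGroup F] [NormedSpace ℝ F] {A : ℝ → E →L[ℝ] F}
    {f : ℝ → E} {a b : ℝ} (hA : AbsolutelyContinuousOnInterval A a b)
    (hf : AbsolutelyContinuousOnInterval f a b) :
    AbsolutelyContinuousOnInterval (fun t => A t (f t)) a b := by
  set e := stdOrthonormalBasis ℝ E
  have h1 : (fun t => A t (f t)) = fun t => ∑ i, (inner ℝ (e i) (f t) : ℝ) • A t (e i) := by
    ext1 t
    conv_lhs => rw [← e.sum_repr' (f t)]
    simp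
  rw [h1]
  refine ac_sum _ fun i _ => AbsolutelyContinuousOnInterval.fun_smul ?_ ?_
  · exact ac_clm_comp (innerSL ℝ (e i)) hf
  · exact ac_clm_comp (ContinuousLinearMap.apply ℝ F (e i)) hA

lemma ac_inner {f g : ℝ → E} {a b : ℝ} (hf : AbsolutelyContinuousOnInterval f a b)
    (hg : AbsolutelyContinuousOnInterval g a b) :
    AbsolutelyContinuousOnInterval (fun t => (inner ℝ (f t) (g t) : ℝ)) a b :=
  ac_clm_apply (A := fun t => innerSL ℝ (f t)) (ac_clm_comp (innerSL ℝ) hf) hg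

lemma ac_integral {f : ℝ → E} {a b c : ℝ} (hf : IntervalIntegrable f volume a b)
    (hc : c ∈ uIcc a b) :
    AbsolutelyContinuousOnInterval (fun t => ∫ τ in c..t, f τ) a b := by
  set e := stdOrthonormalBasis ℝ E
  have h1 : ∀ t ∈ uIcc a b, (∫ τ in c..t, f τ) =
      ∑ i, (∫ τ in c..t, (inner ℝ (e i) (f τ) : ℝ)) • e i := by
    intro t ht
    have hi : IntervalIntegrable f volume c t := hf.mono_set (uIcc_subset_uIcc hc ht)
    conv_lhs => rw [← e.sum_repr' (∫ τ in c..t, f τ)]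
    refine Finset.sum_congr rfl fun i _ => ?_
    congr 1
    exact ((innerSL ℝ (e i)).intervalIntegral_comp_comm hi).symm
  have h2 : AbsolutelyContinuousOnInterval
      (fun t => ∑ i, (∫ τ in c..t, (inner ℝ (e i) (f τ) : ℝ)) • e i) a b := by
    refine ac_sum _ fun i _ => AbsolutelyContinuousOnInterval.fun_smul ?_ (ac_const _ _ _)
    have : IntervalIntegrable (fun τ => (inner ℝ (e i) (f τ) : ℝ)) volume a b :=
      ⟨(innerSL ℝ (e i)).integrable_comp hf.1, (innerSL ℝ (e i)).integrable_comp hf.2⟩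
    exact this.absolutelyContinuousOnInterval_intervalIntegral hc
  rw [absolutelyContinuousOnInterval_iff] at h2 ⊢
  intro ε hε
  obtain ⟨δ, hδ, h⟩ := h2 ε hε
  refine ⟨δ, hδ, fun I hI hI' => ?_⟩
  have h3 := h I hI hI'
  refine lt_of_eq_of_lt (Finset.sum_congr rfl fun i hi => ?_) h3
  rw [h1 _ (hI.1 i hi).1, h1 _ (hI.1 i hi).2]

/-- Integration by parts for the primitive of an integrable function. -/
lemma integral_inner_add_inner {a b : ℝ} (hab : a ≤ b) {X : ℝ → E}
    (hX : IntervalIntegrable X volume a b) (x₀ : E) {φ φ' : ℝ → E}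
    (hφ : ∀ t ∈ Icc a b, HasDerivWithinAt φ (φ' t) (Icc a b) t) (hφ' : ContinuousOn φ' (Icc a b)) :
    ∫ t in a..b, ((inner ℝ (X t) (φ t) : ℝ) + inner ℝ (x₀ + ∫ τ in a..t, X τ) (φ' t)) =
      inner ℝ (x₀ + ∫ τ in a..b, X τ) (φ b) - inner ℝ x₀ (φ a) := by
  have hφc : ContinuousOn φ (uIcc a b) := by
    rw [uIcc_of_le hab]
    exact fun t ht => (hφ t ht).continuousWithinAt
  set x : ℝ → E := fun t => x₀ + ∫ τ in a..t, X τ with hx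
  have hxac : AbsolutelyContinuousOnInterval x a b :=
    (ac_const x₀ a b).fun_add (ac_integral hX left_mem_uIcc)
  have hφac : AbsolutelyContinuousOnInterval φ a b := by
    obtain ⟨C, hC⟩ := isCompact_Icc.exists_bound_of_continuousOn hφ'
    have := (convex_Icc a b).lipschitzOnWith_of_nnnorm_hasDerivWithin_le (C := C.toNNReal) hφ
      fun t ht => by
        rw [← NNReal.coe_le_coe, Real.coe_toNNReal _ ((norm_nonneg _).trans (hC t ht))]
        exact hC t ht
    rw [← uIcc_of_le hab] at this
    exact this.absolutelyContinuousOnInterval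
  have hφ'' : ContinuousOn φ' (uIcc a b) := by rwa [uIcc_of_le hab]
  have hint : IntervalIntegrable (fun t => (inner ℝ (X t) (φ t) : ℝ) + inner ℝ (x t) (φ' t))
      volume a b := by
    refine IntervalIntegrable.add ?_ (hxac.continuousOn.inner hφ'').intervalIntegrable
    rw [intervalIntegrable_iff_integrableOn_Icc_of_le hab] at hX ⊢
    rw [uIcc_of_le hab] at hφc
    obtain ⟨C, hC⟩ := isCompact_Icc.exists_bound_of_continuousOn hφc
    refine (hX.norm.mul_const C).mono'
      (hX.aestronglyMeasurable.inner (hφc.aestronglyMeasurable measurableSet_Icc)) ?_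
    refine (ae_restrict_mem measurableSet_Icc).mono fun t ht => ?_
    exact (norm_inner_le_norm _ _).trans (mul_le_mul_of_nonneg_left (hC t ht) (norm_nonneg _))
  -- The difference of the two sides is absolutely continuous in the end point, with derivative zero
  -- almost everywhere.
  have hac := (ac_inner hxac hφac).fun_sub (ac_integral hint left_mem_uIcc)
  obtain ⟨C, hC⟩ := hac.const_of_ae_hasDerivAt_zero (by
    have hb : ∀ᵐ t : ℝ, t ≠ b := by simp [ae_iff]
    have ha : ∀ᵐ t : ℝ, t ≠ a := by simp [ae_iff]
    filter_upwards [hX.ae_hasDerivAt_integral, hint.ae_hasDerivAt_integral, hb, ha] with t h1 h2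
      h3 h4 ht
    have ht' : t ∈ Icc a b := by rwa [uIcc_of_le hab] at ht
    have h5 : HasDerivAt φ (φ' t) t := (hφ t ht').hasDerivAt
      (Icc_mem_nhds (lt_of_le_of_ne ht'.1 (Ne.symm h4)) (lt_of_le_of_ne ht'.2 h3))
    have h6 : HasDerivAt x (X t) t := (h1 ht a left_mem_uIcc).const_add x₀
    have h7 := (h6.inner ℝ h5).sub (h2 ht a left_mem_uIcc)
    convert! h7 using 1
    ring)
  have h1 := hC a left_mem_uIcc
  have h2 := hC b right_mem_uIcc
  simp only [intervalIntegral.integral_same, sub_zero] at h1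
  have h3 : x a = x₀ := by simp [hx]
  rw [h3] at h1
  linarith

end AbsCont

/-! ### The derivative of the determinant -/

section Det

/-- Jacobi's formula at the identity. By the Leibniz formula, the derivative depends only on the value
and the derivative of `m` at `z`, so that `m` may be replaced by `1 + (t - z) N`. -/
lemma hasDerivAt_matrix_det {ι : Type*} [Fintype ι] [DecidableEq ι] {m : ℝ → Matrix ι ι ℝ}
    {N : Matrix ι ι ℝ} {z : ℝ} (hm : ∀ i j, HasDerivAt (fun t => m t i j) (N i j) z)
    (h1 : m z = 1) : HasDerivAt (fun t => (m t).det) N.trace z := by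
  have key : ∀ m : ℝ → Matrix ι ι ℝ, (∀ i j, HasDerivAt (fun t => m t i j) (N i j) z) →
      HasDerivAt (fun t => (m t).det) (∑ σ : Equiv.Perm ι, ((σ.sign : ℤ) : ℝ) *
        ∑ i, (∏ j ∈ Finset.univ.erase i, m z (σ j) j) • N (σ i) i) z := by
    intro m hm
    simp only [Matrix.det_apply']
    exact HasDerivAt.fun_sum fun σ _ =>
      (HasDerivAt.fun_finsetProd fun i _ => hm (σ i) i).const_mul _
  have h2 := key m hm
  have h3 := key (fun t => 1 + (t - z) • N) (fun i j => by
    simpa using (((hasDerivAt_id z).sub_const z).mul_const (N i j)).const_add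
      ((1 : Matrix ι ι ℝ) i j))
  have h4 : HasDerivAt (fun t => (1 + (t - z) • N).det) N.trace z := by
    have h5 := (Polynomial.hasDerivAt (Matrix.det (1 + (Polynomial.X : Polynomial ℝ) •
      N.map Polynomial.C)) 0)
    rw [Matrix.derivative_det_one_add_X_smul] at h5
    have h6 : (fun t => (1 + (t - z) • N).det) = (fun t => Polynomial.eval t (Matrix.det (1 +
        (Polynomial.X : Polynomial ℝ) • N.map Polynomial.C))) ∘ fun t => t - z := by
      ext1 t
      simp only [Function.comp_apply]
      rw [← Polynomial.coe_evalRingHom, RingHom.map_det]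
      congr 1
      ext i j
      by_cases hij : i = j <;> simp [hij] <;> ring
    rw [h6]
    have h7 : HasDerivAt (fun t : ℝ => t - z) 1 z := (hasDerivAt_id z).sub_const z
    simpa using HasDerivAt.comp z (by simpa using h5) h7
  simp only [sub_self, zero_smul, add_zero] at h3
  rw [h1] at h2
  rw [h3.unique h4] at h2
  exact h2

variable {E : Type*} [NormedAddCommGroup E] [InnerProductSpace ℝ E] [FiniteDimensional ℝ E]

/-- Jacobi's formula at an invertible linear map. -/
lemma hasDerivAt_det {A : ℝ → E →L[ℝ] E} {A' B : E →L[ℝ] E} {z : ℝ} (hA : HasDerivAt A A' z)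
    (hB : B ∘L A z = ContinuousLinearMap.id ℝ E) :
    HasDerivAt (fun t => LinearMap.det (A t : E →ₗ[ℝ] E))
      (LinearMap.det (A z : E →ₗ[ℝ] E) *
        LinearMap.trace ℝ E ((B ∘L A' : E →L[ℝ] E) : E →ₗ[ℝ] E)) z := by
  set e := stdOrthonormalBasis ℝ E
  have hdet : LinearMap.det (B : E →ₗ[ℝ] E) * LinearMap.det (A z : E →ₗ[ℝ] E) = 1 := by
    rw [← LinearMap.det_comp]
    have : (B : E →ₗ[ℝ] E) ∘ₗ (A z : E →ₗ[ℝ] E) = LinearMap.id := by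
      ext v
      exact congrArg (fun T : E →L[ℝ] E => T v) hB
    rw [this, LinearMap.det_id]
  have h1 : HasDerivAt (fun t => (LinearMap.toMatrix e.toBasis e.toBasis
      ((B ∘L A t : E →L[ℝ] E) : E →ₗ[ℝ] E)).det)
      (LinearMap.toMatrix e.toBasis e.toBasis ((B ∘L A' : E →L[ℝ] E) : E →ₗ[ℝ] E)).trace z := by
    refine hasDerivAt_matrix_det (fun i j => ?_) ?_
    · simp only [LinearMap.toMatrix_apply, OrthonormalBasis.coe_toBasis_repr_apply,
        OrthonormalBasis.repr_apply_apply, OrthonormalBasis.coe_toBasis]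
      have h2 := ((innerSL ℝ (e i)) ∘L B ∘L (ContinuousLinearMap.apply ℝ E (e j))).hasFDerivAt
        |>.comp_hasDerivAt z hA
      exact h2
    · rw [hB]
      exact LinearMap.toMatrix_id _
  simp only [LinearMap.det_toMatrix] at h1
  rw [← LinearMap.trace_eq_matrix_trace] at h1
  have h3 : (fun t => LinearMap.det (A t : E →ₗ[ℝ] E)) = fun t =>
      LinearMap.det (A z : E →ₗ[ℝ] E) *
        LinearMap.det ((B ∘L A t : E →L[ℝ] E) : E →ₗ[ℝ] E) := by
    ext1 t
    have : ((B ∘L A t : E →L[ℝ] E) : E →ₗ[ℝ] E) = (B : E →ₗ[ℝ] E) ∘ₗ (A t : E →ₗ[ℝ] E) := rfl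
    rw [this, LinearMap.det_comp, ← mul_assoc, mul_comm (LinearMap.det (A z : E →ₗ[ℝ] E)), hdet,
      one_mul]
  rw [h3]
  exact h1.const_mul _

end Det

/-! ### Jacobi equations in a Euclidean space -/

section Jacobi

variable {E : Type*} [NormedAddCommGroup E] [InnerProductSpace ℝ E] [FiniteDimensional ℝ E]

open ContinuousLinearMap (adjoint)

/-- `A` is a matrix solution of `A'' + z R A = 0` on `[0, 1]`, with derivative `A'`. -/
structure IsJacobi (R : ℝ → E →L[ℝ] E) (z : ℝ) (A A' : ℝ → E →L[ℝ] E) : Prop where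
  deriv : ∀ s ∈ Icc (0 : ℝ) 1, HasDerivWithinAt A (A' s) (Icc 0 1) s
  deriv' : ∀ s ∈ Icc (0 : ℝ) 1, HasDerivWithinAt A' (-(z • R s ∘L A s)) (Icc 0 1) s

variable {R : ℝ → E →L[ℝ] E}

lemma IsJacobi.continuousOn {z : ℝ} {A A' : ℝ → E →L[ℝ] E} (h : IsJacobi R z A A') :
    ContinuousOn A (Icc 0 1) := fun s hs => (h.deriv s hs).continuousWithinAt

lemma IsJacobi.continuousOn' {z : ℝ} {A A' : ℝ → E →L[ℝ] E} (h : IsJacobi R z A A') :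
    ContinuousOn A' (Icc 0 1) := fun s hs => (h.deriv' s hs).continuousWithinAt

lemma exists_solution_second_order {V : Type*} [NormedAddCommGroup V] [NormedSpace ℝ V]
    [FiniteDimensional ℝ V] {C : ℝ → V →L[ℝ] V} (hC : ContinuousOn C (Icc 0 1)) {t₀ : ℝ}
    (ht₀ : t₀ ∈ Icc (0 : ℝ) 1) (v₀ v₁ : V) : ∃ y y' : ℝ → V, y t₀ = v₀ ∧ y' t₀ = v₁ ∧
      (∀ s ∈ Icc (0 : ℝ) 1, HasDerivWithinAt y (y' s) (Icc 0 1) s) ∧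
      ∀ s ∈ Icc (0 : ℝ) 1, HasDerivWithinAt y' (C s (y s)) (Icc 0 1) s := by
  have hL : ContinuousOn (fun s => (ContinuousLinearMap.inl ℝ V V) ∘L (ContinuousLinearMap.snd ℝ V V)
      + (ContinuousLinearMap.inr ℝ V V) ∘L (C s) ∘L ContinuousLinearMap.fst ℝ V V) (Icc 0 1) :=
    continuousOn_const.add (continuousOn_const.clm_comp (hC.clm_comp continuousOn_const))
  obtain ⟨y, hy0, hy⟩ := exists_solution_linear hL ht₀ (v₀, v₁)
  refine ⟨fun s => (y s).1, fun s => (y s).2, by simp [hy0], by simp [hy0], fun s hs => ?_,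
    fun s hs => ?_⟩
  · simpa [Function.comp_def] using
      (ContinuousLinearMap.fst ℝ V V).hasFDerivAt.comp_hasDerivWithinAt s (hy s hs)
  · simpa [Function.comp_def] using
      (ContinuousLinearMap.snd ℝ V V).hasFDerivAt.comp_hasDerivWithinAt s (hy s hs)

set_option synthInstance.maxHeartbeats 200000 in
lemma exists_isJacobi (hR : ContinuousOn R (Icc 0 1)) (z : ℝ) {t₀ : ℝ} (ht₀ : t₀ ∈ Icc (0 : ℝ) 1)
    (A₀ A₀' : E →L[ℝ] E) : ∃ A A', IsJacobi R z A A' ∧ A t₀ = A₀ ∧ A' t₀ = A₀' := by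
  have hC : ContinuousOn (fun s => ContinuousLinearMap.compL ℝ E E E (-z • R s)) (Icc 0 1) :=
    (ContinuousLinearMap.compL ℝ E E E).continuous.comp_continuousOn
      (((continuousOn_const (c := -z)).fun_smul hR))
  obtain ⟨y, y', h0, h1, h, h'⟩ := exists_solution_second_order hC ht₀ A₀ A₀'
  exact ⟨y, y', ⟨h, fun s hs => by simpa using h' s hs⟩, h0, h1⟩

/-- The Wronskian identity. -/
lemma IsJacobi.wronskian (hR : ContinuousOn R (Icc 0 1))
    (hs : ∀ s ∈ Icc (0 : ℝ) 1, (R s : E →ₗ[ℝ] E).IsSymmetric) {a b : ℝ}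
    {A A' B B' : ℝ → E →L[ℝ] E} (hA : IsJacobi R a A A') (hB : IsJacobi R b B B') {r t : ℝ}
    (hr : r ∈ Icc (0 : ℝ) 1) (ht : t ∈ Icc (0 : ℝ) 1) (hrt : r ≤ t) :
    (adjoint (B' t) ∘L A t - adjoint (B t) ∘L A' t) -
      (adjoint (B' r) ∘L A r - adjoint (B r) ∘L A' r) =
    (a - b) • ∫ s in r..t, adjoint (B s) ∘L R s ∘L A s := by
  have hsub : Icc r t ⊆ Icc 0 1 := Icc_subset_Icc hr.1 ht.2
  have hadj : ∀ {P P' : ℝ → E →L[ℝ] E} {s : ℝ}, HasDerivWithinAt P (P' s) (Icc 0 1) s →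
      HasDerivWithinAt (fun s => adjoint (P s)) (adjoint (P' s)) (Icc 0 1) s := fun h =>
    (adjoint (𝕜 := ℝ) (E := E) (F := E)).toContinuousLinearEquiv.toContinuousLinearMap
      |>.hasFDerivAt.comp_hasDerivWithinAt _ h
  have hderiv : ∀ s ∈ Icc (0 : ℝ) 1, HasDerivWithinAt
      (fun s => adjoint (B' s) ∘L A s - adjoint (B s) ∘L A' s)
      ((a - b) • (adjoint (B s) ∘L R s ∘L A s)) (Icc 0 1) s := by
    intro s hs'
    have hRs : adjoint (R s) = R s := (hs s hs').isSelfAdjoint.adjoint_eq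
    have h1 := ((hadj (P' := fun s => -(b • R s ∘L B s)) (hB.deriv' s hs')).clm_comp
      (hA.deriv s hs')).sub ((hadj (hB.deriv s hs')).clm_comp (hA.deriv' s hs'))
    refine HasDerivWithinAt.congr_deriv h1 ?_
    have h2 : adjoint (-(b • R s ∘L B s)) = -(b • adjoint (B s) ∘L R s) := by
      rw [map_neg, map_smulₛₗ, ContinuousLinearMap.adjoint_comp, hRs, conj_trivial]
    rw [h2]
    ext v
    simp only [ContinuousLinearMap.coe_comp, Function.comp_apply, _root_.add_apply,
      _root_.smul_apply, _root_.sub_apply, _root_.neg_apply, map_smul, map_neg]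
    module
  have hcont : ContinuousOn (fun s => adjoint (B s) ∘L R s ∘L A s) (Icc 0 1) :=
    ((adjoint (𝕜 := ℝ) (E := E) (F := E)).continuous.comp_continuousOn hB.continuousOn).clm_comp
      (hR.clm_comp hA.continuousOn)
  rw [← intervalIntegral.integral_smul]
  symm
  refine intervalIntegral.integral_eq_sub_of_hasDerivAt_of_le hrt
    (f := fun s => adjoint (B' s) ∘L A s - adjoint (B s) ∘L A' s)
    (fun s hs' => ((hderiv s (hsub hs')).continuousWithinAt).mono hsub) (fun s hs' => ?_) ?_
  · exact (hderiv s (hsub (Ioo_subset_Icc_self hs'))).hasDerivAt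
      (Icc_mem_nhds (hr.1.trans_lt hs'.1) (hs'.2.trans_le ht.2))
  · refine ContinuousOn.intervalIntegrable ?_
    rw [uIcc_of_le hrt]
    exact (continuousOn_const (c := a - b)).fun_smul (hcont.mono hsub)

/-- Solutions depend Lipschitz continuously on the parameter. -/
lemma IsJacobi.exists_norm_sub_le (hR : ContinuousOn R (Icc 0 1)) (A₀ A₀' : E →L[ℝ] E) :
    ∃ C : ℝ, ∀ z ∈ Icc (0 : ℝ) 1, ∀ w ∈ Icc (0 : ℝ) 1, ∀ A A' B B' : ℝ → E →L[ℝ] E,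
      IsJacobi R z A A' → IsJacobi R w B B' → A 0 = A₀ → A' 0 = A₀' → B 0 = A₀ → B' 0 = A₀' →
      ∀ s ∈ Icc (0 : ℝ) 1, ‖A s - B s‖ ≤ C * |z - w| := by
  obtain ⟨C, hC⟩ := isCompact_Icc.exists_bound_of_continuousOn hR
  have h0 : (0 : ℝ) ∈ Icc (0 : ℝ) 1 := ⟨le_rfl, zero_le_one⟩
  have hC0 : 0 ≤ C := (norm_nonneg _).trans (hC 0 h0)
  set K := 1 + C with hK
  have hK0 : 0 < K := by positivity
  set M := ‖(A₀, A₀')‖ * Real.exp (K * (1 - 0)) with hM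
  have hM0 : 0 ≤ M := by positivity
  have hcomp : ∀ s ∈ Icc (0 : ℝ) 1, ∀ P : E →L[ℝ] E, ‖R s ∘L P‖ ≤ C * ‖P‖ := fun s hs P =>
    ((R s).opNorm_comp_le P).trans (mul_le_mul_of_nonneg_right (hC s hs) (norm_nonneg _))
  refine ⟨C * M / K * Real.exp K, ?_⟩
  intro z hz w hw A A' B B' hA hB hA0 hA0' hB0 hB0' s hs
  -- An a priori bound that is uniform in the parameter.
  have hBM : ∀ s ∈ Icc (0 : ℝ) 1, ‖B s‖ ≤ M := by
    intro s hs
    have := norm_le_mul_exp_of_norm_deriv_le (y := fun s => (B s, B' s))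
      (y' := fun s => (B' s, -(w • R s ∘L B s))) hK0.le h0
      (fun t ht => (hB.deriv t ht).prodMk (hB.deriv' t ht)) (fun t ht => ?_) hs
    · simp only [hB0, hB0'] at this
      exact (norm_fst_le (B s, B' s)).trans this
    · refine max_le ?_ ?_
      · exact (norm_snd_le (B t, B' t)).trans (le_mul_of_one_le_left (norm_nonneg _) (by linarith))
      · rw [norm_neg, norm_smul, Real.norm_of_nonneg hw.1]
        calc w * ‖R t ∘L B t‖ ≤ 1 * (C * ‖B t‖) :=
              mul_le_mul hw.2 (hcomp t ht _) (norm_nonneg _) zero_le_one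
          _ ≤ K * ‖(B t, B' t)‖ := by
              rw [one_mul]
              exact mul_le_mul (by linarith) (norm_fst_le (B t, B' t)) (norm_nonneg _) hK0.le
  -- The difference solves the equation for `z` with an inhomogeneity of size `|z - w| C M`.
  have h1 := norm_le_gronwallBound_of_norm_deriv_right_le
    (f := fun s => (A s - B s, A' s - B' s))
    (f' := fun s => (A' s - B' s, -(z • R s ∘L A s) - -(w • R s ∘L B s))) (δ := 0) (K := K)
    (ε := |z - w| * (C * M)) (a := 0) (b := 1)
    ((hA.continuousOn.sub hB.continuousOn).prodMk (hA.continuousOn'.sub hB.continuousOn'))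
    (fun t ht => (((hA.deriv t ⟨ht.1, ht.2.le⟩).sub (hB.deriv t ⟨ht.1, ht.2.le⟩)).prodMk
      ((hA.deriv' t ⟨ht.1, ht.2.le⟩).sub (hB.deriv' t ⟨ht.1, ht.2.le⟩))).mono_of_mem_nhdsWithin
        (mem_of_superset (Icc_mem_nhdsGE ht.2) (Icc_subset_Icc_left ht.1)))
    (by simp [hA0, hB0, hA0', hB0']) (fun t ht => ?_) s hs
  · refine (norm_fst_le (A s - B s, A' s - B' s)).trans (h1.trans ?_)
    rw [gronwallBound_of_K_ne_0 hK0.ne']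
    simp only [zero_mul, zero_add, sub_zero]
    have h2 : Real.exp (K * s) - 1 ≤ Real.exp K := by
      have : Real.exp (K * s) ≤ Real.exp K :=
        Real.exp_le_exp.2 (mul_le_of_le_one_right hK0.le hs.2)
      linarith
    calc |z - w| * (C * M) / K * (Real.exp (K * s) - 1)
        ≤ |z - w| * (C * M) / K * Real.exp K :=
          mul_le_mul_of_nonneg_left h2 (by positivity)
      _ = C * M / K * Real.exp K * |z - w| := by ring
  · have ht' : t ∈ Icc (0 : ℝ) 1 := ⟨ht.1, ht.2.le⟩
    refine max_le ?_ ?_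
    · have : ‖A' t - B' t‖ ≤ K * ‖(A t - B t, A' t - B' t)‖ :=
        (norm_snd_le (A t - B t, A' t - B' t)).trans
          (le_mul_of_one_le_left (norm_nonneg _) (by linarith))
      exact this.trans (le_add_of_nonneg_right (by positivity))
    · have h3 : -(z • R t ∘L A t) - -(w • R t ∘L B t) =
          -(z • R t ∘L (A t - B t)) - (z - w) • R t ∘L B t := by
        ext v
        simp
        module
      rw [h3]
      refine (norm_sub_le _ _).trans (add_le_add ?_ ?_)
      · rw [norm_neg, norm_smul, Real.norm_of_nonneg hz.1]
        calc z * ‖R t ∘L (A t - B t)‖ ≤ 1 * (C * ‖A t - B t‖) :=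
              mul_le_mul hz.2 (hcomp t ht' _) (norm_nonneg _) zero_le_one
          _ ≤ K * ‖(A t - B t, A' t - B' t)‖ := by
              rw [one_mul]
              exact mul_le_mul (by linarith) (norm_fst_le (A t - B t, A' t - B' t))
                (norm_nonneg _) hK0.le
      · rw [norm_smul, Real.norm_eq_abs]
        refine mul_le_mul_of_nonneg_left ?_ (abs_nonneg _)
        exact (hcomp t ht' _).trans (mul_le_mul_of_nonneg_left (hBM t ht') hC0)

end Jacobi

/-! ### The model Hilbert space -/

section Model

variable {E : Type*} [NormedAddCommGroup E] [InnerProductSpace ℝ E] [FiniteDimensional ℝ E]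

open ContinuousLinearMap (adjoint)
open scoped ENNReal

/-- Lebesgue measure on `[0, 1]`. -/
noncomputable abbrev unitMeasure : Measure ℝ := volume.restrict (Icc (0 : ℝ) 1)

lemma integrable_of_L2 (f : Lp E 2 unitMeasure) : Integrable f unitMeasure :=
  (Lp.memLp f).integrable one_le_two

lemma norm_setIntegral_le_sqrt_mul_norm (f : Lp E 2 unitMeasure) {S : Set ℝ}
    (hS : MeasurableSet S) :
    ‖∫ t in S, f t ∂unitMeasure‖ ≤ √(unitMeasure.real S) * ‖f‖ := by
  have hE : CompleteSpace E := FiniteDimensional.complete ℝ E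
  set w := ∫ t in S, f t ∂unitMeasure
  have h1 := L2.inner_indicatorConstLp_eq_inner_setIntegral ℝ hS (measure_ne_top unitMeasure S) w f
  have h2 := (h1 ▸ real_inner_le_norm
    (indicatorConstLp 2 hS (measure_ne_top unitMeasure S) w) f : inner ℝ w w ≤ _)
  rw [real_inner_self_eq_norm_sq, norm_indicatorConstLp two_ne_zero ENNReal.ofNat_ne_top] at h2
  simp only [ENNReal.toReal_ofNat] at h2
  rw [← Real.sqrt_eq_rpow] at h2
  by_contra! h
  have h3 : 0 ≤ √(unitMeasure.real S) * ‖f‖ := by positivity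
  nlinarith [norm_nonneg w]

/-- The primitive `f ↦ ∫₀ˢ f` as a bounded operator on `L²`. -/
noncomputable def primL (s : ℝ) : Lp E 2 unitMeasure →L[ℝ] E :=
  LinearMap.mkContinuous
    { toFun := fun f => ∫ t in Iic s, f t ∂unitMeasure
      map_add' := fun f g => by
        rw [← integral_add (integrable_of_L2 f).integrableOn (integrable_of_L2 g).integrableOn]
        exact integral_congr_ae (ae_restrict_of_ae (Lp.coeFn_add f g))
      map_smul' := fun c f => by
        rw [RingHom.id_apply, ← integral_smul]
        exact integral_congr_ae (ae_restrict_of_ae (Lp.coeFn_smul c f)) }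
    (√(unitMeasure.real (Iic s)))
    fun f => norm_setIntegral_le_sqrt_mul_norm f measurableSet_Iic

lemma primL_apply {s : ℝ} (hs : s ∈ Icc (0 : ℝ) 1) (f : Lp E 2 unitMeasure) :
    primL s f = ∫ t in (0 : ℝ)..s, f t := by
  change ∫ t in Iic s, f t ∂unitMeasure = _
  rw [Measure.restrict_restrict measurableSet_Iic, intervalIntegral.integral_of_le hs.1,
    ← integral_Icc_eq_integral_Ioc]
  congr 2
  ext t
  simp only [mem_inter_iff, mem_Iic, mem_Icc]
  constructor
  · rintro ⟨h1, h2, h3⟩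
    exact ⟨h2, h1⟩
  · rintro ⟨h1, h2⟩
    exact ⟨h2, h1, h2.trans hs.2⟩

lemma continuous_of_norm_sub_apply_le {F G : Type*} [NormedAddCommGroup F] [NormedSpace ℝ F]
    [NormedAddCommGroup G] [NormedSpace ℝ G] {P : ℝ → F →L[ℝ] G}
    (h : ∀ s t, t ≤ s → ∀ f, ‖P s f - P t f‖ ≤ √(s - t) * ‖f‖) : Continuous P := by
  have h1 : ∀ s t, t ≤ s → ‖P s - P t‖ ≤ √(s - t) := fun s t hst =>
    (P s - P t).opNorm_le_bound (Real.sqrt_nonneg _) (h s t hst)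
  have h2 : ∀ s t : ℝ, ‖P s - P t‖ ≤ √|s - t| := by
    intro s t
    rcases le_total t s with h | h
    · rw [abs_of_nonneg (by linarith)]
      exact h1 _ _ h
    · rw [abs_sub_comm, abs_of_nonneg (by linarith), norm_sub_rev]
      exact h1 _ _ h
  rw [continuous_iff_continuousAt]
  intro t
  refine tendsto_iff_norm_sub_tendsto_zero.2 (squeeze_zero (fun _ => norm_nonneg _)
    (fun s => h2 s t) ?_)
  have : Continuous fun s : ℝ => √|s - t| := by fun_prop
  simpa using this.tendsto t

lemma continuous_primL : Continuous (primL : ℝ → Lp E 2 unitMeasure →L[ℝ] E) := by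
  refine continuous_of_norm_sub_apply_le fun s t hst f => ?_
  have h1 : primL s f - primL t f = ∫ τ in Ioc t s, f τ ∂unitMeasure := by
    change ∫ τ in Iic s, f τ ∂unitMeasure - ∫ τ in Iic t, f τ ∂unitMeasure = _
    rw [intervalIntegral.integral_Iic_sub_Iic (integrable_of_L2 f).integrableOn
      (integrable_of_L2 f).integrableOn, intervalIntegral.integral_of_le hst]
  rw [h1]
  refine (norm_setIntegral_le_sqrt_mul_norm f measurableSet_Ioc).trans ?_
  refine mul_le_mul_of_nonneg_right (Real.sqrt_le_sqrt ?_) (norm_nonneg _)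
  rw [← Real.volume_real_Ioc_of_le hst]
  exact ENNReal.toReal_mono (by simp) (Measure.restrict_apply_le _ _)

variable (E) in
/-- The square integrable functions on `[0, 1]` with vanishing mean. Taking primitives identifies
this space with the `H¹` functions that vanish at the end points. -/
def MeanZero : Type _ := LinearMap.ker (primL 1 : Lp E 2 unitMeasure →L[ℝ] E).toLinearMap

noncomputable instance : NormedAddCommGroup (MeanZero E) :=
  inferInstanceAs (NormedAddCommGroup
    (LinearMap.ker (primL 1 : Lp E 2 unitMeasure →L[ℝ] E).toLinearMap))

noncomputable instance : InnerProductSpace ℝ (MeanZero E) :=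
  inferInstanceAs (InnerProductSpace ℝ
    (LinearMap.ker (primL 1 : Lp E 2 unitMeasure →L[ℝ] E).toLinearMap))

instance : CompleteSpace (MeanZero E) :=
  ContinuousLinearMap.completeSpace_ker (primL 1 : Lp E 2 unitMeasure →L[ℝ] E)

instance : TopologicalSpace.SeparableSpace (MeanZero E) := by
  have : SecondCountableTopology E := by
    have := FiniteDimensional.proper_real E
    infer_instance
  have : SecondCountableTopology (Lp E 2 unitMeasure) := by
    have : Fact ((1 : ℝ≥0∞) ≤ 2) := ⟨one_le_two⟩
    have : Fact ((2 : ℝ≥0∞) ≠ ⊤) := ⟨ENNReal.ofNat_ne_top⟩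
    exact Lp.SecondCountableTopology
  exact @TopologicalSpace.SecondCountableTopology.to_separableSpace _ _
    (TopologicalSpace.Subtype.secondCountableTopology _)

/-- The underlying square integrable function. -/
noncomputable def MeanZero.toL2 (f : MeanZero E) : Lp E 2 unitMeasure := f.1

noncomputable instance : CoeOut (MeanZero E) (Lp E 2 unitMeasure) := ⟨MeanZero.toL2⟩

/-- The value at `s` of the `H¹` function with derivative `f`. -/
noncomputable def evalAt (s : ℝ) : MeanZero E →L[ℝ] E :=
  primL s ∘L (LinearMap.ker (primL 1 : Lp E 2 unitMeasure →L[ℝ] E).toLinearMap).subtypeL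

lemma evalAt_apply {s : ℝ} (hs : s ∈ Icc (0 : ℝ) 1) (f : MeanZero E) :
    evalAt s f = ∫ t in (0 : ℝ)..s, (f : Lp E 2 unitMeasure) t := primL_apply hs f.1

lemma evalAt_one (f : MeanZero E) : evalAt 1 f = 0 := f.2

lemma continuous_evalAt : Continuous (evalAt : ℝ → MeanZero E →L[ℝ] E) :=
  continuous_primL.clm_comp (continuous_const (y := (LinearMap.ker
    (primL 1 : Lp E 2 unitMeasure →L[ℝ] E).toLinearMap).subtypeL))

/-- The adjoint of evaluation at `s`. -/
noncomputable def kernelAt (s : ℝ) : E →L[ℝ] MeanZero E :=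
  adjoint (evalAt s)

lemma adjoint_kernelAt (s : ℝ) :
      adjoint (kernelAt s : E →L[ℝ] MeanZero E) = evalAt s :=
  ContinuousLinearMap.adjoint_adjoint _

lemma continuous_kernelAt : Continuous (kernelAt : ℝ → E →L[ℝ] MeanZero E) :=
  (adjoint (𝕜 := ℝ) (E := MeanZero E) (F := E)).continuous.comp continuous_evalAt

/-- The operator `T - 1`, where `T` represents the form `∫₀¹ ⟨x', y'⟩ - ⟨R x, y⟩`. -/
noncomputable def jacobiOp (R : ℝ → E →L[ℝ] E) : MeanZero E →L[ℝ] MeanZero E :=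
  integralOp kernelAt R

lemma inner_jacobiOp {R : ℝ → E →L[ℝ] E} (hR : ContinuousOn R (Icc 0 1)) (x y : MeanZero E) :
    inner ℝ x (jacobiOp R y) =
      -∫ s in Icc (0 : ℝ) 1, inner ℝ (evalAt s x) (R s (evalAt s y)) := by
  refine (inner_integralOp continuous_kernelAt.continuousOn hR x y).trans ?_
  congr 1
  refine integral_congr_ae (.of_forall fun s => ?_)
  change inner ℝ (adjoint (kernelAt s) x) (R s (adjoint (kernelAt s) y)) = _
  rw [adjoint_kernelAt]

end Model

/-! ### Green's function and the determinant of the model operator -/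

section ModelDet

variable {E : Type*} [NormedAddCommGroup E] [InnerProductSpace ℝ E] [FiniteDimensional ℝ E]

open ContinuousLinearMap (adjoint)

/-- The class of a function with mean zero, together with its primitive. -/
lemma exists_meanZero {g : ℝ → E} (hg : MemLp g 2 (unitMeasure))
    (h0 : ∫ t in (0 : ℝ)..1, g t = 0) : ∃ f : MeanZero E,
      (f : Lp E 2 unitMeasure) =ᵐ[unitMeasure] g ∧
      ∀ s ∈ Icc (0 : ℝ) 1, evalAt s f = ∫ t in (0 : ℝ)..s, g t := by
  have h : ∀ s ∈ Icc (0 : ℝ) 1, ∫ t in (0 : ℝ)..s, hg.toLp g t = ∫ t in (0 : ℝ)..s, g t := by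
    intro s hs
    rw [intervalIntegral.integral_of_le hs.1, intervalIntegral.integral_of_le hs.1]
    refine integral_congr_ae (ae_restrict_of_ae_restrict_of_subset ?_ hg.coeFn_toLp)
    exact fun t ht => ⟨ht.1.le, ht.2.trans hs.2⟩
  have h1 : (1 : ℝ) ∈ Icc (0 : ℝ) 1 := ⟨zero_le_one, le_rfl⟩
  have h2 : primL 1 (hg.toLp g) = 0 := by rw [primL_apply h1, h 1 h1, h0]
  exact ⟨⟨hg.toLp g, h2⟩, hg.coeFn_toLp, fun s hs => (evalAt_apply hs _).trans (h s hs)⟩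

lemma intervalIntegrable_meanZero (f : MeanZero E) {r t : ℝ} (hr : r ∈ Icc (0 : ℝ) 1)
    (ht : t ∈ Icc (0 : ℝ) 1) : IntervalIntegrable (f : Lp E 2 unitMeasure) volume r t := by
  have : IntegrableOn (f : Lp E 2 unitMeasure) (Icc 0 1) := integrable_of_L2 f.toL2
  exact (this.mono_set (uIcc_subset_Icc hr ht)).intervalIntegrable

/-- Integration by parts on `[r, t] ⊆ [0, 1]`. -/
lemma integral_inner_meanZero (h : MeanZero E) {φ φ' : ℝ → E} {r t : ℝ} (hr : r ∈ Icc (0 : ℝ) 1)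
    (ht : t ∈ Icc (0 : ℝ) 1) (hrt : r ≤ t)
    (hφ : ∀ s ∈ Icc (0 : ℝ) 1, HasDerivWithinAt φ (φ' s) (Icc 0 1) s)
    (hφ' : ContinuousOn φ' (Icc 0 1)) :
    ∫ s in r..t, ((inner ℝ ((h : Lp E 2 unitMeasure) s) (φ s) : ℝ) +
      inner ℝ (evalAt s h) (φ' s)) =
      inner ℝ (evalAt t h) (φ t) - inner ℝ (evalAt r h) (φ r) := by
  have hsub : Icc r t ⊆ Icc 0 1 := Icc_subset_Icc hr.1 ht.2
  have h1 := integral_inner_add_inner hrt (intervalIntegrable_meanZero h hr ht) (evalAt r h)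
    (fun s hs => (hφ s (hsub hs)).mono hsub) (hφ'.mono hsub)
  have h0 : (0 : ℝ) ∈ Icc (0 : ℝ) 1 := ⟨le_rfl, zero_le_one⟩
  have h2 : ∀ s ∈ Icc r t, evalAt s h = evalAt r h + ∫ τ in r..s, (h : Lp E 2 unitMeasure) τ := by
    intro s hs
    rw [evalAt_apply (hsub hs), evalAt_apply hr, intervalIntegral.integral_add_adjacent_intervals
      (intervalIntegrable_meanZero h h0 hr) (intervalIntegrable_meanZero h hr (hsub hs))]
  rw [h2 t ⟨hrt, le_rfl⟩, ← h1]
  refine intervalIntegral.integral_congr fun s hs => ?_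
  rw [uIcc_of_le hrt] at hs
  rw [h2 s hs]

lemma inner_meanZero (h f : MeanZero E) {g : ℝ → E}
    (hf : (f : Lp E 2 unitMeasure) =ᵐ[unitMeasure] g) :
    inner ℝ h f = ∫ t in Icc (0 : ℝ) 1, inner ℝ ((h : Lp E 2 unitMeasure) t) (g t) := by
  have h1 : inner ℝ h f = ∫ t in Icc (0 : ℝ) 1,
    inner ℝ ((h : Lp E 2 unitMeasure) t) ((f : Lp E 2 unitMeasure) t) := L2.inner_def _ _
  rw [h1]
  refine integral_congr_ae ?_
  filter_upwards [hf] with t ht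
  rw [ht]

lemma integrable_inner_of_memLp {μ : Measure ℝ} {f g : ℝ → E} (hf : MemLp f 2 μ)
    (hg : MemLp g 2 μ) : Integrable (fun t => (inner ℝ (f t) (g t) : ℝ)) μ := by
  refine (hf.norm.integrable_mul hg.norm).mono (hf.1.inner hg.1) (.of_forall fun t => ?_)
  simpa using abs_real_inner_le_norm (f t) (g t)

variable {R : ℝ → E →L[ℝ] E}

lemma memLp_of_continuousOn {φ : ℝ → E} (hφ : ContinuousOn φ (Icc 0 1)) :
    MemLp φ 2 (unitMeasure) := by
  obtain ⟨C, hC⟩ := isCompact_Icc.exists_bound_of_continuousOn hφ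
  exact MemLp.of_bound (hφ.aestronglyMeasurable measurableSet_Icc) C
    ((ae_restrict_iff' measurableSet_Icc).2 (.of_forall hC))

lemma IsJacobi.apply {z : ℝ} {A A' : ℝ → E →L[ℝ] E} (hA : IsJacobi R z A A') (v : E) :
    (∀ s ∈ Icc (0 : ℝ) 1, HasDerivWithinAt (fun s => A s v) (A' s v) (Icc 0 1) s) ∧
    ∀ s ∈ Icc (0 : ℝ) 1, HasDerivWithinAt (fun s => A' s v) (-(z • R s (A s v))) (Icc 0 1) s :=
  ⟨fun s hs => by simpa using (hA.deriv s hs).clm_apply (hasDerivWithinAt_const s _ v),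
    fun s hs => by simpa using (hA.deriv' s hs).clm_apply (hasDerivWithinAt_const s _ v)⟩

lemma IsJacobi.integral {z : ℝ} {A A' : ℝ → E →L[ℝ] E} (hA : IsJacobi R z A A') (v : E) {r t : ℝ}
    (hr : r ∈ Icc (0 : ℝ) 1) (ht : t ∈ Icc (0 : ℝ) 1) (hrt : r ≤ t) :
    ∫ s in r..t, A' s v = A t v - A r v := by
  have hsub : Icc r t ⊆ Icc 0 1 := Icc_subset_Icc hr.1 ht.2
  refine intervalIntegral.integral_eq_sub_of_hasDerivAt_of_le hrt
    (fun s hs => (((hA.apply v).1 s (hsub hs)).continuousWithinAt).mono hsub) (fun s hs => ?_) ?_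
  · exact ((hA.apply v).1 s (hsub (Ioo_subset_Icc_self hs))).hasDerivAt
      (Icc_mem_nhds (hr.1.trans_lt hs.1) (hs.2.trans_le ht.2))
  · refine ContinuousOn.intervalIntegrable ?_
    rw [uIcc_of_le hrt]
    exact (hA.continuousOn'.clm_apply continuousOn_const).mono hsub

/-- The Green's function of `-d²/ds² - z R` with Dirichlet boundary conditions, with pole at `s`. -/
lemma exists_green (hR : ContinuousOn R (Icc 0 1)) {z : ℝ} {Y Y' Z Z' : ℝ → E →L[ℝ] E}
    (hY : IsJacobi R z Y Y') (hZ : IsJacobi R z Z Z') (hY0 : Y 0 = 0) (hZ1 : Z 1 = 0)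
    {s : ℝ} (hs : s ∈ Icc (0 : ℝ) 1) {c d v : E} (h1 : Y s c = Z s d) (h2 : Y' s c - Z' s d = v) :
    ∃ G : MeanZero E, G + z • jacobiOp R G = kernelAt s v ∧ evalAt s G = Y s c := by
  have h0 : (0 : ℝ) ∈ Icc (0 : ℝ) 1 := ⟨le_rfl, zero_le_one⟩
  have h1' : (1 : ℝ) ∈ Icc (0 : ℝ) 1 := ⟨zero_le_one, le_rfl⟩
  classical
  have hYc : ContinuousOn (fun t => Y' t c) (Icc 0 1) := hY.continuousOn'.clm_apply continuousOn_const
  have hZd : ContinuousOn (fun t => Z' t d) (Icc 0 1) := hZ.continuousOn'.clm_apply continuousOn_const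
  -- The function with mean zero is the derivative of the Green's function, which is `Y c` to the left of
  -- the pole and `Z d` to the right. It is continuous at the pole by `h1`, and its derivative jumps by
  -- `-v` there by `h2`.
  set g : ℝ → E := (Iic s).piecewise (fun t => Y' t c) (fun t => Z' t d) with hg
  have hgm : MemLp g 2 (unitMeasure) := by
    rw [hg, ← indicator_add_compl_eq_piecewise]
    exact ((memLp_of_continuousOn hYc).indicator measurableSet_Iic).add
      ((memLp_of_continuousOn hZd).indicator measurableSet_Iic.compl)
  have hgY : ∀ t ∈ Iic s, g t = Y' t c := fun t ht => piecewise_eq_of_mem _ _ _ ht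
  have hgZ : ∀ t ∈ Ioi s, g t = Z' t d := fun t ht =>
    piecewise_eq_of_notMem _ _ _ (by simpa using ht)
  have hYi : ∀ {t : ℝ}, t ∈ Icc 0 s → ∫ τ in (0 : ℝ)..t, g τ = ∫ τ in (0 : ℝ)..t, Y' τ c := by
    intro t ht
    refine intervalIntegral.integral_congr fun τ hτ => ?_
    rw [uIcc_of_le ht.1] at hτ
    rw [hgY τ (hτ.2.trans ht.2)]
  have hZi : ∀ {t : ℝ}, t ∈ Icc s 1 → ∫ τ in s..t, g τ = ∫ τ in s..t, Z' τ d := by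
    intro t ht
    refine intervalIntegral.integral_congr_ae (.of_forall fun τ hτ => ?_)
    rw [uIoc_of_le ht.1] at hτ
    rw [hgZ τ hτ.1]
  have hgi : ∀ {r t : ℝ}, r ∈ Icc (0 : ℝ) 1 → t ∈ Icc (0 : ℝ) 1 → IntervalIntegrable g volume r t :=
    fun hr ht => by
      have : IntegrableOn g (Icc 0 1) := hgm.integrable one_le_two
      exact (this.mono_set (uIcc_subset_Icc hr ht)).intervalIntegrable
  have hpY : ∀ t ∈ Icc 0 s, ∫ τ in (0 : ℝ)..t, g τ = Y t c := fun t ht => by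
    rw [hYi ht, hY.integral c h0 ⟨ht.1, ht.2.trans hs.2⟩ ht.1, hY0]
    simp
  have hpZ : ∀ t ∈ Icc s 1, ∫ τ in (0 : ℝ)..t, g τ = Z t d := fun t ht => by
    have ht' : t ∈ Icc (0 : ℝ) 1 := ⟨hs.1.trans ht.1, ht.2⟩
    rw [← intervalIntegral.integral_add_adjacent_intervals (hgi h0 hs) (hgi hs ht'),
      hpY s ⟨hs.1, le_rfl⟩, hZi ht, hZ.integral d hs ht' ht.1, h1]
    abel
  obtain ⟨G, hGg, hG⟩ := exists_meanZero hgm (by rw [hpZ 1 ⟨hs.2, le_rfl⟩, hZ1]; simp)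
  refine ⟨G, ext_inner_left ℝ fun h => ?_, by rw [hG s hs, hpY s ⟨hs.1, le_rfl⟩]⟩
  have e1 : inner ℝ h (kernelAt s v) = inner ℝ (evalAt s h) v := by
    rw [← ContinuousLinearMap.adjoint_inner_left, adjoint_kernelAt]
  have e2 : inner ℝ h (z • jacobiOp R G) = z * inner ℝ h (jacobiOp R G) :=
    real_inner_smul_right _ _ _
  rw [e1, inner_add_right, e2, inner_jacobiOp hR, inner_meanZero h G hGg,
    integral_Icc_eq_integral_Ioc, integral_Icc_eq_integral_Ioc,
    ← intervalIntegral.integral_of_le zero_le_one, ← intervalIntegral.integral_of_le zero_le_one]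
  have i1 : ∀ {r t : ℝ}, r ∈ Icc (0 : ℝ) 1 → t ∈ Icc (0 : ℝ) 1 → IntervalIntegrable
      (fun t => (inner ℝ ((h : Lp E 2 unitMeasure) t) (g t) : ℝ)) volume r t := fun hr ht => by
    have : IntegrableOn (fun t => (inner ℝ ((h : Lp E 2 unitMeasure) t) (g t) : ℝ)) (Icc 0 1) :=
      integrable_inner_of_memLp (Lp.memLp h.toL2) hgm
    exact (this.mono_set (uIcc_subset_Icc hr ht)).intervalIntegrable
  have i2 : ∀ {r t : ℝ}, r ∈ Icc (0 : ℝ) 1 → t ∈ Icc (0 : ℝ) 1 → IntervalIntegrable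
      (fun t => (inner ℝ (evalAt t h) (R t (evalAt t G)) : ℝ)) volume r t := fun hr ht => by
    refine ContinuousOn.intervalIntegrable (ContinuousOn.mono ?_ (uIcc_subset_Icc hr ht))
    exact (continuous_evalAt.clm_apply continuous_const).continuousOn.inner
      (hR.clm_apply (continuous_evalAt.clm_apply continuous_const).continuousOn)
  have hRY : ContinuousOn (fun t => -(z • R t (Y t c))) (Icc 0 1) :=
    ((hR.clm_apply (hY.continuousOn.clm_apply continuousOn_const)).const_smul z).neg
  have hRZ : ContinuousOn (fun t => -(z • R t (Z t d))) (Icc 0 1) :=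
    ((hR.clm_apply (hZ.continuousOn.clm_apply continuousOn_const)).const_smul z).neg
  -- Integrate by parts on both sides of the pole; only the jump contributes.
  have p1 := integral_inner_meanZero h h0 hs hs.1 (hY.apply c).2 hRY
  have p2 := integral_inner_meanZero h hs h1' hs.2 (hZ.apply d).2 hRZ
  have q1 : ∫ t in (0 : ℝ)..s, ((inner ℝ ((h : Lp E 2 unitMeasure) t) (g t) : ℝ) -
      z * inner ℝ (evalAt t h) (R t (evalAt t G))) =
      inner ℝ (evalAt s h) (Y' s c) - inner ℝ (evalAt 0 h) (Y' 0 c) := by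
    rw [← p1]
    refine intervalIntegral.integral_congr fun t ht => ?_
    rw [uIcc_of_le hs.1] at ht
    rw [hG t ⟨ht.1, ht.2.trans hs.2⟩, hpY t ht, hgY t ht.2, inner_neg_right, real_inner_smul_right]
    ring
  have q2 : ∫ t in s..1, ((inner ℝ ((h : Lp E 2 unitMeasure) t) (g t) : ℝ) -
      z * inner ℝ (evalAt t h) (R t (evalAt t G))) =
      inner ℝ (evalAt 1 h) (Z' 1 d) - inner ℝ (evalAt s h) (Z' s d) := by
    rw [← p2]
    refine intervalIntegral.integral_congr_ae (.of_forall fun t ht => ?_)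
    rw [uIoc_of_le hs.2] at ht
    rw [hG t ⟨hs.1.trans ht.1.le, ht.2⟩, hpZ t ⟨ht.1.le, ht.2⟩, hgZ t ht.1, inner_neg_right,
      real_inner_smul_right]
    ring
  have q3 := intervalIntegral.integral_add_adjacent_intervals
    ((i1 h0 hs).sub ((i2 h0 hs).const_mul z)) ((i1 hs h1').sub ((i2 hs h1').const_mul z))
  rw [q1, q2, intervalIntegral.integral_sub (i1 h0 h1') ((i2 h0 h1').const_mul z),
    intervalIntegral.integral_const_mul, evalAt_one, inner_zero_left] at q3
  have e0 : evalAt 0 h = 0 := by rw [evalAt_apply h0]; simp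
  rw [e0, inner_zero_left] at q3
  rw [← h2, inner_sub_right]
  linarith

/-- The jump conditions at the pole of the Green's function can be solved: the linear system is
injective by the Wronskian relations, and `c` is determined by `W c = Z^* v`. -/
lemma exists_green_data {Y Y' Z Z' : E →L[ℝ] E} {W : E →L[ℝ] E} (hW : Function.Injective W)
    (hW' : Function.Injective (adjoint W))
    (hYZ : adjoint Z' ∘L Y - adjoint Z ∘L Y' = -W)
    (hZ : adjoint Z' ∘L Z - adjoint Z ∘L Z' = 0)
    (v : E) : ∃ c d, Y c = Z d ∧ Y' c - Z' d = v ∧ W c = adjoint Z v := by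
  have e1 : ∀ c, W c = adjoint Z (Y' c) - adjoint Z' (Y c) := fun c => by
    have := DFunLike.congr_fun hYZ c
    simp only [_root_.sub_apply, ContinuousLinearMap.comp_apply, _root_.neg_apply] at this
    rw [← neg_sub, this, neg_neg]
  have e2 : ∀ d, adjoint Z' (Z d) = adjoint Z (Z' d) := fun d => by
    have := DFunLike.congr_fun hZ d
    simpa [sub_eq_zero] using this
  have e3 : ∀ d, adjoint W d = adjoint Y' (Z d) - adjoint Y (Z' d) := fun d => by
    refine ext_inner_right ℝ fun c => ?_
    rw [ContinuousLinearMap.adjoint_inner_left, e1, inner_sub_left, inner_sub_right,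
      ContinuousLinearMap.adjoint_inner_left, ContinuousLinearMap.adjoint_inner_left,
      ContinuousLinearMap.adjoint_inner_right, ContinuousLinearMap.adjoint_inner_right]
  let L : (E × E) →ₗ[ℝ] E × E :=
    ((Y.coprod (-Z)).prod (Y'.coprod (-Z')) : (E × E) →L[ℝ] E × E)
  have hL : ∀ c d, L (c, d) = (Y c - Z d, Y' c - Z' d) := fun c d => by
    simp [L, sub_eq_add_neg]
  have hinj : Function.Injective L := by
    refine (injective_iff_map_eq_zero _).2 ?_
    rintro ⟨c, d⟩ h
    rw [hL, Prod.mk_eq_zero, sub_eq_zero, sub_eq_zero] at h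
    have hc : c = 0 := hW (by rw [e1, h.1, h.2, e2, sub_self, map_zero])
    have hd : d = 0 := hW' (by rw [e3, ← h.1, ← h.2, hc]; simp)
    rw [hc, hd, Prod.mk_zero_zero]
  obtain ⟨⟨c, d⟩, h⟩ := LinearMap.injective_iff_surjective.1 hinj (0, v)
  rw [hL, Prod.mk.injEq, sub_eq_zero] at h
  refine ⟨c, d, h.1, h.2, ?_⟩
  rw [e1, h.1, e2, ← map_sub, h.2]

/-- The Fredholm determinant of the model operator is the determinant of the solution of the
Jacobi equation with `Y(0) = 0`, `Y'(0) = 1` at time one. -/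
theorem hasFredholmDet_model (hR : ContinuousOn R (Icc 0 1))
    (hs : ∀ s ∈ Icc (0 : ℝ) 1, (R s : E →ₗ[ℝ] E).IsSymmetric)
    (hpos : ∀ f : MeanZero E, 0 ≤ inner ℝ f (f + jacobiOp R f)) {Y₁ Y₁' : ℝ → E →L[ℝ] E}
    (hY₁ : IsJacobi R 1 Y₁ Y₁') (hY₁0 : Y₁ 0 = 0) (hY₁0' : Y₁' 0 = ContinuousLinearMap.id ℝ E) :
    HasFredholmDet (ContinuousLinearMap.id ℝ (MeanZero E) + jacobiOp R)
      (LinearMap.det (Y₁ 1 : E →ₗ[ℝ] E)) := by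
  have h0 : (0 : ℝ) ∈ Icc (0 : ℝ) 1 := ⟨le_rfl, zero_le_one⟩
  have h1 : (1 : ℝ) ∈ Icc (0 : ℝ) 1 := ⟨zero_le_one, le_rfl⟩
  choose Y Y' hY hY0 hY0' using fun z =>
    exists_isJacobi hR z h0 (0 : E →L[ℝ] E) (ContinuousLinearMap.id ℝ E)
  choose Z Z' hZ hZ1 hZ1' using fun z =>
    exists_isJacobi hR z h1 (0 : E →L[ℝ] E) (-ContinuousLinearMap.id ℝ E)
  obtain ⟨C, hC⟩ := IsJacobi.exists_norm_sub_le hR (0 : E →L[ℝ] E) (ContinuousLinearMap.id ℝ E)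
  have hY1 : Y₁ 1 = Y 1 1 := by
    have := hC 1 h1 1 h1 _ _ _ _ hY₁ (hY 1) hY₁0 hY₁0' (hY0 1) (hY0' 1) 1 h1
    simpa [sub_eq_zero] using this
  have hY00 : Y 0 1 = ContinuousLinearMap.id ℝ E := by
    have hJ : IsJacobi R 0 (fun s => s • ContinuousLinearMap.id ℝ E)
        (fun _ => ContinuousLinearMap.id ℝ E) := by
      refine ⟨fun s _ => ?_, fun s _ => ?_⟩
      · simpa using (hasDerivWithinAt_id s (Icc 0 1)).smul_const (ContinuousLinearMap.id ℝ E)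
      · simpa using hasDerivWithinAt_const s (Icc 0 1) (ContinuousLinearMap.id ℝ E)
    have := hC 0 h0 0 h0 _ _ _ _ (hY 0) hJ (hY0 0) (hY0' 0) (by simp) rfl 1 h1
    simpa [sub_eq_zero] using this
  have hid : adjoint (ContinuousLinearMap.id ℝ E) = ContinuousLinearMap.id ℝ E :=
    star_one (E →L[ℝ] E)
  -- The Wronskian identities.
  have w1 : ∀ z, adjoint (Z z 0) = Y z 1 := fun z => by
    have := (hY z).wronskian hR hs (hZ z) h0 h1 zero_le_one
    rw [hZ1', hZ1, hY0, hY0'] at this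
    rw [map_neg, hid] at this
    simp only [map_zero, ContinuousLinearMap.comp_zero, ContinuousLinearMap.zero_comp, sub_zero,
      ContinuousLinearMap.neg_comp, ContinuousLinearMap.id_comp, ContinuousLinearMap.comp_id,
      sub_self, zero_smul, zero_sub, sub_neg_eq_add, neg_add_eq_zero] at this
    exact this.symm
  have w2 : ∀ z w, Y w 1 = Y z 1 - (w - z) • ∫ s in (0 : ℝ)..1,
      adjoint (Z z s) ∘L R s ∘L Y w s := fun z w => by
    have := (hY w).wronskian hR hs (hZ z) h0 h1 zero_le_one
    rw [hZ1', hZ1, hY0, hY0', ContinuousLinearMap.comp_id, w1 z] at this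
    rw [← this, map_neg, hid]
    simp
  have hcont : ∀ z w, ContinuousOn (fun s => adjoint (Z z s) ∘L R s ∘L Y w s) (Icc 0 1) :=
    fun z w => ((adjoint (𝕜 := ℝ) (E := E) (F := E)).continuous.comp_continuousOn
      (hZ z).continuousOn).clm_comp (hR.clm_comp (hY w).continuousOn)
  -- By `w2`, the derivative of `w ↦ Y w 1` at `z` is the integral with `w` replaced by `z`.
  have hderiv : ∀ z ∈ Ioo (0 : ℝ) 1, HasDerivAt (fun w => Y w 1)
      (-∫ s in (0 : ℝ)..1, adjoint (Z z s) ∘L R s ∘L Y z s) z := by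
    intro z hz
    have hz' := Ioo_subset_Icc_self hz
    obtain ⟨C₁, hC₁⟩ := isCompact_Icc.exists_bound_of_continuousOn
      (((adjoint (𝕜 := ℝ) (E := E) (F := E)).continuous.comp_continuousOn
        (hZ z).continuousOn).clm_comp hR)
    have hi : ∀ w, IntervalIntegrable (fun s => adjoint (Z z s) ∘L R s ∘L Y w s) volume 0 1 :=
      fun w => ContinuousOn.intervalIntegrable (by rw [uIcc_of_le zero_le_one]; exact hcont z w)
    rw [hasDerivAt_iff_tendsto_slope]
    have hnh : ∀ᶠ w in 𝓝[≠] z, w ∈ Icc (0 : ℝ) 1 ∧ w ≠ z :=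
      inter_mem (mem_nhdsWithin_of_mem_nhds (Icc_mem_nhds hz.1 hz.2)) self_mem_nhdsWithin
    refine tendsto_iff_norm_sub_tendsto_zero.2 (squeeze_zero' (.of_forall fun _ => norm_nonneg _)
      (g := fun w => C₁ * (C * |w - z|) * |1 - 0|) ?_ ?_)
    · filter_upwards [hnh] with w hw
      have e1 : slope (fun w => Y w 1) z w =
          -∫ s in (0 : ℝ)..1, adjoint (Z z s) ∘L R s ∘L Y w s := by
        rw [slope_def_module, w2 z w, sub_sub_cancel_left, smul_neg,
          inv_smul_smul₀ (sub_ne_zero.2 hw.2)]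
      rw [e1, ← neg_sub', norm_neg, ← intervalIntegral.integral_sub (hi w) (hi z)]
      refine intervalIntegral.norm_integral_le_of_norm_le_const fun s hs' => ?_
      rw [uIoc_of_le zero_le_one] at hs'
      have hs'' : s ∈ Icc (0 : ℝ) 1 := ⟨hs'.1.le, hs'.2⟩
      have e2 : adjoint (Z z s) ∘L R s ∘L Y w s - adjoint (Z z s) ∘L R s ∘L Y z s =
          (adjoint (Z z s) ∘L R s) ∘L (Y w s - Y z s) := by
        rw [ContinuousLinearMap.comp_sub]
        rfl
      rw [e2]
      refine (ContinuousLinearMap.opNorm_comp_le _ _).trans (mul_le_mul (hC₁ s hs'')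
        (hC w hw.1 z hz' _ _ _ _ (hY w) (hY z) (hY0 w) (hY0' w) (hY0 z) (hY0' z) s hs'')
        (norm_nonneg _) ((norm_nonneg _).trans (hC₁ s hs'')))
    · have : Continuous fun w : ℝ => C₁ * (C * |w - z|) * |1 - 0| := by fun_prop
      simpa using (this.tendsto z).mono_left nhdsWithin_le_nhds
  have hYcont : ContinuousOn (fun z => Y z 1) (Icc 0 1) := by
    intro z hz
    refine tendsto_iff_norm_sub_tendsto_zero.2 (squeeze_zero' (.of_forall fun _ => norm_nonneg _)
      (g := fun w => C * |w - z|) ?_ ?_)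
    · filter_upwards [self_mem_nhdsWithin] with w hw
      exact hC w hw z hz _ _ _ _ (hY w) (hY z) (hY0 w) (hY0' w) (hY0 z) (hY0' z) 1 h1
    · have : Continuous fun w : ℝ => C * |w - z| := by fun_prop
      simpa using (this.tendsto z).mono_left nhdsWithin_le_nhds
  -- A vector in the kernel of `Y z 1` gives a function `f` with `⟨f, (1 + z K) f⟩ = 0`,
  -- and this form is positive definite for `z < 1`, as `1 + K` is nonnegative.
  have hinj : ∀ z ∈ Ioo (0 : ℝ) 1, Function.Injective (Y z 1) := by
    intro z hz
    refine (injective_iff_map_eq_zero _).2 fun v hv => ?_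
    have hYv : ContinuousOn (fun t => Y' z t v) (Icc 0 1) :=
      (hY z).continuousOn'.clm_apply continuousOn_const
    have hprim : ∀ t ∈ Icc (0 : ℝ) 1, ∫ τ in (0 : ℝ)..t, Y' z τ v = Y z t v := fun t ht => by
      rw [(hY z).integral v h0 ht ht.1, hY0]
      simp
    obtain ⟨f, hfg, hf⟩ := exists_meanZero (memLp_of_continuousOn hYv) (by rw [hprim 1 h1, hv])
    have hf' : ∀ t ∈ Icc (0 : ℝ) 1, evalAt t f = Y z t v := fun t ht => by
      rw [hf t ht, hprim t ht]
    have hRY : ContinuousOn (fun t => -(z • R t (Y z t v))) (Icc 0 1) :=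
      ((hR.clm_apply ((hY z).continuousOn.clm_apply continuousOn_const)).const_smul z).neg
    have i1 : IntervalIntegrable
        (fun t => (inner ℝ ((f : Lp E 2 unitMeasure) t) (Y' z t v) : ℝ)) volume 0 1 := by
      rw [intervalIntegrable_iff_integrableOn_Icc_of_le zero_le_one]
      exact integrable_inner_of_memLp (Lp.memLp f.toL2) (memLp_of_continuousOn hYv)
    have i2 : IntervalIntegrable (fun t => (inner ℝ (evalAt t f) (-(z • R t (Y z t v))) : ℝ))
        volume 0 1 := by
      refine ContinuousOn.intervalIntegrable ?_
      rw [uIcc_of_le zero_le_one]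
      exact (continuous_evalAt.clm_apply continuous_const).continuousOn.inner hRY
    have p := integral_inner_meanZero f h0 h1 zero_le_one ((hY z).apply v).2 hRY
    rw [hf' 1 h1, hv, hf' 0 h0, hY0, _root_.zero_apply, inner_zero_left, inner_zero_left,
      intervalIntegral.integral_add i1 i2, intervalIntegral.integral_of_le zero_le_one,
      intervalIntegral.integral_of_le zero_le_one, ← integral_Icc_eq_integral_Ioc,
      ← integral_Icc_eq_integral_Ioc, ← inner_meanZero f f hfg] at p
    have q : ∫ t in Icc (0 : ℝ) 1, (inner ℝ (evalAt t f) (-(z • R t (Y z t v))) : ℝ) =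
        z * inner ℝ f (jacobiOp R f) := by
      rw [inner_jacobiOp hR, mul_neg, ← integral_const_mul, ← integral_neg]
      refine setIntegral_congr_fun measurableSet_Icc fun t ht => ?_
      rw [hf' t ht, inner_neg_right, real_inner_smul_right]
    rw [q] at p
    have hp := hpos f
    rw [inner_add_right] at hp
    have hn : inner ℝ f f = ‖f‖ ^ 2 := real_inner_self_eq_norm_sq f
    have hf0 : f = 0 := by
      rw [← norm_eq_zero, ← sq_eq_zero_iff]
      nlinarith [sq_nonneg ‖f‖, hz.1, hz.2, mul_nonneg hz.1.le hp]
    have hYv0 : ∀ t ∈ Icc (0 : ℝ) 1, Y z t v = 0 := fun t ht => by rw [← hf' t ht, hf0, map_zero]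
    -- The Jacobi field vanishes identically, and its derivative at `0` is `v`.
    have d1 := ((hY z).apply v).1 0 h0
    have d2 : HasDerivWithinAt (fun s => Y z s v) 0 (Icc 0 1) 0 :=
      (hasDerivWithinAt_const _ _ (0 : E)).congr hYv0 (hYv0 0 h0)
    have d3 := (uniqueDiffOn_Icc zero_lt_one 0 h0).eq_deriv _ d1 d2
    simpa [hY0'] using d3
  have hne : ∀ z ∈ Ioo (0 : ℝ) 1, LinearMap.det (Y z 1 : E →ₗ[ℝ] E) ≠ 0 := by
    intro z hz h
    exact LinearMap.det_eq_zero_iff_ker_ne_bot.1 h (LinearMap.ker_eq_bot.2 (hinj z hz))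
  rw [hY1]
  refine hasFredholmDet_of_hasDerivAt (D := fun z => LinearMap.det (Y z 1 : E →ₗ[ℝ] E))
    continuous_kernelAt.continuousOn hR hs hpos ?_ ?_ hne ?_
  · exact ContinuousLinearMap.continuous_det.comp_continuousOn hYcont
  · simp [hY00]
  · intro z hz S hS
    obtain ⟨B, hB, hB'⟩ : ∃ B : E →L[ℝ] E, B ∘L Y z 1 = ContinuousLinearMap.id ℝ E ∧
        Y z 1 ∘L B = ContinuousLinearMap.id ℝ E := by
      let e := LinearEquiv.ofInjectiveEndo (Y z 1 : E →ₗ[ℝ] E) (hinj z hz)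
      refine ⟨LinearMap.toContinuousLinearMap (e.symm : E →ₗ[ℝ] E), ?_, ?_⟩
      · ext v
        exact e.symm_apply_apply v
      · ext v
        exact e.apply_symm_apply v
    refine (hasDerivAt_det (hderiv z hz) hB).congr_deriv ?_
    have hinj' : Function.Injective (adjoint (Y z 1)) := by
      refine (injective_iff_map_eq_zero _).2 fun v hv => ?_
      rw [← inner_self_eq_zero (𝕜 := ℝ)]
      have : v = Y z 1 (B v) := (DFunLike.congr_fun hB' v).symm
      nth_rewrite 2 [this]
      rw [← ContinuousLinearMap.adjoint_inner_left, hv, inner_zero_left]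
    -- The compressed resolvent, computed from the Green's function.
    have hgreen : ∀ s ∈ Icc (0 : ℝ) 1, adjoint (kernelAt s) ∘L S ∘L kernelAt s =
        Y z s ∘L B ∘L adjoint (Z z s) := by
      intro s hs'
      have wr : ∀ {A A' A₁ A₁' : ℝ → E →L[ℝ] E}, IsJacobi R z A A' → IsJacobi R z A₁ A₁' →
          ∀ {r t : ℝ}, r ∈ Icc (0 : ℝ) 1 → t ∈ Icc (0 : ℝ) 1 → r ≤ t →
          adjoint (A₁' t) ∘L A t - adjoint (A₁ t) ∘L A' t =
          adjoint (A₁' r) ∘L A r - adjoint (A₁ r) ∘L A' r := fun hA hA₁ r t hr ht hrt => by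
        have := hA.wronskian hR hs hA₁ hr ht hrt
        rwa [sub_self, zero_smul, sub_eq_zero] at this
      ext v
      obtain ⟨c, d, e1, e2, e3⟩ := exists_green_data (W := Y z 1) (hinj z hz) hinj'
        (Y := Y z s) (Y' := Y' z s) (Z := Z z s) (Z' := Z' z s)
        (by rw [← wr (hY z) (hZ z) hs' h1 hs'.2, hZ1, hZ1', map_neg, hid]; simp)
        (by rw [← wr (hZ z) (hZ z) hs' h1 hs'.2, hZ1]; simp) v
      obtain ⟨G, hG, hG'⟩ := exists_green hR (hY z) (hZ z) (hY0 z) (hZ1 z) hs' e1 e2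
      have hBc : B (adjoint (Z z s) v) = c := by
        rw [← e3]
        exact DFunLike.congr_fun hB c
      rw [adjoint_kernelAt]
      simp only [ContinuousLinearMap.comp_apply]
      rw [← hG, hBc, ← hG']
      exact congrArg _ (hS G)
    congr 1
    rw [ContinuousLinearMap.comp_neg]
    let tr : (E →L[ℝ] E) →L[ℝ] ℝ := LinearMap.toContinuousLinearMap
      (LinearMap.trace ℝ E ∘ₗ ContinuousLinearMap.coeLM ℝ)
    have htr : ∀ P : E →L[ℝ] E, tr P = LinearMap.trace ℝ E (P : E →ₗ[ℝ] E) := fun P => rfl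
    simp only [← htr]
    rw [map_neg]
    congr 1
    have hi : IntegrableOn (fun s => adjoint (Z z s) ∘L R s ∘L Y z s) (Icc (0 : ℝ) 1) :=
      (hcont z z).integrableOn_compact isCompact_Icc
    rw [intervalIntegral.integral_of_le zero_le_one, ← integral_Icc_eq_integral_Ioc]
    have e4 : tr (B ∘L ∫ s in Icc (0 : ℝ) 1, adjoint (Z z s) ∘L R s ∘L Y z s) =
        ∫ s in Icc (0 : ℝ) 1, (tr ∘L ContinuousLinearMap.compL ℝ E E E B)
          (adjoint (Z z s) ∘L R s ∘L Y z s) := by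
      rw [ContinuousLinearMap.integral_comp_comm _ hi]
      rfl
    rw [e4]
    refine setIntegral_congr_fun measurableSet_Icc fun s hs' => ?_
    change LinearMap.trace ℝ E
        (((B ∘L adjoint (Z z s) ∘L R s : E →L[ℝ] E) : E →ₗ[ℝ] E) ∘ₗ (Y z s : E →ₗ[ℝ] E)) =
      LinearMap.trace ℝ E ((adjoint (kernelAt s) ∘L S ∘L kernelAt s) ∘L R s : E →L[ℝ] E)
    -- Here `tr (B Z^* R Y) = tr (Y B Z^* R)`, and `Y B Z^*` is the compressed resolvent.
    rw [hgreen s hs', LinearMap.trace_comp_comm']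
    rfl

end ModelDet

set_option maxSynthPendingDepth 3

/-! ### The Koszul formula -/

section Koszul

variable {F : Type*} [NormedAddCommGroup F] [NormedSpace ℝ F]
  {F' : Type*} [NormedAddCommGroup F'] [NormedSpace ℝ F']

/-- The Christoffel symbols of the first kind, of a possibly degenerate metric `G` on a vector
space: the right hand side of the Koszul formula for `⟨∇_a c, d⟩`, with `a`, `c`, `d` constant. -/
noncomputable def kos (G : F → F →L[ℝ] F →L[ℝ] ℝ) (b a c d : F) : ℝ :=
  (1 / 2) * (fderiv ℝ G b a c d + fderiv ℝ G b c a d - fderiv ℝ G b d a c)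

lemma hasDerivAt_apply_apply {G : F → F →L[ℝ] F →L[ℝ] ℝ} {b ξ η : ℝ → F} {b' ξ' η' : F} {s : ℝ}
    (hG : DifferentiableAt ℝ G (b s)) (hb : HasDerivAt b b' s) (hξ : HasDerivAt ξ ξ' s)
    (hη : HasDerivAt η η' s) :
    HasDerivAt (fun t => G (b t) (ξ t) (η t))
      (fderiv ℝ G (b s) b' (ξ s) (η s) + G (b s) ξ' (η s) + G (b s) (ξ s) η') s := by
  have h := ((hG.hasFDerivAt.comp_hasDerivAt s hb).clm_apply hξ).clm_apply hη
  simpa using h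

/-- The Christoffel symbols of a pulled back metric. -/
lemma kos_pullback {G : F → F →L[ℝ] F →L[ℝ] ℝ} {G' : F' → F' →L[ℝ] F' →L[ℝ] ℝ} {ψ : F → F'} {b : F}
    (hG : DifferentiableAt ℝ G b) (hG' : DifferentiableAt ℝ G' (ψ b)) (hψ : ContDiffAt ℝ ∞ ψ b)
    (hsymm : ∀ x y, G' (ψ b) x y = G' (ψ b) y x)
    (h : ∀ᶠ p in 𝓝 b, ∀ x y, G p x y = G' (ψ p) (fderiv ℝ ψ p x) (fderiv ℝ ψ p y)) (a c d : F) :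
    kos G b a c d = kos G' (ψ b) (fderiv ℝ ψ b a) (fderiv ℝ ψ b c) (fderiv ℝ ψ b d) +
      G' (ψ b) (fderiv ℝ (fderiv ℝ ψ) b a c) (fderiv ℝ ψ b d) := by
  have hψ1 : DifferentiableAt ℝ ψ b := hψ.differentiableAt (by simp)
  have hψ2 : DifferentiableAt ℝ (fderiv ℝ ψ) b :=
    (hψ.fderiv_right (m := 1) (by norm_cast)).differentiableAt (by simp)
  have hsym : ∀ x y, fderiv ℝ (fderiv ℝ ψ) b x y = fderiv ℝ (fderiv ℝ ψ) b y x := fun x y =>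
    (hψ.isSymmSndFDerivAt (by simp; exact WithTop.coe_le_coe.2 le_top)).eq x y
  have key : ∀ x y z, fderiv ℝ G b x y z =
      fderiv ℝ G' (ψ b) (fderiv ℝ ψ b x) (fderiv ℝ ψ b y) (fderiv ℝ ψ b z) +
      G' (ψ b) (fderiv ℝ (fderiv ℝ ψ) b x y) (fderiv ℝ ψ b z) +
      G' (ψ b) (fderiv ℝ ψ b y) (fderiv ℝ (fderiv ℝ ψ) b x z) := by
    intro x y z
    have hl : HasDerivAt (fun t : ℝ => b + t • x) x 0 := by
      simpa using ((hasDerivAt_id (0 : ℝ)).smul_const x).const_add b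
    have hc : Tendsto (fun t : ℝ => b + t • x) (𝓝 0) (𝓝 b) := by
      simpa using hl.continuousAt.tendsto
    have h0 : b + (0 : ℝ) • x = b := by simp
    have hd2 : ∀ w, HasDerivAt (fun t : ℝ => fderiv ℝ ψ (b + t • x) w)
        (fderiv ℝ (fderiv ℝ ψ) b x w) 0 := fun w => by
      have := (hψ2.hasFDerivAt.comp_hasDerivAt_of_eq 0 hl h0.symm).clm_apply
        (hasDerivAt_const (0 : ℝ) w)
      simpa using this
    have hd1 : HasDerivAt (fun t : ℝ => ψ (b + t • x)) (fderiv ℝ ψ b x) 0 :=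
      hψ1.hasFDerivAt.comp_hasDerivAt_of_eq 0 hl h0.symm
    have h1 := hasDerivAt_apply_apply (G := G) (b := fun t : ℝ => b + t • x) (s := 0)
      (ξ := fun _ => y) (η := fun _ => z) (by rw [h0]; exact hG) hl (hasDerivAt_const 0 y)
      (hasDerivAt_const 0 z)
    have h2 := hasDerivAt_apply_apply (G := G') (b := fun t : ℝ => ψ (b + t • x)) (s := 0)
      (ξ := fun t => fderiv ℝ ψ (b + t • x) y) (η := fun t => fderiv ℝ ψ (b + t • x) z)
      (by rw [h0]; exact hG') hd1 (hd2 y) (hd2 z)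
    have h3 := h1.unique (h2.congr_of_eventuallyEq ((hc.eventually h).mono fun t ht => ht y z))
    simp only [h0, map_zero, _root_.zero_apply, add_zero] at h3
    exact h3
  -- In the cyclic combination all but one pair of the terms with second derivatives of `ψ` cancel.
  rw [kos, kos, key, key, key, hsym c a, hsym d a, hsym d c,
    hsymm (fderiv ℝ ψ b c) (fderiv ℝ (fderiv ℝ ψ) b a d)]
  ring

end Koszul

/-! ### Metrics pulled back to vector spaces -/

section Pull

variable {n : ℕ} {M : Type*} [TopologicalSpace M] [ChartedSpace (EuclideanSpace ℝ (Fin n)) M]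
  [IsManifold (𝓡 n) ∞ M] [RiemannianBundle (fun x : M => TangentSpace (𝓡 n) x)]
variable {F : Type*} [NormedAddCommGroup F] [NormedSpace ℝ F]

variable (n) in
/-- The inner product of `T_qM`, as a bilinear form on the model space. -/
noncomputable def metricAt (q : M) :
    EuclideanSpace ℝ (Fin n) →L[ℝ] EuclideanSpace ℝ (Fin n) →L[ℝ] ℝ :=
  innerSL ℝ (E := TangentSpace (𝓡 n) q)

omit [IsManifold (𝓡 n) ∞ M] in
lemma metricAt_symm (q : M) (u v : EuclideanSpace ℝ (Fin n)) :
    metricAt n q u v = metricAt n q v u :=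
  real_inner_comm (F := TangentSpace (𝓡 n) q) v u

omit [IsManifold (𝓡 n) ∞ M] in
lemma metricAt_self_pos (q : M) {u : EuclideanSpace ℝ (Fin n)} (hu : u ≠ 0) :
    0 < metricAt n q u u :=
  real_inner_self_pos (F := TangentSpace (𝓡 n) q) |>.2 hu

variable (n) in
/-- The differential of a map into `M`, with values in the model space. -/
noncomputable def tder (Φ : F → M) (b : F) : F →L[ℝ] EuclideanSpace ℝ (Fin n) :=
  mfderiv 𝓘(ℝ, F) (𝓡 n) Φ b

variable (n) in
/-- The metric of `M`, pulled back to a vector space by a map `Φ`, as a bilinear form. -/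
noncomputable def pullMetric (Φ : F → M) (b : F) : F →L[ℝ] F →L[ℝ] ℝ :=
  (metricAt n (Φ b)).bilinearComp (tder n Φ b) (tder n Φ b)

omit [IsManifold (𝓡 n) ∞ M] in
lemma pullMetric_apply (Φ : F → M) (b ξ η : F) :
    pullMetric n Φ b ξ η = metricAt n (Φ b) (tder n Φ b ξ) (tder n Φ b η) := rfl

omit [IsManifold (𝓡 n) ∞ M] in
lemma pullMetric_symm (Φ : F → M) (b ξ η : F) : pullMetric n Φ b ξ η = pullMetric n Φ b η ξ :=
  metricAt_symm _ _ _

omit [IsManifold (𝓡 n) ∞ M] [RiemannianBundle (fun x : M => TangentSpace (𝓡 n) x)] in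
lemma tder_comp {F' : Type*} [NormedAddCommGroup F'] [NormedSpace ℝ F'] {Φ : F → M}
    {Φ' : F' → M} {ψ : F → F'} {b : F} (hΦ' : MDifferentiableAt 𝓘(ℝ, F') (𝓡 n) Φ' (ψ b))
    (hψ : DifferentiableAt ℝ ψ b) (h : ∀ᶠ p in 𝓝 b, Φ p = Φ' (ψ p)) :
    tder n Φ b = tder n Φ' (ψ b) ∘L fderiv ℝ ψ b := by
  have h2 : Φ =ᶠ[𝓝 b] Φ' ∘ ψ := h
  have h3 := mfderiv_comp b hΦ' hψ.mdifferentiableAt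
  rw [mfderiv_eq_fderiv] at h3
  exact (h2.mfderiv_eq (I := 𝓘(ℝ, F)) (I' := 𝓡 n)).trans h3

omit [IsManifold (𝓡 n) ∞ M] in
lemma pullMetric_comp {F' : Type*} [NormedAddCommGroup F'] [NormedSpace ℝ F'] {Φ : F → M}
    {Φ' : F' → M} {ψ : F → F'} {b : F} (hΦ' : MDifferentiableAt 𝓘(ℝ, F') (𝓡 n) Φ' (ψ b))
    (hψ : DifferentiableAt ℝ ψ b) (h : ∀ᶠ p in 𝓝 b, Φ p = Φ' (ψ p)) (ξ η : F) :
    pullMetric n Φ b ξ η = pullMetric n Φ' (ψ b) (fderiv ℝ ψ b ξ) (fderiv ℝ ψ b η) := by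
  rw [pullMetric_apply, pullMetric_apply, tder_comp hΦ' hψ h, h.self_of_nhds]
  rfl

omit [IsManifold (𝓡 n) ∞ M] [RiemannianBundle (fun x : M => TangentSpace (𝓡 n) x)] in
lemma contDiffAt_clm_of_apply {D F G : Type*} [NormedAddCommGroup D] [NormedSpace ℝ D]
    [NormedAddCommGroup F] [NormedSpace ℝ F] [NormedAddCommGroup G] [NormedSpace ℝ G]
    [FiniteDimensional ℝ F] {k : WithTop ℕ∞} {f : D → F →L[ℝ] G} {x : D}
    (h : ∀ y, ContDiffAt ℝ k (fun p => f p y) x) : ContDiffAt ℝ k f x := by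
  let d := Module.finrank ℝ F
  have hd : d = Module.finrank ℝ (Fin d → ℝ) := (Module.finrank_fin_fun ℝ).symm
  let e₁ := ContinuousLinearEquiv.ofFinrankEq hd
  let e₂ := (e₁.arrowCongr (1 : G ≃L[ℝ] G)).trans (ContinuousLinearEquiv.piRing (Fin d))
  rw [← Function.id_comp f, ← e₂.symm_comp_self]
  exact e₂.symm.contDiff.contDiffAt.comp x (contDiffAt_pi.mpr fun i => h _)

lemma contMDiffAt_mfderiv_apply {D : Type*} [NormedAddCommGroup D] [NormedSpace ℝ D] {Φ : F → M}
    {b ξ : D → F} {t : D} (hΦ : ContMDiffAt 𝓘(ℝ, F) (𝓡 n) ∞ Φ (b t)) (hb : ContDiffAt ℝ ∞ b t)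
    (hξ : ContDiffAt ℝ ∞ ξ t) :
    ContMDiffAt 𝓘(ℝ, D) (𝓡 n).tangent ∞
      (fun p => (⟨Φ (b p), tder n Φ (b p) (ξ p)⟩ : TangentBundle (𝓡 n) M)) t := by
  have h0 : ContMDiffAt 𝓘(ℝ, F) 𝓘(ℝ, F →L[ℝ] EuclideanSpace ℝ (Fin n)) ∞
      (inTangentCoordinates 𝓘(ℝ, F) (𝓡 n) id Φ (mfderiv 𝓘(ℝ, F) (𝓡 n) Φ) (b t)) (b t) :=
    hΦ.mfderiv_const (m := ∞) le_rfl
  have h1 := ContMDiffAt.comp t (f := b) h0 (contMDiffAt_iff_contDiffAt.2 hb)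
  refine ContMDiffAt.clm_apply_of_inCoordinates (IB₁ := 𝓘(ℝ, F)) (IB₂ := 𝓡 n)
    (IM := 𝓘(ℝ, D)) (F₁ := F) (E₁ := TangentSpace 𝓘(ℝ, F) (M := F))
    (b₁ := b) (b₂ := fun p => Φ (b p)) (ϕ := fun p => mfderiv 𝓘(ℝ, F) (𝓡 n) Φ (b p))
    (v := ξ) (m₀ := t) h1 ?_ (hΦ.comp t hb.contMDiffAt)
  rw [contMDiffAt_totalSpace]
  refine ⟨contMDiffAt_iff_contDiffAt.2 hb, ?_⟩
  simpa using hξ.contMDiffAt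

variable [IsContMDiffRiemannianBundle (𝓡 n) ∞ (EuclideanSpace ℝ (Fin n))
    (fun x : M => TangentSpace (𝓡 n) x)]

lemma contDiffAt_pullMetric [FiniteDimensional ℝ F] {Φ : F → M} {b : F}
    (hΦ : ContMDiffAt 𝓘(ℝ, F) (𝓡 n) ∞ Φ b) : ContDiffAt ℝ ∞ (pullMetric n Φ) b := by
  refine contDiffAt_clm_of_apply fun ξ => contDiffAt_clm_of_apply fun η => ?_
  rw [← contMDiffAt_iff_contDiffAt]
  exact (contMDiffAt_mfderiv_apply (b := id) (ξ := fun _ => ξ) hΦ contDiffAt_id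
    contDiffAt_const).inner_bundle (contMDiffAt_mfderiv_apply (b := id) (ξ := fun _ => η) hΦ
      contDiffAt_id contDiffAt_const)

section ChartFormula

local notation "𝔼" => EuclideanSpace ℝ (Fin n)

omit [RiemannianBundle (fun x : M => TangentSpace (𝓡 n) x)]
  [IsContMDiffRiemannianBundle (𝓡 n) ∞ (EuclideanSpace ℝ (Fin n))
    (fun x : M => TangentSpace (𝓡 n) x)] in
lemma symmL_eq_tder {p q : M} (hq : q ∈ (chartAt 𝔼 p).source) (a : 𝔼) :
    (trivializationAt 𝔼 (TangentSpace (𝓡 n)) p).symmL ℝ q a =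
      tder n (extChartAt (𝓡 n) p).symm (extChartAt (𝓡 n) p q) a := by
  rw [TangentBundle.symmL_trivializationAt hq]
  have : range (𝓡 n) = univ := by simp
  rw [this, mfderivWithin_univ]
  rfl

omit [RiemannianBundle (fun x : M => TangentSpace (𝓡 n) x)]
  [IsContMDiffRiemannianBundle (𝓡 n) ∞ (EuclideanSpace ℝ (Fin n))
    (fun x : M => TangentSpace (𝓡 n) x)] in
lemma coord_tder {p : M} {Φ : F → M} {b : F} (hΦ : MDifferentiableAt 𝓘(ℝ, F) (𝓡 n) Φ b)
    (hb : Φ b ∈ (chartAt 𝔼 p).source) (ξ : F) :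
    coord n p (Φ b) (tder n Φ b ξ) = fderiv ℝ (fun x => extChartAt (𝓡 n) p (Φ x)) b ξ := by
  have h1 : MDifferentiableAt (𝓡 n) 𝓘(ℝ, 𝔼) (extChartAt (𝓡 n) p) (Φ b) :=
    mdifferentiableAt_extChartAt hb
  have h2 := mfderiv_comp b h1 hΦ
  rw [mfderiv_eq_fderiv] at h2
  change _ = fderiv ℝ (extChartAt (𝓡 n) p ∘ Φ) b ξ
  rw [h2, coord, TangentBundle.continuousLinearMapAt_trivializationAt hb]
  rfl

omit [IsContMDiffRiemannianBundle (𝓡 n) ∞ (EuclideanSpace ℝ (Fin n))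
    (fun x : M => TangentSpace (𝓡 n) x)] in
lemma metricCoeff_eq {p : M} {z : 𝔼} (hz : z ∈ (extChartAt (𝓡 n) p).target) (i j : Fin n) :
    metricCoeff n p z i j = pullMetric n (extChartAt (𝓡 n) p).symm z (EuclideanSpace.single i 1)
      (EuclideanSpace.single j 1) := by
  have hq : (extChartAt (𝓡 n) p).symm z ∈ (chartAt 𝔼 p).source := by
    rw [← extChartAt_source (𝓡 n)]
    exact (extChartAt (𝓡 n) p).map_target hz
  rw [pullMetric_apply, metricCoeff, Matrix.of_apply, coordField, coordField]
  change metricAt n _ _ _ = _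
  rw [symmL_eq_tder hq, symmL_eq_tder hq, (extChartAt (𝓡 n) p).right_inv hz]

lemma metricPartial_eq {p : M} {z : 𝔼} (hz : z ∈ (extChartAt (𝓡 n) p).target) (l i j : Fin n) :
    metricPartial n p l i j z = fderiv ℝ (pullMetric n (extChartAt (𝓡 n) p).symm) z
      (EuclideanSpace.single l 1) (EuclideanSpace.single i 1) (EuclideanSpace.single j 1) := by
  have h1 : (fun w => metricCoeff n p w i j) =ᶠ[𝓝 z] fun w =>
      pullMetric n (extChartAt (𝓡 n) p).symm w (EuclideanSpace.single i 1)
        (EuclideanSpace.single j 1) := by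
    filter_upwards [(isOpen_extChartAt_target (I := 𝓡 n) p).mem_nhds hz] with w hw
    exact metricCoeff_eq hw i j
  have h2 : DifferentiableAt ℝ (pullMetric n (extChartAt (𝓡 n) p).symm) z :=
    (contDiffAt_pullMetric ((contMDiffOn_extChartAt_symm p).contMDiffAt
      ((isOpen_extChartAt_target (I := 𝓡 n) p).mem_nhds hz))).differentiableAt (by simp)
  rw [metricPartial, h1.fderiv_eq]
  have h3 := (h2.hasFDerivAt.clm_apply (hasFDerivAt_const (EuclideanSpace.single i (1 : ℝ)) z)).clm_apply
    (hasFDerivAt_const (EuclideanSpace.single j (1 : ℝ)) z)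
  rw [h3.fderiv]
  simp

end ChartFormula

end Pull

/-! ### The covariant derivative in arbitrary coordinates -/

section Cov

variable {n : ℕ} {M : Type*} [TopologicalSpace M] [ChartedSpace (EuclideanSpace ℝ (Fin n)) M]
  [IsManifold (𝓡 n) ∞ M] [RiemannianBundle (fun x : M => TangentSpace (𝓡 n) x)]
variable {F : Type*} [NormedAddCommGroup F] [NormedSpace ℝ F]
variable [IsContMDiffRiemannianBundle (𝓡 n) ∞ (EuclideanSpace ℝ (Fin n))
    (fun x : M => TangentSpace (𝓡 n) x)]

local notation "𝔼" => EuclideanSpace ℝ (Fin n)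

lemma euclidean_eq_sum (d : 𝔼) : d = ∑ m, d m • EuclideanSpace.single m (1 : ℝ) := by
  ext j
  simp [Finset.sum_apply, Pi.single_apply]

lemma clm_eq_sum {V : Type*} [NormedAddCommGroup V] [NormedSpace ℝ V] (L : 𝔼 →L[ℝ] V) (d : 𝔼) :
    L d = ∑ m, d m • L (EuclideanSpace.single m 1) := by
  conv_lhs => rw [euclidean_eq_sum d]
  simp only [map_sum, map_smul]

lemma tder_chart_injective {p : M} {z : 𝔼} (hz : z ∈ (extChartAt (𝓡 n) p).target) :
    Function.Injective (tder n (extChartAt (𝓡 n) p).symm z) := by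
  have hq : (extChartAt (𝓡 n) p).symm z ∈ (chartAt 𝔼 p).source := by
    rw [← extChartAt_source (𝓡 n)]
    exact (extChartAt (𝓡 n) p).map_target hz
  have hq' : (extChartAt (𝓡 n) p).symm z ∈
      (trivializationAt 𝔼 (TangentSpace (𝓡 n)) p).baseSet := by
    rwa [TangentBundle.trivializationAt_baseSet]
  intro a a' h
  have h1 : ∀ a, coord n p ((extChartAt (𝓡 n) p).symm z)
      (tder n (extChartAt (𝓡 n) p).symm z a) = a := fun a => by
    have h2 := symmL_eq_tder hq a
    rw [(extChartAt (𝓡 n) p).right_inv hz] at h2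
    rw [← h2]
    exact Bundle.Trivialization.continuousLinearMapAt_symmL _ hq' a
  rw [← h1 a, ← h1 a', h]

lemma pullMetric_chart_eq_sum {p : M} {z : 𝔼} (hz : z ∈ (extChartAt (𝓡 n) p).target) (w d : 𝔼) :
    pullMetric n (extChartAt (𝓡 n) p).symm z w d = d ⬝ᵥ (metricCoeff n p z).mulVec w := by
  rw [pullMetric_symm, clm_eq_sum (pullMetric n (extChartAt (𝓡 n) p).symm z) d]
  simp only [dotProduct, Matrix.mulVec, _root_.sum_apply, _root_.smul_apply,
    smul_eq_mul]
  refine Finset.sum_congr rfl fun i _ => ?_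
  rw [clm_eq_sum _ w]
  congr 1
  refine Finset.sum_congr rfl fun j _ => ?_
  rw [metricCoeff_eq hz, smul_eq_mul, mul_comm]

lemma det_metricCoeff_ne_zero {p : M} {z : 𝔼} (hz : z ∈ (extChartAt (𝓡 n) p).target) :
    (metricCoeff n p z).det ≠ 0 := by
  intro h
  obtain ⟨v, hv, hv'⟩ := Matrix.exists_mulVec_eq_zero_iff.2 h
  have h1 := pullMetric_chart_eq_sum hz (WithLp.toLp 2 v) (WithLp.toLp 2 v)
  rw [show (metricCoeff n p z).mulVec (WithLp.toLp 2 v : 𝔼) = 0 from hv', dotProduct_zero,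
    pullMetric_apply] at h1
  by_contra
  have h2 : tder n (extChartAt (𝓡 n) p).symm z (WithLp.toLp 2 v) = 0 := by
    by_contra h3
    exact (metricAt_self_pos _ h3).ne' h1
  have h3 := tder_chart_injective hz (h2.trans (map_zero _).symm)
  exact hv (by simpa using congrArg (WithLp.ofLp) h3)

omit [IsManifold (𝓡 n) ∞ M] in
lemma sum_rotate {ι : Type*} [Fintype ι] (f : ι → ι → ι → ℝ) :
    ∑ i, ∑ j, ∑ k, f i j k = ∑ k, ∑ i, ∑ j, f i j k := by
  rw [Finset.sum_comm]
  rw [Finset.sum_congr rfl fun j _ => Finset.sum_comm]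
  rw [Finset.sum_comm]
  exact Finset.sum_congr rfl fun k _ => Finset.sum_comm

lemma trilinear_eq_sum (L : 𝔼 →L[ℝ] 𝔼 →L[ℝ] 𝔼 →L[ℝ] ℝ) (x y z : 𝔼) :
    L x y z = ∑ i, ∑ j, ∑ k, x i * (y j * (z k * L (EuclideanSpace.single i 1)
      (EuclideanSpace.single j 1) (EuclideanSpace.single k 1))) := by
  rw [clm_eq_sum L x]
  simp only [_root_.sum_apply, _root_.smul_apply]
  refine Finset.sum_congr rfl fun i _ => ?_
  rw [clm_eq_sum (L _) y]
  simp only [_root_.sum_apply, _root_.smul_apply, Finset.smul_sum]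
  refine Finset.sum_congr rfl fun j _ => ?_
  rw [clm_eq_sum (L _ _) z]
  simp only [smul_eq_mul, Finset.mul_sum]

/-- The Koszul formula in the chart at the base point, which is the chart in which `covDeriv` is
defined. -/
lemma metricAt_covDeriv_chart (c : ℝ → M) (X : ∀ s, TangentSpace (𝓡 n) (c s)) (s : ℝ) (d : 𝔼) :
    metricAt n (c s) (covDeriv n c X s)
      (tder n (extChartAt (𝓡 n) (c s)).symm (extChartAt (𝓡 n) (c s) (c s)) d) =
    pullMetric n (extChartAt (𝓡 n) (c s)).symm (extChartAt (𝓡 n) (c s) (c s))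
      (deriv (fun t => coord n (c s) (c t) (X t)) s) d +
    kos (pullMetric n (extChartAt (𝓡 n) (c s)).symm) (extChartAt (𝓡 n) (c s) (c s))
      (coord n (c s) (c s) (velocity n c s)) (coord n (c s) (c s) (X s)) d := by
  set p := c s with hp
  set z := extChartAt (𝓡 n) p p with hz
  have hzt : z ∈ (extChartAt (𝓡 n) p).target := mem_extChartAt_target p
  set X' := deriv (fun t => coord n p (c t) (X t)) s with hX'
  set a := coord n p p (velocity n c s) with ha
  set e := coord n p p (X s) with he
  set w : 𝔼 := WithLp.toLp 2 fun k => ∑ i, ∑ j, christoffel n p k i j z * a i * e j with hw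
  have h1 : (covDeriv n c X s : 𝔼) = tder n (extChartAt (𝓡 n) p).symm z (X' + w) := by
    rw [clm_eq_sum]
    refine Finset.sum_congr rfl fun k _ => ?_
    rw [coordField, symmL_eq_tder (mem_chart_source _ _)]
    rfl
  set τ : Fin n → ℝ := fun l => ∑ i, ∑ j, (1 / 2) * (metricPartial n p i j l z +
    metricPartial n p j i l z - metricPartial n p l i j z) * a i * e j with hτ
  -- The Christoffel symbols of the second kind arise from those of the first kind by the inverse matrix
  -- of the metric coefficients.
  have h2 : (w : Fin n → ℝ) = (metricCoeff n p z)⁻¹.mulVec τ := by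
    funext k
    simp only [hw, hτ, Matrix.mulVec, dotProduct, christoffel, Finset.mul_sum, Finset.sum_mul]
    rw [sum_rotate]
    refine Finset.sum_congr rfl fun l _ => Finset.sum_congr rfl fun i _ =>
      Finset.sum_congr rfl fun j _ => ?_
    ring
  have h3 : pullMetric n (extChartAt (𝓡 n) p).symm z w d =
      kos (pullMetric n (extChartAt (𝓡 n) p).symm) z a e d := by
    rw [pullMetric_chart_eq_sum hzt, h2, Matrix.mulVec_mulVec, Matrix.mul_nonsing_inv _
      (isUnit_iff_ne_zero.2 (det_metricCoeff_ne_zero hzt)), Matrix.one_mulVec]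
    rw [kos, trilinear_eq_sum _ a e d, trilinear_eq_sum _ e a d, trilinear_eq_sum _ d a e]
    simp only [← metricPartial_eq hzt, hτ, dotProduct]
    rw [sum_rotate (fun i j m => a i * (e j * (d m * metricPartial n p i j m z))),
      sum_rotate (fun i j m => e i * (a j * (d m * metricPartial n p i j m z))), ← Finset.sum_add_distrib, ← Finset.sum_sub_distrib, Finset.mul_sum]
    refine Finset.sum_congr rfl fun m _ => ?_
    rw [Finset.sum_comm (f := fun i j => e i * (a j * (d m * metricPartial n p i j m z))),
      ← Finset.sum_add_distrib, ← Finset.sum_sub_distrib, Finset.mul_sum, Finset.mul_sum]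
    refine Finset.sum_congr rfl fun i _ => ?_
    rw [← Finset.sum_add_distrib, ← Finset.sum_sub_distrib, Finset.mul_sum, Finset.mul_sum]
    refine Finset.sum_congr rfl fun j _ => ?_
    ring
  have h4 : (extChartAt (𝓡 n) p).symm z = p := extChartAt_to_inv p
  rw [h1, ← h3, ← _root_.add_apply, ← map_add, pullMetric_apply, h4]

/-- The Koszul formula for the covariant derivative along a curve `Φ ∘ b`, of the field
`dΦ(ξ)`. The map `Φ` need not be an immersion. -/
lemma metricAt_covDeriv [FiniteDimensional ℝ F] {Φ : F → M} {b ξ : ℝ → F} {s : ℝ} {b' ξ' : F}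
    (hΦ : ContMDiffAt 𝓘(ℝ, F) (𝓡 n) ∞ Φ (b s)) (hb : HasDerivAt b b' s) (hξ : HasDerivAt ξ ξ' s)
    (d : F) :
    metricAt n (Φ (b s)) (covDeriv n (fun t => Φ (b t)) (fun t => tder n Φ (b t) (ξ t)) s)
      (tder n Φ (b s) d) =
    pullMetric n Φ (b s) ξ' d + kos (pullMetric n Φ) (b s) b' (ξ s) d := by
  set p := Φ (b s) with hp
  set φ := extChartAt (𝓡 n) p with hφ
  set ψ : F → 𝔼 := fun x => φ (Φ x) with hψ
  have hsrc : ∀ᶠ x in 𝓝 (b s), Φ x ∈ (chartAt 𝔼 p).source :=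
    hΦ.continuousAt.preimage_mem_nhds (chart_source_mem_nhds _ _)
  have hψs : ContDiffAt ℝ ∞ ψ (b s) := by
    rw [← contMDiffAt_iff_contDiffAt]
    exact (contMDiffAt_extChartAt (I := 𝓡 n)).comp (b s) hΦ
  have hψd : DifferentiableAt ℝ ψ (b s) := hψs.differentiableAt (by simp)
  have hψd2 : DifferentiableAt ℝ (fderiv ℝ ψ) (b s) :=
    (hψs.fderiv_right (m := 1) (by norm_cast)).differentiableAt (by simp)
  have hinv : ∀ᶠ x in 𝓝 (b s), Φ x = φ.symm (ψ x) := by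
    filter_upwards [hsrc] with x hx
    refine (φ.left_inv ?_).symm
    rwa [hφ, extChartAt_source]
  have hsymm : ∀ z ∈ φ.target, ContMDiffAt 𝓘(ℝ, 𝔼) (𝓡 n) ∞ φ.symm z := fun z hz =>
    (contMDiffOn_extChartAt_symm p).contMDiffAt
      ((isOpen_extChartAt_target (I := 𝓡 n) p).mem_nhds hz)
  have htgt : ∀ᶠ x in 𝓝 (b s), ψ x ∈ φ.target := by
    filter_upwards [hsrc] with x hx
    exact φ.map_source (by rwa [hφ, extChartAt_source])
  have hΦn : ∀ᶠ x in 𝓝 (b s), MDifferentiableAt 𝓘(ℝ, F) (𝓡 n) Φ x := by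
    have : ContMDiffAt 𝓘(ℝ, F) (𝓡 n) 1 Φ (b s) := hΦ.of_le (by norm_cast)
    filter_upwards [contMDiffAt_iff_contMDiffAt_nhds (by simp) |>.1 this] with x hx
    exact hx.mdifferentiableAt (by simp)
  have hψn : ∀ᶠ x in 𝓝 (b s), DifferentiableAt ℝ ψ x := by
    have : ContDiffAt ℝ 1 ψ (b s) := hψs.of_le (by norm_cast)
    filter_upwards [this.eventually (by simp)] with x hx
    exact hx.differentiableAt (by simp)
  have hcoord : ∀ᶠ x in 𝓝 (b s), ∀ ζ, coord n p (Φ x) (tder n Φ x ζ) = fderiv ℝ ψ x ζ := by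
    filter_upwards [hsrc, hΦn] with x hx hx' ζ
    exact coord_tder hx' hx ζ
  have hpull : ∀ᶠ x in 𝓝 (b s), ∀ ζ η, pullMetric n Φ x ζ η =
      pullMetric n φ.symm (ψ x) (fderiv ℝ ψ x ζ) (fderiv ℝ ψ x η) := by
    filter_upwards [hψn, htgt, hinv.eventually_nhds] with x h1 h2 h3 ζ η
    exact pullMetric_comp ((hsymm _ h2).mdifferentiableAt (by simp)) h1 h3 ζ η
  have hder : deriv (fun t => coord n p (Φ (b t)) (tder n Φ (b t) (ξ t))) s =
      fderiv ℝ (fderiv ℝ ψ) (b s) b' (ξ s) + fderiv ℝ ψ (b s) ξ' := by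
    have h1 : (fun t => coord n p (Φ (b t)) (tder n Φ (b t) (ξ t))) =ᶠ[𝓝 s]
        fun t => fderiv ℝ ψ (b t) (ξ t) := by
      filter_upwards [hb.continuousAt.eventually hcoord] with t ht
      exact ht _
    rw [h1.deriv_eq]
    exact ((hψd2.hasFDerivAt.comp_hasDerivAt s hb).clm_apply hξ).deriv
  have hvel : velocity n (fun t => Φ (b t)) s = tder n Φ (b s) b' := by
    have h1 := tder_comp (n := n) (Φ := fun t => Φ (b t)) (Φ' := Φ) (ψ := b) (b := s)
      (hΦ.mdifferentiableAt (by simp)) hb.differentiableAt (.of_forall fun _ => rfl)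
    have h2 := DFunLike.congr_fun h1 (1 : ℝ)
    refine Eq.trans h2 ?_
    rw [ContinuousLinearMap.comp_apply, fderiv_eq_smul_deriv, one_smul, hb.deriv]
  have htd : tder n Φ (b s) d = tder n φ.symm (ψ (b s)) (fderiv ℝ ψ (b s) d) := by
    rw [tder_comp ((hsymm _ htgt.self_of_nhds).mdifferentiableAt (by simp)) hψd hinv]
    rfl
  -- The curve in the chart is `ψ ∘ b` for `ψ = φ ∘ Φ`. The second derivative of `ψ` that enters with the
  -- derivative of the field is absorbed by `kos_pullback`.
  have hmain := metricAt_covDeriv_chart (fun t => Φ (b t)) (fun t => tder n Φ (b t) (ξ t)) s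
    (fderiv ℝ ψ (b s) d)
  simp only [hvel] at hmain
  rw [← hp, ← hφ, hder] at hmain
  rw [htd]
  refine Eq.trans hmain ?_
  rw [hcoord.self_of_nhds, hcoord.self_of_nhds, hpull.self_of_nhds,
    kos_pullback ((contDiffAt_pullMetric hΦ).differentiableAt (by simp))
      ((contDiffAt_pullMetric (hsymm _ htgt.self_of_nhds)).differentiableAt (by simp)) hψs
      (fun x y => pullMetric_symm _ _ _ _) hpull, map_add, _root_.add_apply]
  ring

end Cov

/-! ### Time dependent coordinates -/

section Tubes

variable {n : ℕ} {M : Type*} [TopologicalSpace M] [ChartedSpace (EuclideanSpace ℝ (Fin n)) M]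
  [IsManifold (𝓡 n) ∞ M]

local notation "𝔼" => EuclideanSpace ℝ (Fin n)

variable (n M) in
/-- Time dependent coordinates on `M`: a diffeomorphism over `ℝ` between open subsets of `ℝ × M` and
of `ℝ × 𝔼`. -/
structure Tube where
  /-- the domain in coordinates -/
  dom : Set (ℝ × 𝔼)
  /-- the image in space-time -/
  img : Set (ℝ × M)
  /-- the parametrization -/
  Φ : ℝ × 𝔼 → M
  /-- the coordinates -/
  A : ℝ × M → 𝔼
  isOpen_dom : IsOpen dom
  isOpen_img : IsOpen img
  smooth_Φ : ∀ b ∈ dom, ContMDiffAt 𝓘(ℝ, ℝ × 𝔼) (𝓡 n) ∞ Φ b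
  smooth_A : ∀ q ∈ img, ContMDiffAt (𝓘(ℝ, ℝ).prod (𝓡 n)) 𝓘(ℝ, 𝔼) ∞ A q
  mem_img : ∀ b ∈ dom, (b.1, Φ b) ∈ img
  mem_dom : ∀ q ∈ img, (q.1, A q) ∈ dom
  left_inv : ∀ b ∈ dom, A (b.1, Φ b) = b.2
  right_inv : ∀ q ∈ img, Φ (q.1, A q) = q.2

/-- The coordinates of a chart, as constant time dependent coordinates. -/
noncomputable def chartTube (p : M) : Tube n M where
  dom := {b | b.2 ∈ (extChartAt (𝓡 n) p).target}
  img := {q | q.2 ∈ (extChartAt (𝓡 n) p).source}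
  Φ b := (extChartAt (𝓡 n) p).symm b.2
  A q := extChartAt (𝓡 n) p q.2
  isOpen_dom := (isOpen_extChartAt_target (I := 𝓡 n) p).preimage continuous_snd
  isOpen_img := (isOpen_extChartAt_source (I := 𝓡 n) p).preimage continuous_snd
  smooth_Φ b hb := by
    have h1 : ContMDiffAt 𝓘(ℝ, 𝔼) (𝓡 n) ∞ (extChartAt (𝓡 n) p).symm b.2 :=
      (contMDiffOn_extChartAt_symm p).contMDiffAt
        ((isOpen_extChartAt_target (I := 𝓡 n) p).mem_nhds hb)
    exact h1.comp b (contMDiffAt_iff_contDiffAt.2 contDiffAt_snd)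
  smooth_A q hq := by
    have h1 : ContMDiffAt (𝓡 n) 𝓘(ℝ, 𝔼) ∞ (extChartAt (𝓡 n) p) q.2 :=
      contMDiffAt_extChartAt' (by rwa [← extChartAt_source (𝓡 n)])
    exact h1.comp q contMDiffAt_snd
  mem_img b hb := (extChartAt (𝓡 n) p).map_target hb
  mem_dom q hq := (extChartAt (𝓡 n) p).map_source hq
  left_inv b hb := (extChartAt (𝓡 n) p).right_inv hb
  right_inv q hq := (extChartAt (𝓡 n) p).left_inv hq

lemma contMDiffAt_prodMk_of_curve {c : ℝ → M} {s : ℝ} (hc : ContMDiffAt 𝓘(ℝ, ℝ) (𝓡 n) ∞ c s) :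
    ContMDiffAt 𝓘(ℝ, ℝ) (𝓘(ℝ, ℝ).prod (𝓡 n)) ∞ (fun t => (t, c t)) s :=
  contMDiffAt_id.prodMk hc

namespace Tube

variable (τ : Tube n M)

lemma contDiffAt_coords {c : ℝ → M} {s : ℝ} (hc : ContMDiffAt 𝓘(ℝ, ℝ) (𝓡 n) ∞ c s)
    (h : (s, c s) ∈ τ.img) : ContDiffAt ℝ ∞ (fun t => τ.A (t, c t)) s := by
  rw [← contMDiffAt_iff_contDiffAt]
  exact (τ.smooth_A _ h).comp s (contMDiffAt_prodMk_of_curve hc)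

lemma eventually_mem_img {c : ℝ → M} {s : ℝ} (hc : ContinuousAt c s) (h : (s, c s) ∈ τ.img) :
    ∀ᶠ t in 𝓝 s, (t, c t) ∈ τ.img :=
  (continuousAt_id.prodMk hc).preimage_mem_nhds (τ.isOpen_img.mem_nhds h)

lemma eventually_mem_dom {a : ℝ → 𝔼} {s : ℝ} (ha : ContinuousAt a s) (h : (s, a s) ∈ τ.dom) :
    ∀ᶠ t in 𝓝 s, (t, a t) ∈ τ.dom :=
  (continuousAt_id.prodMk ha).preimage_mem_nhds (τ.isOpen_dom.mem_nhds h)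

lemma velocity_eq {a : ℝ → 𝔼} {a' : 𝔼} {s : ℝ} (ha : HasDerivAt a a' s) (h : (s, a s) ∈ τ.dom) :
    (velocity n (fun t => τ.Φ (t, a t)) s : 𝔼) = tder n τ.Φ (s, a s) (1, a') := by
  have hb : HasDerivAt (fun t => (t, a t)) (1, a') s := (hasDerivAt_id s).prodMk ha
  have h1 := tder_comp (n := n) (Φ := fun t => τ.Φ (t, a t)) (Φ' := τ.Φ) (ψ := fun t => (t, a t))
    (b := s) ((τ.smooth_Φ _ h).mdifferentiableAt (by simp)) hb.differentiableAt
    (.of_forall fun _ => rfl)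
  refine (DFunLike.congr_fun h1 (1 : ℝ)).trans ?_
  rw [ContinuousLinearMap.comp_apply, fderiv_eq_smul_deriv, one_smul, hb.deriv]

/-- The coordinate vector fields span the tangent space. -/
lemma tder_bijective {b : ℝ × 𝔼} (hb : b ∈ τ.dom) :
    Function.Bijective (fun y : 𝔼 => tder n τ.Φ b (0, y)) := by
  have hΦ := τ.smooth_Φ b hb
  let L : 𝔼 →L[ℝ] 𝔼 := tder n τ.Φ b ∘L ContinuousLinearMap.inr ℝ ℝ 𝔼
  suffices h : Function.Injective L from
    ⟨h, (LinearMap.injective_iff_surjective (f := (L : 𝔼 →ₗ[ℝ] 𝔼))).1 h⟩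
  have h0 : HasFDerivAt (fun y : 𝔼 => (b.1, y)) (ContinuousLinearMap.inr ℝ ℝ 𝔼) b.2 :=
    (hasFDerivAt_const b.1 b.2).prodMk (hasFDerivAt_id b.2)
  -- The derivative of `y ↦ A (b₁, Φ (b₁, y)) = y` is the identity.
  have hA : MDifferentiableAt (𝓡 n) 𝓘(ℝ, 𝔼) (fun q => τ.A (b.1, q)) (τ.Φ b) := by
    have h1 := (τ.smooth_A _ (τ.mem_img b hb)).mdifferentiableAt (by simp)
    exact h1.comp (τ.Φ b) (mdifferentiableAt_const.prodMk mdifferentiableAt_id)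
  have hΦ' : MDifferentiableAt 𝓘(ℝ, 𝔼) (𝓡 n) (fun y : 𝔼 => τ.Φ (b.1, y)) b.2 :=
    (hΦ.mdifferentiableAt (by simp)).comp b.2 h0.differentiableAt.mdifferentiableAt
  have h1 : tder n (fun y : 𝔼 => τ.Φ (b.1, y)) b.2 = L := by
    rw [tder_comp (n := n) (Φ' := τ.Φ) (ψ := fun y : 𝔼 => (b.1, y))
      (hΦ.mdifferentiableAt (by simp)) h0.differentiableAt (.of_forall fun _ => rfl), h0.fderiv]
  have h2 := mfderiv_comp b.2 (g := fun q => τ.A (b.1, q)) hA hΦ'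
  have h3 : (fun q => τ.A (b.1, q)) ∘ (fun y : 𝔼 => τ.Φ (b.1, y)) =ᶠ[𝓝 b.2] id := by
    have : ∀ᶠ y in 𝓝 b.2, (b.1, y) ∈ τ.dom :=
      h0.continuousAt.preimage_mem_nhds (τ.isOpen_dom.mem_nhds hb)
    filter_upwards [this] with y hy
    exact τ.left_inv _ hy
  rw [mfderiv_eq_fderiv, h3.fderiv_eq, fderiv_id] at h2
  have h4 : ∀ y : 𝔼, y = mfderiv (𝓡 n) 𝓘(ℝ, 𝔼) (fun q => τ.A (b.1, q)) (τ.Φ b) (L y) := fun y => by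
    rw [← h1]
    exact DFunLike.congr_fun h2 y
  intro y y' h
  rw [h4 y, h4 y', h]

end Tube

variable [RiemannianBundle (fun x : M => TangentSpace (𝓡 n) x)]

lemma velocity_congr {c c₂ : ℝ → M} {s : ℝ} (h : c =ᶠ[𝓝 s] c₂) :
    (velocity n c s : 𝔼) = velocity n c₂ s :=
  DFunLike.congr_fun (h.mfderiv_eq (I := 𝓘(ℝ, ℝ)) (I' := 𝓡 n)) (1 : ℝ)

/-- The covariant derivative at `s` depends only on the germ of the vector field at `s`. -/
lemma covDeriv_congr {c c₂ : ℝ → M} {X : ∀ s, TangentSpace (𝓡 n) (c s)}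
    {X₂ : ∀ s, TangentSpace (𝓡 n) (c₂ s)} {s : ℝ} (hc : c =ᶠ[𝓝 s] c₂)
    (hX : ∀ᶠ t in 𝓝 s, (X t : 𝔼) = X₂ t) : (covDeriv n c X s : 𝔼) = covDeriv n c₂ X₂ s := by
  let f : M → 𝔼 → 𝔼 → 𝔼 → 𝔼 := fun p w v x => ∑ k, (w k + ∑ i, ∑ j,
    christoffel n p k i j (extChartAt (𝓡 n) p p) * coord n p p v i * coord n p p x j) •
    coordField n p k p
  let g : M → M → 𝔼 → 𝔼 := fun p q x => coord n p q x
  have h1 : (covDeriv n c X s : 𝔼) =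
    f (c s) (deriv (fun t => g (c s) (c t) (X t)) s) (velocity n c s) (X s) := rfl
  have h2 : (covDeriv n c₂ X₂ s : 𝔼) =
    f (c₂ s) (deriv (fun t => g (c₂ s) (c₂ t) (X₂ t)) s) (velocity n c₂ s) (X₂ s) := rfl
  have h3 : (fun t => g (c s) (c t) (X t)) =ᶠ[𝓝 s] fun t => g (c₂ s) (c₂ t) (X₂ t) := by
    filter_upwards [hc, hX] with t ht ht'
    rw [ht, hc.self_of_nhds, ht']
  rw [h1, h2, h3.deriv_eq, velocity_congr hc, hc.self_of_nhds, hX.self_of_nhds]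

variable [IsContMDiffRiemannianBundle (𝓡 n) ∞ (EuclideanSpace ℝ (Fin n))
    (fun x : M => TangentSpace (𝓡 n) x)]

namespace Tube

variable (τ : Tube n M)

/-- The metric on the slices of a tube. -/
noncomputable def sliceMetric (b : ℝ × 𝔼) : 𝔼 →L[ℝ] 𝔼 →L[ℝ] ℝ :=
  (pullMetric n τ.Φ b).bilinearComp (ContinuousLinearMap.inr ℝ ℝ 𝔼)
    (ContinuousLinearMap.inr ℝ ℝ 𝔼)

lemma sliceMetric_apply (b : ℝ × 𝔼) (y z : 𝔼) :
    τ.sliceMetric b y z = pullMetric n τ.Φ b (0, y) (0, z) := rfl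

/-- The Christoffel symbols `⟨∇_{(1, η)} (1, η), z⟩` of a tube. -/
noncomputable def sliceForce (p : (ℝ × 𝔼) × 𝔼) : 𝔼 →L[ℝ] ℝ :=
  fderiv ℝ (pullMetric n τ.Φ) p.1 (1, p.2) (1, p.2) ∘L ContinuousLinearMap.inr ℝ ℝ 𝔼 -
    (1 / 2 : ℝ) • ContinuousLinearMap.apply ℝ ℝ ((1, p.2) : ℝ × 𝔼) ∘L
      ContinuousLinearMap.apply ℝ (ℝ × 𝔼 →L[ℝ] ℝ) ((1, p.2) : ℝ × 𝔼) ∘L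
        fderiv ℝ (pullMetric n τ.Φ) p.1 ∘L ContinuousLinearMap.inr ℝ ℝ 𝔼

lemma sliceForce_apply (p : (ℝ × 𝔼) × 𝔼) (z : 𝔼) :
    τ.sliceForce p z = kos (pullMetric n τ.Φ) p.1 (1, p.2) (1, p.2) (0, z) := by
  simp only [sliceForce, kos, _root_.sub_apply, _root_.smul_apply, ContinuousLinearMap.comp_apply,
    ContinuousLinearMap.inr_apply, ContinuousLinearMap.apply_apply, smul_eq_mul]
  ring

/-- The right hand side of the geodesic equation `a'' = f(s, a, a')` in a tube. -/
noncomputable def rhs (p : (ℝ × 𝔼) × 𝔼) : 𝔼 :=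
  -(τ.sliceMetric p.1).inverse (τ.sliceForce p)

variable {τ}

lemma contDiffAt_metric {b : ℝ × 𝔼} (hb : b ∈ τ.dom) : ContDiffAt ℝ ∞ (pullMetric n τ.Φ) b :=
  contDiffAt_pullMetric (τ.smooth_Φ b hb)

lemma contDiffAt_sliceMetric {b : ℝ × 𝔼} (hb : b ∈ τ.dom) : ContDiffAt ℝ ∞ τ.sliceMetric b := by
  refine contDiffAt_clm_of_apply fun y => contDiffAt_clm_of_apply fun z => ?_
  exact ((contDiffAt_metric hb).clm_apply contDiffAt_const).clm_apply contDiffAt_const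

lemma contDiffAt_sliceForce {p : (ℝ × 𝔼) × 𝔼} (hp : p.1 ∈ τ.dom) :
    ContDiffAt ℝ ∞ τ.sliceForce p := by
  refine contDiffAt_clm_of_apply fun z => ?_
  simp only [sliceForce_apply, kos]
  have h1 : ContDiffAt ℝ ∞ (fun p : (ℝ × 𝔼) × 𝔼 => fderiv ℝ (pullMetric n τ.Φ) p.1) p :=
    ((contDiffAt_metric hp).fderiv_right (m := ∞) (by simp)).comp p contDiffAt_fst
  have h2 : ContDiffAt ℝ ∞ (fun p : (ℝ × 𝔼) × 𝔼 => ((1, p.2) : ℝ × 𝔼)) p :=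
    contDiffAt_const.prodMk contDiffAt_snd
  have h3 : ∀ {u v w : (ℝ × 𝔼) × 𝔼 → ℝ × 𝔼}, ContDiffAt ℝ ∞ u p → ContDiffAt ℝ ∞ v p →
      ContDiffAt ℝ ∞ w p →
      ContDiffAt ℝ ∞ (fun p => fderiv ℝ (pullMetric n τ.Φ) p.1 (u p) (v p) (w p)) p :=
    fun hu hv hw => ((h1.clm_apply hu).clm_apply hv).clm_apply hw
  exact contDiffAt_const.mul (((h3 h2 h2 contDiffAt_const).add (h3 h2 h2 contDiffAt_const)).sub
    (h3 contDiffAt_const h2 h2))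

lemma isInvertible_sliceMetric {b : ℝ × 𝔼} (hb : b ∈ τ.dom) :
    (τ.sliceMetric b).IsInvertible := by
  have hinj : Function.Injective (τ.sliceMetric b) := by
    refine (injective_iff_map_eq_zero _).2 fun y hy => ?_
    by_contra h
    have h1 : tder n τ.Φ b (0, y) ≠ 0 := fun h2 =>
      h ((τ.tder_bijective hb).1 (h2.trans (map_zero (tder n τ.Φ b)).symm))
    have h2 := metricAt_self_pos (τ.Φ b) h1
    rw [← pullMetric_apply, ← sliceMetric_apply, hy] at h2
    exact lt_irrefl _ h2
  have hdim : Module.finrank ℝ 𝔼 = Module.finrank ℝ (𝔼 →L[ℝ] ℝ) :=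
    (InnerProductSpace.toDual ℝ 𝔼).toLinearEquiv.finrank_eq
  let e := LinearMap.linearEquivOfInjective (τ.sliceMetric b : 𝔼 →ₗ[ℝ] (𝔼 →L[ℝ] ℝ)) hinj hdim
  exact ⟨e.toContinuousLinearEquiv, by ext; rfl⟩

lemma contDiffAt_rhs {p : (ℝ × 𝔼) × 𝔼} (hp : p.1 ∈ τ.dom) : ContDiffAt ℝ ∞ τ.rhs p := by
  have h1 : ContDiffAt ℝ ∞ (fun p : (ℝ × 𝔼) × 𝔼 => (τ.sliceMetric p.1).inverse) p := by
    have h2 : ContDiffAt ℝ ∞ (fun p : (ℝ × 𝔼) × 𝔼 => τ.sliceMetric p.1) p :=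
      (contDiffAt_sliceMetric hp).comp p contDiffAt_fst
    exact ContDiffAt.comp (g := ContinuousLinearMap.inverse) p
      ((isInvertible_sliceMetric hp).contDiffAt_map_inverse (n := ∞)) h2
  exact (h1.clm_apply (contDiffAt_sliceForce hp)).neg

/-- The right hand side of the geodesic equation is characterized by pairing with all coordinate
directions, since the metric on the slices is nondegenerate. -/
lemma eq_rhs_iff {p : (ℝ × 𝔼) × 𝔼} (hp : p.1 ∈ τ.dom) (w : 𝔼) :
    w = τ.rhs p ↔ ∀ z, τ.sliceMetric p.1 w z + τ.sliceForce p z = 0 := by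
  have hinv := isInvertible_sliceMetric hp
  constructor
  · rintro rfl z
    rw [rhs, map_neg, hinv.self_apply_inverse]
    simp
  · intro h
    have h1 : τ.sliceMetric p.1 w = -τ.sliceForce p := by
      ext z
      exact eq_neg_of_add_eq_zero_left (h z)
    rw [rhs, ← map_neg, ← h1, hinv.inverse_apply_self]

/-- The geodesic equation in a tube. -/
lemma covDeriv_velocity_eq_zero_iff {a a' : ℝ → 𝔼} {a'' : 𝔼} {s : ℝ}
    (ha : ∀ᶠ t in 𝓝 s, HasDerivAt a (a' t) t) (ha' : HasDerivAt a' a'' s) (h : (s, a s) ∈ τ.dom) :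
    covDeriv n (fun t => τ.Φ (t, a t)) (velocity n fun t => τ.Φ (t, a t)) s = 0 ↔
      a'' = τ.rhs ((s, a s), a' s) := by
  rw [eq_rhs_iff h]
  have hb : HasDerivAt (fun t => (t, a t)) (1, a' s) s := (hasDerivAt_id s).prodMk ha.self_of_nhds
  have hξ : HasDerivAt (fun t => ((1 : ℝ), a' t)) (0, a'') s := (hasDerivAt_const s (1 : ℝ)).prodMk ha'
  have h1 : (covDeriv n (fun t => τ.Φ (t, a t)) (velocity n fun t => τ.Φ (t, a t)) s : 𝔼) =
      covDeriv n (fun t => τ.Φ (t, a t)) (fun t => tder n τ.Φ (t, a t) (1, a' t)) s := by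
    refine covDeriv_congr (.of_forall fun _ => rfl) ?_
    filter_upwards [ha, τ.eventually_mem_dom ha.self_of_nhds.continuousAt h] with t ht ht'
    exact τ.velocity_eq ht ht'
  have h2 := fun z : 𝔼 => metricAt_covDeriv (τ.smooth_Φ _ h) hb hξ (0, z)
  rw [← h1] at h2
  have h3 : ∀ z, τ.sliceMetric (s, a s) a'' z + τ.sliceForce ((s, a s), a' s) z =
      metricAt n (τ.Φ (s, a s))
        (covDeriv n (fun t => τ.Φ (t, a t)) (velocity n fun t => τ.Φ (t, a t)) s)
        (tder n τ.Φ (s, a s) (0, z)) := fun z => by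
    rw [sliceForce_apply, sliceMetric_apply]
    exact (h2 z).symm
  simp only [h3]
  constructor
  · intro h0 z
    exact (congrArg (fun w : 𝔼 => metricAt n (τ.Φ (s, a s)) w (tder n τ.Φ (s, a s) (0, z))) h0).trans
      (DFunLike.congr_fun (map_zero (metricAt n (τ.Φ (s, a s)))) _)
  · intro h0
    obtain ⟨y, hy⟩ := (τ.tder_bijective h).2
      (covDeriv n (fun t => τ.Φ (t, a t)) (velocity n fun t => τ.Φ (t, a t)) s)
    by_contra hne
    have := metricAt_self_pos (τ.Φ (s, a s)) hne
    rw [← hy] at this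
    simp only at hy
    have h4 := h0 y
    rw [← hy] at h4
    exact this.ne' h4

end Tube

end Tubes

/-! ### Smooth dependence for autonomous equations -/

section SmoothODE

variable {V : Type*} [NormedAddCommGroup V] [NormedSpace ℝ V] [CompleteSpace V]

/-- The solutions of a `C¹` autonomous equation with initial values near `x₀` exist for a uniform
time and stay near `x₀`. -/
lemma exists_solution_near {f : V → V} {x₀ : V} (hf : ContDiffAt ℝ 1 f x₀) {U : Set V}
    (hU : U ∈ 𝓝 x₀) : ∃ r > (0 : ℝ), ∃ ε > (0 : ℝ), ∀ x ∈ Metric.closedBall x₀ r, ∀ t₀ : ℝ,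
      ∃ α : ℝ → V, α t₀ = x ∧ ∀ t ∈ Ioo (t₀ - ε) (t₀ + ε), α t ∈ U ∧ HasDerivAt α (f (α t)) t := by
  obtain ⟨ε, hε, a, r, L, K, hr, h⟩ := IsPicardLindelof.of_contDiffAt_one hf
  obtain ⟨α, hα, hc⟩ := (h 0).exists_forall_mem_closedBall_eq_hasDerivWithinAt_continuousOn
  simp only [zero_sub, zero_add] at hα hc
  have h0 : α (x₀, 0) = x₀ := (hα x₀ (Metric.mem_closedBall_self r.2)).1
  have hn : Metric.closedBall x₀ (r : ℝ) ×ˢ Icc (-ε) ε ∈ 𝓝 (x₀, (0 : ℝ)) :=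
    prod_mem_nhds (Metric.closedBall_mem_nhds _ hr) (Icc_mem_nhds (by linarith) hε)
  have hV : {p : V × ℝ | α p ∈ U} ∈ 𝓝 (x₀, (0 : ℝ)) :=
    (hc.continuousAt hn).preimage_mem_nhds (by rwa [h0])
  obtain ⟨δ, hδ, hsub⟩ := Metric.nhds_basis_closedBall.mem_iff.1 hV
  refine ⟨min δ r, lt_min hδ hr, min δ ε, lt_min hδ hε, fun x hx t₀ => ?_⟩
  have hx1 : x ∈ Metric.closedBall x₀ (r : ℝ) :=
    Metric.closedBall_subset_closedBall (min_le_right _ _) hx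
  have hx2 : x ∈ Metric.closedBall x₀ δ :=
    Metric.closedBall_subset_closedBall (min_le_left _ _) hx
  refine ⟨fun t => α (x, t - t₀), by simpa using (hα x hx1).1, fun t ht => ?_⟩
  have e1 := min_le_left δ ε
  have e2 := min_le_right δ ε
  constructor
  · apply hsub
    rw [← closedBall_prod_same]
    refine ⟨hx2, ?_⟩
    rw [Metric.mem_closedBall, Real.dist_eq, sub_zero, abs_le]
    constructor <;> linarith [ht.1, ht.2]
  · have h1 := ((hα x hx1).2 (t - t₀) ⟨by linarith [ht.1], by linarith [ht.2]⟩).hasDerivAt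
      (Icc_mem_nhds (by linarith [ht.1]) (by linarith [ht.2]))
    simpa using HasDerivAt.comp_sub_const t t₀ h1

lemma contDiffAt_of_solution {f : V → V} {U : Set V} (hU : IsOpen U)
    (hf : ∀ x ∈ U, ContDiffAt ℝ ∞ f x) {α : ℝ → V} {s : ℝ} (hs : α s ∈ U)
    (h : ∀ᶠ t in 𝓝 s, HasDerivAt α (f (α t)) t) : ContDiffAt ℝ ∞ α s := by
  have h1 : ∀ᶠ t in 𝓝 s, α t ∈ U := h.self_of_nhds.continuousAt.preimage_mem_nhds (hU.mem_nhds hs)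
  obtain ⟨ε, hε, hb⟩ := Metric.nhds_basis_closedBall.eventually_iff.1 (h.and h1)
  rw [Real.closedBall_eq_Icc] at hb
  have := ODE.contDiffOn_enat_Icc_of_hasDerivWithinAt (n := ⊤) (f := fun _ => f) (α := α) (u := U)
    (tmin := s - ε) (tmax := s + ε)
    (fun p hp => ((hf p.2 hp.2).comp p contDiffAt_snd).contDiffWithinAt)
    (fun t ht => (hb ht).1.hasDerivWithinAt) (fun t ht => (hb ht).2)
  exact this.contDiffAt (Icc_mem_nhds (by linarith) (by linarith))

lemma eventuallyEq_of_solution {f : V → V} {α β : ℝ → V} {s : ℝ} (hf : ContDiffAt ℝ 1 f (α s))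
    (hα : ∀ᶠ t in 𝓝 s, HasDerivAt α (f (α t)) t) (hβ : ∀ᶠ t in 𝓝 s, HasDerivAt β (f (β t)) t)
    (h : α s = β s) : α =ᶠ[𝓝 s] β := by
  obtain ⟨K, t, ht, hl⟩ := hf.exists_lipschitzOnWith
  exact ODE_solution_unique_of_eventually (v := fun _ => f) (s := fun _ => t) (.of_forall fun _ => hl)
    (hα.and (hα.self_of_nhds.continuousAt.preimage_mem_nhds ht))
    (hβ.and (hβ.self_of_nhds.continuousAt.preimage_mem_nhds (h ▸ ht))) h

end SmoothODE

lemma _root_.ContDiffAt.contDiffAt_deriv {W : Type*} [NormedAddCommGroup W] [NormedSpace ℝ W]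
    {f : ℝ → W} {s : ℝ} (h : ContDiffAt ℝ ∞ f s) : ContDiffAt ℝ ∞ (deriv f) s :=
  ((h.fderiv_right (m := ∞) (by simp)).clm_apply (contDiffAt_const (c := (1 : ℝ)))).congr_of_eventuallyEq
    (.of_forall fun _ => fderiv_apply_one_eq_deriv.symm)

/-! ### Geodesics -/

section Geodesics

variable {n : ℕ} {M : Type*} [TopologicalSpace M] [ChartedSpace (EuclideanSpace ℝ (Fin n)) M]
  [IsManifold (𝓡 n) ∞ M] [RiemannianBundle (fun x : M => TangentSpace (𝓡 n) x)]

local notation "𝔼" => EuclideanSpace ℝ (Fin n)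

variable (n) in
/-- The curve `c` is smooth near `s` and `∇_s c' = 0` at `s`. -/
def IsGeodesicAt (c : ℝ → M) (s : ℝ) : Prop :=
  ContMDiffAt 𝓘(ℝ, ℝ) (𝓡 n) ∞ c s ∧ covDeriv n c (velocity n c) s = 0

lemma IsGeodesicAt.congr {c c₂ : ℝ → M} {s : ℝ} (h : IsGeodesicAt n c s) (hc : c₂ =ᶠ[𝓝 s] c) :
    IsGeodesicAt n c₂ s := by
  refine ⟨h.1.congr_of_eventuallyEq hc, ?_⟩
  exact (covDeriv_congr hc (hc.eventuallyEq_nhds.mono fun t ht => velocity_congr ht)).trans h.2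

lemma IsGeodesic.isGeodesicAt {c : SmoothCurve n M} (h : IsGeodesic n c) (s : ℝ) :
    IsGeodesicAt n c s := ⟨c.contMDiff.contMDiffAt, h s⟩

variable [IsContMDiffRiemannianBundle (𝓡 n) ∞ (EuclideanSpace ℝ (Fin n))
    (fun x : M => TangentSpace (𝓡 n) x)]

namespace Tube

variable (τ : Tube n M)

/-- The geodesic equation in a tube, as an autonomous first order equation. -/
noncomputable def field (p : (ℝ × 𝔼) × 𝔼) : (ℝ × 𝔼) × 𝔼 := ((1, p.2), τ.rhs p)

/-- The coordinates of the time, the position and the velocity of a curve. -/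
noncomputable def jet (c : ℝ → M) (t : ℝ) : (ℝ × 𝔼) × 𝔼 :=
  ((t, τ.A (t, c t)), deriv (fun t => τ.A (t, c t)) t)

lemma contDiffAt_field {p : (ℝ × 𝔼) × 𝔼} (hp : p.1 ∈ τ.dom) : ContDiffAt ℝ ∞ τ.field p :=
  (contDiffAt_const.prodMk contDiffAt_snd).prodMk (contDiffAt_rhs hp)

lemma eventuallyEq_coords {c : ℝ → M} {s : ℝ} (hc : ContinuousAt c s) (h : (s, c s) ∈ τ.img) :
    (fun t => τ.Φ (t, τ.A (t, c t))) =ᶠ[𝓝 s] c := by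
  filter_upwards [τ.eventually_mem_img hc h] with t ht
  exact τ.right_inv _ ht

lemma velocity_eq_jet {c : ℝ → M} {s : ℝ} (hc : ContMDiffAt 𝓘(ℝ, ℝ) (𝓡 n) ∞ c s)
    (h : (s, c s) ∈ τ.img) : (velocity n c s : 𝔼) = tder n τ.Φ (τ.jet c s).1 (1, (τ.jet c s).2) := by
  rw [← velocity_congr (τ.eventuallyEq_coords hc.continuousAt h)]
  exact τ.velocity_eq ((τ.contDiffAt_coords hc h).differentiableAt (by simp)).hasDerivAt
    (τ.mem_dom _ h)

/-- The jet of a geodesic solves the first order equation. -/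
lemma hasDerivAt_jet {c : ℝ → M} {s : ℝ} (hc : IsGeodesicAt n c s) (h : (s, c s) ∈ τ.img) :
    HasDerivAt (τ.jet c) (τ.field (τ.jet c s)) s := by
  have ha := τ.contDiffAt_coords hc.1 h
  have ha' : ContDiffAt ℝ ∞ (deriv fun t => τ.A (t, c t)) s := ha.contDiffAt_deriv
  have h1 : ∀ᶠ t in 𝓝 s, HasDerivAt (fun t => τ.A (t, c t)) (deriv (fun t => τ.A (t, c t)) t) t := by
    filter_upwards [(ha.of_le (m := 1) (by simp)).eventually (by simp)] with t ht
    exact (ht.differentiableAt (by simp)).hasDerivAt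
  have h2 := (ha'.differentiableAt (by simp)).hasDerivAt
  have h3 := (covDeriv_velocity_eq_zero_iff h1 h2 (τ.mem_dom _ h)).1
    (hc.congr (τ.eventuallyEq_coords hc.1.continuousAt h)).2
  rw [h3] at h2
  exact ((hasDerivAt_id s).prodMk h1.self_of_nhds).prodMk h2

/-- Conversely, a solution of the first order equation gives a geodesic, with the expected velocity. -/
lemma isGeodesicAt_of_solution {p : ℝ → (ℝ × 𝔼) × 𝔼} {s : ℝ} (h0 : (p s).1 ∈ τ.dom)
    (ht : ∀ᶠ t in 𝓝 s, (p t).1.1 = t) (h : ∀ᶠ t in 𝓝 s, HasDerivAt p (τ.field (p t)) t) :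
    IsGeodesicAt n (fun t => τ.Φ (p t).1) s ∧
      (velocity n (fun t => τ.Φ (p t).1) s : 𝔼) = tder n τ.Φ (p s).1 (1, (p s).2) := by
  have hp : ContDiffAt ℝ ∞ p s := contDiffAt_of_solution (f := τ.field) (U := {p | p.1 ∈ τ.dom})
    (τ.isOpen_dom.preimage continuous_fst : IsOpen {p : (ℝ × 𝔼) × 𝔼 | p.1 ∈ τ.dom}) (fun p hp => τ.contDiffAt_field hp) h0 h
  have h1 : ∀ᶠ t in 𝓝 s, HasDerivAt (fun t => (p t).1.2) (p t).2 t := by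
    filter_upwards [h] with t ht
    exact ht.fst.snd
  have h2 : HasDerivAt (fun t => (p t).2) (τ.rhs (p s)) s := h.self_of_nhds.snd
  have e : (p s).1 = (s, (p s).1.2) := Prod.ext ht.self_of_nhds rfl
  have h3 : (fun t => τ.Φ (p t).1) =ᶠ[𝓝 s] fun t => τ.Φ (t, (p t).1.2) := by
    filter_upwards [ht] with t ht
    congr 1
    exact Prod.ext ht rfl
  have h4 : ContMDiffAt 𝓘(ℝ, ℝ) (𝓡 n) ∞ (fun t => τ.Φ (p t).1) s :=
    (τ.smooth_Φ _ h0).comp s (contMDiffAt_iff_contDiffAt.2 (contDiffAt_fst.comp s hp))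
  have h0' : (s, (p s).1.2) ∈ τ.dom := e ▸ h0
  constructor
  · refine IsGeodesicAt.congr ⟨h4.congr_of_eventuallyEq h3.symm, ?_⟩ h3
    refine (covDeriv_velocity_eq_zero_iff h1 h2 h0').2 ?_
    congr 1
    exact Prod.ext e rfl
  · rw [velocity_congr h3, e]
    exact τ.velocity_eq h1.self_of_nhds h0'

/-- Geodesics with nearby initial values exist for a uniform time. -/
lemma exists_geodesic_near {p : (ℝ × 𝔼) × 𝔼} (hp : p.1 ∈ τ.dom) :
    ∃ r > (0 : ℝ), ∃ ε > (0 : ℝ), ∀ x ∈ Metric.closedBall p r, ∃ c : ℝ → M,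
      (∀ t ∈ Ioo (x.1.1 - ε) (x.1.1 + ε), IsGeodesicAt n c t) ∧ c x.1.1 = τ.Φ x.1 ∧
        (velocity n c x.1.1 : 𝔼) = tder n τ.Φ x.1 (1, x.2) := by
  obtain ⟨r, hr, ε, hε, h⟩ := exists_solution_near ((τ.contDiffAt_field hp).of_le (by simp))
    ((τ.isOpen_dom.preimage continuous_fst).mem_nhds hp : {p | p.1 ∈ τ.dom} ∈ 𝓝 p)
  refine ⟨r, hr, ε, hε, fun x hx => ?_⟩
  obtain ⟨α, hα, h'⟩ := h x hx x.1.1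
  have hx1 : x.1.1 ∈ Ioo (x.1.1 - ε) (x.1.1 + ε) := ⟨by linarith, by linarith⟩
  have htime : ∀ t ∈ Ioo (x.1.1 - ε) (x.1.1 + ε), (α t).1.1 = t := by
    intro t ht
    have h1 : ∀ t ∈ Ioo (x.1.1 - ε) (x.1.1 + ε),
        HasDerivAt (fun t => (α t).1.1 - t) 0 t := fun t ht => by
      have : HasDerivAt (fun t => (α t).1.1) 1 t := (h' t ht).2.fst.fst
      exact (this.sub (hasDerivAt_id t)).congr_deriv (sub_self _)
    have h2 := isOpen_Ioo.is_const_of_deriv_eq_zero isPreconnected_Ioo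
      (fun t ht => (h1 t ht).differentiableAt.differentiableWithinAt)
      (fun t ht => (h1 t ht).deriv) ht hx1
    simp only [hα, sub_self] at h2
    linarith
  have key := fun t (ht : t ∈ Ioo (x.1.1 - ε) (x.1.1 + ε)) =>
    τ.isGeodesicAt_of_solution (p := α) (h' t ht).1
      (by filter_upwards [isOpen_Ioo.mem_nhds ht] with t ht using htime t ht)
      (by filter_upwards [isOpen_Ioo.mem_nhds ht] with t ht using (h' t ht).2)
  refine ⟨fun t => τ.Φ (α t).1, fun t ht => (key t ht).1, by simp only [hα], ?_⟩
  rw [(key _ hx1).2, hα]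

end Tube

/-- Local uniqueness of geodesics. -/
lemma eventuallyEq_of_jet_eq (τ : Tube n M) {c₁ c₂ : ℝ → M} {s : ℝ}
    (h₁ : ∀ᶠ t in 𝓝 s, IsGeodesicAt n c₁ t) (h₂ : ∀ᶠ t in 𝓝 s, IsGeodesicAt n c₂ t)
    (hm : (s, c₁ s) ∈ τ.img) (h0 : c₁ s = c₂ s) (hj : τ.jet c₁ s = τ.jet c₂ s) :
    c₁ =ᶠ[𝓝 s] c₂ := by
  have hc₁ := h₁.self_of_nhds.1.continuousAt
  have hc₂ := h₂.self_of_nhds.1.continuousAt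
  have hm₂ : (s, c₂ s) ∈ τ.img := h0 ▸ hm
  have h3 : τ.jet c₁ =ᶠ[𝓝 s] τ.jet c₂ := by
    refine eventuallyEq_of_solution (f := τ.field)
      ((τ.contDiffAt_field (τ.mem_dom _ hm)).of_le (by simp)) ?_ ?_ hj
    · filter_upwards [h₁, τ.eventually_mem_img hc₁ hm] with t ht ht'
      exact τ.hasDerivAt_jet ht ht'
    · filter_upwards [h₂, τ.eventually_mem_img hc₂ hm₂] with t ht ht'
      exact τ.hasDerivAt_jet ht ht'
  filter_upwards [h3, τ.eventuallyEq_coords hc₁ hm, τ.eventuallyEq_coords hc₂ hm₂] with t e e₁ e₂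
  rw [← e₁, ← e₂]
  exact congrArg (fun p => τ.Φ p.1) e

/-- A geodesic is determined by its initial position and velocity. -/
theorem eqOn_of_isGeodesicAt [T2Space M] {c₁ c₂ : ℝ → M} {I : Set ℝ} (hI : IsOpen I)
    (hI' : IsPreconnected I) (h₁ : ∀ t ∈ I, IsGeodesicAt n c₁ t) (h₂ : ∀ t ∈ I, IsGeodesicAt n c₂ t)
    {t₀ : ℝ} (ht₀ : t₀ ∈ I) (h0 : c₁ t₀ = c₂ t₀)
    (h0' : (velocity n c₁ t₀ : 𝔼) = velocity n c₂ t₀) : EqOn c₁ c₂ I := by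
  have hev : ∀ {c : ℝ → M}, (∀ t ∈ I, IsGeodesicAt n c t) → ∀ s ∈ I,
      ∀ᶠ t in 𝓝 s, IsGeodesicAt n c t := fun h s hs => by
    filter_upwards [hI.mem_nhds hs] with t ht using h t ht
  have hmem : ∀ s, (s, c₁ s) ∈ (chartTube (c₁ s) : Tube n M).img := fun s =>
    mem_extChartAt_source (I := 𝓡 n) (c₁ s)
  have hopen : IsOpen {t | c₁ =ᶠ[𝓝 t] c₂} := isOpen_setOfPred_eventually_nhds
  suffices h : I ⊆ {t | c₁ =ᶠ[𝓝 t] c₂} from fun t ht => (h ht).self_of_nhds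
  refine hI'.subset_of_closure_inter_subset hopen ⟨t₀, ht₀, ?_⟩ ?_
  · let τ : Tube n M := chartTube (c₁ t₀)
    have hm : (t₀, c₁ t₀) ∈ τ.img := hmem t₀
    refine eventuallyEq_of_jet_eq τ (hev h₁ t₀ ht₀) (hev h₂ t₀ ht₀) hm h0 ?_
    have e1 := τ.velocity_eq_jet (h₁ t₀ ht₀).1 hm
    have e2 := τ.velocity_eq_jet (h₂ t₀ ht₀).1 (h0 ▸ hm)
    have e3 : (τ.jet c₁ t₀).1 = (τ.jet c₂ t₀).1 := by simp only [Tube.jet, h0]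
    refine Prod.ext e3 ?_
    rw [← e3] at e2
    have e4 : tder n τ.Φ (τ.jet c₁ t₀).1 (1, (τ.jet c₁ t₀).2) =
        tder n τ.Φ (τ.jet c₁ t₀).1 (1, (τ.jet c₂ t₀).2) := e1.symm.trans (h0'.trans e2)
    rw [← sub_eq_zero, ← map_sub, Prod.mk_sub_mk, sub_self] at e4
    exact sub_eq_zero.1 ((τ.tder_bijective (τ.mem_dom _ hm)).1
      (e4.trans (map_zero (tder n τ.Φ (τ.jet c₁ t₀).1)).symm))
  · rintro s ⟨hs, hsI⟩
    let τ : Tube n M := chartTube (c₁ s)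
    have hm : (s, c₁ s) ∈ τ.img := hmem s
    have hfr : ∃ᶠ t in 𝓝 s, c₁ =ᶠ[𝓝 t] c₂ := mem_closure_iff_frequently.1 hs
    have hc₁ := (h₁ s hsI).1.continuousAt
    have hc₂ := (h₂ s hsI).1.continuousAt
    have e0 : c₁ s = c₂ s := tendsto_nhds_unique_of_frequently_eq hc₁ hc₂ (hfr.mono fun t ht => ht.self_of_nhds)
    refine eventuallyEq_of_jet_eq τ (hev h₁ s hsI) (hev h₂ s hsI) hm e0 ?_
    refine tendsto_nhds_unique_of_frequently_eq (τ.hasDerivAt_jet (h₁ s hsI) hm).continuousAt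
      (τ.hasDerivAt_jet (h₂ s hsI) (e0 ▸ hm)).continuousAt (hfr.mono fun t ht => ?_)
    have : (fun t => τ.A (t, c₁ t)) =ᶠ[𝓝 t] fun t => τ.A (t, c₂ t) := by
      filter_upwards [ht] with t ht
      rw [ht]
    rw [Tube.jet, Tube.jet, this.deriv_eq, ht.self_of_nhds]

/-- Geodesics have constant speed. -/
lemma hasDerivAt_speed {c : ℝ → M} {s : ℝ} (h : IsGeodesicAt n c s) :
    HasDerivAt (fun t => metricAt n (c t) (velocity n c t) (velocity n c t)) 0 s := by
  have h1 := metricAt_covDeriv (Φ := c) (b := fun t => t) (ξ := fun _ => (1 : ℝ)) h.1 (hasDerivAt_id s)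
    (hasDerivAt_const s (1 : ℝ)) (1 : ℝ)
  have h2 : (covDeriv n (fun t => c t) (fun t => tder n c t (1 : ℝ)) s : 𝔼) = 0 := h.2
  replace h1 : (0 : ℝ) = pullMetric n c s 0 1 + kos (pullMetric n c) s 1 1 1 :=
    (congrArg (fun w : 𝔼 => metricAt n (c s) w (tder n c s 1)) h2).trans
      (DFunLike.congr_fun (map_zero (metricAt n (c s))) _) |>.symm.trans h1
  rw [map_zero, kos] at h1
  have h3 := ((contDiffAt_pullMetric h.1).differentiableAt (by simp)).hasFDerivAt.hasDerivAt
  have h4 := (h3.clm_apply (hasDerivAt_const s (1 : ℝ))).clm_apply (hasDerivAt_const s (1 : ℝ))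
  refine h4.congr_deriv ?_
  simp only [_root_.zero_apply, map_zero, _root_.add_apply] at h1 ⊢
  linarith

end Geodesics

/-! ### Geodesics on complete manifolds -/

section Completeness

variable {n : ℕ} {M : Type*} [EMetricSpace M] [ChartedSpace (EuclideanSpace ℝ (Fin n)) M]
  [IsManifold (𝓡 n) ∞ M] [RiemannianBundle (fun x : M => TangentSpace (𝓡 n) x)]

local notation "𝔼" => EuclideanSpace ℝ (Fin n)

lemma norm_velocity_sq (c : ℝ → M) (s : ℝ) :
    ‖velocity n c s‖ ^ 2 = metricAt n (c s) (velocity n c s) (velocity n c s) :=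
  (real_inner_self_eq_norm_sq (F := TangentSpace (𝓡 n) (c s)) (velocity n c s)).symm

lemma edist_le_of_norm_velocity_le [IsRiemannianManifold (𝓡 n) M] {c : ℝ → M} {a b C : ℝ}
    (hab : a ≤ b) (hc : ∀ t ∈ Icc a b, ContMDiffAt 𝓘(ℝ, ℝ) (𝓡 n) ∞ c t)
    (hv : ∀ t ∈ Icc a b, ‖velocity n c t‖ ≤ C) :
    edist (c a) (c b) ≤ ENNReal.ofReal C * ENNReal.ofReal (b - a) := by
  rw [IsRiemannianManifold.out (I := 𝓡 n) (c a) (c b)]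
  refine (riemannianEDist_le_pathELength
    (fun t ht => ((hc t ht).of_le (by simp)).contMDiffWithinAt) rfl rfl hab).trans ?_
  rw [pathELength_eq_lintegral_mfderiv_Icc, ← Real.volume_Icc, ← setLIntegral_const]
  refine setLIntegral_mono measurable_const fun t ht => ?_
  exact (ofReal_norm (E := TangentSpace (𝓡 n) (c t)) _).symm.trans_le
    (ENNReal.ofReal_le_ofReal (hv t ht))

variable [IsContMDiffRiemannianBundle (𝓡 n) ∞ (EuclideanSpace ℝ (Fin n))
    (fun x : M => TangentSpace (𝓡 n) x)]

lemma exists_norm_velocity_eq {c : ℝ → M} {a b : ℝ} (h : ∀ t ∈ Ioo a b, IsGeodesicAt n c t) :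
    ∃ C, ∀ t ∈ Ioo a b, ‖velocity n c t‖ = C := by
  rcases (Ioo a b).eq_empty_or_nonempty with h0 | ⟨t₀, ht₀⟩
  · exact ⟨0, fun t ht => absurd ht (h0 ▸ notMem_empty t)⟩
  refine ⟨‖velocity n c t₀‖, fun t ht => ?_⟩
  have h1 := isOpen_Ioo.is_const_of_deriv_eq_zero isPreconnected_Ioo
    (fun t ht => (hasDerivAt_speed (h t ht)).differentiableAt.differentiableWithinAt)
    (fun t ht => (hasDerivAt_speed (h t ht)).deriv) ht ht₀
  simp only [← norm_velocity_sq] at h1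
  exact (pow_left_inj₀ (norm_nonneg _) (norm_nonneg _) two_ne_zero).1 h1

instance : IsContinuousRiemannianBundle 𝔼 (fun x : M => TangentSpace (𝓡 n) x) := by
  obtain ⟨g, hg, hg'⟩ := IsContMDiffRiemannianBundle.exists_contMDiff (IB := 𝓡 n) (n := ∞)
    (F := 𝔼) (E := fun x : M => TangentSpace (𝓡 n) x)
  exact ⟨g, hg.continuous, hg'⟩

lemma eventually_norm_deriv_chart_le (q : M) : ∃ C > 0, ∀ᶠ y in 𝓝 q, ∀ (c : ℝ → M) (t : ℝ), c t = y →
    ContMDiffAt 𝓘(ℝ, ℝ) (𝓡 n) ∞ c t →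
      ‖deriv (fun t => extChartAt (𝓡 n) q (c t)) t‖ ≤ C * ‖velocity n c t‖ := by
  obtain ⟨C, hC, h⟩ := eventually_norm_mfderiv_extChartAt_lt (I := 𝓡 n) q
  refine ⟨C, hC, ?_⟩
  filter_upwards [h, chart_source_mem_nhds 𝔼 q] with y hy hy' c t hct hc
  subst hct
  have h1 := mfderiv_comp t (mdifferentiableAt_extChartAt (I := 𝓡 n) hy') (hc.mdifferentiableAt (by simp))
  rw [mfderiv_eq_fderiv] at h1
  have h2 : deriv (fun t => extChartAt (𝓡 n) q (c t)) t =
      mfderiv (𝓡 n) 𝓘(ℝ, 𝔼) (extChartAt (𝓡 n) q) (c t) (velocity n c t) :=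
    DFunLike.congr_fun h1 (1 : ℝ)
  rw [h2]
  exact (ContinuousLinearMap.le_opNorm _ _).trans
    (mul_le_mul_of_nonneg_right hy.le (norm_nonneg _))

/-- On a complete manifold, a geodesic on an open interval extends beyond the end points. -/
lemma exists_geodesic_extension [IsRiemannianManifold (𝓡 n) M] [CompleteSpace M] {c : ℝ → M}
    {a b e : ℝ} (hab : a < b) (he : e ∈ Icc a b) (h : ∀ t ∈ Ioo a b, IsGeodesicAt n c t) :
    ∃ ε > 0, ∃ c₂ : ℝ → M, (∀ t ∈ Ioo (e - ε) (e + ε), IsGeodesicAt n c₂ t) ∧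
      EqOn c c₂ (Ioo a b ∩ Ioo (e - ε) (e + ε)) := by
  obtain ⟨C, hC⟩ := exists_norm_velocity_eq h
  rw [← closure_Ioo hab.ne, mem_closure_iff_seq_limit] at he
  obtain ⟨t, ht, hte⟩ := he
  -- The speed is bounded, so the curve is Lipschitz and converges along `t` to a point `q`.
  have hlip : LipschitzOnWith C.toNNReal c (Ioo a b) := by
    have key : ∀ s ∈ Ioo a b, ∀ r ∈ Ioo a b, s ≤ r → edist (c s) (c r) ≤ C.toNNReal * edist s r := by
      intro s hs r hr hsr
      have hsub : Icc s r ⊆ Ioo a b := Icc_subset_Ioo hs.1 hr.2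
      refine (edist_le_of_norm_velocity_le hsr (fun t ht => (h t (hsub ht)).1)
        (fun t ht => (hC t (hsub ht)).le)).trans_eq ?_
      rw [edist_comm, edist_dist, Real.dist_eq, abs_of_nonneg (sub_nonneg.2 hsr)]
      rfl
    intro s hs r hr
    rcases le_total s r with hsr | hsr
    · exact key s hs r hr hsr
    · rw [edist_comm, edist_comm s]
      exact key r hr s hs hsr
  have hcauchy : CauchySeq (c ∘ t) := by
    have := (uniformContinuousOn_iff_restrict.1 hlip.uniformContinuousOn)
    have h1 : CauchySeq (fun k => (⟨t k, ht k⟩ : Ioo a b)) :=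
      isUniformEmbedding_subtype_val.isUniformInducing.cauchy_map_iff.1 hte.cauchySeq
    exact this.comp_cauchySeq h1
  obtain ⟨q, hq⟩ := cauchySeq_tendsto_of_complete hcauchy
  let τ : Tube n M := chartTube q
  have hqm : (e, q) ∈ τ.img := mem_extChartAt_source (I := 𝓡 n) q
  obtain ⟨D, hD, hD'⟩ := eventually_norm_deriv_chart_le (n := n) q
  -- The velocities are bounded in the chart at `q` and subconverge. Near the limit jet, geodesics exist
  -- for a uniform time, which carries the solution that starts at a late time beyond `e`.
  have hbd : ∀ᶠ k in atTop, (τ.jet c (t k)).2 ∈ Metric.closedBall (0 : 𝔼) (D * C) := by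
    filter_upwards [hq.eventually hD'] with k hk
    have := hk c (t k) rfl (h _ (ht k)).1
    rw [hC _ (ht k)] at this
    exact mem_closedBall_zero_iff.2 this
  obtain ⟨d, -, φ, hφ, hd⟩ := tendsto_subseq_of_frequently_bounded Metric.isBounded_closedBall
    hbd.frequently
  have hp : Tendsto (fun k => τ.jet c (t (φ k))) atTop (𝓝 ((e, τ.A (e, q)), d)) := by
    have h1 : Tendsto (fun k => (t (φ k), c (t (φ k)))) atTop (𝓝 (e, q)) :=
      (hte.prodMk_nhds hq).comp hφ.tendsto_atTop
    exact ((h1.fst_nhds).prodMk_nhds ((τ.smooth_A _ hqm).continuousAt.tendsto.comp h1)).prodMk_nhds hd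
  obtain ⟨r, hr, ε, hε, hgeo⟩ := τ.exists_geodesic_near (p := ((e, τ.A (e, q)), d)) (τ.mem_dom _ hqm)
  have hev : ∀ᶠ k in atTop, (t (φ k), c (t (φ k))) ∈ τ.img ∧
      τ.jet c (t (φ k)) ∈ Metric.closedBall ((e, τ.A (e, q)), d) r ∧
        t (φ k) ∈ Ioo (e - ε / 2) (e + ε / 2) := by
    refine (((hte.prodMk_nhds hq).comp hφ.tendsto_atTop).eventually
      (τ.isOpen_img.mem_nhds hqm)).and ((hp.eventually (Metric.closedBall_mem_nhds _ hr)).and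
        ((hte.comp hφ.tendsto_atTop).eventually (Ioo_mem_nhds (by linarith) (by linarith))))
  obtain ⟨k, hk1, hk2, hk3⟩ := hev.exists
  obtain ⟨c₂, hc₂, hc₂0, hc₂v⟩ := hgeo _ hk2
  set t₀ := t (φ k) with ht₀
  change ∀ s ∈ Ioo (t₀ - ε) (t₀ + ε), _ at hc₂
  have hsub : Ioo (e - ε / 2) (e + ε / 2) ⊆ Ioo (t₀ - ε) (t₀ + ε) :=
    Ioo_subset_Ioo (by linarith [hk3.2]) (by linarith [hk3.1])
  refine ⟨ε / 2, half_pos hε, c₂, fun s hs => hc₂ s (hsub hs), ?_⟩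
  refine (eqOn_of_isGeodesicAt (I := Ioo a b ∩ Ioo (t₀ - ε) (t₀ + ε)) (isOpen_Ioo.inter isOpen_Ioo)
    ?_ (fun s hs => h s hs.1) (fun s hs => hc₂ s hs.2) (t₀ := t₀)
    ⟨ht _, by linarith, by linarith⟩ ?_ ?_).mono (inter_subset_inter_right _ hsub)
  · rw [Ioo_inter_Ioo]
    exact isPreconnected_Ioo
  · exact (hc₂0.trans (τ.right_inv _ hk1)).symm
  · exact (τ.velocity_eq_jet (h _ (ht _)).1 hk1).trans hc₂v.symm

variable (n) in
/-- The numbers `T` such that there is a geodesic on `(-T, T)` with initial position `x` and initial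
velocity `v`. -/
def geodesicTimes (x : M) (v : 𝔼) : Set ℝ :=
  {T | 0 < T ∧ ∃ c : ℝ → M, (∀ t ∈ Ioo (-T) T, IsGeodesicAt n c t) ∧ c 0 = x ∧
    (velocity n c 0 : 𝔼) = v}

lemma exists_mem_geodesicTimes (x : M) (v : 𝔼) : ∃ T, T ∈ geodesicTimes n x v := by
  let τ : Tube n M := chartTube x
  have hm : ((0 : ℝ), x) ∈ τ.img := mem_extChartAt_source (I := 𝓡 n) x
  have hd := τ.mem_dom _ hm
  obtain ⟨y, hy⟩ := (τ.tder_bijective hd).2 (v - tder n τ.Φ (0, τ.A (0, x)) (1, 0))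
  obtain ⟨r, hr, ε, hε, h⟩ := τ.exists_geodesic_near (p := ((0, τ.A (0, x)), y)) hd
  obtain ⟨c, hc, hc0, hcv⟩ := h _ (Metric.mem_closedBall_self hr.le)
  simp only [zero_sub, zero_add] at hc
  refine ⟨ε, hε, c, hc, hc0.trans (τ.right_inv _ hm), hcv.trans ?_⟩
  have : ((1, y) : ℝ × 𝔼) = (1, 0) + (0, y) := by simp
  rw [this, map_add]
  exact (congrArg _ hy).trans (add_sub_cancel _ _)

/-- The geodesics on different intervals fit together. -/
lemma exists_geodesic_of_times {x : M} {v : 𝔼} {J : Set ℝ} (h0 : (0 : ℝ) ∈ J)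
    (hJ : ∀ s ∈ J, ∃ T > |s|, T ∈ geodesicTimes n x v) :
    ∃ c : ℝ → M, (∀ t ∈ J, IsGeodesicAt n c t) ∧ c 0 = x ∧ (velocity n c 0 : 𝔼) = v := by
  classical
  have : Nonempty M := ⟨x⟩
  choose! c hc hc0 hcv using fun T (hT : T ∈ geodesicTimes n x v) => hT.2
  let C : ℝ → M := fun t => if h : ∃ T > |t|, T ∈ geodesicTimes n x v then c h.choose t else x
  have key : ∀ T ∈ geodesicTimes n x v, EqOn C (c T) (Ioo (-T) T) := by
    intro T hT t ht
    have h1 : ∃ T > |t|, T ∈ geodesicTimes n x v := ⟨T, abs_lt.2 ht, hT⟩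
    have h2 := h1.choose_spec
    simp only [C, dif_pos h1]
    set T' := h1.choose
    refine eqOn_of_isGeodesicAt (I := Ioo (-T') T' ∩ Ioo (-T) T) (isOpen_Ioo.inter isOpen_Ioo) ?_
      (fun s hs => hc T' h2.2 s hs.1) (fun s hs => hc T hT s hs.2) (t₀ := 0) ?_
      ((hc0 T' h2.2).trans (hc0 T hT).symm) ((hcv T' h2.2).trans (hcv T hT).symm)
      ⟨abs_lt.1 h2.1, ht⟩
    · rw [Ioo_inter_Ioo]
      exact isPreconnected_Ioo
    · exact ⟨⟨neg_lt_zero.2 h2.2.1, h2.2.1⟩, ⟨neg_lt_zero.2 hT.1, hT.1⟩⟩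
  have key2 : ∀ s ∈ J, ∃ T, T ∈ geodesicTimes n x v ∧ s ∈ Ioo (-T) T ∧ C =ᶠ[𝓝 s] c T := by
    intro s hs
    obtain ⟨T, hT, hT'⟩ := hJ s hs
    refine ⟨T, hT', abs_lt.1 hT, ?_⟩
    filter_upwards [isOpen_Ioo.mem_nhds (abs_lt.1 hT)] with t ht using key T hT' ht
  obtain ⟨T₀, hT₀, -, hC0⟩ := key2 0 h0
  refine ⟨C, fun t ht => ?_, hC0.self_of_nhds.trans (hc0 T₀ hT₀),
    (velocity_congr hC0).trans (hcv T₀ hT₀)⟩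
  obtain ⟨T, hT, hT', hCT⟩ := key2 t ht
  exact (hc T hT t hT').congr hCT

/-- On a complete manifold, every geodesic extends to the whole real line. -/
theorem exists_geodesic [IsRiemannianManifold (𝓡 n) M] [CompleteSpace M] (x : M) (v : 𝔼) :
    ∃ c : SmoothCurve n M, IsGeodesic n c ∧ c 0 = x ∧ (velocity n c 0 : 𝔼) = v := by
  suffices h : ∀ s : ℝ, ∃ T > |s|, T ∈ geodesicTimes n x v by
    obtain ⟨c, hc, h0, hv⟩ := exists_geodesic_of_times (J := univ) (mem_univ 0) fun s _ => h s
    exact ⟨⟨c, fun t => (hc t (mem_univ t)).1⟩, fun t => (hc t (mem_univ t)).2, h0, hv⟩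
  by_contra! hbd
  obtain ⟨s₀, hs₀⟩ := hbd
  -- If the existence times are bounded, the geodesic on the maximal interval extends at both ends.
  set S := sSup (geodesicTimes n x v) with hS
  have hb : BddAbove (geodesicTimes n x v) := ⟨|s₀|, fun T hT => not_lt.1 fun h => hs₀ T h hT⟩
  obtain ⟨T₀, hT₀⟩ := exists_mem_geodesicTimes x v
  have hSpos : 0 < S := hT₀.1.trans_le (le_csSup hb hT₀)
  obtain ⟨c, hc, hc0, hcv⟩ := exists_geodesic_of_times (x := x) (v := v) (J := Ioo (-S) S)
    ⟨by linarith, hSpos⟩ (fun s hs => by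
      obtain ⟨T, hT, hT'⟩ := exists_lt_of_lt_csSup ⟨T₀, hT₀⟩ (abs_lt.2 hs)
      exact ⟨T, hT', hT⟩)
  have hSS : -S < S := by linarith
  obtain ⟨ε₁, hε₁, c₁, hc₁, he₁⟩ := exists_geodesic_extension hSS (right_mem_Icc.2 hSS.le) hc
  obtain ⟨ε₂, hε₂, c₂, hc₂, he₂⟩ := exists_geodesic_extension hSS (left_mem_Icc.2 hSS.le) hc
  obtain ⟨δ, hδ, hδ'⟩ := exists_between (lt_min hSpos (lt_min hε₁ hε₂))
  have d0 : δ < S := hδ'.trans_le (min_le_left _ _)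
  have d1 : δ < ε₁ := hδ'.trans_le ((min_le_right _ _).trans (min_le_left _ _))
  have d2 : δ < ε₂ := hδ'.trans_le ((min_le_right _ _).trans (min_le_right _ _))
  classical
  let C : ℝ → M := fun t => if t ∈ Ioo (-S) S then c t else if 0 < t then c₁ t else c₂ t
  have hC : EqOn C c (Ioo (-S) S) := fun t ht => if_pos ht
  have hC₁ : EqOn C c₁ (Ioo (S - δ) (S + δ)) := by
    intro t ht
    by_cases h : t ∈ Ioo (-S) S
    · exact (if_pos h).trans (he₁ ⟨h, by linarith [ht.1], by linarith [ht.2]⟩)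
    · exact (if_neg h).trans (if_pos (by linarith [ht.1]))
  have hC₂ : EqOn C c₂ (Ioo (-S - δ) (-S + δ)) := by
    intro t ht
    by_cases h : t ∈ Ioo (-S) S
    · exact (if_pos h).trans (he₂ ⟨h, by linarith [ht.1], by linarith [ht.2]⟩)
    · exact (if_neg h).trans (if_neg (by linarith [ht.2]))
  have hmem : S + δ ∈ geodesicTimes n x v := by
    refine ⟨by linarith, C, fun t ht => ?_, ?_, ?_⟩
    · rcases lt_or_ge t S with h1 | h1
      · rcases lt_or_ge (-S) t with h2 | h2
        · exact (hc t ⟨h2, h1⟩).congr (hC.eventuallyEq_of_mem (isOpen_Ioo.mem_nhds ⟨h2, h1⟩))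
        · have h3 : t ∈ Ioo (-S - δ) (-S + δ) := ⟨by linarith [ht.1], by linarith⟩
          exact (hc₂ t ⟨by linarith [h3.1], by linarith [h3.2]⟩).congr
            (hC₂.eventuallyEq_of_mem (isOpen_Ioo.mem_nhds h3))
      · have h3 : t ∈ Ioo (S - δ) (S + δ) := ⟨by linarith, ht.2⟩
        exact (hc₁ t ⟨by linarith [h3.1], by linarith [h3.2]⟩).congr
          (hC₁.eventuallyEq_of_mem (isOpen_Ioo.mem_nhds h3))
    · rw [hC ⟨by linarith, hSpos⟩, hc0]
    · rw [velocity_congr (hC.eventuallyEq_of_mem (isOpen_Ioo.mem_nhds ⟨by linarith, hSpos⟩)), hcv]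
  linarith [le_csSup hb hmem]

/-- The exponential map is computed by any geodesic on an interval that contains `0` and `1`. -/
lemma riemannianExp_eq [IsRiemannianManifold (𝓡 n) M] [CompleteSpace M] {c : ℝ → M} {I : Set ℝ}
    (hI : IsOpen I) (hI' : IsPreconnected I) (h0 : (0 : ℝ) ∈ I) (h1 : (1 : ℝ) ∈ I)
    (hc : ∀ t ∈ I, IsGeodesicAt n c t) (v : TangentSpace (𝓡 n) (c 0))
    (hv : (velocity n c 0 : 𝔼) = v) : riemannianExp n (c 0) v = c 1 := by
  obtain ⟨c', hc', hc'0, hc'v⟩ := exists_geodesic (c 0) v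
  have hex : ∃ c' : SmoothCurve n M, IsGeodesic n c' ∧
      (⟨c' 0, velocity n c' 0⟩ : TangentBundle (𝓡 n) M) = ⟨c 0, v⟩ :=
    ⟨c', hc', Bundle.TotalSpace.ext hc'0 (heq_of_eq hc'v)⟩
  rw [riemannianExp, dif_pos hex]
  have hs := hex.choose_spec
  set c₂ := hex.choose
  refine eqOn_of_isGeodesicAt hI hI' (fun t _ => IsGeodesic.isGeodesicAt hs.1 t) hc h0
    (congrArg Bundle.TotalSpace.proj hs.2) ?_ h1
  have : (velocity n c₂ 0 : 𝔼) = v := congrArg (fun p : TangentBundle (𝓡 n) M => (p.2 : 𝔼)) hs.2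
  exact this.trans hv.symm

end Completeness

/-! ### Existence of time dependent coordinates along an arc -/

section TubeExistence

variable {n : ℕ} {M : Type*} [TopologicalSpace M] [ChartedSpace (EuclideanSpace ℝ (Fin n)) M]
  [IsManifold (𝓡 n) ∞ M] [RiemannianBundle (fun x : M => TangentSpace (𝓡 n) x)]
  [IsContMDiffRiemannianBundle (𝓡 n) ∞ (EuclideanSpace ℝ (Fin n))
    (fun x : M => TangentSpace (𝓡 n) x)]

local notation "𝔼" => EuclideanSpace ℝ (Fin n)

/-- The derivative of a time dependent map `A` to the model space in the directions of `M`. -/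
noncomputable def sliceDeriv (A : ℝ × M → 𝔼) (p : ℝ × M) : 𝔼 →L[ℝ] 𝔼 :=
  mfderiv (𝓡 n) 𝓘(ℝ, 𝔼) (fun q => A (p.1, q)) p.2

/-- A time dependent map `A`, read in the chart at `p`. -/
noncomputable def inChart (A : ℝ × M → 𝔼) (p : M) (b : ℝ × 𝔼) : 𝔼 :=
  A (b.1, (extChartAt (𝓡 n) p).symm b.2)

lemma sliceDeriv_congr {A B : ℝ × M → 𝔼} {p : ℝ × M} (h : A =ᶠ[𝓝 p] B) :
    sliceDeriv A p = sliceDeriv B p := by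
  have h1 : (fun q => A (p.1, q)) =ᶠ[𝓝 p.2] fun q => B (p.1, q) :=
    (Continuous.prodMk_right p.1).continuousAt.eventually h
  exact h1.mfderiv_eq (I := 𝓡 n) (I' := 𝓘(ℝ, 𝔼))

lemma contDiffAt_inChart {A : ℝ × M → 𝔼} {p : M} {s : ℝ} {q : M}
    (hA : ContMDiffAt (𝓘(ℝ, ℝ).prod (𝓡 n)) 𝓘(ℝ, 𝔼) ∞ A (s, q)) (hq : q ∈ (extChartAt (𝓡 n) p).source) :
    ContDiffAt ℝ ∞ (inChart A p) (s, extChartAt (𝓡 n) p q) := by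
  rw [← contMDiffAt_iff_contDiffAt]
  have h1 : ContMDiffAt 𝓘(ℝ, 𝔼) (𝓡 n) ∞ (extChartAt (𝓡 n) p).symm (extChartAt (𝓡 n) p q) :=
    (contMDiffOn_extChartAt_symm p).contMDiffAt
      ((isOpen_extChartAt_target (I := 𝓡 n) p).mem_nhds ((extChartAt (𝓡 n) p).map_source hq))
  have h2 : ContMDiffAt 𝓘(ℝ, ℝ × 𝔼) (𝓘(ℝ, ℝ).prod (𝓡 n)) ∞
      (fun b : ℝ × 𝔼 => (b.1, (extChartAt (𝓡 n) p).symm b.2)) (s, extChartAt (𝓡 n) p q) :=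
    (contMDiffAt_iff_contDiffAt.2 contDiffAt_fst).prodMk
      (ContMDiffAt.comp (g := (extChartAt (𝓡 n) p).symm) (f := Prod.snd)
        (s, extChartAt (𝓡 n) p q) h1 (contMDiffAt_iff_contDiffAt.2 contDiffAt_snd))
  refine ContMDiffAt.comp (g := A) (s, extChartAt (𝓡 n) p q) ?_ h2
  rwa [(extChartAt (𝓡 n) p).left_inv hq]

lemma hasFDerivAt_inChart_slice {A : ℝ × M → 𝔼} {p : M} {s : ℝ} {q : M}
    (hA : ContMDiffAt (𝓘(ℝ, ℝ).prod (𝓡 n)) 𝓘(ℝ, 𝔼) ∞ A (s, q)) (hq : q ∈ (extChartAt (𝓡 n) p).source) :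
    HasFDerivAt (fun z => inChart A p (s, z)) (fderiv ℝ (inChart A p) (s, extChartAt (𝓡 n) p q) ∘L
      ContinuousLinearMap.inr ℝ ℝ 𝔼) (extChartAt (𝓡 n) p q) :=
  ((contDiffAt_inChart hA hq).differentiableAt (by simp)).hasFDerivAt.comp (extChartAt (𝓡 n) p q)
    ((hasFDerivAt_const s _).prodMk (hasFDerivAt_id _))

lemma fderiv_inChart {A : ℝ × M → 𝔼} {p : M} {s : ℝ} {q : M}
    (hA : ContMDiffAt (𝓘(ℝ, ℝ).prod (𝓡 n)) 𝓘(ℝ, 𝔼) ∞ A (s, q)) (hq : q ∈ (extChartAt (𝓡 n) p).source) :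
    fderiv ℝ (inChart A p) (s, extChartAt (𝓡 n) p q) ∘L ContinuousLinearMap.inr ℝ ℝ 𝔼 =
      sliceDeriv A (s, q) ∘L tder n (extChartAt (𝓡 n) p).symm (extChartAt (𝓡 n) p q) := by
  set z := extChartAt (𝓡 n) p q
  have h1 := hasFDerivAt_inChart_slice hA hq
  have h2 : MDifferentiableAt 𝓘(ℝ, 𝔼) (𝓡 n) (extChartAt (𝓡 n) p).symm z :=
    ((contMDiffOn_extChartAt_symm (n := ∞) p).contMDiffAt
      ((isOpen_extChartAt_target (I := 𝓡 n) p).mem_nhds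
        ((extChartAt (𝓡 n) p).map_source hq))).mdifferentiableAt (by simp)
  have h3 : MDifferentiableAt (𝓡 n) 𝓘(ℝ, 𝔼) (fun q => A (s, q)) ((extChartAt (𝓡 n) p).symm z) := by
    rw [(extChartAt (𝓡 n) p).left_inv hq]
    exact (hA.mdifferentiableAt (by simp)).comp q (mdifferentiableAt_const.prodMk mdifferentiableAt_id)
  have h4 := mfderiv_comp z h3 h2
  rw [mfderiv_eq_fderiv, (extChartAt (𝓡 n) p).left_inv hq] at h4
  exact h1.fderiv.symm.trans h4

/-- Invertibility of the slice derivative can be tested in any chart. -/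
lemma bijective_sliceDeriv_iff {A : ℝ × M → 𝔼} {p : M} {s : ℝ} {q : M}
    (hA : ContMDiffAt (𝓘(ℝ, ℝ).prod (𝓡 n)) 𝓘(ℝ, 𝔼) ∞ A (s, q)) (hq : q ∈ (extChartAt (𝓡 n) p).source) :
    Function.Injective (sliceDeriv A (s, q)) ↔ Function.Injective
      (fderiv ℝ (inChart A p) (s, extChartAt (𝓡 n) p q) ∘L ContinuousLinearMap.inr ℝ ℝ 𝔼) := by
  have h1 := tder_chart_injective ((extChartAt (𝓡 n) p).map_source hq)
  have h2 : Function.Surjective (tder n (extChartAt (𝓡 n) p).symm (extChartAt (𝓡 n) p q)) :=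
    (LinearMap.injective_iff_surjective
      (f := (tder n (extChartAt (𝓡 n) p).symm (extChartAt (𝓡 n) p q) : 𝔼 →ₗ[ℝ] 𝔼))).1 h1
  rw [fderiv_inChart hA hq, ContinuousLinearMap.coe_comp]
  exact ⟨fun h => h.comp h1, fun h => h.of_comp_right h2⟩

lemma injective_iff_det_ne_zero (L : 𝔼 →L[ℝ] 𝔼) : Function.Injective L ↔ L.det ≠ 0 := by
  change Function.Injective (L : 𝔼 →ₗ[ℝ] 𝔼) ↔ ¬LinearMap.det (L : 𝔼 →ₗ[ℝ] 𝔼) = 0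
  rw [← LinearMap.ker_eq_bot, LinearMap.det_eq_zero_iff_ker_ne_bot, not_not]

/-- The inverse function theorem for `(s, q) ↦ (s, A (s, q))`. -/
lemma exists_local_section {A : ℝ × M → 𝔼} {s : ℝ} {q : M}
    (hA : ContMDiffAt (𝓘(ℝ, ℝ).prod (𝓡 n)) 𝓘(ℝ, 𝔼) ∞ A (s, q))
    (hinj : Function.Injective (sliceDeriv A (s, q))) :
    ∃ Ψ : ℝ × 𝔼 → ℝ × M, ContMDiffAt 𝓘(ℝ, ℝ × 𝔼) (𝓘(ℝ, ℝ).prod (𝓡 n)) ∞ Ψ (s, A (s, q)) ∧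
      Ψ (s, A (s, q)) = (s, q) ∧ (∀ᶠ b in 𝓝 (s, A (s, q)), ((Ψ b).1, A (Ψ b)) = b) ∧
        ∀ᶠ p in 𝓝 (s, q), Ψ (p.1, A p) = p := by
  have hq : q ∈ (extChartAt (𝓡 n) q).source := mem_extChartAt_source q
  set φ := extChartAt (𝓡 n) q with hφ
  have ha := contDiffAt_inChart hA hq
  have hinj' := (bijective_sliceDeriv_iff hA hq).1 hinj
  set b₀ : ℝ × 𝔼 := (s, φ q) with hb₀
  let f : ℝ × 𝔼 → ℝ × 𝔼 := fun b => (b.1, inChart A q b)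
  have hf : ContDiffAt ℝ ∞ f b₀ := contDiffAt_fst.prodMk ha
  let L : ℝ × 𝔼 →L[ℝ] ℝ × 𝔼 := (ContinuousLinearMap.fst ℝ ℝ 𝔼).prod (fderiv ℝ (inChart A q) b₀)
  have hL : HasFDerivAt f L b₀ := hasFDerivAt_fst.prodMk (ha.differentiableAt (by simp)).hasFDerivAt
  have hLinj : Function.Injective L := by
    refine (injective_iff_map_eq_zero L).2 fun x hx => ?_
    have h1 : x.1 = 0 := congrArg Prod.fst hx
    have h2 : fderiv ℝ (inChart A q) b₀ x = 0 := congrArg Prod.snd hx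
    have h3 : x = (0, x.2) := Prod.ext h1 rfl
    have h4 : x.2 = 0 := (injective_iff_map_eq_zero _).1 hinj' x.2 (h3 ▸ h2)
    rw [h3, h4]
    rfl
  let e : (ℝ × 𝔼) ≃L[ℝ] ℝ × 𝔼 :=
    (LinearEquiv.ofInjectiveEndo (L : ℝ × 𝔼 →ₗ[ℝ] ℝ × 𝔼) hLinj).toContinuousLinearEquiv
  have he : HasFDerivAt f (e : ℝ × 𝔼 →L[ℝ] ℝ × 𝔼) b₀ := hL.congr_fderiv (by ext <;> rfl)
  let g := hf.localInverse he (by simp)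
  have hfb : f b₀ = (s, A (s, q)) := by
    change (s, A (s, φ.symm (φ q))) = _
    rw [φ.left_inv hq]
  have hg : ContDiffAt ℝ ∞ g (s, A (s, q)) := hfb ▸ hf.to_localInverse he (by simp)
  have hgb : g (s, A (s, q)) = b₀ := hfb ▸ hf.localInverse_apply_image he (by simp)
  have hs := hf.hasStrictFDerivAt' he (by simp)
  have h1 : ContMDiffAt 𝓘(ℝ, 𝔼) (𝓡 n) ∞ φ.symm (g (s, A (s, q))).2 := by
    rw [hgb]
    exact (contMDiffOn_extChartAt_symm q).contMDiffAt
      ((isOpen_extChartAt_target (I := 𝓡 n) q).mem_nhds (φ.map_source hq))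
  refine ⟨fun b => ((g b).1, φ.symm (g b).2), ?_, ?_, ?_, ?_⟩
  · exact (contMDiffAt_iff_contDiffAt.2 hg.fst).prodMk
      (ContMDiffAt.comp (g := φ.symm) (f := fun b => (g b).2) (s, A (s, q)) h1
        (contMDiffAt_iff_contDiffAt.2 hg.snd))
  · simp only [hgb, hb₀, φ.left_inv hq]
  · have := hs.eventually_right_inverse
    rw [hfb] at this
    exact this
  · have hc : ContinuousAt (fun p : ℝ × M => (p.1, φ p.2)) (s, q) :=
      continuousAt_fst.prodMk ((continuousAt_extChartAt (I := 𝓡 n) q).comp continuousAt_snd)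
    have h2 : ∀ᶠ p in 𝓝 (s, q), p.2 ∈ φ.source :=
      continuousAt_snd.preimage_mem_nhds (extChartAt_source_mem_nhds (I := 𝓡 n) q)
    filter_upwards [hc.eventually hs.eventually_left_inverse, h2] with p hp hp2
    have h3 : f (p.1, φ p.2) = (p.1, A p) := by
      change (p.1, A (p.1, φ.symm (φ p.2))) = _
      rw [φ.left_inv hp2]
    have h4 : g (p.1, A p) = (p.1, φ p.2) := h3 ▸ hp
    simp only [h4, φ.left_inv hp2]

/-- The map `A`, defined near the graph of `γ` over `J`, gives coordinates on every slice, centred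
at `γ`. -/
structure IsCoordAlong (γ : ℝ → M) (A : ℝ × M → 𝔼) (W : Set (ℝ × M)) (J : Set ℝ) : Prop where
  isOpen : IsOpen W
  smooth : ∀ p ∈ W, ContMDiffAt (𝓘(ℝ, ℝ).prod (𝓡 n)) 𝓘(ℝ, 𝔼) ∞ A p
  mem : ∀ s ∈ J, (s, γ s) ∈ W
  zero : ∀ p ∈ W, A (p.1, γ p.1) = 0
  inj : ∀ s ∈ J, Function.Injective (sliceDeriv A (s, γ s))

/-- Coordinates along a compact arc define a tube. -/
lemma IsCoordAlong.exists_tube [T2Space M] {γ : ℝ → M} (hγ : Continuous γ) {A : ℝ × M → 𝔼}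
    {W : Set (ℝ × M)} {J : Set ℝ} (h : IsCoordAlong γ A W J) (hJ : IsCompact J) :
    ∃ τ : Tube n M, τ.A = A ∧ ∀ s ∈ J, (s, γ s) ∈ τ.img := by
  let F : ℝ × M → ℝ × 𝔼 := fun p => (p.1, A p)
  let K : Set (ℝ × M) := (fun s => (s, γ s)) '' J
  have hK : IsCompact K := hJ.image (continuous_id.prodMk hγ)
  have hKW : K ⊆ W := by
    rintro _ ⟨s, hs, rfl⟩
    exact h.mem s hs
  have hFc : ∀ p ∈ W, ContinuousAt F p := fun p hp =>
    continuousAt_fst.prodMk (h.smooth p hp).continuousAt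
  have hinjK : InjOn F K := by
    rintro _ ⟨s, hs, rfl⟩ _ ⟨r, hr, rfl⟩ e
    have : s = r := congrArg Prod.fst e
    rw [this]
  -- A map that is injective on a compact set and locally injective near its points is injective on a
  -- neighbourhood of the set.
  obtain ⟨t, ht, hinj⟩ := hinjK.exists_mem_nhdsSet hK (fun p hp => hFc p (hKW hp)) (by
    rintro _ ⟨s, hs, rfl⟩
    obtain ⟨Ψ, -, -, -, hΨ⟩ := exists_local_section (h.smooth _ (h.mem s hs)) (h.inj s hs)
    refine ⟨_, hΨ, fun p hp p' hp' e => ?_⟩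
    have hp1 : Ψ (F p) = p := hp
    have hp2 : Ψ (F p') = p' := hp'
    rw [← hp1, ← hp2, e])
  -- Restrict to the open set of points where the slice derivative of `A` is invertible.
  let V : Set (ℝ × M) := {p | p ∈ interior t ∧ p ∈ W ∧ Function.Injective (sliceDeriv A p)}
  have hV : IsOpen V := by
    refine isOpen_iff_mem_nhds.2 ?_
    rintro ⟨s, q⟩ ⟨h1, h2, h3⟩
    have hq : q ∈ (extChartAt (𝓡 n) q).source := mem_extChartAt_source q
    set φ := extChartAt (𝓡 n) q with hφ
    let D : ℝ × 𝔼 → ℝ := fun b =>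
      (fderiv ℝ (inChart A q) b ∘L ContinuousLinearMap.inr ℝ ℝ 𝔼).det
    have hDiff : ∀ b, Function.Injective (fderiv ℝ (inChart A q) b ∘L ContinuousLinearMap.inr ℝ ℝ 𝔼) ↔
        D b ≠ 0 := fun b => injective_iff_det_ne_zero _
    have hDc : ContinuousAt D (s, φ q) := by
      have h4 : ContinuousAt (fderiv ℝ (inChart A q)) (s, φ q) :=
        ((contDiffAt_inChart (h.smooth _ h2) hq).fderiv_right (m := ∞) (by simp)).continuousAt
      exact ContinuousLinearMap.continuous_det.continuousAt.comp
        (h4.clm_comp continuousAt_const)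
    have hc : ContinuousAt (fun p : ℝ × M => (p.1, φ p.2)) (s, q) :=
      continuousAt_fst.prodMk ((continuousAt_extChartAt (I := 𝓡 n) q).comp continuousAt_snd)
    have h5 : ∀ᶠ p in 𝓝 (s, q), p.2 ∈ φ.source :=
      continuousAt_snd.preimage_mem_nhds (extChartAt_source_mem_nhds (I := 𝓡 n) q)
    have h6 : ∀ᶠ p : ℝ × M in 𝓝 (s, q), D (p.1, φ p.2) ≠ 0 :=
      (ContinuousAt.comp (f := fun p : ℝ × M => (p.1, φ p.2)) (x := (s, q)) hDc hc).eventually_ne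
        ((hDiff _).1 ((bijective_sliceDeriv_iff (h.smooth _ h2) hq).1 h3))
    filter_upwards [isOpen_interior.mem_nhds h1, h.isOpen.mem_nhds h2, h5, h6] with p p1 p2 p3 p4
    exact ⟨p1, p2, (bijective_sliceDeriv_iff (h.smooth _ p2) p3).2 ((hDiff _).2 p4)⟩
  have hinjV : InjOn F V := hinj.mono fun p hp => interior_subset hp.1
  have hloc : ∀ p ∈ V, ∃ Ψ : ℝ × 𝔼 → ℝ × M,
      ContMDiffAt 𝓘(ℝ, ℝ × 𝔼) (𝓘(ℝ, ℝ).prod (𝓡 n)) ∞ Ψ (F p) ∧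
        ∀ᶠ b in 𝓝 (F p), Ψ b ∈ V ∧ F (Ψ b) = b := by
    intro p hp
    obtain ⟨Ψ, h1, h2, h3, -⟩ := exists_local_section (h.smooth _ hp.2.1) hp.2.2
    refine ⟨Ψ, h1, Eventually.and ?_ h3⟩
    exact h1.continuousAt.preimage_mem_nhds (hV.mem_nhds (by rw [h2]; exact hp))
  have : Nonempty (ℝ × M) := ⟨(0, γ 0)⟩
  let inv := Function.invFunOn F V
  have hinv : ∀ p ∈ V, inv (F p) = p := fun p hp => hinjV.leftInvOn_invFunOn hp
  refine ⟨{
    dom := F '' V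
    img := V
    Φ := fun b => (inv b).2
    A := A
    isOpen_dom := ?_
    isOpen_img := hV
    smooth_Φ := ?_
    smooth_A := fun p hp => h.smooth p hp.2.1
    mem_img := ?_
    mem_dom := fun p hp => mem_image_of_mem F hp
    left_inv := ?_
    right_inv := fun p hp => by rw [show (p.1, A p) = F p from rfl, hinv p hp] }, rfl, ?_⟩
  · refine isOpen_iff_mem_nhds.2 ?_
    rintro _ ⟨p, hp, rfl⟩
    obtain ⟨Ψ, -, h1⟩ := hloc p hp
    filter_upwards [h1] with b hb
    exact ⟨Ψ b, hb.1, hb.2⟩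
  · rintro _ ⟨p, hp, rfl⟩
    obtain ⟨Ψ, h1, h2⟩ := hloc p hp
    have h3 : (fun b => (inv b).2) =ᶠ[𝓝 (F p)] fun b => (Ψ b).2 := by
      filter_upwards [h2] with b hb
      rw [← hb.2, hinv _ hb.1, hb.2]
    exact (contMDiffAt_snd.comp _ h1).congr_of_eventuallyEq h3
  · rintro _ ⟨p, hp, rfl⟩
    simp only [hinv p hp]
    exact hp
  · rintro _ ⟨p, hp, rfl⟩
    simp only [hinv p hp]
    rfl
  · intro s hs
    exact ⟨mem_interior_iff_mem_nhds.2 (mem_nhdsSet_iff_forall.1 ht _ ⟨s, hs, rfl⟩), h.mem s hs, h.inj s hs⟩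

/-- The coordinates `L (φ q - φ (γ s))`, for a chart `φ`. -/
noncomputable def chartCoord (γ : ℝ → M) (p : M) (L : 𝔼 →L[ℝ] 𝔼) (x : ℝ × M) : 𝔼 :=
  L (extChartAt (𝓡 n) p x.2 - extChartAt (𝓡 n) p (γ x.1))

lemma contMDiffAt_chartCoord {γ : ℝ → M} (hγ : ContMDiff 𝓘(ℝ, ℝ) (𝓡 n) ∞ γ) {p : M} (L : 𝔼 →L[ℝ] 𝔼)
    {x : ℝ × M} (h1 : γ x.1 ∈ (extChartAt (𝓡 n) p).source) (h2 : x.2 ∈ (extChartAt (𝓡 n) p).source) :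
    ContMDiffAt (𝓘(ℝ, ℝ).prod (𝓡 n)) 𝓘(ℝ, 𝔼) ∞ (chartCoord γ p L) x := by
  have h3 : ∀ {q : M}, q ∈ (extChartAt (𝓡 n) p).source →
      ContMDiffAt (𝓡 n) 𝓘(ℝ, 𝔼) ∞ (extChartAt (𝓡 n) p) q := fun hq =>
    contMDiffAt_extChartAt' (by rwa [← extChartAt_source (𝓡 n)])
  have h4 : ContMDiffAt (𝓘(ℝ, ℝ).prod (𝓡 n)) 𝓘(ℝ, 𝔼) ∞
      (fun x : ℝ × M => extChartAt (𝓡 n) p x.2 - extChartAt (𝓡 n) p (γ x.1)) x :=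
    ((h3 h2).comp x contMDiffAt_snd).sub ((h3 h1).comp x (hγ.contMDiffAt.comp x contMDiffAt_fst))
  exact (contMDiffAt_iff_contDiffAt.2 L.contDiff.contDiffAt).comp x h4

lemma hasFDerivAt_chartCoord (γ : ℝ → M) (p : M) (L : 𝔼 →L[ℝ] 𝔼) (s : ℝ) {z : 𝔼}
    (hz : z ∈ (extChartAt (𝓡 n) p).target) :
    HasFDerivAt (fun z => inChart (chartCoord γ p L) p (s, z)) L z := by
  have h1 : (fun z => inChart (chartCoord γ p L) p (s, z)) =ᶠ[𝓝 z]
      fun z => L (z - extChartAt (𝓡 n) p (γ s)) := by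
    filter_upwards [(isOpen_extChartAt_target (I := 𝓡 n) p).mem_nhds hz] with w hw
    simp only [inChart, chartCoord, (extChartAt (𝓡 n) p).right_inv hw]
  refine HasFDerivAt.congr_of_eventuallyEq ?_ h1
  exact (L.hasFDerivAt.comp z ((hasFDerivAt_id z).sub_const _)).congr_fderiv (by ext; rfl)

/-- Coordinates along an arc extend across a chart. -/
lemma IsCoordAlong.extend {γ : ℝ → M} (hγ : ContMDiff 𝓘(ℝ, ℝ) (𝓡 n) ∞ γ) {A : ℝ × M → 𝔼}
    {W : Set (ℝ × M)} {a t₀ t₁ : ℝ} (h : IsCoordAlong γ A W (Icc a t₀)) (ha : a ≤ t₀) (ht : t₀ ≤ t₁)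
    {p : M} (hp : ∀ s ∈ Icc t₀ t₁, γ s ∈ (extChartAt (𝓡 n) p).source) :
    ∃ (A' : ℝ × M → 𝔼) (W' : Set (ℝ × M)), IsCoordAlong γ A' W' (Icc a t₁) := by
  have hγc := hγ.continuous
  set φ := extChartAt (𝓡 n) p with hφ
  have hφo : IsOpen φ.source := isOpen_extChartAt_source (I := 𝓡 n) p
  have hm₀ : (t₀, γ t₀) ∈ W := h.mem t₀ ⟨ha, le_rfl⟩
  have hp₀ : γ t₀ ∈ φ.source := hp t₀ ⟨le_rfl, ht⟩
  -- The slice derivative of `A` along `γ`, read in the chart. The new coordinates `B` have the constant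
  -- derivative `L = D t₀` along `γ`; for `s` near `t₀`, convex combinations of `D s` and `L` stay in a ball
  -- of invertible maps, so that `A` can be deformed into `B` by a cutoff function in `s`.
  let D : ℝ → 𝔼 →L[ℝ] 𝔼 := fun s =>
    fderiv ℝ (inChart A p) (s, φ (γ s)) ∘L ContinuousLinearMap.inr ℝ ℝ 𝔼
  have hDc : ContinuousAt D t₀ := by
    have h4 : ContinuousAt (fderiv ℝ (inChart A p)) (t₀, φ (γ t₀)) :=
      ((contDiffAt_inChart (h.smooth _ hm₀) hp₀).fderiv_right (m := ∞) (by simp)).continuousAt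
    have h5 : ContinuousAt (fun s => (s, φ (γ s))) t₀ :=
      continuousAt_id.prodMk ((continuousAt_extChartAt' hp₀).comp hγc.continuousAt)
    exact (ContinuousAt.comp (f := fun s => (s, φ (γ s))) h4 h5).clm_comp continuousAt_const
  set L := D t₀ with hL
  have hLinj : Function.Injective L :=
    (bijective_sliceDeriv_iff (h.smooth _ hm₀) hp₀).1 (h.inj t₀ ⟨ha, le_rfl⟩)
  have hU : {T : 𝔼 →L[ℝ] 𝔼 | T.det ≠ 0} ∈ 𝓝 L :=
    (isOpen_ne_fun ContinuousLinearMap.continuous_det continuous_const).mem_nhds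
      ((injective_iff_det_ne_zero L).1 hLinj)
  obtain ⟨r, hr, hball⟩ := Metric.mem_nhds_iff.1 hU
  have hev : ∀ᶠ s in 𝓝 t₀, D s ∈ Metric.ball L r ∧ (s, γ s) ∈ W ∧ γ s ∈ φ.source :=
    inter_mem (hDc.preimage_mem_nhds (Metric.ball_mem_nhds _ hr)) (inter_mem
      ((continuous_id.prodMk hγc).continuousAt.preimage_mem_nhds (h.isOpen.mem_nhds hm₀))
      (hγc.continuousAt.preimage_mem_nhds (hφo.mem_nhds hp₀)))
  obtain ⟨η, hη, hb⟩ := Metric.eventually_nhds_iff.1 hev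
  have hη2 : 0 < η / 2 := half_pos hη
  let χ : ℝ → ℝ := fun s => Real.smoothTransition ((s - t₀) / (η / 2))
  have hχ : ContDiff ℝ ∞ χ :=
    Real.smoothTransition.contDiff.comp ((contDiff_id.sub contDiff_const).div_const _)
  have hχ0 : ∀ s ≤ t₀, χ s = 0 := fun s hs => Real.smoothTransition.zero_of_nonpos
    (div_nonpos_of_nonpos_of_nonneg (sub_nonpos.2 hs) hη2.le)
  have hχ1 : ∀ s, t₀ + η / 2 ≤ s → χ s = 1 := fun s hs => Real.smoothTransition.one_of_one_le
    ((one_le_div hη2).2 (by linarith))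
  let B : ℝ × M → 𝔼 := chartCoord γ p L
  let A' : ℝ × M → 𝔼 := fun x => (1 - χ x.1) • A x + χ x.1 • B x
  let S : Set (ℝ × M) := {x | γ x.1 ∈ φ.source ∧ x.2 ∈ φ.source}
  have hS : IsOpen S := (hφo.preimage (hγc.comp continuous_fst)).inter (hφo.preimage continuous_snd)
  have hB : ∀ x ∈ S, ContMDiffAt (𝓘(ℝ, ℝ).prod (𝓡 n)) 𝓘(ℝ, 𝔼) ∞ B x := fun x hx =>
    contMDiffAt_chartCoord hγ L hx.1 hx.2
  have hBz : ∀ s, B (s, γ s) = 0 := fun s => by simp [B, chartCoord]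
  have hχs : ∀ x : ℝ × M, ContMDiffAt (𝓘(ℝ, ℝ).prod (𝓡 n)) 𝓘(ℝ, ℝ) ∞ (fun x => χ x.1) x := fun x =>
    (contMDiffAt_iff_contDiffAt.2 hχ.contDiffAt).comp x contMDiffAt_fst
  let W₁ : Set (ℝ × M) := W ∩ {x | x.1 < t₀}
  let W₂ : Set (ℝ × M) := W ∩ S
  let W₃ : Set (ℝ × M) := S ∩ {x | t₀ + η / 2 < x.1}
  have hW₁ : IsOpen W₁ := h.isOpen.inter (isOpen_lt continuous_fst continuous_const)
  have hW₂ : IsOpen W₂ := h.isOpen.inter hS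
  have hW₃ : IsOpen W₃ := hS.inter (isOpen_lt continuous_const continuous_fst)
  have e₁ : ∀ x ∈ W₁, A' =ᶠ[𝓝 x] A := fun x hx => by
    filter_upwards [hW₁.mem_nhds hx] with y hy
    have : χ y.1 = 0 := hχ0 y.1 (le_of_lt hy.2)
    simp [A', this]
  have e₃ : ∀ x ∈ W₃, A' =ᶠ[𝓝 x] B := fun x hx => by
    filter_upwards [hW₃.mem_nhds hx] with y hy
    have : χ y.1 = 1 := hχ1 y.1 (le_of_lt hy.2)
    simp [A', this]
  have s₂ : ∀ x ∈ W₂, ContMDiffAt (𝓘(ℝ, ℝ).prod (𝓡 n)) 𝓘(ℝ, 𝔼) ∞ A' x := fun x hx =>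
    ((contMDiffAt_const.sub (hχs x)).smul (h.smooth x hx.1)).add ((hχs x).smul (hB x hx.2))
  refine ⟨A', W₁ ∪ W₂ ∪ W₃, (hW₁.union hW₂).union hW₃, ?_, ?_, ?_, ?_⟩
  · rintro x ((hx | hx) | hx)
    · exact (h.smooth x hx.1).congr_of_eventuallyEq (e₁ x hx)
    · exact s₂ x hx
    · exact (hB x hx.1).congr_of_eventuallyEq (e₃ x hx)
  · intro s hs
    rcases lt_or_ge s t₀ with h1 | h1
    · exact Or.inl (Or.inl ⟨h.mem s ⟨hs.1, h1.le⟩, h1⟩)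
    · rcases lt_or_ge s (t₀ + η) with h2 | h2
      · have h3 := hb (y := s) (by rw [Real.dist_eq, abs_lt]; constructor <;> linarith)
        exact Or.inl (Or.inr ⟨h3.2.1, h3.2.2, h3.2.2⟩)
      · have h3 := hp s ⟨h1, hs.2⟩
        exact Or.inr ⟨⟨h3, h3⟩, show t₀ + η / 2 < s by linarith⟩
  · rintro x ((hx | hx) | hx)
    · have : χ x.1 = 0 := hχ0 x.1 (le_of_lt hx.2)
      simp [A', this, h.zero x hx.1]
    · simp [A', hBz, h.zero x hx.1]
    · have : χ x.1 = 1 := hχ1 x.1 (le_of_lt hx.2)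
      simp [A', this, hBz]
  · intro s hs
    rcases lt_or_ge s t₀ with h1 | h1
    · have h2 : (s, γ s) ∈ W₁ := ⟨h.mem s ⟨hs.1, h1.le⟩, h1⟩
      rw [sliceDeriv_congr (e₁ _ h2)]
      exact h.inj s ⟨hs.1, h1.le⟩
    · rcases lt_or_ge s (t₀ + η) with h2 | h2
      · obtain ⟨h3, h4, h5⟩ := hb (y := s) (by rw [Real.dist_eq, abs_lt]; constructor <;> linarith)
        have h6 := s₂ (s, γ s) ⟨h4, h5, h5⟩
        rw [bijective_sliceDeriv_iff h6 h5]
        have h7 := (((hasFDerivAt_inChart_slice (h.smooth _ h4) h5).const_smul (1 - χ s)).add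
          ((hasFDerivAt_chartCoord γ p L s (φ.map_source h5)).const_smul (χ s)))
        have h8 := (hasFDerivAt_inChart_slice h6 h5).unique h7
        rw [h8, injective_iff_det_ne_zero]
        refine hball (convex_ball L r h3 (Metric.mem_ball_self hr) ?_ ?_ (by ring))
        · exact sub_nonneg.2 (Real.smoothTransition.le_one _)
        · exact Real.smoothTransition.nonneg _
      · have h3 := hp s ⟨h1, hs.2⟩
        have h4 : (s, γ s) ∈ W₃ := ⟨⟨h3, h3⟩, show t₀ + η / 2 < s by linarith⟩
        rw [sliceDeriv_congr (e₃ _ h4), bijective_sliceDeriv_iff (hB _ h4.1) h3,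
          (hasFDerivAt_inChart_slice (hB _ h4.1) h3).unique
            (hasFDerivAt_chartCoord γ p L s (φ.map_source h3))]
        exact hLinj

/-- There is a tube around every arc. -/
lemma exists_tube_along [T2Space M] {γ : ℝ → M} (hγ : ContMDiff 𝓘(ℝ, ℝ) (𝓡 n) ∞ γ) {a b : ℝ}
    (hab : a ≤ b) : ∃ τ : Tube n M, ∀ s ∈ Icc a b, (s, (0 : 𝔼)) ∈ τ.dom ∧ τ.Φ (s, 0) = γ s := by
  have hγc := hγ.continuous
  obtain ⟨t, ht0, htm, ⟨m, hm⟩, hc⟩ := exists_monotone_Icc_subset_open_cover_Icc hab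
    (c := fun p : M => {s : Icc a b | γ s ∈ (extChartAt (𝓡 n) p).source})
    (fun p => (isOpen_extChartAt_source (I := 𝓡 n) p).preimage (hγc.comp continuous_subtype_val))
    (fun s _ => mem_iUnion.2 ⟨γ s, mem_extChartAt_source (I := 𝓡 n) (γ s)⟩)
  have key : ∀ k, ∃ (A : ℝ × M → 𝔼) (W : Set (ℝ × M)), IsCoordAlong γ A W (Icc a (t k)) := by
    intro k
    induction k with
    | zero =>
      have hs : ∀ s ∈ Icc a (t 0 : ℝ), s = a := fun s hs => by
        rw [ht0] at hs
        exact le_antisymm hs.2 hs.1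
      have hmem : γ a ∈ (extChartAt (𝓡 n) (γ a)).source := mem_extChartAt_source (I := 𝓡 n) (γ a)
      have ho := isOpen_extChartAt_source (I := 𝓡 n) (γ a)
      refine ⟨chartCoord γ (γ a) (ContinuousLinearMap.id ℝ 𝔼),
        {x | γ x.1 ∈ (extChartAt (𝓡 n) (γ a)).source ∧ x.2 ∈ (extChartAt (𝓡 n) (γ a)).source},
        (ho.preimage (hγc.comp continuous_fst)).inter (ho.preimage continuous_snd),
        fun x hx => contMDiffAt_chartCoord hγ _ hx.1 hx.2, fun s h => ?_,
        fun x _ => by simp [chartCoord], fun s h => ?_⟩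
      · rw [hs s h]
        exact ⟨hmem, hmem⟩
      · rw [hs s h, bijective_sliceDeriv_iff (contMDiffAt_chartCoord hγ _ hmem hmem) hmem,
          (hasFDerivAt_inChart_slice (contMDiffAt_chartCoord hγ _ hmem hmem) hmem).unique
            (hasFDerivAt_chartCoord γ _ _ a ((extChartAt (𝓡 n) (γ a)).map_source hmem))]
        exact Function.injective_id
    | succ k ih =>
      obtain ⟨A, W, h⟩ := ih
      obtain ⟨p, hp⟩ := hc k
      exact h.extend hγ (t k).2.1 (htm k.le_succ) (p := p) fun s hs =>
        hp (show (⟨s, (t k).2.1.trans hs.1, hs.2.trans (t (k + 1)).2.2⟩ : Icc a b) ∈ _ from hs)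
  obtain ⟨A, W, h⟩ := key m
  rw [hm m le_rfl] at h
  obtain ⟨τ, rfl, hτ⟩ := h.exists_tube hγc isCompact_Icc
  refine ⟨τ, fun s hs => ?_⟩
  have h1 := τ.mem_dom _ (hτ s hs)
  have h2 := τ.right_inv _ (hτ s hs)
  simp only [h.zero _ (h.mem s hs)] at h1 h2
  exact ⟨h1, h2⟩

end TubeExistence

/-! ### Coordinates adapted to a geodesic -/

section AdaptedTubes

variable {n : ℕ} {M : Type*} [TopologicalSpace M] [ChartedSpace (EuclideanSpace ℝ (Fin n)) M]
  [IsManifold (𝓡 n) ∞ M] [RiemannianBundle (fun x : M => TangentSpace (𝓡 n) x)]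
  [IsContMDiffRiemannianBundle (𝓡 n) ∞ (EuclideanSpace ℝ (Fin n))
    (fun x : M => TangentSpace (𝓡 n) x)]

local notation "𝔼" => EuclideanSpace ℝ (Fin n)

lemma metricAt_of_eq_zero {q : M} {w : 𝔼} (h : w = 0) (z : 𝔼) : metricAt n q w z = 0 := by
  rw [h, map_zero]
  rfl

lemma fderiv_pullMetric_symm {F : Type*} [NormedAddCommGroup F] [NormedSpace ℝ F]
    [FiniteDimensional ℝ F] {Φ : F → M} {b : F} (hΦ : ContMDiffAt 𝓘(ℝ, F) (𝓡 n) ∞ Φ b) (v ξ η : F) :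
    fderiv ℝ (pullMetric n Φ) b v ξ η = fderiv ℝ (pullMetric n Φ) b v η ξ := by
  have hd := ((contDiffAt_pullMetric hΦ).differentiableAt (by simp)).hasFDerivAt
  have h1 := (hd.clm_apply (hasFDerivAt_const ξ b)).clm_apply (hasFDerivAt_const η b)
  have h2 := (hd.clm_apply (hasFDerivAt_const η b)).clm_apply (hasFDerivAt_const ξ b)
  simp only [pullMetric_symm Φ _ η ξ] at h2
  simpa using DFunLike.congr_fun (h1.unique h2) v

namespace Tube

/-- A linear change of coordinates in the slices of a tube. -/
noncomputable def twist (τ : Tube n M) (P : ℝ → 𝔼 →L[ℝ] 𝔼) {J : Set ℝ} (hJ : IsOpen J)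
    (hP : ∀ s ∈ J, ContDiffAt ℝ ∞ P s) (hinv : ∀ s ∈ J, (P s).IsInvertible) : Tube n M where
  dom := {b | b.1 ∈ J} ∩ (fun b => (b.1, P b.1 b.2)) ⁻¹' τ.dom
  img := {q | q.1 ∈ J} ∩ τ.img
  Φ b := τ.Φ (b.1, P b.1 b.2)
  A q := (P q.1).inverse (τ.A q)
  isOpen_dom := by
    refine ContinuousOn.isOpen_inter_preimage (fun b hb => ?_) (hJ.preimage continuous_fst) τ.isOpen_dom
    have h1 : ContinuousAt (fun b : ℝ × 𝔼 => P b.1) b :=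
      ContinuousAt.comp (f := Prod.fst) (hP _ hb).continuousAt continuousAt_fst
    exact (continuousAt_fst.prodMk (h1.clm_apply continuousAt_snd)).continuousWithinAt
  isOpen_img := (hJ.preimage continuous_fst).inter τ.isOpen_img
  smooth_Φ b hb := by
    have h1 : ContDiffAt ℝ ∞ (fun b : ℝ × 𝔼 => P b.1) b :=
      ContDiffAt.comp b (hP _ hb.1) contDiffAt_fst
    exact (τ.smooth_Φ _ hb.2).comp b (contMDiffAt_iff_contDiffAt.2
      (contDiffAt_fst.prodMk (h1.clm_apply contDiffAt_snd)))
  smooth_A q hq := by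
    have h1 : ContDiffAt ℝ ∞ (fun s => (P s).inverse) q.1 :=
      ContDiffAt.comp (g := ContinuousLinearMap.inverse) q.1
        ((hinv _ hq.1).contDiffAt_map_inverse (n := ∞)) (hP _ hq.1)
    have h2 : ContMDiffAt (𝓘(ℝ, ℝ).prod (𝓡 n)) 𝓘(ℝ, 𝔼 →L[ℝ] 𝔼) ∞ (fun q : ℝ × M => (P q.1).inverse) q :=
      ContMDiffAt.comp (g := fun s => (P s).inverse) (f := Prod.fst) q
        (contMDiffAt_iff_contDiffAt.2 h1) contMDiffAt_fst
    exact h2.clm_apply (τ.smooth_A q hq.2)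
  mem_img b hb := ⟨hb.1, τ.mem_img _ hb.2⟩
  mem_dom q hq := ⟨hq.1, by
    simp only [mem_preimage, (hinv _ hq.1).self_apply_inverse]
    exact τ.mem_dom _ hq.2⟩
  left_inv b hb := by
    have := τ.left_inv _ hb.2
    simp only at this
    rw [this, (hinv _ hb.1).inverse_apply_self]
  right_inv q hq := by
    rw [(hinv _ hq.1).self_apply_inverse]
    exact τ.right_inv _ hq.2

lemma tder_twist (τ : Tube n M) {P : ℝ → 𝔼 →L[ℝ] 𝔼} {J : Set ℝ} (hJ : IsOpen J)
    (hP : ∀ s ∈ J, ContDiffAt ℝ ∞ P s) (hinv : ∀ s ∈ J, (P s).IsInvertible) {s : ℝ} (hs : s ∈ J)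
    (h0 : (s, (0 : 𝔼)) ∈ τ.dom) (σ : ℝ) (x : 𝔼) :
    tder n (τ.twist P hJ hP hinv).Φ (s, 0) (σ, x) = tder n τ.Φ (s, 0) (σ, P s x) := by
  have h1 : HasFDerivAt (fun b : ℝ × 𝔼 => P b.1) (fderiv ℝ P s ∘L ContinuousLinearMap.fst ℝ ℝ 𝔼)
      (s, 0) := ((hP s hs).differentiableAt (by simp)).hasFDerivAt.comp ((s, 0) : ℝ × 𝔼) hasFDerivAt_fst
  have h2 := hasFDerivAt_fst.prodMk (h1.clm_apply hasFDerivAt_snd)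
  have h3 : ((s, P s 0) : ℝ × 𝔼) = (s, 0) := by rw [map_zero]
  have h4 := tder_comp (n := n) (Φ := (τ.twist P hJ hP hinv).Φ) (Φ' := τ.Φ)
    (ψ := fun b : ℝ × 𝔼 => (b.1, P b.1 b.2)) (b := (s, 0))
    ((τ.smooth_Φ _ (show (s, P s 0) ∈ τ.dom by rw [h3]; exact h0)).mdifferentiableAt (by simp)) h2.differentiableAt (.of_forall fun _ => rfl)
  rw [h4, h2.fderiv]
  simp

/-- The tube is adapted to the geodesic `γ` over `J`: it is centred at `γ`, and its coordinate vector
fields form an orthonormal parallel frame along `γ`. -/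
structure IsAdapted (τ : Tube n M) (γ : ℝ → M) (J : Set ℝ) : Prop where
  mem : ∀ s ∈ J, (s, (0 : 𝔼)) ∈ τ.dom
  center : ∀ s ∈ J, τ.Φ (s, 0) = γ s
  orthonormal : ∀ s ∈ J, ∀ x y : 𝔼, pullMetric n τ.Φ (s, 0) (0, x) (0, y) = inner ℝ x y
  parallel : ∀ s ∈ J, ∀ x y : 𝔼, kos (pullMetric n τ.Φ) (s, 0) (1, 0) (0, x) (0, y) = 0
  geodesic : ∀ s ∈ J, ∀ y : 𝔼, kos (pullMetric n τ.Φ) (s, 0) (1, 0) (1, 0) (0, y) = 0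

/-- The connection form `⟨∇_s x, y⟩` of the coordinate vector fields of a tube. -/
noncomputable def connForm (τ : Tube n M) (b : ℝ × 𝔼) : 𝔼 →L[ℝ] 𝔼 →L[ℝ] ℝ :=
  (1 / 2 : ℝ) • ((fderiv ℝ (pullMetric n τ.Φ) b (1, 0)).bilinearComp
      (ContinuousLinearMap.inr ℝ ℝ 𝔼) (ContinuousLinearMap.inr ℝ ℝ 𝔼) +
    ((fderiv ℝ (pullMetric n τ.Φ) b).flip (1, 0)).bilinearComp
      (ContinuousLinearMap.inr ℝ ℝ 𝔼) (ContinuousLinearMap.inr ℝ ℝ 𝔼) -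
    (((fderiv ℝ (pullMetric n τ.Φ) b).flip (1, 0)).bilinearComp
      (ContinuousLinearMap.inr ℝ ℝ 𝔼) (ContinuousLinearMap.inr ℝ ℝ 𝔼)).flip)

lemma connForm_apply (τ : Tube n M) (b : ℝ × 𝔼) (x y : 𝔼) :
    τ.connForm b x y = kos (pullMetric n τ.Φ) b (1, 0) (0, x) (0, y) := rfl

lemma contDiffAt_connForm {τ : Tube n M} {b : ℝ × 𝔼} (hb : b ∈ τ.dom) :
    ContDiffAt ℝ ∞ τ.connForm b := by
  refine contDiffAt_clm_of_apply fun x => contDiffAt_clm_of_apply fun y => ?_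
  simp only [connForm_apply, kos]
  have h1 : ContDiffAt ℝ ∞ (fderiv ℝ (pullMetric n τ.Φ)) b :=
    (contDiffAt_metric hb).fderiv_right (m := ∞) (by simp)
  have h3 : ∀ u v w : ℝ × 𝔼, ContDiffAt ℝ ∞ (fun p => fderiv ℝ (pullMetric n τ.Φ) p u v w) b :=
    fun u v w => ((h1.clm_apply contDiffAt_const).clm_apply contDiffAt_const).clm_apply contDiffAt_const
  exact contDiffAt_const.mul (((h3 _ _ _).add (h3 _ _ _)).sub (h3 _ _ _))

/-- A frame at one point of a tube that is orthonormal for the metric of `M`. -/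
lemma exists_orthonormal_frame (τ : Tube n M) {b : ℝ × 𝔼} (hb : b ∈ τ.dom) :
    ∃ P₀ : 𝔼 →L[ℝ] 𝔼, ∀ x y, τ.sliceMetric b (P₀ x) (P₀ y) = inner ℝ x y := by
  have hd : Module.finrank ℝ (TangentSpace (𝓡 n) (τ.Φ b)) = n := finrank_euclideanSpace_fin (𝕜 := ℝ)
  let e := ((stdOrthonormalBasis ℝ (TangentSpace (𝓡 n) (τ.Φ b))).reindex (finCongr hd)).repr.symm
  let Q : 𝔼 →ₗ[ℝ] 𝔼 := e.toLinearEquiv.toLinearMap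
  have hQ : ∀ x y, metricAt n (τ.Φ b) (Q x) (Q y) = inner ℝ x y := fun x y => e.inner_map_map x y
  let L : 𝔼 →ₗ[ℝ] 𝔼 := (tder n τ.Φ b ∘L ContinuousLinearMap.inr ℝ ℝ 𝔼 : 𝔼 →L[ℝ] 𝔼)
  let L' := LinearEquiv.ofBijective L (τ.tder_bijective hb)
  refine ⟨LinearMap.toContinuousLinearMap (L'.symm.toLinearMap ∘ₗ Q), fun x y => ?_⟩
  have h1 : ∀ w, tder n τ.Φ b (0, L'.symm w) = w := fun w => L'.apply_symm_apply w
  rw [sliceMetric_apply, pullMetric_apply]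
  change metricAt n (τ.Φ b) (tder n τ.Φ b (0, L'.symm (Q x))) (tder n τ.Φ b (0, L'.symm (Q y))) = _
  rw [h1, h1, hQ]

end Tube

/-- There is an adapted tube around every geodesic. -/
theorem exists_adapted_tube [T2Space M] {γ : SmoothCurve n M} (hγ : IsGeodesic n γ) :
    ∃ τ : Tube n M, τ.IsAdapted γ (Ioo (-1) 2) := by
  obtain ⟨τ, hτ⟩ := exists_tube_along γ.contMDiff (show (-1 : ℝ) ≤ 2 by norm_num)
  set G := pullMetric n τ.Φ with hG
  -- A frame `P` is parallel along `γ` if `P' = L P`.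
  let L : ℝ → 𝔼 →L[ℝ] 𝔼 := fun s => -((τ.sliceMetric (s, 0)).inverse ∘L τ.connForm (s, 0))
  have hLs : ∀ s ∈ Icc (-1 : ℝ) 2, ContDiffAt ℝ ∞ L s := by
    intro s hs
    have h0 : ContDiffAt ℝ ∞ (fun s : ℝ => (s, (0 : 𝔼))) s := contDiffAt_id.prodMk contDiffAt_const
    have h1 : ContDiffAt ℝ ∞ (fun s : ℝ => (τ.sliceMetric (s, 0)).inverse) s :=
      ContDiffAt.comp (g := ContinuousLinearMap.inverse) s
        ((Tube.isInvertible_sliceMetric (hτ s hs).1).contDiffAt_map_inverse (n := ∞))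
        (ContDiffAt.comp (g := τ.sliceMetric) s (Tube.contDiffAt_sliceMetric (hτ s hs).1) h0)
    exact (h1.clm_comp (ContDiffAt.comp (g := τ.connForm) s (Tube.contDiffAt_connForm (hτ s hs).1) h0)).neg
  have hL : ∀ s ∈ Icc (-1 : ℝ) 2, ∀ x y, G (s, 0) (0, L s x) (0, y) =
      -kos G (s, 0) (1, 0) (0, x) (0, y) := by
    intro s hs x y
    rw [hG, ← Tube.sliceMetric_apply, ← Tube.connForm_apply]
    simp only [L, _root_.neg_apply, ContinuousLinearMap.comp_apply, map_neg]
    rw [(Tube.isInvertible_sliceMetric (hτ s hs).1).self_apply_inverse]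
  obtain ⟨P₀, hP₀⟩ := τ.exists_orthonormal_frame (hτ 0 (by norm_num)).1
  obtain ⟨P, hP0, hP⟩ := exists_solution_linear (F := 𝔼 →L[ℝ] 𝔼) (a := -1) (b := 2) (t₀ := 0)
    (L := fun s => ContinuousLinearMap.compL ℝ 𝔼 𝔼 𝔼 (L s))
    (fun s hs => ((ContinuousLinearMap.compL ℝ 𝔼 𝔼 𝔼).continuous.continuousAt.comp
      (hLs s hs).continuousAt).continuousWithinAt) (by norm_num) P₀
  set J : Set ℝ := Ioo (-1) 2 with hJ
  have hJo : IsOpen J := isOpen_Ioo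
  have hJI : J ⊆ Icc (-1) 2 := Ioo_subset_Icc_self
  have hPd : ∀ s ∈ J, HasDerivAt P (L s ∘L P s) s := fun s hs =>
    (hP s (hJI hs)).hasDerivAt (Icc_mem_nhds hs.1 hs.2)
  have hPs : ∀ s ∈ J, ContDiffAt ℝ ∞ P s := by
    intro s hs
    have h1 : ContDiffAt ℝ ∞ (fun t => (t, P t)) s := by
      refine contDiffAt_of_solution (f := fun p : ℝ × (𝔼 →L[ℝ] 𝔼) => ((1 : ℝ), L p.1 ∘L p.2))
        (hJo.preimage continuous_fst) (fun p hp => ?_) (show s ∈ J from hs) ?_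
      · exact contDiffAt_const.prodMk ((ContDiffAt.comp (g := L) (f := Prod.fst) p (hLs p.1 (hJI hp))
          contDiffAt_fst).clm_comp contDiffAt_snd)
      · filter_upwards [hJo.mem_nhds hs] with t ht
        exact (hasDerivAt_id t).prodMk (hPd t ht)
    exact h1.snd
  have hb : ∀ s, HasDerivAt (fun t : ℝ => (t, (0 : 𝔼))) (1, 0) s := fun s =>
    (hasDerivAt_id s).prodMk (hasDerivAt_const s 0)
  have hPx : ∀ s ∈ J, ∀ x, HasDerivAt (fun t => ((0 : ℝ), P t x)) (0, L s (P s x)) s := fun s hs x =>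
    (hasDerivAt_const s (0 : ℝ)).prodMk
      (((hPd s hs).clm_apply (hasDerivAt_const s x)).congr_deriv (by simp))
  -- A parallel frame that is orthonormal at `0` is orthonormal.
  have hort : ∀ s ∈ J, ∀ x y, G (s, 0) (0, P s x) (0, P s y) = inner ℝ x y := by
    intro s hs x y
    have h1 : ∀ t ∈ J, HasDerivAt (fun t => G (t, 0) (0, P t x) (0, P t y)) 0 t := by
      intro t ht
      have hsm := τ.smooth_Φ _ (hτ t (hJI ht)).1
      have h2 := hasDerivAt_apply_apply (G := G) (b := fun t => (t, (0 : 𝔼)))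
        ((contDiffAt_pullMetric hsm).differentiableAt (by simp)) (hb t) (hPx t ht x) (hPx t ht y)
      refine h2.congr_deriv ?_
      rw [hG, pullMetric_symm _ _ (0, P t x) (0, L t (P t y)), ← hG, hL t (hJI ht), hL t (hJI ht), kos, kos,
        hG, fderiv_pullMetric_symm hsm (1, 0) (0, P t y) (0, P t x)]
      ring
    have h3 := hJo.is_const_of_deriv_eq_zero isPreconnected_Ioo
      (fun t ht => (h1 t ht).differentiableAt.differentiableWithinAt) (fun t ht => (h1 t ht).deriv) hs
      (show (0 : ℝ) ∈ J by norm_num [hJ])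
    rw [h3, hP0, ← hP₀ x y]
    rfl
  have hinv : ∀ s ∈ J, (P s).IsInvertible := by
    intro s hs
    have hinj : Function.Injective (P s) := by
      refine (injective_iff_map_eq_zero _).2 fun x hx => ?_
      have := hort s hs x x
      rw [hx, Prod.mk_zero_zero, map_zero] at this
      exact inner_self_eq_zero.1 this.symm
    exact ⟨(LinearEquiv.ofInjectiveEndo (P s : 𝔼 →ₗ[ℝ] 𝔼) hinj).toContinuousLinearEquiv, by ext; rfl⟩
  set τ' := τ.twist P hJo hPs hinv with hτ'
  have hP0' : ∀ t : ℝ, ((t, P t 0) : ℝ × 𝔼) = (t, 0) := fun t => by rw [map_zero]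
  have hmem : ∀ s ∈ J, (s, (0 : 𝔼)) ∈ τ'.dom := fun s hs =>
    ⟨hs, by simp only [mem_preimage, hP0', (hτ s (hJI hs)).1]⟩
  have hΦ : ∀ t, τ'.Φ (t, 0) = τ.Φ (t, 0) := fun t => congrArg τ.Φ (hP0' t)
  have hc : ∀ s ∈ J, τ'.Φ (s, 0) = γ s := fun s hs => (hΦ s).trans (hτ s (hJI hs)).2
  have htd : ∀ s ∈ J, ∀ σ x, tder n τ'.Φ (s, 0) (σ, x) = tder n τ.Φ (s, 0) (σ, P s x) :=
    fun s hs σ x => τ.tder_twist hJo hPs hinv hs (hτ s (hJI hs)).1 σ x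
  refine ⟨τ', hmem, hc, ?_, ?_, ?_⟩
  · intro s hs x y
    rw [pullMetric_apply, htd s hs, htd s hs, hΦ, ← hort s hs x y]
    rfl
  · intro s hs x y
    have h1 := metricAt_covDeriv (τ'.smooth_Φ _ (hmem s hs)) (hb s)
      (hasDerivAt_const s ((0 : ℝ), x)) (0, y)
    have h2 := metricAt_covDeriv (τ.smooth_Φ _ (hτ s (hJI hs)).1) (hb s) (hPx s hs x) (0, P s y)
    have h3 : (covDeriv n (fun t => τ'.Φ (t, 0)) (fun t => tder n τ'.Φ (t, 0) (0, x)) s : 𝔼) =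
        covDeriv n (fun t => τ.Φ (t, 0)) (fun t => tder n τ.Φ (t, 0) (0, P t x)) s := by
      refine covDeriv_congr (.of_forall hΦ) ?_
      filter_upwards [hJo.mem_nhds hs] with t ht using htd t ht 0 x
    rw [← hG, hL s (hJI hs), neg_add_cancel] at h2
    rw [← h3, ← htd s hs, ← hΦ] at h2
    rw [map_zero, _root_.zero_apply, zero_add] at h1
    exact h1.symm.trans h2
  · intro s hs y
    have h1 := metricAt_covDeriv (τ'.smooth_Φ _ (hmem s hs)) (hb s)
      (hasDerivAt_const s ((1 : ℝ), (0 : 𝔼))) (0, y)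
    have hcur : (fun t => τ'.Φ (t, 0)) =ᶠ[𝓝 s] γ := by
      filter_upwards [hJo.mem_nhds hs] with t ht using hc t ht
    have h3 : (covDeriv n (fun t => τ'.Φ (t, 0)) (fun t => tder n τ'.Φ (t, 0) (1, 0)) s : 𝔼) = 0 := by
      refine (covDeriv_congr (X₂ := velocity n γ) hcur ?_).trans (hγ s)
      filter_upwards [hJo.mem_nhds hs, hcur.eventuallyEq_nhds] with t ht ht'
      exact (τ'.velocity_eq (hasDerivAt_const t (0 : 𝔼)) (hmem t ht)).symm.trans (velocity_congr ht')
    rw [map_zero, _root_.zero_apply, zero_add] at h1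
    exact h1.symm.trans (metricAt_of_eq_zero h3 _)

end AdaptedTubes

/-! ### Calculus of maps into spaces of bilinear forms -/

section Calculus

/-- Differentiation under the integral sign, for a function that is smooth near the segment. -/
lemma hasDerivAt_integral_of_contDiffAt {f : ℝ × ℝ → ℝ} {O : Set (ℝ × ℝ)} (hO : IsOpen O)
    (hf : ∀ p ∈ O, ContDiffAt ℝ ∞ f p) {u₀ : ℝ} (hu : ∀ s ∈ Icc (0 : ℝ) 1, (u₀, s) ∈ O) :
    HasDerivAt (fun u => ∫ s in (0 : ℝ)..1, f (u, s))
      (∫ s in (0 : ℝ)..1, fderiv ℝ f (u₀, s) (1, 0)) u₀ := by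
  obtain ⟨V, W, hV, hW, hVu, hWs, hVW⟩ := generalized_tube_lemma (isCompact_singleton (x := u₀))
    (isCompact_Icc (a := (0 : ℝ)) (b := 1)) hO (by
      rintro ⟨u, s⟩ ⟨hu', hs⟩
      have : u = u₀ := hu'
      subst this
      exact hu s hs)
  obtain ⟨ε, hε, hball⟩ := Metric.nhds_basis_closedBall.mem_iff.1 (hV.mem_nhds (hVu rfl))
  have hmem : ∀ u ∈ Metric.closedBall u₀ ε, ∀ s ∈ Icc (0 : ℝ) 1, (u, s) ∈ O := fun u hu s hs =>
    hVW ⟨hball hu, hWs hs⟩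
  let f' : ℝ × ℝ → ℝ := fun p => fderiv ℝ f p (1, 0)
  have hf' : ∀ p ∈ O, ContinuousAt f' p := fun p hp =>
    (((hf p hp).fderiv_right (m := ∞) (by simp)).clm_apply contDiffAt_const).continuousAt
  have hcs : ∀ {g : ℝ × ℝ → ℝ}, (∀ p ∈ O, ContinuousAt g p) → ∀ u ∈ Metric.closedBall u₀ ε,
      ContinuousOn (fun s => g (u, s)) (Icc 0 1) := fun hg u hu s hs =>
    (ContinuousAt.comp (f := fun s => (u, s)) (hg _ (hmem u hu s hs))
      (Continuous.prodMk_right u).continuousAt).continuousWithinAt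
  obtain ⟨C, hC⟩ := ((isCompact_closedBall u₀ ε).prod (isCompact_Icc (a := (0 : ℝ)) (b := 1)))
    |>.exists_bound_of_continuousOn (f := f') (fun p hp =>
      (hf' p (hmem p.1 hp.1 p.2 hp.2)).continuousWithinAt)
  have hI : uIoc (0 : ℝ) 1 = Ioc 0 1 := uIoc_of_le zero_le_one
  have hfc := fun {g : ℝ × ℝ → ℝ} (hg : ∀ p ∈ O, ContinuousAt g p) u hu =>
    (hcs hg u hu).mono (Ioc_subset_Icc_self)
  have hmeas : ∀ {g : ℝ × ℝ → ℝ}, (∀ p ∈ O, ContinuousAt g p) → ∀ u ∈ Metric.closedBall u₀ ε,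
      AEStronglyMeasurable (fun s => g (u, s)) (volume.restrict (uIoc (0 : ℝ) 1)) := fun hg u hu => by
    rw [hI]
    exact (hfc hg u hu).aestronglyMeasurable measurableSet_Ioc
  have hfO : ∀ p ∈ O, ContinuousAt f p := fun p hp => (hf p hp).continuousAt
  have hu₀ : u₀ ∈ Metric.closedBall u₀ ε := Metric.mem_closedBall_self hε.le
  refine (intervalIntegral.hasDerivAt_integral_of_dominated_loc_of_deriv_le
    (F := fun u s => f (u, s)) (F' := fun u s => f' (u, s)) (bound := fun _ => C)
    (Metric.closedBall_mem_nhds u₀ hε) ?_ ?_ (hmeas hf' u₀ hu₀) ?_ intervalIntegrable_const ?_).2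
  · filter_upwards [Metric.closedBall_mem_nhds u₀ hε] with u hu using hmeas hfO u hu
  · exact ContinuousOn.intervalIntegrable (by rw [uIcc_of_le zero_le_one]; exact hcs hfO u₀ hu₀)
  · refine .of_forall fun s hs u hu => hC (u, s) ⟨hu, ?_⟩
    rw [hI] at hs
    exact Ioc_subset_Icc_self hs
  · refine .of_forall fun s hs u hu => ?_
    rw [hI] at hs
    have h1 := ((hf _ (hmem u hu s (Ioc_subset_Icc_self hs))).differentiableAt (by simp)).hasFDerivAt
    exact h1.comp_hasDerivAt u ((hasDerivAt_id u).prodMk (hasDerivAt_const u s))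

variable {H F W : Type*} [NormedAddCommGroup H] [NormedSpace ℝ H] [NormedAddCommGroup F]
  [NormedSpace ℝ F] [NormedAddCommGroup W] [NormedSpace ℝ W]

lemma fderiv_fderiv_apply_comm {a : H → W} {p : H} (ha : ContDiffAt ℝ ∞ a p) (v w : H) :
    fderiv ℝ (fun q => fderiv ℝ a q v) p w = fderiv ℝ (fun q => fderiv ℝ a q w) p v := by
  have h1 := (ha.fderiv_right (m := ∞) (by simp)).differentiableAt (by simp)
  have h2 : ∀ v w, fderiv ℝ (fun q => fderiv ℝ a q v) p w = fderiv ℝ (fderiv ℝ a) p w v := by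
    intro v w
    rw [(h1.hasFDerivAt.clm_apply (hasFDerivAt_const v p)).fderiv]
    simp
  rw [h2, h2]
  exact (ha.isSymmSndFDerivAt (by simp; exact WithTop.coe_le_coe.2 le_top)).eq w v

lemma fderiv_apply_apply {G : F → F →L[ℝ] F →L[ℝ] ℝ} {b ξ η : H → F} {p : H}
    (hG : DifferentiableAt ℝ G (b p)) (hb : DifferentiableAt ℝ b p) (hξ : DifferentiableAt ℝ ξ p)
    (hη : DifferentiableAt ℝ η p) (w : H) :
    fderiv ℝ (fun q => G (b q) (ξ q) (η q)) p w = fderiv ℝ G (b p) (fderiv ℝ b p w) (ξ p) (η p) +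
      G (b p) (fderiv ℝ ξ p w) (η p) + G (b p) (ξ p) (fderiv ℝ η p w) := by
  have h := ((hG.hasFDerivAt.comp p hb.hasFDerivAt).clm_apply hξ.hasFDerivAt).clm_apply hη.hasFDerivAt
  rw [show (fun q => G (b q) (ξ q) (η q)) = fun q => (G ∘ b) q (ξ q) (η q) from rfl, h.fderiv]
  simp only [_root_.add_apply, ContinuousLinearMap.comp_apply, ContinuousLinearMap.flip_apply,
    Function.comp_apply]
  ring

end Calculus

/-! ### The curvature along a geodesic -/

section Curvature

variable {n : ℕ} {M : Type*} [TopologicalSpace M] [ChartedSpace (EuclideanSpace ℝ (Fin n)) M]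
  [IsManifold (𝓡 n) ∞ M] [RiemannianBundle (fun x : M => TangentSpace (𝓡 n) x)]
  [IsContMDiffRiemannianBundle (𝓡 n) ∞ (EuclideanSpace ℝ (Fin n))
    (fun x : M => TangentSpace (𝓡 n) x)]

local notation "𝔼" => EuclideanSpace ℝ (Fin n)

namespace Tube

/-- The curvature operator `x ↦ R(x, γ')γ'` in an adapted tube: the linearization of the geodesic
equation along `γ` is `y'' = -R y`. -/
noncomputable def curv (τ : Tube n M) (s : ℝ) : 𝔼 →L[ℝ] 𝔼 :=
  -(fderiv ℝ τ.rhs ((s, 0), 0) ∘L ContinuousLinearMap.inl ℝ (ℝ × 𝔼) 𝔼 ∘L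
    ContinuousLinearMap.inr ℝ ℝ 𝔼)

variable {τ : Tube n M}

lemma sliceMetric_rhs_add {p : (ℝ × 𝔼) × 𝔼} (hp : p.1 ∈ τ.dom) (z : 𝔼) :
    pullMetric n τ.Φ p.1 (0, τ.rhs p) (0, z) +
      kos (pullMetric n τ.Φ) p.1 (1, p.2) (1, p.2) (0, z) = 0 := by
  have := (eq_rhs_iff hp (τ.rhs p)).1 rfl z
  rwa [sliceForce_apply, sliceMetric_apply] at this

variable {γ : ℝ → M} {J : Set ℝ}

lemma IsAdapted.rhs_eq_zero (h : τ.IsAdapted γ J) {s : ℝ} (hs : s ∈ J) : τ.rhs ((s, 0), 0) = 0 := by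
  refine ((eq_rhs_iff (p := ((s, 0), 0)) (h.mem s hs) 0).2 fun z => ?_).symm
  rw [sliceForce_apply, map_zero, _root_.zero_apply, zero_add]
  exact h.geodesic s hs z

lemma contDiffAt_fderiv_metric {b : ℝ × 𝔼} (hb : b ∈ τ.dom) :
    ContDiffAt ℝ ∞ (fderiv ℝ (pullMetric n τ.Φ)) b :=
  (contDiffAt_metric hb).fderiv_right (m := ∞) (by simp)

/-- The linearized geodesic equation. -/
lemma IsAdapted.inner_fderiv_rhs (h : τ.IsAdapted γ J) {s : ℝ} (hs : s ∈ J) (y y' z : 𝔼) :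
    inner ℝ (fderiv ℝ τ.rhs ((s, 0), 0) ((0, y), y')) z =
      -(fderiv ℝ (fderiv ℝ (pullMetric n τ.Φ)) (s, 0) (0, y) (1, 0) (1, 0) (0, z) -
        1 / 2 * fderiv ℝ (fderiv ℝ (pullMetric n τ.Φ)) (s, 0) (0, y) (0, z) (1, 0) (1, 0)) := by
  have hm := h.mem s hs
  set G := pullMetric n τ.Φ with hG
  -- Differentiate the equation for `rhs` along the line `((s, t y), t y')`.
  let b : ℝ → ℝ × 𝔼 := fun t => (s, t • y)
  let ξ : ℝ → ℝ × 𝔼 := fun t => (1, t • y')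
  have hlin : ∀ y : 𝔼, HasDerivAt (fun t : ℝ => t • y) y 0 := fun y => by
    simpa using (hasDerivAt_id (0 : ℝ)).smul_const y
  have hb : HasDerivAt b (0, y) 0 := (hasDerivAt_const 0 s).prodMk (hlin y)
  have hξ : HasDerivAt ξ (0, y') 0 := (hasDerivAt_const (0 : ℝ) (1 : ℝ)).prodMk (hlin y')
  have hb0 : b 0 = (s, 0) := by simp [b]
  have hξ0 : ξ 0 = (1, 0) := by simp [ξ]
  have hp0 : ((b 0, (0 : ℝ) • y') : (ℝ × 𝔼) × 𝔼) = ((s, 0), 0) := by rw [hb0, zero_smul]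
  have hr : HasDerivAt (fun t : ℝ => τ.rhs (b t, t • y'))
      (fderiv ℝ τ.rhs ((s, 0), 0) ((0, y), y')) 0 :=
    ((contDiffAt_rhs (p := ((s, 0), 0)) hm).differentiableAt (by simp)).hasFDerivAt.comp_hasDerivAt_of_eq 0
      (hb.prodMk (hlin y')) hp0.symm
  have hGd : DifferentiableAt ℝ G (b 0) := hb0 ▸ (contDiffAt_metric hm).differentiableAt (by simp)
  have h1 := hasDerivAt_apply_apply (G := G) (b := b) (ξ := fun t => ((0 : ℝ), τ.rhs (b t, t • y')))
    (η := fun _ => ((0 : ℝ), z)) hGd hb ((hasDerivAt_const _ _).prodMk hr) (hasDerivAt_const _ _)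
  have hDG : HasDerivAt (fun t => fderiv ℝ G (b t)) (fderiv ℝ (fderiv ℝ G) (s, 0) (0, y)) 0 :=
    ((contDiffAt_fderiv_metric hm).differentiableAt (by simp)).hasFDerivAt.comp_hasDerivAt_of_eq 0
      hb hb0.symm
  have hz : HasDerivAt (fun _ : ℝ => ((0 : ℝ), z)) 0 0 := hasDerivAt_const _ _
  have h2 := ((hDG.clm_apply hξ).clm_apply hξ).clm_apply hz
  have h3 := ((hDG.clm_apply hz).clm_apply hξ).clm_apply hξ
  have hev : ∀ᶠ t in 𝓝 (0 : ℝ), b t ∈ τ.dom :=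
    hb.continuousAt.preimage_mem_nhds (τ.isOpen_dom.mem_nhds (by rw [hb0]; exact hm))
  have h4 := (h1.add (((h2.add h2).sub h3).const_mul (1 / 2))).congr_of_eventuallyEq
    (f₁ := fun _ => 0) (by
      filter_upwards [hev] with t ht
      exact (sliceMetric_rhs_add (p := (b t, t • y')) ht z).symm)
  have h5 := h4.unique (hasDerivAt_const _ _)
  simp only [hb0, hξ0, zero_smul, h.rhs_eq_zero hs, map_zero, _root_.zero_apply, _root_.add_apply, Prod.mk_zero_zero,
    add_zero, zero_add] at h5
  rw [hG, h.orthonormal s hs, ← hG] at h5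
  have h6 := h.parallel s hs y' z
  rw [← hG, kos] at h6
  have h7 : fderiv ℝ G (s, 0) (0, z) (0, y') (1, 0) = fderiv ℝ G (s, 0) (0, z) (1, 0) (0, y') :=
    fderiv_pullMetric_symm (τ.smooth_Φ _ hm) _ _ _
  linarith

/-- The linearized geodesic equation has no first order term, as the frame is parallel. -/
lemma IsAdapted.fderiv_rhs (h : τ.IsAdapted γ J) {s : ℝ} (hs : s ∈ J) (y y' : 𝔼) :
    fderiv ℝ τ.rhs ((s, 0), 0) ((0, y), y') = -τ.curv s y := by
  refine ext_inner_right ℝ fun z => ?_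
  have e : τ.curv s y = -fderiv ℝ τ.rhs ((s, 0), 0) ((0, y), 0) := rfl
  rw [e, neg_neg, h.inner_fderiv_rhs hs, h.inner_fderiv_rhs hs]

lemma IsAdapted.continuousOn_curv (h : τ.IsAdapted γ J) : ContinuousOn τ.curv J := by
  intro s hs
  have h1 : ContinuousAt (fderiv ℝ τ.rhs) ((s, 0), 0) :=
    ((contDiffAt_rhs (p := ((s, 0), 0)) (h.mem s hs)).fderiv_right (m := ∞) (by simp)).continuousAt
  have h2 : ContinuousAt (fun s : ℝ => fderiv ℝ τ.rhs ((s, 0), 0)) s :=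
    ContinuousAt.comp (f := fun s : ℝ => (((s, 0), 0) : (ℝ × 𝔼) × 𝔼)) h1 (by fun_prop)
  exact (h2.clm_comp continuousAt_const).neg.continuousWithinAt

/-- The symmetry `⟨R(x, γ')γ', y⟩ = ⟨R(y, γ')γ', x⟩` of the curvature, from the symmetry of second
derivatives of the metric. -/
lemma IsAdapted.curv_isSymmetric (h : τ.IsAdapted γ J) (hJ : IsOpen J) {s : ℝ} (hs : s ∈ J) :
    (τ.curv s : 𝔼 →ₗ[ℝ] 𝔼).IsSymmetric := by
  set G := pullMetric n τ.Φ with hG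
  have hb : ∀ s, HasDerivAt (fun t : ℝ => (t, (0 : 𝔼))) (1, 0) s := fun s =>
    (hasDerivAt_id s).prodMk (hasDerivAt_const s 0)
  have hmem := h.mem s hs
  have hDG : HasDerivAt (fun t : ℝ => fderiv ℝ G (t, 0)) (fderiv ℝ (fderiv ℝ G) (s, 0) (1, 0)) s :=
    ((contDiffAt_fderiv_metric hmem).differentiableAt (by simp)).hasFDerivAt.comp_hasDerivAt s (hb s)
  have hsym2 : ∀ v w, fderiv ℝ (fderiv ℝ G) (s, 0) v w = fderiv ℝ (fderiv ℝ G) (s, 0) w v :=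
    fun v w => ((contDiffAt_metric hmem).isSymmSndFDerivAt
      (by simp; exact WithTop.coe_le_coe.2 le_top)).eq v w
  -- As the frame is orthonormal and parallel, `D_y G(γ', z)` is symmetric in `y` and `z`.
  have hB : ∀ t ∈ J, ∀ y z : 𝔼, fderiv ℝ G (t, 0) (0, y) (1, 0) (0, z) =
      fderiv ℝ G (t, 0) (0, z) (1, 0) (0, y) := by
    intro t ht y z
    have h1 := h.parallel t ht y z
    have h2 := hasDerivAt_apply_apply (G := G) (b := fun t => (t, (0 : 𝔼)))
      ((contDiffAt_metric (h.mem t ht)).differentiableAt (by simp)) (hb t)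
      (hasDerivAt_const t ((0 : ℝ), y)) (hasDerivAt_const t ((0 : ℝ), z))
    have h3 : (fun t : ℝ => G (t, 0) (0, y) (0, z)) =ᶠ[𝓝 t] fun _ => inner ℝ y z := by
      filter_upwards [hJ.mem_nhds ht] with r hr using h.orthonormal r hr y z
    have h4 := (h2.congr_of_eventuallyEq h3.symm).unique (hasDerivAt_const _ _)
    simp only [map_zero, _root_.zero_apply, add_zero] at h4
    have h5 := fderiv_pullMetric_symm (τ.smooth_Φ _ (h.mem t ht)) (0, z) (0, y) (1, 0)
    rw [kos, ← hG] at h1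
    rw [← hG] at h5
    linarith
  have hB' : ∀ y z : 𝔼, fderiv ℝ (fderiv ℝ G) (s, 0) (1, 0) (0, y) (1, 0) (0, z) =
      fderiv ℝ (fderiv ℝ G) (s, 0) (1, 0) (0, z) (1, 0) (0, y) := by
    intro y z
    have key : ∀ y z : 𝔼, HasDerivAt (fun t : ℝ => fderiv ℝ G (t, 0) (0, y) (1, 0) (0, z))
        (fderiv ℝ (fderiv ℝ G) (s, 0) (1, 0) (0, y) (1, 0) (0, z)) s := by
      intro y z
      have := ((hDG.clm_apply (hasDerivAt_const s ((0 : ℝ), y))).clm_apply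
        (hasDerivAt_const s ((1 : ℝ), (0 : 𝔼)))).clm_apply (hasDerivAt_const s ((0 : ℝ), z))
      simpa using this
    refine (key y z).unique ((key z y).congr_of_eventuallyEq ?_)
    filter_upwards [hJ.mem_nhds hs] with t ht using hB t ht y z
  intro y z
  have key : ∀ y z : 𝔼, inner ℝ (τ.curv s y) z =
      fderiv ℝ (fderiv ℝ G) (s, 0) (1, 0) (0, y) (1, 0) (0, z) -
        1 / 2 * fderiv ℝ (fderiv ℝ G) (s, 0) (0, y) (0, z) (1, 0) (1, 0) := by
    intro y z
    have := h.inner_fderiv_rhs hs y 0 z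
    rw [h.fderiv_rhs hs, inner_neg_left, ← hG, hsym2 (0, y) (1, 0)] at this
    exact neg_injective this
  change inner ℝ (τ.curv s y) z = inner ℝ y (τ.curv s z)
  rw [real_inner_comm _ y, key, key, hB', hsym2 (0, y) (0, z)]

end Tube

end Curvature

/-! ### The energy density of a family of curves -/

section Variation

variable {n : ℕ} {M : Type*} [TopologicalSpace M] [ChartedSpace (EuclideanSpace ℝ (Fin n)) M]
  [IsManifold (𝓡 n) ∞ M] [RiemannianBundle (fun x : M => TangentSpace (𝓡 n) x)]
  [IsContMDiffRiemannianBundle (𝓡 n) ∞ (EuclideanSpace ℝ (Fin n))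
    (fun x : M => TangentSpace (𝓡 n) x)]

local notation "𝔼" => EuclideanSpace ℝ (Fin n)

namespace Tube

/-- The partial derivative of a map in the direction `w`. -/
noncomputable def pder {W : Type*} [NormedAddCommGroup W] [NormedSpace ℝ W] (w : ℝ × ℝ × ℝ)
    (a : ℝ × ℝ × ℝ → W) (p : ℝ × ℝ × ℝ) : W := fderiv ℝ a p w

lemma contDiffAt_pder {W : Type*} [NormedAddCommGroup W] [NormedSpace ℝ W] {w : ℝ × ℝ × ℝ}
    {a : ℝ × ℝ × ℝ → W} {p : ℝ × ℝ × ℝ} (ha : ContDiffAt ℝ ∞ a p) : ContDiffAt ℝ ∞ (pder w a) p :=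
  (ha.fderiv_right (m := ∞) (by simp)).clm_apply contDiffAt_const

lemma hasDerivAt_line {W : Type*} [NormedAddCommGroup W] [NormedSpace ℝ W]
    {a : ℝ × ℝ × ℝ → W} {u v s : ℝ} (ha : ContDiffAt ℝ ∞ a (u, v, s)) :
    HasDerivAt (fun t => a (u, v, t)) (pder (0, 0, 1) a (u, v, s)) s :=
  (ha.differentiableAt (by simp)).hasFDerivAt.comp_hasDerivAt s
    ((hasDerivAt_const s u).prodMk ((hasDerivAt_const s v).prodMk (hasDerivAt_id s)))

variable (τ : Tube n M) (a : ℝ × ℝ × ℝ → EuclideanSpace ℝ (Fin n))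

/-- The energy density `½ |∂_s α|²` of the family of curves `α = Φ(s, a(u, v, s))`. -/
noncomputable def energy (p : ℝ × ℝ × ℝ) : ℝ :=
  1 / 2 * pullMetric n τ.Φ (p.2.2, a p) (1, pder (0, 0, 1) a p) (1, pder (0, 0, 1) a p)

/-- The boundary term `⟨∂_s α, ∂_v α⟩` of the first variation. -/
noncomputable def momentum (p : ℝ × ℝ × ℝ) : ℝ :=
  pullMetric n τ.Φ (p.2.2, a p) (1, pder (0, 0, 1) a p) (0, pder (0, 1, 0) a p)

/-- The integrand `⟨∇_s ∂_s α, ∂_v α⟩` of the first variation. -/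
noncomputable def euler (p : ℝ × ℝ × ℝ) : ℝ :=
  pullMetric n τ.Φ (p.2.2, a p)
    (0, pder (0, 0, 1) (pder (0, 0, 1) a) p - τ.rhs ((p.2.2, a p), pder (0, 0, 1) a p))
    (0, pder (0, 1, 0) a p)

variable {τ a} {p : ℝ × ℝ × ℝ}

lemma contDiffAt_base (ha : ContDiffAt ℝ ∞ a p) : ContDiffAt ℝ ∞ (fun q => (q.2.2, a q)) p :=
  contDiffAt_snd.snd.prodMk ha

lemma fderiv_base (ha : ContDiffAt ℝ ∞ a p) (w : ℝ × ℝ × ℝ) :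
    fderiv ℝ (fun q => (q.2.2, a q)) p w = (w.2.2, pder w a p) := by
  have h := (hasFDerivAt_snd.snd (𝕜 := ℝ) (x := p)).prodMk
    (ha.differentiableAt (by simp)).hasFDerivAt
  rw [h.fderiv]
  rfl

lemma fderiv_const_prodMk {f : ℝ × ℝ × ℝ → 𝔼} (hf : ContDiffAt ℝ ∞ f p) (c : ℝ) (w : ℝ × ℝ × ℝ) :
    fderiv ℝ (fun q => (c, f q)) p w = (0, pder w f p) := by
  have h := (hasFDerivAt_const (𝕜 := ℝ) c p).prodMk (hf.differentiableAt (by simp)).hasFDerivAt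
  rw [h.fderiv]
  rfl

lemma contDiffAt_metric_base (ha : ContDiffAt ℝ ∞ a p) (hp : (p.2.2, a p) ∈ τ.dom) :
    ContDiffAt ℝ ∞ (fun q => pullMetric n τ.Φ (q.2.2, a q)) p :=
  ContDiffAt.comp (g := pullMetric n τ.Φ) p (contDiffAt_metric hp) (contDiffAt_base ha)

lemma contDiffAt_energy (ha : ContDiffAt ℝ ∞ a p) (hp : (p.2.2, a p) ∈ τ.dom) :
    ContDiffAt ℝ ∞ (τ.energy a) p := by
  have h1 : ContDiffAt ℝ ∞ (fun q => ((1 : ℝ), pder (0, 0, 1) a q)) p :=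
    contDiffAt_const.prodMk (contDiffAt_pder ha)
  exact contDiffAt_const.mul (((contDiffAt_metric_base ha hp).clm_apply h1).clm_apply h1)

lemma contDiffAt_momentum (ha : ContDiffAt ℝ ∞ a p) (hp : (p.2.2, a p) ∈ τ.dom) :
    ContDiffAt ℝ ∞ (τ.momentum a) p :=
  ((contDiffAt_metric_base ha hp).clm_apply (contDiffAt_const.prodMk (contDiffAt_pder ha))).clm_apply
    (contDiffAt_const.prodMk (contDiffAt_pder ha))

lemma contDiffAt_acceleration (ha : ContDiffAt ℝ ∞ a p) (hp : (p.2.2, a p) ∈ τ.dom) :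
    ContDiffAt ℝ ∞ (fun p => pder (0, 0, 1) (pder (0, 0, 1) a) p -
      τ.rhs ((p.2.2, a p), pder (0, 0, 1) a p)) p :=
  (contDiffAt_pder (contDiffAt_pder ha)).sub (ContDiffAt.comp (g := τ.rhs) p
    (contDiffAt_rhs (p := ((p.2.2, a p), pder (0, 0, 1) a p)) hp)
    ((contDiffAt_base ha).prodMk (contDiffAt_pder ha)))

lemma contDiffAt_euler (ha : ContDiffAt ℝ ∞ a p) (hp : (p.2.2, a p) ∈ τ.dom) :
    ContDiffAt ℝ ∞ (τ.euler a) p :=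
  ((contDiffAt_metric_base ha hp).clm_apply
    (contDiffAt_const.prodMk (contDiffAt_acceleration ha hp))).clm_apply
    (contDiffAt_const.prodMk (contDiffAt_pder ha))

/-- The pointwise first variation formula. -/
lemma pder_energy (ha : ContDiffAt ℝ ∞ a p) (hp : (p.2.2, a p) ∈ τ.dom) :
    pder (0, 1, 0) (τ.energy a) p = pder (0, 0, 1) (τ.momentum a) p - τ.euler a p := by
  have hG : DifferentiableAt ℝ (pullMetric n τ.Φ) (p.2.2, a p) :=
    (contDiffAt_metric hp).differentiableAt (by simp)
  have hb := (contDiffAt_base ha).differentiableAt (by simp)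
  have has : ContDiffAt ℝ ∞ (pder (0, 0, 1) a) p := contDiffAt_pder ha
  have hav : ContDiffAt ℝ ∞ (pder (0, 1, 0) a) p := contDiffAt_pder ha
  have hξ : DifferentiableAt ℝ (fun q => ((1 : ℝ), pder (0, 0, 1) a q)) p :=
    (contDiffAt_const.prodMk has).differentiableAt (by simp)
  have hη : DifferentiableAt ℝ (fun q => ((0 : ℝ), pder (0, 1, 0) a q)) p :=
    (contDiffAt_const.prodMk hav).differentiableAt (by simp)
  have h1 := fderiv_apply_apply (G := pullMetric n τ.Φ) (b := fun q => (q.2.2, a q)) hG hb hξ hξ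
    (0, 1, 0)
  have h2 := fderiv_apply_apply (G := pullMetric n τ.Φ) (b := fun q => (q.2.2, a q)) hG hb hξ hη
    (0, 0, 1)
  rw [fderiv_base ha, fderiv_const_prodMk has] at h1
  rw [fderiv_base ha, fderiv_const_prodMk has, fderiv_const_prodMk hav] at h2
  have h3 : pder (0, 1, 0) (τ.energy a) p = 1 / 2 * fderiv ℝ (fun q => pullMetric n τ.Φ (q.2.2, a q)
      (1, pder (0, 0, 1) a q) (1, pder (0, 0, 1) a q)) p (0, 1, 0) := by
    have h4 : DifferentiableAt ℝ (fun q => pullMetric n τ.Φ (q.2.2, a q)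
      (1, pder (0, 0, 1) a q) (1, pder (0, 0, 1) a q)) p :=
      (((contDiffAt_metric_base ha hp).differentiableAt (by simp)).clm_apply hξ).clm_apply hξ
    have h5 := h4.hasFDerivAt.const_mul (1 / 2)
    rw [pder, show τ.energy a = fun q => 1 / 2 * pullMetric n τ.Φ (q.2.2, a q)
      (1, pder (0, 0, 1) a q) (1, pder (0, 0, 1) a q) from rfl, h5.fderiv]
    rfl
  have h6 : pder (0, 0, 1) (τ.momentum a) p = _ := h2
  have h7 : pder (0, 1, 0) (pder (0, 0, 1) a) p = pder (0, 0, 1) (pder (0, 1, 0) a) p :=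
    fderiv_fderiv_apply_comm ha _ _
  have h8 := sliceMetric_rhs_add (τ := τ) (p := ((p.2.2, a p), pder (0, 0, 1) a p)) hp (pder (0, 1, 0) a p)
  have h9 : ∀ x y : 𝔼, ((0 : ℝ), x - y) = (0, x) - (0, y) := fun x y => by simp
  -- By the definition of `rhs`, the derivative of the metric in the energy is that of the Koszul formula.
  rw [h3, h1, h6, euler, h9, map_sub, _root_.sub_apply, h7]
  rw [kos] at h8
  have h10 := pullMetric_symm (n := n) τ.Φ (p.2.2, a p) ((0 : ℝ), pder (0, 0, 1) (pder (0, 1, 0) a) p)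
    (1, pder (0, 0, 1) a p)
  simp only at h8 ⊢
  linarith

/-- The linearization of the Euler term at a geodesic is the Jacobi operator. -/
lemma IsAdapted.pder_euler {γ : ℝ → M} {J : Set ℝ} (h : τ.IsAdapted γ J) {s : ℝ} (hs : s ∈ J)
    (ha : ContDiffAt ℝ ∞ a (0, 0, s)) (h0 : ∀ᶠ t in 𝓝 s, a (0, 0, t) = 0) :
    pder (1, 0, 0) (τ.euler a) (0, 0, s) =
      inner ℝ (pder (1, 0, 0) (pder (0, 0, 1) (pder (0, 0, 1) a)) (0, 0, s) +
        τ.curv s (pder (1, 0, 0) a (0, 0, s))) (pder (0, 1, 0) a (0, 0, s)) := by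
  have ha0 : a (0, 0, s) = 0 := h0.self_of_nhds
  have hp : (s, a (0, 0, s)) ∈ τ.dom := by rw [ha0]; exact h.mem s hs
  have has : ContDiffAt ℝ ∞ (pder (0, 0, 1) a) (0, 0, s) := contDiffAt_pder ha
  have hass : ContDiffAt ℝ ∞ (pder (0, 0, 1) (pder (0, 0, 1) a)) (0, 0, s) := contDiffAt_pder has
  have h1 : ∀ᶠ t in 𝓝 s, ContDiffAt ℝ 2 a (0, 0, t) :=
    (ContinuousAt.tendsto (f := fun t : ℝ => ((0, 0, t) : ℝ × ℝ × ℝ)) (by fun_prop)).eventually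
      ((ha.of_le (m := 2) (WithTop.coe_le_coe.2 le_top)).eventually (by simp))
  have hs0 : ∀ᶠ t in 𝓝 s, pder (0, 0, 1) a (0, 0, t) = 0 := by
    filter_upwards [h0.eventually_nhds, h1] with t ht ht1
    have h2 : HasDerivAt (fun t => a (0, 0, t)) (pder (0, 0, 1) a (0, 0, t)) t :=
      (ht1.differentiableAt (by simp)).hasFDerivAt.comp_hasDerivAt t
        ((hasDerivAt_const t 0).prodMk ((hasDerivAt_const t 0).prodMk (hasDerivAt_id t)))
    exact h2.unique ((hasDerivAt_const t 0).congr_of_eventuallyEq ht)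
  have hss0 : pder (0, 0, 1) (pder (0, 0, 1) a) (0, 0, s) = 0 :=
    (hasDerivAt_line has).unique ((hasDerivAt_const s 0).congr_of_eventuallyEq hs0)
  have has0 := hs0.self_of_nhds
  have hacc := contDiffAt_acceleration ha hp
  have hG : DifferentiableAt ℝ (pullMetric n τ.Φ) (s, a (0, 0, s)) :=
    (contDiffAt_metric hp).differentiableAt (by simp)
  -- The acceleration vanishes at `u = v = 0`, so only its derivative contributes.
  have h2 := fderiv_apply_apply (G := pullMetric n τ.Φ) (b := fun q => (q.2.2, a q)) hG
    ((contDiffAt_base ha).differentiableAt (by simp))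
    ((contDiffAt_const (c := (0 : ℝ)).prodMk hacc).differentiableAt (by simp))
    ((contDiffAt_const (c := (0 : ℝ)).prodMk
      (contDiffAt_pder (w := (0, 1, 0)) ha)).differentiableAt (by simp)) (1, 0, 0)
  rw [fderiv_const_prodMk hacc] at h2
  refine Eq.trans (b := _) h2 ?_
  have h3 : pder (1, 0, 0) (fun p => pder (0, 0, 1) (pder (0, 0, 1) a) p -
      τ.rhs ((p.2.2, a p), pder (0, 0, 1) a p)) (0, 0, s) =
      pder (1, 0, 0) (pder (0, 0, 1) (pder (0, 0, 1) a)) (0, 0, s) +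
        τ.curv s (pder (1, 0, 0) a (0, 0, s)) := by
    have e1 : (((s, a (0, 0, s)), pder (0, 0, 1) a (0, 0, s)) : (ℝ × 𝔼) × 𝔼) = ((s, 0), 0) := by
      rw [ha0, has0]
    have h4 := (contDiffAt_rhs (p := ((s, 0), 0)) (h.mem s hs)).differentiableAt (by simp)
    rw [← e1] at h4
    have h5 := ((hass.differentiableAt (by simp)).hasFDerivAt).sub (h4.hasFDerivAt.comp (0, 0, s)
      (((contDiffAt_base ha).differentiableAt (by simp)).hasFDerivAt.prodMk
        (has.differentiableAt (by simp)).hasFDerivAt))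
    rw [pder, show (fun p => pder (0, 0, 1) (pder (0, 0, 1) a) p -
      τ.rhs ((p.2.2, a p), pder (0, 0, 1) a p)) = _ - τ.rhs ∘ _ from rfl, h5.fderiv]
    rw [_root_.sub_apply, ContinuousLinearMap.comp_apply, ContinuousLinearMap.prod_apply,
      fderiv_base ha, e1, h.fderiv_rhs hs, sub_neg_eq_add]
    rfl
  rw [h3]
  simp only [ha0, has0, hss0, h.rhs_eq_zero hs, sub_zero, Prod.mk_zero_zero, map_zero,
    _root_.zero_apply, zero_add, add_zero]
  exact h.orthonormal s hs _ _

end Tube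

end Variation

/-! ### First and second variation of the energy -/

section Variation

variable {n : ℕ} {M : Type*} [TopologicalSpace M] [ChartedSpace (EuclideanSpace ℝ (Fin n)) M]
  [IsManifold (𝓡 n) ∞ M] [RiemannianBundle (fun x : M => TangentSpace (𝓡 n) x)]
  [IsContMDiffRiemannianBundle (𝓡 n) ∞ (EuclideanSpace ℝ (Fin n))
    (fun x : M => TangentSpace (𝓡 n) x)]

local notation "𝔼" => EuclideanSpace ℝ (Fin n)

namespace Tube

lemma hasDerivAt_pder {W : Type*} [NormedAddCommGroup W] [NormedSpace ℝ W]
    {f : ℝ × ℝ × ℝ → W} {c : ℝ → ℝ × ℝ × ℝ} {w : ℝ × ℝ × ℝ} {t : ℝ}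
    (hf : ContDiffAt ℝ ∞ f (c t)) (hc : HasDerivAt c w t) :
    HasDerivAt (fun t => f (c t)) (pder w f (c t)) t :=
  (hf.differentiableAt (by simp)).hasFDerivAt.comp_hasDerivAt t hc

/-- Differentiation under the integral sign in a family of functions on `[0,1]` along a line of
parameters. -/
lemma hasDerivAt_integral_pder {f : ℝ × ℝ × ℝ → ℝ} {O : Set (ℝ × ℝ × ℝ)} (hO : IsOpen O)
    (hf : ∀ p ∈ O, ContDiffAt ℝ ∞ f p) (L : ℝ × ℝ →L[ℝ] ℝ × ℝ × ℝ) (c : ℝ × ℝ × ℝ) {t₀ : ℝ}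
    (h : ∀ s ∈ Icc (0 : ℝ) 1, c + L (t₀, s) ∈ O) :
    HasDerivAt (fun t => ∫ s in (0 : ℝ)..1, f (c + L (t, s)))
      (∫ s in (0 : ℝ)..1, pder (L (1, 0)) f (c + L (t₀, s))) t₀ := by
  have hL : ∀ p, HasFDerivAt (fun p => c + L p) L p := fun p => L.hasFDerivAt.const_add c
  have hLc : ContDiff ℝ ∞ (fun p => c + L p) := contDiff_const.add L.contDiff
  have h1 := hasDerivAt_integral_of_contDiffAt (f := fun p => f (c + L p)) (hO.preimage hLc.continuous)
    (fun p hp => (hf _ hp).comp p hLc.contDiffAt) h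
  refine h1.congr_deriv (intervalIntegral.integral_congr fun s hs => ?_)
  rw [uIcc_of_le zero_le_one] at hs
  have h2 := ((hf _ (h s hs)).differentiableAt (by simp)).hasFDerivAt.comp (t₀, s) (hL _)
  rw [show (fun p => f (c + L p)) = f ∘ fun p => c + L p from rfl, h2.fderiv]
  rfl

lemma continuousOn_line {W : Type*} [NormedAddCommGroup W] [NormedSpace ℝ W] {f : ℝ × ℝ × ℝ → W}
    {O : Set (ℝ × ℝ × ℝ)} (hf : ∀ p ∈ O, ContDiffAt ℝ ∞ f p) {u v : ℝ}
    (h : ∀ s ∈ Icc (0 : ℝ) 1, (u, v, s) ∈ O) :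
    ContinuousOn (fun s => f (u, v, s)) (Icc 0 1) := fun s hs =>
  (hasDerivAt_line (hf _ (h s hs))).continuousAt.continuousWithinAt

lemma intervalIntegrable_line {f : ℝ × ℝ × ℝ → ℝ}
    {O : Set (ℝ × ℝ × ℝ)} (hf : ∀ p ∈ O, ContDiffAt ℝ ∞ f p) {u v : ℝ}
    (h : ∀ s ∈ Icc (0 : ℝ) 1, (u, v, s) ∈ O) :
    IntervalIntegrable (fun s => f (u, v, s)) volume 0 1 :=
  ContinuousOn.intervalIntegrable (by
    rw [uIcc_of_le zero_le_one]
    exact continuousOn_line hf h)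

variable {τ : Tube n M} {a : ℝ × ℝ × ℝ → EuclideanSpace ℝ (Fin n)} {O : Set (ℝ × ℝ × ℝ)}

/-- The first variation formula. -/
lemma hasDerivAt_energy (hO : IsOpen O) (ha : ∀ p ∈ O, ContDiffAt ℝ ∞ a p)
    (hd : ∀ p ∈ O, (p.2.2, a p) ∈ τ.dom) (h0 : ∀ u v, (u, v, 0) ∈ O → a (u, v, 0) = 0)
    (h1 : ∀ u v, (u, v, 1) ∈ O → a (u, v, 1) = 0) {u : ℝ}
    (hu : ∀ s ∈ Icc (0 : ℝ) 1, (u, 0, s) ∈ O) :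
    HasDerivAt (fun v => ∫ s in (0 : ℝ)..1, τ.energy a (u, v, s))
      (-∫ s in (0 : ℝ)..1, τ.euler a (u, 0, s)) 0 := by
  let L : ℝ × ℝ →L[ℝ] ℝ × ℝ × ℝ := ContinuousLinearMap.inr ℝ ℝ (ℝ × ℝ)
  have hcL : ∀ v s, ((u, 0, 0) : ℝ × ℝ × ℝ) + L (v, s) = (u, v, s) := fun v s => by simp [L]
  have key := hasDerivAt_integral_pder (f := τ.energy a) hO
    (fun p hp => contDiffAt_energy (ha p hp) (hd p hp)) L (u, 0, 0) (t₀ := 0)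
    (fun s hs => by rw [hcL]; exact hu s hs)
  simp only [hcL] at key
  refine key.congr_deriv ?_
  have hm : ∀ p ∈ O, ContDiffAt ℝ ∞ (τ.momentum a) p := fun p hp =>
    contDiffAt_momentum (ha p hp) (hd p hp)
  have hE : ∀ p ∈ O, ContDiffAt ℝ ∞ (τ.euler a) p := fun p hp => contDiffAt_euler (ha p hp) (hd p hp)
  have e1 : ∫ s in (0 : ℝ)..1, pder (L (1, 0)) (τ.energy a) (u, 0, s) =
      ∫ s in (0 : ℝ)..1, (pder (0, 0, 1) (τ.momentum a) (u, 0, s) - τ.euler a (u, 0, s)) := by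
    refine intervalIntegral.integral_congr fun s hs => ?_
    rw [uIcc_of_le zero_le_one] at hs
    exact pder_energy (ha _ (hu s hs)) (hd _ (hu s hs))
  -- The boundary term vanishes, since the variation fixes the end points.
  have hend : ∀ r ∈ Icc (0 : ℝ) 1, (∀ u v, (u, v, r) ∈ O → a (u, v, r) = 0) →
      τ.momentum a (u, 0, r) = 0 := by
    intro r hr hz
    have h2 : HasDerivAt (fun v : ℝ => ((u, v, r) : ℝ × ℝ × ℝ)) (0, 1, 0) 0 :=
      (hasDerivAt_const _ _).prodMk ((hasDerivAt_id _).prodMk (hasDerivAt_const _ _))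
    have h3 : (fun v => a (u, v, r)) =ᶠ[𝓝 0] fun _ => 0 := by
      filter_upwards [h2.continuousAt.preimage_mem_nhds (hO.mem_nhds (hu r hr))] with v hv
      exact hz u v hv
    have h4 : pder (0, 1, 0) a (u, 0, r) = 0 :=
      (hasDerivAt_pder (c := fun v => (u, v, r)) (ha _ (hu r hr)) h2).unique
        ((hasDerivAt_const 0 0).congr_of_eventuallyEq h3)
    rw [momentum, h4, Prod.mk_zero_zero, map_zero]
  rw [e1, intervalIntegral.integral_sub
    (intervalIntegrable_line (fun p hp => contDiffAt_pder (hm p hp)) hu)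
    (intervalIntegrable_line hE hu),
    intervalIntegral.integral_eq_sub_of_hasDerivAt (f := fun s => τ.momentum a (u, 0, s)) (fun s hs => by
      rw [uIcc_of_le zero_le_one] at hs
      exact hasDerivAt_line (hm _ (hu s hs)))
    (intervalIntegrable_line (fun p hp => contDiffAt_pder (hm p hp)) hu),
    hend 1 (by simp) h1, hend 0 (by simp) h0]
  ring

/-- The second variation formula. -/
lemma IsAdapted.hasDerivAt_deriv_energy {γ : ℝ → M} (h : τ.IsAdapted γ (Ioo (-1) 2))
    (hO : IsOpen O) (ha : ∀ p ∈ O, ContDiffAt ℝ ∞ a p)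
    (hd : ∀ p ∈ O, (p.2.2, a p) ∈ τ.dom) (h0 : ∀ u v, (u, v, 0) ∈ O → a (u, v, 0) = 0)
    (h1 : ∀ u v, (u, v, 1) ∈ O → a (u, v, 1) = 0) (hu : ∀ s ∈ Icc (0 : ℝ) 1, (0, 0, s) ∈ O)
    (hb : ∀ s ∈ Icc (0 : ℝ) 1, a (0, 0, s) = 0) :
    HasDerivAt (fun u => deriv (fun v => ∫ s in (0 : ℝ)..1, τ.energy a (u, v, s)) 0)
      ((∫ s in (0 : ℝ)..1, inner ℝ (pder (0, 0, 1) (pder (1, 0, 0) a) (0, 0, s))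
          (pder (0, 0, 1) (pder (0, 1, 0) a) (0, 0, s))) -
        ∫ s in (0 : ℝ)..1, inner ℝ (τ.curv s (pder (1, 0, 0) a (0, 0, s)))
          (pder (0, 1, 0) a (0, 0, s))) 0 := by
  have hev : ∀ᶠ u in 𝓝 (0 : ℝ), ∀ s ∈ Icc (0 : ℝ) 1, (u, 0, s) ∈ O := by
    refine isCompact_Icc.eventually_forall_of_forall_eventually fun s hs => ?_
    exact (ContinuousAt.preimage_mem_nhds (f := fun p : ℝ × ℝ => (p.1, (0 : ℝ), p.2)) (by fun_prop)
      (hO.mem_nhds (hu s hs)))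
  let L : ℝ × ℝ →L[ℝ] ℝ × ℝ × ℝ :=
    (ContinuousLinearMap.fst ℝ ℝ ℝ).prod ((0 : ℝ × ℝ →L[ℝ] ℝ).prod (ContinuousLinearMap.snd ℝ ℝ ℝ))
  have hcL : ∀ u s, (0 : ℝ × ℝ × ℝ) + L (u, s) = (u, 0, s) := fun v s => by simp [L]
  have key := (hasDerivAt_integral_pder (f := τ.euler a) hO
    (fun p hp => contDiffAt_euler (ha p hp) (hd p hp)) L 0 (t₀ := 0)
    (fun s hs => by rw [hcL]; exact hu s hs)).neg
  simp only [hcL] at key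
  have key2 := key.congr_of_eventuallyEq
    (f₁ := fun u => deriv (fun v => ∫ s in (0 : ℝ)..1, τ.energy a (u, v, s)) 0) (by
      filter_upwards [hev] with u hu
      exact (hasDerivAt_energy hO ha hd h0 h1 hu).deriv)
  refine key2.congr_deriv ?_
  set x' := fun s => pder (0, 0, 1) (pder (1, 0, 0) a) (0, 0, s) with hx'
  set x'' := fun s => pder (0, 0, 1) (pder (0, 0, 1) (pder (1, 0, 0) a)) (0, 0, s) with hx''
  set y := fun s => pder (0, 1, 0) a (0, 0, s) with hy
  set y' := fun s => pder (0, 0, 1) (pder (0, 1, 0) a) (0, 0, s) with hy'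
  have hpd : ∀ w, ∀ p ∈ O, ContDiffAt ℝ ∞ (pder w a) p := fun w p hp => contDiffAt_pder (ha p hp)
  have hppd : ∀ w w', ∀ p ∈ O, ContDiffAt ℝ ∞ (pder w' (pder w a)) p := fun w w' p hp =>
    contDiffAt_pder (hpd w p hp)
  have cR : ContinuousOn (fun s => inner ℝ (τ.curv s (pder (1, 0, 0) a (0, 0, s))) (y s)) (Icc 0 1) :=
    ((h.continuousOn_curv.mono (Icc_subset_Ioo (by norm_num) (by norm_num))).clm_apply
      (continuousOn_line (hpd _) hu)).inner (continuousOn_line (hpd _) hu)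
  have hyz : ∀ r ∈ Icc (0 : ℝ) 1, (∀ u v, (u, v, r) ∈ O → a (u, v, r) = 0) → y r = 0 := by
    intro r hr hz
    have h2 : HasDerivAt (fun v : ℝ => ((0, v, r) : ℝ × ℝ × ℝ)) (0, 1, 0) 0 :=
      (hasDerivAt_const _ _).prodMk ((hasDerivAt_id _).prodMk (hasDerivAt_const _ _))
    have h3 : (fun v => a (0, v, r)) =ᶠ[𝓝 0] fun _ => 0 := by
      filter_upwards [h2.continuousAt.preimage_mem_nhds (hO.mem_nhds (hu r hr))] with v hv
      exact hz 0 v hv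
    exact (hasDerivAt_pder (c := fun v => (0, v, r)) (ha _ (hu r hr)) h2).unique
        ((hasDerivAt_const 0 0).congr_of_eventuallyEq h3)
  have e1 : ∫ s in (0 : ℝ)..1, pder (L (1, 0)) (τ.euler a) (0, 0, s) =
      ∫ s in (0 : ℝ)..1, (inner ℝ (x'' s) (y s) +
        inner ℝ (τ.curv s (pder (1, 0, 0) a (0, 0, s))) (y s)) := by
    -- The curve is the base curve only on `[0,1]`, so derivatives in `s` are known only in the interior.
    refine intervalIntegral.integral_congr_ae ?_
    rw [uIoc_of_le zero_le_one]
    filter_upwards [(measure_singleton (μ := volume) (1 : ℝ) : volume {(1 : ℝ)} = 0) |>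
      compl_mem_ae_iff.2] with s hs1 hs
    have hs' : s ∈ Ioo (0 : ℝ) 1 := ⟨hs.1, lt_of_le_of_ne hs.2 hs1⟩
    have hsI := Ioo_subset_Icc_self hs'
    have h2 := h.pder_euler (s := s) ⟨by linarith [hs'.1], by linarith [hs'.2]⟩ (ha _ (hu s hsI)) (by
      filter_upwards [Ioo_mem_nhds hs'.1 hs'.2] with t ht using hb t (Ioo_subset_Icc_self ht))
    have h3 : pder (1, 0, 0) (pder (0, 0, 1) (pder (0, 0, 1) a)) (0, 0, s) = x'' s := by
      refine (fderiv_fderiv_apply_comm (hpd _ _ (hu s hsI)) _ _).trans ?_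
      change pder _ _ _ = _
      have h4 : pder (1, 0, 0) (pder (0, 0, 1) a) =ᶠ[𝓝 (0, 0, s)] pder (0, 0, 1) (pder (1, 0, 0) a) := by
        filter_upwards [hO.mem_nhds (hu s hsI)] with p hp
        exact fderiv_fderiv_apply_comm (ha p hp) _ _
      exact congrArg (fun D : ℝ × ℝ × ℝ →L[ℝ] 𝔼 => D (0, 0, 1)) h4.fderiv_eq
    rw [h3, inner_add_left] at h2
    exact h2
  have i1 : IntervalIntegrable (fun s => inner ℝ (x' s) (y' s)) volume 0 1 :=
    ContinuousOn.intervalIntegrable (by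
      rw [uIcc_of_le zero_le_one]
      exact (continuousOn_line (hppd _ _) hu).inner (continuousOn_line (hppd _ _) hu))
  have i2 : IntervalIntegrable (fun s => inner ℝ (x'' s) (y s)) volume 0 1 :=
    ContinuousOn.intervalIntegrable (by
      rw [uIcc_of_le zero_le_one]
      exact (continuousOn_line (fun p hp => contDiffAt_pder (hppd _ _ p hp)) hu).inner
        (continuousOn_line (hpd _) hu))
  have i3 : IntervalIntegrable
      (fun s => inner ℝ (τ.curv s (pder (1, 0, 0) a (0, 0, s))) (y s)) volume 0 1 :=
    ContinuousOn.intervalIntegrable (by rwa [uIcc_of_le zero_le_one])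
  have e2 : ∫ s in (0 : ℝ)..1, (inner ℝ (x' s) (y' s) + inner ℝ (x'' s) (y s)) = 0 := by
    rw [intervalIntegral.integral_eq_sub_of_hasDerivAt (f := fun s => inner ℝ (x' s) (y s))
      (fun s hs => by
        rw [uIcc_of_le zero_le_one] at hs
        exact (hasDerivAt_line (hppd _ _ _ (hu s hs))).inner ℝ (hasDerivAt_line (hpd _ _ (hu s hs))))
      (i1.add i2), hyz 1 (by simp) h1, hyz 0 (by simp) h0, inner_zero_right, inner_zero_right, sub_zero]
  rw [intervalIntegral.integral_add i1 i2] at e2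
  rw [e1, intervalIntegral.integral_add i2 i3]
  linarith

end Tube

end Variation

/-! ### Second variation of the action -/

section Action

variable {n : ℕ} {M : Type*} [TopologicalSpace M] [ChartedSpace (EuclideanSpace ℝ (Fin n)) M]
  [IsManifold (𝓡 n) ∞ M] [RiemannianBundle (fun x : M => TangentSpace (𝓡 n) x)]
  [IsContMDiffRiemannianBundle (𝓡 n) ∞ (EuclideanSpace ℝ (Fin n))
    (fun x : M => TangentSpace (𝓡 n) x)]

local notation "𝔼" => EuclideanSpace ℝ (Fin n)

namespace Tube

variable {τ : Tube n M}

lemma norm_velocity_sq_eq {c : ℝ → M} {a : ℝ → 𝔼} {a' : 𝔼} {s : ℝ} (ha : HasDerivAt a a' s)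
    (hs : (s, a s) ∈ τ.dom) (hc : c =ᶠ[𝓝 s] fun t => τ.Φ (t, a t)) :
    ‖velocity n c s‖ ^ 2 = pullMetric n τ.Φ (s, a s) (1, a') (1, a') := by
  have h1 : (velocity n c s : 𝔼) = tder n τ.Φ (s, a s) (1, a') :=
    (velocity_congr hc).trans (τ.velocity_eq ha hs)
  have h2 : ∀ v : 𝔼, metricAt n (c s) v v = metricAt n (τ.Φ (s, a s)) v v := fun v => by
    rw [show c s = τ.Φ (s, a s) from hc.self_of_nhds]
  have h3 : ‖velocity n c s‖ ^ 2 = metricAt n (c s) (velocity n c s) (velocity n c s) :=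
    (real_inner_self_eq_norm_sq (F := TangentSpace (𝓡 n) (c s)) (velocity n c s)).symm
  exact h3.trans ((h2 _).trans (congrArg (fun v : 𝔼 => metricAt n (τ.Φ (s, a s)) v v) h1))

lemma velocity_slice {c : ℝ → M} {a : ℝ → 𝔼} {a' : 𝔼} {s u : ℝ} (ha : HasDerivAt a a' u)
    (hs : (s, a u) ∈ τ.dom) (hc : c =ᶠ[𝓝 u] fun t => τ.Φ (s, a t)) :
    (velocity n c u : 𝔼) = tder n τ.Φ (s, a u) (0, a') := by
  have hb : HasDerivAt (fun t => (s, a t)) (0, a') u := (hasDerivAt_const u s).prodMk ha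
  have h1 := tder_comp (n := n) (Φ := c) (Φ' := τ.Φ) (ψ := fun t => (s, a t))
    (b := u) ((τ.smooth_Φ _ hs).mdifferentiableAt (by simp)) hb.differentiableAt hc
  refine (DFunLike.congr_fun h1 (1 : ℝ)).trans ?_
  rw [ContinuousLinearMap.comp_apply, fderiv_eq_smul_deriv, one_smul, hb.deriv]

/-- The second variation of the action at a geodesic, in an adapted frame: it is
`∫ ⟨x', y'⟩ - ∫ ⟨R x, y⟩`, where `x` and `y` are the components of the variation fields. -/
theorem IsAdapted.hasDerivAt_deriv_action {γ : ℝ → M} (h : τ.IsAdapted γ (Ioo (-1) 2))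
    {α : ℝ → ℝ → ℝ → M}
    (hα : ContMDiff 𝓘(ℝ, ℝ × ℝ × ℝ) (𝓡 n) ∞ (fun q : ℝ × ℝ × ℝ => α q.1 q.2.1 q.2.2))
    (hbase : ∀ s ∈ Icc (0 : ℝ) 1, α 0 0 s = γ s) (h0 : ∀ u v, α u v 0 = γ 0)
    (h1 : ∀ u v, α u v 1 = γ 1) :
    ∃ x y x' y' : ℝ → 𝔼, ContinuousOn x' (Icc 0 1) ∧ ContinuousOn y' (Icc 0 1) ∧
      (∀ s ∈ Icc (0 : ℝ) 1, HasDerivAt x (x' s) s ∧ HasDerivAt y (y' s) s ∧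
        (velocity n (fun u => α u 0 s) 0 : 𝔼) = tder n τ.Φ (s, 0) (0, x s) ∧
        (velocity n (fun v => α 0 v s) 0 : 𝔼) = tder n τ.Φ (s, 0) (0, y s)) ∧
      DifferentiableAt ℝ (fun v => action n (α 0 v)) 0 ∧
      HasDerivAt (fun u => deriv (fun v => action n (α u v)) 0)
        ((∫ s in (0 : ℝ)..1, inner ℝ (x' s) (y' s)) -
          ∫ s in (0 : ℝ)..1, inner ℝ (τ.curv s (x s)) (y s)) 0 := by
  let f : ℝ × ℝ × ℝ → ℝ × M := fun q => (q.2.2, α q.1 q.2.1 q.2.2)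
  have hf : Continuous f := continuous_snd.snd.prodMk hα.continuous
  -- The coordinates of `α` are defined only on the open set `O`, which contains `(u, v, s)` for `u` and `v`
  -- near zero and all `s ∈ [0,1]`.
  let O : Set (ℝ × ℝ × ℝ) := f ⁻¹' τ.img
  have hO : IsOpen O := τ.isOpen_img.preimage hf
  let a : ℝ × ℝ × ℝ → 𝔼 := fun q => τ.A (f q)
  have ha : ∀ p ∈ O, ContDiffAt ℝ ∞ a p := fun p hp => by
    rw [← contMDiffAt_iff_contDiffAt]
    have e : ContMDiffAt 𝓘(ℝ, ℝ × ℝ × ℝ) 𝓘(ℝ, ℝ) ∞ (fun q : ℝ × ℝ × ℝ => q.2.2) p :=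
      contMDiffAt_iff_contDiffAt.2 contDiffAt_snd.snd
    exact (τ.smooth_A _ hp).comp p (e.prodMk hα.contMDiffAt)
  have hd : ∀ p ∈ O, (p.2.2, a p) ∈ τ.dom := fun p hp => τ.mem_dom _ hp
  have hr : ∀ p ∈ O, τ.Φ (p.2.2, a p) = α p.1 p.2.1 p.2.2 := fun p hp => τ.right_inv _ hp
  have hJ : ∀ s ∈ Icc (0 : ℝ) 1, s ∈ Ioo (-1 : ℝ) 2 := fun s hs =>
    ⟨by linarith [hs.1], by linarith [hs.2]⟩
  have hz : ∀ u v s, s ∈ Icc (0 : ℝ) 1 → α u v s = γ s → (u, v, s) ∈ O ∧ a (u, v, s) = 0 := by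
    intro u v s hs e
    have e1 : f (u, v, s) = (s, τ.Φ (s, 0)) := by
      rw [h.center s (hJ s hs)]
      exact congrArg (Prod.mk s) e
    refine ⟨?_, ?_⟩
    · change f (u, v, s) ∈ τ.img
      rw [e1]
      exact τ.mem_img _ (h.mem s (hJ s hs))
    · change τ.A (f (u, v, s)) = 0
      rw [e1]
      exact τ.left_inv _ (h.mem s (hJ s hs))
  have hu : ∀ s ∈ Icc (0 : ℝ) 1, (0, 0, s) ∈ O := fun s hs => (hz 0 0 s hs (hbase s hs)).1
  have hb : ∀ s ∈ Icc (0 : ℝ) 1, a (0, 0, s) = 0 := fun s hs => (hz 0 0 s hs (hbase s hs)).2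
  have key := h.hasDerivAt_deriv_energy hO ha hd (fun u v _ => (hz u v 0 (by simp) (h0 u v)).2)
    (fun u v _ => (hz u v 1 (by simp) (h1 u v)).2) hu hb
  have hpd : ∀ w, ∀ p ∈ O, ContDiffAt ℝ ∞ (pder w a) p := fun w p hp => contDiffAt_pder (ha p hp)
  refine ⟨fun s => pder (1, 0, 0) a (0, 0, s), fun s => pder (0, 1, 0) a (0, 0, s),
    fun s => pder (0, 0, 1) (pder (1, 0, 0) a) (0, 0, s),
    fun s => pder (0, 0, 1) (pder (0, 1, 0) a) (0, 0, s),
    continuousOn_line (fun p hp => contDiffAt_pder (hpd _ p hp)) hu,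
    continuousOn_line (fun p hp => contDiffAt_pder (hpd _ p hp)) hu,
    fun s hs => ⟨hasDerivAt_line (hpd _ _ (hu s hs)), hasDerivAt_line (hpd _ _ (hu s hs)), ?_, ?_⟩, ?_⟩
  · have h2 : HasDerivAt (fun u : ℝ => ((u, 0, s) : ℝ × ℝ × ℝ)) (1, 0, 0) 0 :=
      (hasDerivAt_id _).prodMk ((hasDerivAt_const _ _).prodMk (hasDerivAt_const _ _))
    have h3 := velocity_slice (c := fun u => α u 0 s)
      (hasDerivAt_pder (c := fun u => (u, 0, s)) (ha _ (hu s hs)) h2) (hd _ (hu s hs)) (by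
        filter_upwards [h2.continuousAt.preimage_mem_nhds (hO.mem_nhds (hu s hs))] with u hu'
        exact (hr (u, 0, s) hu').symm)
    rw [h3, hb s hs]
  · have h2 : HasDerivAt (fun v : ℝ => ((0, v, s) : ℝ × ℝ × ℝ)) (0, 1, 0) 0 :=
      (hasDerivAt_const _ _).prodMk ((hasDerivAt_id _).prodMk (hasDerivAt_const _ _))
    have h3 := velocity_slice (c := fun v => α 0 v s)
      (hasDerivAt_pder (c := fun v => (0, v, s)) (ha _ (hu s hs)) h2) (hd _ (hu s hs)) (by
        filter_upwards [h2.continuousAt.preimage_mem_nhds (hO.mem_nhds (hu s hs))] with u hu'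
        exact (hr (0, u, s) hu').symm)
    rw [h3, hb s hs]
  · have hev : ∀ᶠ q in 𝓝 ((0, 0) : ℝ × ℝ), ∀ s ∈ Icc (0 : ℝ) 1, (q.1, q.2, s) ∈ O := by
      refine isCompact_Icc.eventually_forall_of_forall_eventually fun s hs => ?_
      exact (ContinuousAt.preimage_mem_nhds (f := fun p : (ℝ × ℝ) × ℝ => (p.1.1, p.1.2, p.2))
        (by fun_prop) (hO.mem_nhds (hu s hs)))
    have hact : ∀ u v, (∀ s ∈ Icc (0 : ℝ) 1, (u, v, s) ∈ O) →
        action n (α u v) = ∫ s in (0 : ℝ)..1, τ.energy a (u, v, s) := by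
      intro u v huv
      rw [action, ← intervalIntegral.integral_const_mul]
      refine intervalIntegral.integral_congr fun s hs => ?_
      rw [uIcc_of_le zero_le_one] at hs
      have h2 : Continuous fun t : ℝ => ((u, v, t) : ℝ × ℝ × ℝ) := by fun_prop
      have h3 := norm_velocity_sq_eq (c := α u v) (hasDerivAt_line (ha _ (huv s hs)))
        (hd _ (huv s hs)) (by
          filter_upwards [h2.continuousAt.preimage_mem_nhds (hO.mem_nhds (huv s hs))] with t ht
          exact (hr (u, v, t) ht).symm)
      exact congrArg (fun r : ℝ => 1 / 2 * r) h3
    have hev' := hev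
    rw [nhds_prod_eq] at hev'
    refine ⟨?_, key.congr_of_eventuallyEq ?_⟩
    · refine ((hasDerivAt_energy hO ha hd (fun u v _ => (hz u v 0 (by simp) (h0 u v)).2)
        (fun u v _ => (hz u v 1 (by simp) (h1 u v)).2) hu).differentiableAt).congr_of_eventuallyEq ?_
      filter_upwards [hev'.curry.self_of_nhds] with v hv using hact 0 v hv
    filter_upwards [hev'.curry] with u hu'
    refine Filter.EventuallyEq.deriv_eq ?_
    filter_upwards [hu'] with v hv
    exact hact u v hv

end Tube

end Action

/-! ### Parallel frames -/

section Frames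

variable {n : ℕ} {M : Type*} [TopologicalSpace M] [ChartedSpace (EuclideanSpace ℝ (Fin n)) M]
  [IsManifold (𝓡 n) ∞ M]

local notation "𝔼" => EuclideanSpace ℝ (Fin n)

lemma isInvertible_of_injective {B : 𝔼 →L[ℝ] 𝔼} (hB : Function.Injective B) : B.IsInvertible :=
  ⟨(LinearEquiv.ofInjectiveEndo (B : 𝔼 →ₗ[ℝ] 𝔼) hB).toContinuousLinearEquiv, by ext1 x; rfl⟩

lemma coord_injective {p q : M} (hq : q ∈ (chartAt 𝔼 p).source) :
    Function.Injective (fun w : 𝔼 => (coord n p q w : 𝔼)) := by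
  have hq' : q ∈ (trivializationAt 𝔼 (TangentSpace (𝓡 n)) p).baseSet := by
    rwa [TangentBundle.trivializationAt_baseSet]
  intro v w hvw
  have h : ∀ v : 𝔼, ((trivializationAt 𝔼 (TangentSpace (𝓡 n)) p).symmL ℝ q (coord n p q v) : 𝔼) = v :=
    fun v => Bundle.Trivialization.symmL_continuousLinearMapAt _ hq' v
  rw [← h v, ← h w]
  exact congrArg (fun z : 𝔼 => ((trivializationAt 𝔼 (TangentSpace (𝓡 n)) p).symmL ℝ q z : 𝔼)) hvw

variable [RiemannianBundle (fun x : M => TangentSpace (𝓡 n) x)]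
  [IsContMDiffRiemannianBundle (𝓡 n) ∞ (EuclideanSpace ℝ (Fin n))
    (fun x : M => TangentSpace (𝓡 n) x)]

namespace Tube

/-- The coordinate vector fields of a tube along its centre. -/
noncomputable def frame (τ : Tube n M) (s : ℝ) : 𝔼 →L[ℝ] 𝔼 :=
  tder n τ.Φ (s, 0) ∘L ContinuousLinearMap.inr ℝ ℝ 𝔼

variable {τ : Tube n M} {γ : ℝ → M} {J : Set ℝ}

lemma IsAdapted.frame_bijective (h : τ.IsAdapted γ J) {s : ℝ} (hs : s ∈ J) :
    Function.Bijective (τ.frame s) := τ.tder_bijective (h.mem s hs)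

lemma IsAdapted.metricAt_frame (h : τ.IsAdapted γ J) {s : ℝ} (hs : s ∈ J) (x y : 𝔼) :
    metricAt n (γ s) (τ.frame s x) (τ.frame s y) = inner ℝ x y := by
  rw [← h.center s hs]
  exact h.orthonormal s hs x y

/-- In a chart, the frame of a tube is given by a smooth family of invertible matrices. -/
lemma IsAdapted.exists_coord_frame (h : τ.IsAdapted γ J) (hJ : IsOpen J) (hγ : Continuous γ) {s₀ : ℝ}
    (hs₀ : s₀ ∈ J) : ∃ B : ℝ → 𝔼 →L[ℝ] 𝔼, ∃ ε > 0, ∀ s ∈ Icc (s₀ - ε) (s₀ + ε), s ∈ J ∧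
      ContDiffAt ℝ ∞ B s ∧ (B s).IsInvertible ∧
        ∀ x : 𝔼, coord n (γ s₀) (γ s) (τ.frame s x) = B s x := by
  have h1 : ∀ᶠ s in 𝓝 s₀, s ∈ J ∧ γ s ∈ (chartAt 𝔼 (γ s₀)).source :=
    Filter.Eventually.and (hJ.mem_nhds hs₀) (hγ.continuousAt.preimage_mem_nhds (chart_source_mem_nhds _ _))
  obtain ⟨ε, hε, hb⟩ := Metric.nhds_basis_closedBall.eventually_iff.1 h1
  rw [Real.closedBall_eq_Icc] at hb
  let ψ : ℝ × 𝔼 → 𝔼 := fun b => extChartAt (𝓡 n) (γ s₀) (τ.Φ b)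
  refine ⟨fun s => fderiv ℝ ψ (s, 0) ∘L ContinuousLinearMap.inr ℝ ℝ 𝔼, ε, hε, fun s hs => ?_⟩
  obtain ⟨hsJ, hsrc⟩ := hb hs
  have hm := h.mem s hsJ
  have hsrc' : τ.Φ (s, 0) ∈ (chartAt 𝔼 (γ s₀)).source := by rwa [h.center s hsJ]
  have hψ : ContDiffAt ℝ ∞ ψ (s, 0) := by
    rw [← contMDiffAt_iff_contDiffAt]
    exact (contMDiffAt_extChartAt' hsrc').comp _ (τ.smooth_Φ _ hm)
  have hB : ∀ x : 𝔼, coord n (γ s₀) (γ s) (τ.frame s x) = fderiv ℝ ψ (s, 0) (0, x) := by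
    intro x
    have h2 := coord_tder (p := γ s₀) ((τ.smooth_Φ _ hm).mdifferentiableAt (by simp)) hsrc' (0, x)
    have h3 : ∀ q, q = γ s → ∀ w : 𝔼, (coord n (γ s₀) (γ s) w : 𝔼) = coord n (γ s₀) q w := by
      rintro _ rfl _
      rfl
    exact (h3 _ (h.center s hsJ) _).trans h2
  refine ⟨hsJ, ?_, isInvertible_of_injective fun x y hxy => ?_, hB⟩
  · have h4 : ContDiffAt ℝ ∞ (fun s : ℝ => fderiv ℝ ψ (s, 0)) s :=
      ContDiffAt.comp (g := fderiv ℝ ψ) s (hψ.fderiv_right (m := ∞) (by simp))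
        (contDiffAt_id.prodMk contDiffAt_const)
    exact h4.clm_comp contDiffAt_const
  · refine (h.frame_bijective hsJ).1 (coord_injective hsrc ?_)
    exact (hB x).trans (hxy.trans (hB y).symm)

/-- The frame of an adapted tube is parallel. -/
lemma IsAdapted.covDeriv_frame (h : τ.IsAdapted γ J) (hJ : IsOpen J) {s : ℝ} (hs : s ∈ J)
    {X : ∀ s, TangentSpace (𝓡 n) (γ s)} {x : ℝ → 𝔼} {x' : 𝔼}
    (hX : ∀ᶠ t in 𝓝 s, (X t : 𝔼) = τ.frame t (x t)) (hx : HasDerivAt x x' s) :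
    (covDeriv n γ X s : 𝔼) = τ.frame s x' := by
  have hm := h.mem s hs
  have hb : HasDerivAt (fun t : ℝ => (t, (0 : 𝔼))) (1, 0) s :=
    (hasDerivAt_id s).prodMk (hasDerivAt_const s 0)
  have hξ : HasDerivAt (fun t : ℝ => ((0 : ℝ), x t)) (0, x') s := (hasDerivAt_const s 0).prodMk hx
  have h1 : (covDeriv n γ X s : 𝔼) = covDeriv n (fun t => τ.Φ (t, 0))
      (fun t => tder n τ.Φ (t, 0) (0, x t)) s := by
    refine covDeriv_congr ?_ hX
    filter_upwards [hJ.mem_nhds hs] with t ht using (h.center t ht).symm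
  have h2 := metricAt_covDeriv (b := fun t : ℝ => (t, (0 : 𝔼))) (τ.smooth_Φ _ hm) hb hξ
  rw [h1]
  set w : 𝔼 := covDeriv n (fun t => τ.Φ (t, 0)) (fun t => tder n τ.Φ (t, 0) (0, x t)) s with hw
  by_contra hne
  obtain ⟨y, hy⟩ := (τ.tder_bijective hm).2 (w - τ.frame s x')
  have h3 := metricAt_self_pos (τ.Φ (s, 0)) (sub_ne_zero.2 hne)
  refine h3.ne' ?_
  have h4 : metricAt n (τ.Φ (s, 0)) w (tder n τ.Φ (s, 0) (0, y)) =
      pullMetric n τ.Φ (s, 0) (0, x') (0, y) := by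
    refine (h2 (0, y)).trans ?_
    rw [h.parallel s hs, add_zero]
  have h5 : ∀ v : 𝔼, v = tder n τ.Φ (s, 0) (0, y) →
      metricAt n (τ.Φ (s, 0)) (w - τ.frame s x') v = 0 := by
    rintro _ rfl
    refine (DFunLike.congr_fun (map_sub (metricAt n (τ.Φ (s, 0))) w (τ.frame s x')) _).trans ?_
    exact sub_eq_zero.2 h4
  exact h5 _ hy.symm

end Tube

end Frames

/-! ### Sobolev fields in a parallel frame -/

section SobolevFields

variable {n : ℕ} {M : Type*} [TopologicalSpace M] [ChartedSpace (EuclideanSpace ℝ (Fin n)) M]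
  [IsManifold (𝓡 n) ∞ M] [RiemannianBundle (fun x : M => TangentSpace (𝓡 n) x)]

local notation "𝔼" => EuclideanSpace ℝ (Fin n)

lemma ac_congr {X : Type*} [PseudoMetricSpace X] {f g : ℝ → X} {a b : ℝ}
    (hf : AbsolutelyContinuousOnInterval f a b) (h : EqOn f g (uIcc a b)) :
    AbsolutelyContinuousOnInterval g a b := by
  rw [absolutelyContinuousOnInterval_iff] at hf ⊢
  intro ε hε
  obtain ⟨δ, hδ, hf⟩ := hf ε hε
  refine ⟨δ, hδ, fun I hI hI' => lt_of_eq_of_lt (Finset.sum_congr rfl fun i hi => ?_) (hf I hI hI')⟩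
  rw [h (hI.1 i hi).1, h (hI.1 i hi).2]

lemma covDeriv_eq_zero {γ : ℝ → M} {X : ∀ s, TangentSpace (𝓡 n) (γ s)} {s : ℝ}
    (h : ∀ᶠ t in 𝓝 s, X t = 0) : covDeriv n γ X s = 0 := by
  have h1 : covDeriv n γ (0 : ∀ s, TangentSpace (𝓡 n) (γ s)) s = 0 := by
    have := covDeriv_smul (γ := γ) 0 (0 : ∀ s, TangentSpace (𝓡 n) (γ s)) s
    simpa using this
  exact (covDeriv_congr .rfl h).trans h1

lemma memLp_clm_apply {B : ℝ → 𝔼 →L[ℝ] 𝔼} {g : ℝ → 𝔼} {a b : ℝ} (hB : ContinuousOn B (Icc a b))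
    (hg : MemLp g 2 (volume.restrict (Icc a b))) :
    MemLp (fun s => B s (g s)) 2 (volume.restrict (Icc a b)) := by
  obtain ⟨C, hC⟩ := isCompact_Icc.exists_bound_of_continuousOn hB
  refine hg.of_le_mul (c := C) ((ContinuousLinearMap.id ℝ (𝔼 →L[ℝ] 𝔼)).aestronglyMeasurable_comp₂
    (hB.aestronglyMeasurable measurableSet_Icc) hg.1) ?_
  refine (ae_restrict_iff' measurableSet_Icc).2 (.of_forall fun s hs => ?_)
  exact ((B s).le_opNorm _).trans (by gcongr; exact hC s hs)

variable [IsContMDiffRiemannianBundle (𝓡 n) ∞ (EuclideanSpace ℝ (Fin n))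
    (fun x : M => TangentSpace (𝓡 n) x)]

namespace Tube

variable {τ : Tube n M} {γ : ℝ → M}

lemma IsAdapted.ae_covDeriv_frame {J : Set ℝ} (h : τ.IsAdapted γ J) (hJ : IsOpen J) {x g : ℝ → 𝔼}
    (hg : Integrable g) (hx : ∀ s, x s = ∫ t in (0 : ℝ)..s, g t) :
    ∀ᵐ s, s ∈ J → (covDeriv n γ (fun s => (τ.frame s (x s) : 𝔼)) s : 𝔼) = τ.frame s (g s) := by
  filter_upwards [LocallyIntegrable.ae_hasDerivAt_integral hg.locallyIntegrable] with s hs hsJ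
  refine h.covDeriv_frame hJ hsJ (.of_forall fun _ => rfl) ?_
  rw [show x = fun s => ∫ t in (0 : ℝ)..s, g t from funext hx]
  exact hs 0

/-- Primitives of square integrable functions are the components of fields in `H¹₀`. -/
lemma IsAdapted.isH10_frame (h : τ.IsAdapted γ (Ioo (-1) 2)) (hγ : Continuous γ) {x g : ℝ → 𝔼}
    (hg : Integrable g) (hg2 : MemLp g 2 volume) (hx : ∀ s, x s = ∫ t in (0 : ℝ)..s, g t)
    (hx0 : ∀ s, s ∉ Ioo (0 : ℝ) 1 → x s = 0) :
    IsH10 γ (fun s => (τ.frame s (x s) : 𝔼)) := by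
  have hxe : x = fun s => ∫ t in (0 : ℝ)..s, g t := funext hx
  have hac : ∀ a b, AbsolutelyContinuousOnInterval x a b := by
    intro a b
    have hle : min (min a b) 0 ≤ max (max a b) 0 := (min_le_right _ _).trans (le_max_right _ _)
    have h1 := ac_integral (f := g) (a := min (min a b) 0) (b := max (max a b) 0) (c := 0)
      hg.intervalIntegrable (by
        rw [uIcc_of_le hle]
        exact ⟨min_le_right _ _, le_max_right _ _⟩)
    rw [← hxe] at h1
    refine h1.mono ?_
    rw [uIcc_of_le hle]
    exact Icc_subset_Icc (min_le_left _ _) (le_max_left _ _)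
  have hd : ∀ᵐ s, DifferentiableAt ℝ x s := by
    filter_upwards [LocallyIntegrable.ae_hasDerivAt_integral hg.locallyIntegrable] with s hs
    rw [hxe]
    exact (hs 0).differentiableAt
  -- Where the frame is not defined, the field vanishes near `s₀`.
  have hout : ∀ s₀ ∉ Ioo (-1 : ℝ) 2, ∀ s ∈ Ioo (s₀ - 1) (s₀ + 1), s ∉ Ioo (0 : ℝ) 1 := by
    intro s₀ hs₀ s hs hs'
    exact hs₀ ⟨by linarith [hs.2, hs'.1], by linarith [hs.1, hs'.2]⟩
  have hz : ∀ s ∉ Ioo (0 : ℝ) 1, (τ.frame s (x s) : 𝔼) = 0 := fun s hs => by rw [hx0 s hs, map_zero]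
  refine ⟨hz, fun s₀ => ?_, ?_, fun s₀ => ?_⟩
  · by_cases hs₀ : s₀ ∈ Ioo (-1 : ℝ) 2
    · obtain ⟨B, ε, hε, hB⟩ := h.exists_coord_frame isOpen_Ioo hγ hs₀
      refine ⟨ε, hε, ?_⟩
      have hIcc : uIcc (s₀ - ε) (s₀ + ε) = Icc (s₀ - ε) (s₀ + ε) := uIcc_of_le (by linarith)
      have h1 : AbsolutelyContinuousOnInterval B (s₀ - ε) (s₀ + ε) := by
        refine ContDiffOn.absolutelyContinuousOnInterval fun s hs => ?_
        rw [hIcc] at hs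
        exact ((hB s hs).2.1.of_le (by simp)).contDiffWithinAt
      refine ac_congr (ac_clm_apply h1 (hac _ _)) fun s hs => ?_
      rw [hIcc] at hs
      exact ((hB s hs).2.2.2 _).symm
    · refine ⟨1 / 2, by norm_num, ac_congr (ac_const (0 : 𝔼) _ _) fun s hs => ?_⟩
      rw [uIcc_of_le (by linarith)] at hs
      have := hz s (hout s₀ hs₀ s ⟨by linarith [hs.1], by linarith [hs.2]⟩)
      exact ((congrArg (coord n (γ s₀) (γ s)) this).trans (map_zero (coord n (γ s₀) (γ s)))).symm
  · filter_upwards [hd] with s hs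
    by_cases hsJ : s ∈ Ioo (-1 : ℝ) 2
    · obtain ⟨B, ε, hε, hB⟩ := h.exists_coord_frame isOpen_Ioo hγ hsJ
      have h1 : (fun t => coord n (γ s) (γ t) (τ.frame t (x t) : 𝔼)) =ᶠ[𝓝 s] fun t => B t (x t) := by
        filter_upwards [Icc_mem_nhds (show s - ε < s by linarith) (show s < s + ε by linarith)]
          with t ht using (hB t ht).2.2.2 _
      exact ((((hB s ⟨by linarith, by linarith⟩).2.1.differentiableAt (by simp)).clm_apply hs)
        ).congr_of_eventuallyEq h1
    · have h1 : (fun t => coord n (γ s) (γ t) (τ.frame t (x t) : 𝔼)) =ᶠ[𝓝 s] fun t => 0 := by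
        filter_upwards [Ioo_mem_nhds (show s - 1 < s by linarith) (show s < s + 1 by linarith)]
          with t ht
        exact (congrArg (coord n (γ s) (γ t)) (hz t (hout s hsJ t ht))).trans
          (map_zero (coord n (γ s) (γ t)))
      exact (differentiableAt_const _).congr_of_eventuallyEq h1
  · by_cases hs₀ : s₀ ∈ Ioo (-1 : ℝ) 2
    · obtain ⟨B, ε, hε, hB⟩ := h.exists_coord_frame isOpen_Ioo hγ hs₀
      refine ⟨ε, hε, ?_⟩
      have h1 := (memLp_clm_apply (B := B) (g := g) (a := s₀ - ε) (b := s₀ + ε)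
        (fun s hs => (hB s hs).2.1.continuousAt.continuousWithinAt) (hg2.restrict _)).mono_measure
          (Measure.restrict_mono Ioo_subset_Icc_self le_rfl)
      refine h1.ae_eq ((ae_restrict_iff' measurableSet_Ioo).2 ?_)
      filter_upwards [h.ae_covDeriv_frame isOpen_Ioo hg hx] with s hs hs'
      have hs'' := Ioo_subset_Icc_self hs'
      exact ((hB s hs'').2.2.2 _).symm.trans
        (congrArg (coord n (γ s₀) (γ s)) (hs (hB s hs'').1).symm)
    · refine ⟨1, one_pos, ?_⟩
      refine (MemLp.zero (ε := 𝔼)).ae_eq ((ae_restrict_iff' measurableSet_Ioo).2 (.of_forall fun s hs => ?_))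
      have h1 : covDeriv n γ (fun s => (τ.frame s (x s) : 𝔼)) s = 0 := by
        refine covDeriv_eq_zero ?_
        filter_upwards [isOpen_Ioo.mem_nhds hs] with t ht using hz t (hout s₀ hs₀ t ht)
      exact ((congrArg (coord n (γ s₀) (γ s)) h1).trans (map_zero (coord n (γ s₀) (γ s)))).symm

end Tube

end SobolevFields

/-! ### Primitives of functions with mean zero -/

section Primitives

variable {E : Type*} [NormedAddCommGroup E] [InnerProductSpace ℝ E] [FiniteDimensional ℝ E]

/-- A square integrable function on `[0,1]` with mean zero, extended by zero. -/
noncomputable def MeanZero.ext (f : MeanZero E) : ℝ → E :=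
  (Icc (0 : ℝ) 1).indicator (f : Lp E 2 unitMeasure)

lemma MeanZero.memLp_ext (f : MeanZero E) : MemLp f.ext 2 volume :=
  (memLp_indicator_iff_restrict measurableSet_Icc).2 (Lp.memLp f.toL2)

lemma MeanZero.integrable_ext (f : MeanZero E) : Integrable f.ext :=
  (integrable_indicator_iff measurableSet_Icc).2 (integrable_of_L2 f.toL2)

open Classical in
/-- The value at `s ∈ ℝ` of the primitive of a function with mean zero on `[0,1]`. -/
noncomputable def MeanZero.prim (s : ℝ) : MeanZero E →L[ℝ] E :=
  if s ∈ Icc (0 : ℝ) 1 then evalAt s else 0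

lemma MeanZero.prim_eq {s : ℝ} (hs : s ∈ Icc (0 : ℝ) 1) : (prim s : MeanZero E →L[ℝ] E) = evalAt s :=
  if_pos hs

lemma MeanZero.prim_eq_zero {s : ℝ} (hs : s ∉ Ioo (0 : ℝ) 1) (f : MeanZero E) : prim s f = 0 := by
  by_cases h : s ∈ Icc (0 : ℝ) 1
  · rw [prim_eq h]
    rcases eq_endpoints_or_mem_Ioo_of_mem_Icc h with rfl | rfl | h'
    · rw [evalAt_apply h, intervalIntegral.integral_same]
    · exact evalAt_one f
    · exact absurd h' hs
  · rw [prim, if_neg h, _root_.zero_apply]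

lemma MeanZero.prim_apply (s : ℝ) (f : MeanZero E) : prim s f = ∫ t in (0 : ℝ)..s, f.ext t := by
  have key : ∀ s ∈ Icc (0 : ℝ) 1, evalAt s f = ∫ t in (0 : ℝ)..s, f.ext t := by
    intro s hs
    rw [evalAt_apply hs]
    refine intervalIntegral.integral_congr fun t ht => ?_
    rw [uIcc_of_le hs.1] at ht
    exact (indicator_of_mem (show t ∈ Icc (0 : ℝ) 1 from ⟨ht.1, ht.2.trans hs.2⟩) _).symm
  by_cases h : s ∈ Icc (0 : ℝ) 1
  · rw [prim_eq h, key s h]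
  have hi : ∀ a b, IntervalIntegrable f.ext volume a b := fun a b =>
    f.integrable_ext.intervalIntegrable
  rw [prim_eq_zero (fun h' => h (Ioo_subset_Icc_self h'))]
  rw [mem_Icc, not_and_or, not_le, not_le] at h
  rcases h with h | h
  · refine (intervalIntegral.integral_zero_ae ?_).symm
    filter_upwards [compl_mem_ae_iff.2 (measure_singleton (μ := volume) (0 : ℝ))] with t ht ht'
    rw [uIoc_of_ge h.le] at ht'
    exact indicator_of_notMem (fun h2 => ht (le_antisymm ht'.2 h2.1)) _
  · rw [← intervalIntegral.integral_add_adjacent_intervals (hi 0 1) (hi 1 s), ← key 1 (by simp),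
      evalAt_one, zero_add]
    refine (intervalIntegral.integral_zero_ae (.of_forall fun t ht => ?_)).symm
    rw [uIoc_of_le h.le] at ht
    exact indicator_of_notMem (fun h2 => absurd h2.2 (not_le.2 ht.1)) _

end Primitives

/-! ### The space of Sobolev fields as a space of functions -/

section Isometry

variable {n : ℕ} {M : Type*} [TopologicalSpace M] [ChartedSpace (EuclideanSpace ℝ (Fin n)) M]
  [IsManifold (𝓡 n) ∞ M] [RiemannianBundle (fun x : M => TangentSpace (𝓡 n) x)]
  [IsContMDiffRiemannianBundle (𝓡 n) ∞ (EuclideanSpace ℝ (Fin n))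
    (fun x : M => TangentSpace (𝓡 n) x)]

local notation "𝔼" => EuclideanSpace ℝ (Fin n)

namespace Tube

variable {τ : Tube n M} {γ : SmoothCurve n M}

/-- The field with components the primitive of `f` in the parallel frame of an adapted tube. -/
noncomputable def IsAdapted.toField (h : τ.IsAdapted γ (Ioo (-1) 2)) :
    MeanZero 𝔼 →ₗ[ℝ] PathTangent γ where
  toFun f := ⟨fun s => (τ.frame s (MeanZero.prim s f) : 𝔼),
    h.isH10_frame γ.contMDiff.continuous f.integrable_ext f.memLp_ext
      (fun s => MeanZero.prim_apply s f) fun s hs => MeanZero.prim_eq_zero hs f⟩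
  map_add' f g := Subtype.ext (funext fun s => by
    change τ.frame s _ = (_ : 𝔼) + (_ : 𝔼)
    rw [map_add, map_add])
  map_smul' c f := Subtype.ext (funext fun s => by
    change τ.frame s _ = c • (_ : 𝔼)
    rw [map_smul, map_smul])

lemma IsAdapted.inner_toField (h : τ.IsAdapted γ (Ioo (-1) 2)) (f g : MeanZero 𝔼) :
    inner ℝ (h.toField f) (h.toField g) = (inner ℝ f g : ℝ) := by
  rw [inner_meanZero f g (ae_eq_refl _)]
  change ∫ s in Icc (0 : ℝ) 1, inner ℝ (covDeriv n γ (h.toField f).field s)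
    (covDeriv n γ (h.toField g).field s) = _
  refine integral_congr_ae ((ae_restrict_iff' measurableSet_Icc).2 ?_)
  filter_upwards [h.ae_covDeriv_frame isOpen_Ioo f.integrable_ext (fun s => MeanZero.prim_apply s f),
    h.ae_covDeriv_frame isOpen_Ioo g.integrable_ext (fun s => MeanZero.prim_apply s g)]
    with s hf hg hs
  have hJ : s ∈ Ioo (-1 : ℝ) 2 := ⟨by linarith [hs.1], by linarith [hs.2]⟩
  have h1 : metricAt n (γ s) (τ.frame s (f.ext s)) (τ.frame s (g.ext s)) =
      inner ℝ ((f : Lp 𝔼 2 unitMeasure) s) ((g : Lp 𝔼 2 unitMeasure) s) := by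
    rw [h.metricAt_frame hJ, MeanZero.ext, MeanZero.ext, indicator_of_mem hs, indicator_of_mem hs]
  refine Eq.trans ?_ h1
  rw [← hf hJ, ← hg hJ]
  rfl

/-- The components `x` of a field in `H¹₀` are absolutely continuous, so they are the primitive of their
derivative, which is square integrable since it gives the components of the covariant derivative. -/
lemma IsAdapted.toField_surjective (h : τ.IsAdapted γ (Ioo (-1) 2)) :
    Function.Surjective h.toField := by
  intro X
  set J : Set ℝ := Ioo (-1 : ℝ) 2 with hJ
  have hγ : Continuous γ := γ.contMDiff.continuous
  let x : ℝ → 𝔼 := fun s => (τ.frame s).inverse (X.field s)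
  have hframe : ∀ s ∈ J, (X.field s : 𝔼) = τ.frame s (x s) := fun s hs =>
    ((isInvertible_of_injective (h.frame_bijective hs).1).self_apply_inverse _).symm
  have hx0 : ∀ s ∉ Ioo (0 : ℝ) 1, x s = 0 := fun s hs =>
    (congrArg (τ.frame s).inverse (X.isH10.support s hs)).trans (map_zero _)
  have hloc : ∀ s₀ ∈ J, ∃ C : ℝ → 𝔼 →L[ℝ] 𝔼, ∃ ε > 0, ∀ s ∈ Icc (s₀ - ε) (s₀ + ε), s ∈ J ∧
      ContDiffAt ℝ ∞ C s ∧ x s = C s (coord n (γ s₀) (γ s) (X.field s)) := by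
    intro s₀ hs₀
    obtain ⟨B, ε, hε, hB⟩ := h.exists_coord_frame isOpen_Ioo hγ hs₀
    refine ⟨fun s => (B s).inverse, ε, hε, fun s hs => ?_⟩
    obtain ⟨h1, h2, h3, h4⟩ := hB s hs
    refine ⟨h1, ContDiffAt.comp (g := ContinuousLinearMap.inverse) s
        (h3.contDiffAt_map_inverse (n := ∞)) h2, ?_⟩
    have h5 := (congrArg (coord n (γ s₀) (γ s)) (hframe s h1)).trans (h4 (x s))
    rw [h5, h3.inverse_apply_self]
  have hdiff : ∀ᵐ s, s ∈ J → DifferentiableAt ℝ x s := by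
    filter_upwards [X.isH10.ae_differentiable] with s hs hsJ
    obtain ⟨C, ε, hε, hC⟩ := hloc s hsJ
    have h1 : x =ᶠ[𝓝 s] fun t => C t (coord n (γ s) (γ t) (X.field t)) := by
      filter_upwards [Icc_mem_nhds (show s - ε < s by linarith) (show s < s + ε by linarith)]
        with t ht using (hC t ht).2.2
    exact (((hC s ⟨by linarith, by linarith⟩).2.1.differentiableAt (by simp)).clm_apply hs
      ).congr_of_eventuallyEq h1
  have hcov : ∀ᵐ s, s ∈ J → (covDeriv n γ X.field s : 𝔼) = τ.frame s (deriv x s) := by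
    filter_upwards [hdiff] with s hs hsJ
    refine h.covDeriv_frame isOpen_Ioo hsJ ?_ (hs hsJ).hasDerivAt
    filter_upwards [isOpen_Ioo.mem_nhds hsJ] with t ht using hframe t ht
  have hsupp : Function.support (deriv x) ⊆ Icc (0 : ℝ) 1 := by
    intro s hs
    by_contra hs'
    refine hs ?_
    have : x =ᶠ[𝓝 s] fun _ => 0 := by
      filter_upwards [isClosed_Icc.isOpen_compl.mem_nhds hs'] with t ht
      exact hx0 t fun ht' => ht (Ioo_subset_Icc_self ht')
    rw [this.deriv_eq, deriv_const]
  have hIJ : ∀ s ∈ Icc (0 : ℝ) 1, s ∈ J := fun s hs => ⟨by linarith [hs.1], by linarith [hs.2]⟩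
  have hL2 : MemLp (deriv x) 2 unitMeasure := by
    refine (memLp_two_iff_integrable_sq_norm (stronglyMeasurable_deriv x).aestronglyMeasurable).2 ?_
    have h1 := (PathTangent.locallyIntegrable_inner X X).integrableOn_isCompact
      (isCompact_Icc (a := 0) (b := 1))
    refine h1.congr ((ae_restrict_iff' measurableSet_Icc).2 ?_)
    filter_upwards [hcov] with s hs hsI
    have h2 := h.metricAt_frame (hIJ s hsI) (deriv x s) (deriv x s)
    rw [← hs (hIJ s hsI), real_inner_self_eq_norm_sq] at h2
    exact h2
  have hint : Integrable (deriv x) :=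
    (integrableOn_iff_integrable_of_support_subset hsupp).1 (hL2.integrable one_le_two)
  -- Locally, `x` minus the primitive of its derivative is absolutely continuous with derivative zero
  -- almost everywhere, hence constant.
  have hz : ∀ s ∈ J, HasDerivAt (fun s => x s - ∫ t in (0 : ℝ)..s, deriv x t) 0 s := by
    intro s₀ hs₀
    obtain ⟨C, ε, hε, hC⟩ := hloc s₀ hs₀
    obtain ⟨δ, hδ, hac⟩ := X.isH10.absCont s₀
    set r := min ε δ with hr
    have hr0 : 0 < r := lt_min hε hδ
    have hI : uIcc (s₀ - r) (s₀ + r) = Icc (s₀ - r) (s₀ + r) := uIcc_of_le (by linarith)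
    have hrε : Icc (s₀ - r) (s₀ + r) ⊆ Icc (s₀ - ε) (s₀ + ε) :=
      Icc_subset_Icc (by linarith [min_le_left ε δ]) (by linarith [min_le_left ε δ])
    have hrδ : uIcc (s₀ - r) (s₀ + r) ⊆ uIcc (s₀ - δ) (s₀ + δ) := by
      rw [hI, uIcc_of_le (by linarith)]
      exact Icc_subset_Icc (by linarith [min_le_right ε δ]) (by linarith [min_le_right ε δ])
    have h1 : AbsolutelyContinuousOnInterval C (s₀ - r) (s₀ + r) := by
      refine ContDiffOn.absolutelyContinuousOnInterval fun s hs => ?_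
      rw [hI] at hs
      exact ((hC s (hrε hs)).2.1.of_le (by simp)).contDiffWithinAt
    have h2 : AbsolutelyContinuousOnInterval x (s₀ - r) (s₀ + r) :=
      ac_congr (ac_clm_apply h1 (hac.mono hrδ)) fun s hs => by
        rw [hI] at hs
        exact (hC s (hrε hs)).2.2.symm
    have h3 : AbsolutelyContinuousOnInterval (fun s => ∫ t in s₀..s, deriv x t) (s₀ - r) (s₀ + r) :=
      ac_integral hint.intervalIntegrable (by rw [hI]; constructor <;> linarith)
    obtain ⟨c, hc⟩ := (h2.sub h3).const_of_ae_hasDerivAt_zero (by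
      filter_upwards [hdiff, LocallyIntegrable.ae_hasDerivAt_integral hint.locallyIntegrable]
        with s hs1 hs2 hs
      rw [hI] at hs
      have := (hs1 (hC s (hrε hs)).1).hasDerivAt.sub (hs2 s₀)
      rwa [sub_self] at this)
    refine (hasDerivAt_const s₀ (c - ∫ t in (0 : ℝ)..s₀, deriv x t)).congr_of_eventuallyEq ?_
    filter_upwards [Icc_mem_nhds (show s₀ - r < s₀ by linarith) (show s₀ < s₀ + r by linarith)] with s hs
    have h4 := hc s (by rwa [hI])
    rw [Pi.sub_apply] at h4
    have h5 := intervalIntegral.integral_add_adjacent_intervals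
      (hint.intervalIntegrable (a := 0) (b := s₀)) (hint.intervalIntegrable (a := s₀) (b := s))
    rw [← h5, ← h4]
    abel
  have hprim : ∀ s ∈ Icc (0 : ℝ) 1, x s = ∫ t in (0 : ℝ)..s, deriv x t := by
    intro s hs
    have h1 := isOpen_Ioo.is_const_of_deriv_eq_zero isPreconnected_Ioo
      (fun t ht => (hz t ht).differentiableAt.differentiableWithinAt)
      (fun t ht => (hz t ht).deriv) (hIJ s hs) (hIJ 0 (by simp))
    simp only [intervalIntegral.integral_same, hx0 0 (by simp), sub_zero] at h1
    exact sub_eq_zero.1 h1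
  obtain ⟨f, -, hf⟩ := exists_meanZero hL2 (by rw [← hprim 1 (by simp), hx0 1 (by simp)])
  refine ⟨f, Subtype.ext (funext fun s => ?_)⟩
  change (τ.frame s (MeanZero.prim s f) : 𝔼) = X.field s
  by_cases hs : s ∈ Ioo (0 : ℝ) 1
  · have hsI := Ioo_subset_Icc_self hs
    rw [MeanZero.prim_eq hsI, hf s hsI, ← hprim s hsI]
    exact (hframe s (hIJ s hsI)).symm
  · rw [MeanZero.prim_eq_zero hs, map_zero]
    exact (X.isH10.support s hs).symm

/-- An adapted tube identifies `H¹₀([0,1], γ^*TM)` with the space of functions with mean zero, which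
are the derivatives of the components of the fields. -/
noncomputable def IsAdapted.isometry (h : τ.IsAdapted γ (Ioo (-1) 2)) :
    MeanZero 𝔼 ≃ₗᵢ[ℝ] PathTangent γ :=
  LinearIsometryEquiv.ofSurjective (h.toField.isometryOfInner h.inner_toField) h.toField_surjective

lemma IsAdapted.isometry_field (h : τ.IsAdapted γ (Ioo (-1) 2)) (f : MeanZero 𝔼) (s : ℝ) :
    ((h.isometry f).field s : 𝔼) = τ.frame s (MeanZero.prim s f) := rfl

end Tube

end Isometry

/-! ### The Hessian along smooth variations -/

section Hessian

variable {n : ℕ} {M : Type*} [TopologicalSpace M] [ChartedSpace (EuclideanSpace ℝ (Fin n)) M]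
  [IsManifold (𝓡 n) ∞ M] [RiemannianBundle (fun x : M => TangentSpace (𝓡 n) x)]
  [IsContMDiffRiemannianBundle (𝓡 n) ∞ (EuclideanSpace ℝ (Fin n))
    (fun x : M => TangentSpace (𝓡 n) x)]

local notation "𝔼" => EuclideanSpace ℝ (Fin n)

namespace Tube

variable {τ : Tube n M} {γ : SmoothCurve n M}

/-- The second variation along a variation with fields `f` and `g`, in an adapted tube. -/
lemma IsAdapted.hasDerivAt_of_isVariation (h : τ.IsAdapted γ (Ioo (-1) 2)) {f g : MeanZero 𝔼}
    {α : ℝ → ℝ → ℝ → M} (hα : IsVariation γ α (h.isometry f) (h.isometry g)) :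
    DifferentiableAt ℝ (fun v => action n (α 0 v)) 0 ∧
      HasDerivAt (fun u => deriv (fun v => action n (α u v)) 0)
        (inner ℝ f (g + jacobiOp τ.curv g)) 0 := by
  obtain ⟨x, y, x', y', hx', hy', hxy, hdiff, hder⟩ :=
    h.hasDerivAt_deriv_action hα.smooth hα.base hα.source hα.target
  refine ⟨hdiff, hder.congr_deriv ?_⟩
  have hIJ : ∀ s ∈ Icc (0 : ℝ) 1, s ∈ Ioo (-1 : ℝ) 2 := fun s hs =>
    ⟨by linarith [hs.1], by linarith [hs.2]⟩
  have hfx : ∀ s ∈ Icc (0 : ℝ) 1, evalAt s f = x s := fun s hs => by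
    refine (h.frame_bijective (hIJ s hs)).1 ?_
    rw [← MeanZero.prim_eq hs]
    exact (congrArg (fun p : TangentBundle (𝓡 n) M => (p.2 : 𝔼)) (hα.fst s hs)).symm.trans
      (hxy s hs).2.2.1
  have hgy : ∀ s ∈ Icc (0 : ℝ) 1, evalAt s g = y s := fun s hs => by
    refine (h.frame_bijective (hIJ s hs)).1 ?_
    rw [← MeanZero.prim_eq hs]
    exact (congrArg (fun p : TangentBundle (𝓡 n) M => (p.2 : 𝔼)) (hα.snd s hs)).symm.trans
      (hxy s hs).2.2.2
  -- A function with mean zero is determined by its primitive.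
  have hae : ∀ (f : MeanZero 𝔼) (x x' : ℝ → 𝔼), (∀ s ∈ Icc (0 : ℝ) 1, evalAt s f = x s) →
      ContinuousOn x' (Icc 0 1) → (∀ s ∈ Icc (0 : ℝ) 1, HasDerivAt x (x' s) s) →
      (f : Lp 𝔼 2 unitMeasure) =ᵐ[unitMeasure] x' := by
    intro f x x' hfx hx' hx
    have hz : x 0 = 0 := by
      rw [← hfx 0 (by simp), evalAt_apply (by simp), intervalIntegral.integral_same]
    have hint : ∀ s ∈ Icc (0 : ℝ) 1, ∫ t in (0 : ℝ)..s, x' t = x s := by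
      intro s hs
      have hsub : uIcc 0 s ⊆ Icc (0 : ℝ) 1 := uIcc_subset_Icc (by simp) hs
      rw [intervalIntegral.integral_eq_sub_of_hasDerivAt (fun t ht => hx t (hsub ht))
        (hx'.mono hsub).intervalIntegrable, hz, sub_zero]
    obtain ⟨f', hf', hev⟩ := exists_meanZero (memLp_of_continuousOn hx') (by
      rw [hint 1 (by simp), ← hfx 1 (by simp), evalAt_one])
    have : f' = f := by
      refine h.isometry.injective (Subtype.ext (funext fun s => ?_))
      change (τ.frame s (MeanZero.prim s f') : 𝔼) = τ.frame s (MeanZero.prim s f)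
      by_cases hs : s ∈ Icc (0 : ℝ) 1
      · rw [MeanZero.prim_eq hs, hev s hs, hint s hs, hfx s hs]
      · rw [MeanZero.prim_eq_zero fun h' => hs (Ioo_subset_Icc_self h'),
          MeanZero.prim_eq_zero fun h' => hs (Ioo_subset_Icc_self h')]
    rwa [← this]
  have hf := hae f x x' hfx hx' fun s hs => (hxy s hs).1
  have hg := hae g y y' hgy hy' fun s hs => (hxy s hs).2.1
  rw [inner_add_right, inner_meanZero f g hg,
    inner_jacobiOp (h.continuousOn_curv.mono fun s hs => hIJ s hs), sub_eq_add_neg,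
    intervalIntegral.integral_of_le zero_le_one, intervalIntegral.integral_of_le zero_le_one,
    ← integral_Icc_eq_integral_Ioc, ← integral_Icc_eq_integral_Ioc]
  congr 1
  · refine integral_congr_ae ?_
    filter_upwards [hf] with s hs
    rw [hs]
  · refine congrArg Neg.neg (setIntegral_congr_fun measurableSet_Icc fun s hs => ?_)
    rw [hfx s hs, hgy s hs]
    exact h.curv_isSymmetric isOpen_Ioo (hIJ s hs) (x s) (y s)

/-- An adapted tube contains a tube of constant radius over `[-1/2, 3/2]`. -/
lemma IsAdapted.exists_radius {γ : ℝ → M} (h : τ.IsAdapted γ (Ioo (-1) 2)) :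
    ∃ κ > (0 : ℝ), ∀ s ∈ Icc (-1 / 2 : ℝ) (3 / 2), ∀ w : 𝔼, ‖w‖ ≤ κ → (s, w) ∈ τ.dom := by
  obtain ⟨V, W, hV, hW, hVs, hW0, hVW⟩ := generalized_tube_lemma
    (isCompact_Icc (a := (-1 / 2 : ℝ)) (b := 3 / 2)) (isCompact_singleton (x := (0 : 𝔼))) τ.isOpen_dom (by
      rintro ⟨s, w⟩ ⟨hs, hw⟩
      have : w = 0 := hw
      subst this
      exact h.mem s ⟨by linarith [hs.1], by linarith [hs.2]⟩)
  obtain ⟨ε, hε, hball⟩ := Metric.nhds_basis_closedBall.mem_iff.1 (hW.mem_nhds (hW0 rfl))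
  exact ⟨ε, hε, fun s hs w hw => hVW ⟨hVs hs, hball (by simpa using hw)⟩⟩

open Classical in
/-- The variation of `γ` by the displacement `W(u, v, s)` in the coordinates of a tube. -/
noncomputable def displace (τ : Tube n M) (γ : ℝ → M) (W : ℝ × ℝ × ℝ → 𝔼) (u v s : ℝ) : M :=
  if s ∈ Ioo (-1 : ℝ) 2 then τ.Φ (s, W (u, v, s)) else γ s

lemma IsAdapted.displace_of_eq_zero {γ : ℝ → M} (h : τ.IsAdapted γ (Ioo (-1) 2)) {W : ℝ × ℝ × ℝ → 𝔼}
    {u v s : ℝ} (hW : W (u, v, s) = 0) : τ.displace γ W u v s = γ s := by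
  unfold displace
  split_ifs with hs
  · rw [hW, h.center s hs]
  · rfl

lemma IsAdapted.contMDiff_displace (h : τ.IsAdapted γ (Ioo (-1) 2)) {W : ℝ × ℝ × ℝ → 𝔼}
    (hW : ContDiff ℝ ∞ W) (hd : ∀ p : ℝ × ℝ × ℝ, p.2.2 ∈ Icc (-1 / 2 : ℝ) (3 / 2) → (p.2.2, W p) ∈ τ.dom)
    (h0 : ∀ p : ℝ × ℝ × ℝ, p.2.2 ∉ Icc (-1 / 2 : ℝ) (3 / 2) → W p = 0) :
    ContMDiff 𝓘(ℝ, ℝ × ℝ × ℝ) (𝓡 n) ∞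
      (fun q : ℝ × ℝ × ℝ => τ.displace γ W q.1 q.2.1 q.2.2) := by
  intro q
  by_cases hq : q.2.2 ∈ Ioo (-1 : ℝ) 2
  · have hdom : (q.2.2, W q) ∈ τ.dom := by
      by_cases hq' : q.2.2 ∈ Icc (-1 / 2 : ℝ) (3 / 2)
      · exact hd q hq'
      · rw [h0 q hq']
        exact h.mem _ hq
    have h1 : ContMDiffAt 𝓘(ℝ, ℝ × ℝ × ℝ) (𝓡 n) ∞ (fun q : ℝ × ℝ × ℝ => τ.Φ (q.2.2, W q)) q :=
      (τ.smooth_Φ _ hdom).comp q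
        (contMDiffAt_iff_contDiffAt.2 (contDiffAt_snd.snd.prodMk hW.contDiffAt))
    refine h1.congr_of_eventuallyEq ?_
    have h2 : ∀ᶠ q : ℝ × ℝ × ℝ in 𝓝 q, q.2.2 ∈ Ioo (-1 : ℝ) 2 :=
      continuous_snd.snd.continuousAt.preimage_mem_nhds (isOpen_Ioo.mem_nhds hq)
    filter_upwards [h2] with p hp using if_pos hp
  · have h1 : ContMDiffAt 𝓘(ℝ, ℝ × ℝ × ℝ) (𝓡 n) ∞ (fun q : ℝ × ℝ × ℝ => γ q.2.2) q :=
      γ.contMDiff.contMDiffAt.comp q (contMDiffAt_iff_contDiffAt.2 contDiffAt_snd.snd)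
    refine h1.congr_of_eventuallyEq ?_
    have h2 : ∀ᶠ q : ℝ × ℝ × ℝ in 𝓝 q, q.2.2 ∈ (Icc (-1 / 2 : ℝ) (3 / 2))ᶜ :=
      continuous_snd.snd.continuousAt.preimage_mem_nhds (isClosed_Icc.isOpen_compl.mem_nhds fun h' =>
        hq ⟨by linarith [h'.1], by linarith [h'.2]⟩)
    filter_upwards [h2] with p hp using h.displace_of_eq_zero (h0 p hp)

/-- The variation fields of a displacement are read off from its derivatives in the coordinates. -/
lemma IsAdapted.isVariation_displace (h : τ.IsAdapted γ (Ioo (-1) 2)) {W : ℝ × ℝ × ℝ → 𝔼}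
    (hW : ContDiff ℝ ∞ W) (hd : ∀ p : ℝ × ℝ × ℝ, p.2.2 ∈ Icc (-1 / 2 : ℝ) (3 / 2) → (p.2.2, W p) ∈ τ.dom)
    (h0 : ∀ p : ℝ × ℝ × ℝ, p.2.2 ∉ Icc (-1 / 2 : ℝ) (3 / 2) → W p = 0)
    (hb : ∀ s, W (0, 0, s) = 0) (hs0 : ∀ u v, W (u, v, 0) = 0) (hs1 : ∀ u v, W (u, v, 1) = 0)
    {f g : MeanZero 𝔼}
    (hu : ∀ s ∈ Icc (0 : ℝ) 1, HasDerivAt (fun u => W (u, 0, s)) (evalAt s f) 0)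
    (hv : ∀ s ∈ Icc (0 : ℝ) 1, HasDerivAt (fun v => W (0, v, s)) (evalAt s g) 0) :
    IsVariation γ (τ.displace γ W) (h.isometry f) (h.isometry g) := by
  have hIJ : ∀ s ∈ Icc (0 : ℝ) 1, s ∈ Ioo (-1 : ℝ) 2 := fun s hs =>
    ⟨by linarith [hs.1], by linarith [hs.2]⟩
  have hbase : ∀ s, τ.displace γ W 0 0 s = γ s := fun s => h.displace_of_eq_zero (hb s)
  have key : ∀ (p q : M) (v w : 𝔼), p = q → v = w →
      (⟨p, v⟩ : TangentBundle (𝓡 n) M) = ⟨q, w⟩ := by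
    rintro p q v w rfl rfl
    rfl
  refine ⟨h.contMDiff_displace hW hd h0, fun s _ => hbase s,
    fun u v => h.displace_of_eq_zero (hs0 u v), fun u v => h.displace_of_eq_zero (hs1 u v),
    fun s hs => key _ _ _ _ (hbase s) ?_, fun s hs => key _ _ _ _ (hbase s) ?_⟩
  · have h1 := velocity_slice (τ := τ) (c := fun u => τ.displace γ W u 0 s) (s := s) (hu s hs)
      (by simpa only [hb] using h.mem s (hIJ s hs)) (.of_forall fun u => if_pos (hIJ s hs))
    rw [h1, h.isometry_field, MeanZero.prim_eq hs, hb]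
    rfl
  · have h1 := velocity_slice (τ := τ) (c := fun v => τ.displace γ W 0 v s) (s := s) (hv s hs)
      (by simpa only [hb] using h.mem s (hIJ s hs)) (.of_forall fun u => if_pos (hIJ s hs))
    rw [h1, h.isometry_field, MeanZero.prim_eq hs, hb]
    rfl

end Tube

end Hessian

/-! ### Density of smooth fields -/

section SmoothFields

variable {E : Type*} [NormedAddCommGroup E] [InnerProductSpace ℝ E] [FiniteDimensional ℝ E]

variable (E) in
/-- The functions with mean zero whose primitives are smooth. -/
noncomputable def smoothFields : Submodule ℝ (MeanZero E) where
  carrier := {f | ∃ x : ℝ → E, ContDiff ℝ ∞ x ∧ ∀ s ∈ Icc (0 : ℝ) 1, evalAt s f = x s}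
  add_mem' := by
    rintro f g ⟨x, hx, hfx⟩ ⟨y, hy, hgy⟩
    exact ⟨x + y, hx.add hy, fun s hs => by rw [map_add, hfx s hs, hgy s hs]; rfl⟩
  zero_mem' := ⟨0, contDiff_const, fun s hs => by rw [map_zero]; rfl⟩
  smul_mem' := by
    rintro c f ⟨x, hx, hfx⟩
    exact ⟨c • x, contDiff_const.smul hx, fun s hs => by rw [map_smul, hfx s hs]; rfl⟩

lemma contDiff_integral {h : ℝ → E} (hh : ContDiff ℝ ∞ h) :
    ContDiff ℝ ∞ fun s => ∫ t in (0 : ℝ)..s, h t := by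
  have hd : ∀ s, HasDerivAt (fun s => ∫ t in (0 : ℝ)..s, h t) (h s) s := fun s =>
    hh.continuous.integral_hasStrictDerivAt 0 s |>.hasDerivAt
  refine contDiff_infty_iff_deriv.2 ⟨fun s => (hd s).differentiableAt, ?_⟩
  rwa [show deriv (fun s => ∫ t in (0 : ℝ)..s, h t) = h from funext fun s => (hd s).deriv]

lemma MeanZero.integral_eq_zero (g : MeanZero E) :
    ∫ t in Icc (0 : ℝ) 1, (g : Lp E 2 unitMeasure) t = 0 := by
  rw [integral_Icc_eq_integral_Ioc, ← intervalIntegral.integral_of_le zero_le_one,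
    ← evalAt_apply (by simp), evalAt_one]

/-- A function orthogonal to all smooth functions with mean zero is constant; if its own mean is zero, it
vanishes. -/
lemma dense_smoothFields : Dense (smoothFields E : Set (MeanZero E)) := by
  rw [Submodule.dense_iff_topologicalClosure_eq_top, Submodule.topologicalClosure_eq_top_iff,
    Submodule.eq_bot_iff]
  intro g hg
  rw [Submodule.mem_orthogonal'] at hg
  have key : ∀ φ : ℝ → ℝ, ContDiff ℝ ∞ φ → ∀ e : E,
      ∫ t in Icc (0 : ℝ) 1, inner ℝ ((g : Lp E 2 unitMeasure) t) (φ t • e) = 0 := by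
    intro φ hφ e
    set h : ℝ → E := fun t => φ t • e with hh
    have hs : ContDiff ℝ ∞ h := hφ.smul contDiff_const
    set c := ∫ t in (0 : ℝ)..1, h t with hc
    have hhc : Continuous (fun t => h t - c) := hs.continuous.sub continuous_const
    obtain ⟨f, hf, hev⟩ := exists_meanZero (memLp_of_continuousOn hhc.continuousOn) (by
      rw [intervalIntegral.integral_sub (hs.continuous.intervalIntegrable _ _)
        intervalIntegrable_const, ← hc]
      simp)
    have h1 := hg f ⟨_, contDiff_integral (hs.sub contDiff_const), hev⟩
    rw [inner_meanZero g f hf] at h1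
    simp only [inner_sub_right] at h1
    rw [integral_sub (integrable_inner_of_memLp (Lp.memLp g.toL2)
        (memLp_of_continuousOn hs.continuous.continuousOn))
      (integrable_inner_of_memLp (Lp.memLp g.toL2) (memLp_of_continuousOn continuousOn_const))] at h1
    have h2 : ∫ t in Icc (0 : ℝ) 1, inner ℝ ((g : Lp E 2 unitMeasure) t) c = 0 := by
      have := integral_inner (𝕜 := ℝ) (integrable_of_L2 g.toL2) c
      rw [show ∫ t, g.toL2 t ∂unitMeasure = 0 from g.integral_eq_zero, inner_zero_right] at this
      refine Eq.trans ?_ this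
      exact integral_congr_ae (.of_forall fun t => real_inner_comm (F := E) _ _)
    rwa [h2, sub_zero] at h1
  have h0 : ∀ᵐ t, g.ext t = 0 := by
    refine ae_eq_zero_of_integral_contDiff_smul_eq_zero g.integrable_ext.locallyIntegrable
      fun φ hφ hc => ?_
    set w := ∫ t, φ t • g.ext t with hw
    have hi : Integrable fun t => φ t • g.ext t := by
      obtain ⟨C, hC⟩ := hφ.continuous.bounded_above_of_compact_support hc
      exact g.integrable_ext.bdd_smul C hφ.continuous.aestronglyMeasurable (.of_forall hC)
    have h1 := integral_inner (𝕜 := ℝ) hi w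
    have h2 : ∫ t, inner ℝ w (φ t • g.ext t) = 0 := by
      rw [← key φ hφ w, ← integral_indicator measurableSet_Icc]
      congr 1
      ext t
      by_cases ht : t ∈ Icc (0 : ℝ) 1
      · rw [indicator_of_mem ht, MeanZero.ext, indicator_of_mem ht, real_inner_smul_right,
          real_inner_smul_right, real_inner_comm]
      · rw [indicator_of_notMem ht, MeanZero.ext, indicator_of_notMem ht, smul_zero, inner_zero_right]
    rw [h2] at h1
    exact inner_self_eq_zero.1 h1.symm
  refine inner_self_eq_zero (𝕜 := ℝ).1 ?_
  rw [inner_meanZero g g (ae_eq_refl _)]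
  refine integral_eq_zero_of_ae ((ae_restrict_iff' measurableSet_Icc).2 ?_)
  filter_upwards [h0] with t ht hs
  rw [MeanZero.ext, indicator_of_mem hs] at ht
  rw [ht, inner_zero_left]
  rfl

end SmoothFields

/-! ### Variations with given fields -/

section Variations

variable {n : ℕ} {M : Type*} [TopologicalSpace M] [ChartedSpace (EuclideanSpace ℝ (Fin n)) M]
  [IsManifold (𝓡 n) ∞ M] [RiemannianBundle (fun x : M => TangentSpace (𝓡 n) x)]
  [IsContMDiffRiemannianBundle (𝓡 n) ∞ (EuclideanSpace ℝ (Fin n))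
    (fun x : M => TangentSpace (𝓡 n) x)]

local notation "𝔼" => EuclideanSpace ℝ (Fin n)

/-- A one-parameter family, reparametrized as a two-parameter family by the sum of the parameters. -/
lemma IsVariation.diag {γ : SmoothCurve n M} {α : ℝ → ℝ → ℝ → M} {X Y : PathTangent γ}
    (h : IsVariation γ α X Y) : IsVariation γ (fun u v => α (u + v) 0) X X where
  smooth := by
    have h1 : ContMDiff 𝓘(ℝ, ℝ × ℝ × ℝ) 𝓘(ℝ, ℝ × ℝ × ℝ) ∞
        (fun q : ℝ × ℝ × ℝ => (q.1 + q.2.1, (0 : ℝ), q.2.2)) :=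
      contMDiff_iff_contDiff.2 (by fun_prop)
    exact h.smooth.comp h1
  base s hs := by simpa using h.base s hs
  source u v := h.source _ _
  target u v := h.target _ _
  fst s hs := (congrArg (fun c : ℝ → M => (⟨c 0, velocity n c 0⟩ : TangentBundle (𝓡 n) M))
    (show (fun u => α (u + 0) 0 s) = fun u => α u 0 s by simp)).trans (h.fst s hs)
  snd s hs := (congrArg (fun c : ℝ → M => (⟨c 0, velocity n c 0⟩ : TangentBundle (𝓡 n) M))
    (show (fun v => α (0 + v) 0 s) = fun u => α u 0 s by simp)).trans (h.fst s hs)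

/-- A bump function on `ℝ` that is `1` on `[0,1]` and vanishes off `[-1/2, 3/2]`. -/
noncomputable def unitBump : ContDiffBump (1 / 2 : ℝ) := ⟨3 / 4, 1, by norm_num, by norm_num⟩

lemma unitBump_eq_one {s : ℝ} (hs : s ∈ Icc (0 : ℝ) 1) : unitBump s = 1 := by
  refine unitBump.one_of_mem_closedBall ?_
  rw [Real.closedBall_eq_Icc]
  exact ⟨by norm_num [unitBump]; linarith [hs.1], by norm_num [unitBump]; linarith [hs.2]⟩

lemma unitBump_eq_zero {s : ℝ} (hs : s ∉ Icc (-1 / 2 : ℝ) (3 / 2)) : unitBump s = 0 := by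
  refine unitBump.zero_of_le_dist ?_
  by_contra h
  rw [not_le, Real.dist_eq, abs_lt] at h
  simp only [unitBump] at h
  exact hs ⟨by linarith [h.1], by linarith [h.2]⟩

namespace Tube

variable {τ : Tube n M} {γ : SmoothCurve n M}

/-- Smooth fields are the variation fields of smooth variations. -/
lemma IsAdapted.exists_isVariation (h : τ.IsAdapted γ (Ioo (-1) 2)) {f g : MeanZero 𝔼}
    (hf : f ∈ smoothFields 𝔼) (hg : g ∈ smoothFields 𝔼) :
    ∃ α, IsVariation γ α (h.isometry f) (h.isometry g) := by
  obtain ⟨x, hx, hfx⟩ := hf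
  obtain ⟨y, hy, hgy⟩ := hg
  obtain ⟨κ, hκ, hdom⟩ := h.exists_radius
  obtain ⟨C, hC⟩ := isCompact_Icc (a := (-1 / 2 : ℝ)) (b := 3 / 2) |>.exists_bound_of_continuousOn
    hx.continuous.continuousOn
  obtain ⟨D, hD⟩ := isCompact_Icc (a := (-1 / 2 : ℝ)) (b := 3 / 2) |>.exists_bound_of_continuousOn
    hy.continuous.continuousOn
  have hC0 : 0 ≤ C := (norm_nonneg _).trans (hC 0 (by constructor <;> norm_num))
  have hD0 : 0 ≤ D := (norm_nonneg _).trans (hD 0 (by constructor <;> norm_num))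
  -- `φ` is a bounded substitute for the identity, so that the displacement stays in the tube.
  set c := κ / (C + D + 1) with hc
  have hc0 : 0 < c := by positivity
  let φ : ℝ → ℝ := fun u => c * Real.sin (u / c)
  have hφ0 : φ 0 = 0 := by simp [φ]
  have hφs : ContDiff ℝ ∞ φ := contDiff_const.mul (Real.contDiff_sin.comp (contDiff_id.div_const c))
  have hφd : HasDerivAt φ 1 0 := by
    have h1 := (((hasDerivAt_id (0 : ℝ)).div_const c).sin).const_mul c
    refine h1.congr_deriv ?_
    simp [hc0.ne']
  have hφb : ∀ u, |φ u| ≤ c := fun u => by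
    rw [abs_mul, abs_of_pos hc0]
    exact mul_le_of_le_one_right hc0.le (Real.abs_sin_le_one _)
  let W : ℝ × ℝ × ℝ → 𝔼 := fun p => unitBump p.2.2 • (φ p.1 • x p.2.2 + φ p.2.1 • y p.2.2)
  have hev0 : ∀ f : MeanZero 𝔼, evalAt 0 f = 0 := fun f => by
    rw [evalAt_apply (by simp), intervalIntegral.integral_same]
  have hx0 : x 0 = 0 := by rw [← hfx 0 (by simp), hev0]
  have hy0 : y 0 = 0 := by rw [← hgy 0 (by simp), hev0]
  have hx1 : x 1 = 0 := by rw [← hfx 1 (by simp), evalAt_one]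
  have hy1 : y 1 = 0 := by rw [← hgy 1 (by simp), evalAt_one]
  refine ⟨τ.displace γ W, h.isVariation_displace ?_ (fun p hp => hdom _ hp _ ?_) (fun p hp => ?_)
    (fun s => ?_) (fun u v => ?_) (fun u v => ?_) (fun s hs => ?_) (fun s hs => ?_)⟩
  · have h1 : ContDiff ℝ ∞ fun p : ℝ × ℝ × ℝ => p.2.2 := contDiff_snd.snd
    exact (unitBump.contDiff.comp h1).smul (((hφs.comp contDiff_fst).smul (hx.comp h1)).add
      ((hφs.comp contDiff_snd.fst).smul (hy.comp h1)))
  · have h2 : ‖φ p.1 • x p.2.2 + φ p.2.1 • y p.2.2‖ ≤ c * C + c * D := by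
      refine (norm_add_le _ _).trans ?_
      rw [norm_smul, norm_smul, Real.norm_eq_abs, Real.norm_eq_abs]
      gcongr
      · exact hφb _
      · exact hC _ hp
      · exact hφb _
      · exact hD _ hp
    have h3 : c * (C + D + 1) = κ := by rw [hc]; field_simp
    rw [norm_smul, Real.norm_eq_abs, abs_of_nonneg unitBump.nonneg]
    calc _ ≤ 1 * (c * C + c * D) := by gcongr; exact unitBump.le_one
      _ ≤ κ := by linarith
  · simp only [W, unitBump_eq_zero hp, zero_smul]
  · simp [W, hφ0]
  · simp [W, hx0, hy0]
  · simp [W, hx1, hy1]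
  · rw [hfx s hs]
    have h1 := (hφd.smul_const (x s)).const_smul (unitBump s)
    simpa [W, hφ0, unitBump_eq_one hs] using h1
  · rw [hgy s hs]
    have h1 := (hφd.smul_const (y s)).const_smul (unitBump s)
    simpa [W, hφ0, unitBump_eq_one hs] using h1

end Tube

end Variations

/-! ### The operator that represents the Hessian -/

section Uniqueness

variable {n : ℕ} {M : Type*} [TopologicalSpace M] [ChartedSpace (EuclideanSpace ℝ (Fin n)) M]
  [IsManifold (𝓡 n) ∞ M] [RiemannianBundle (fun x : M => TangentSpace (𝓡 n) x)]
  [IsContMDiffRiemannianBundle (𝓡 n) ∞ (EuclideanSpace ℝ (Fin n))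
    (fun x : M => TangentSpace (𝓡 n) x)]

local notation "𝔼" => EuclideanSpace ℝ (Fin n)

namespace Tube

variable {τ : Tube n M} {γ : SmoothCurve n M}

/-- The operator that represents the Hessian of the action: `1 + jacobiOp R`, transported to
`H¹₀([0,1], γ^*TM)` by an adapted tube. -/
noncomputable def IsAdapted.hessian (h : τ.IsAdapted γ (Ioo (-1) 2)) :
    PathTangent γ →L[ℝ] PathTangent γ :=
  h.isometry.toContinuousLinearEquiv.toContinuousLinearMap ∘L
    (ContinuousLinearMap.id ℝ (MeanZero 𝔼) + jacobiOp τ.curv) ∘L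
      h.isometry.symm.toContinuousLinearEquiv.toContinuousLinearMap

lemma IsAdapted.hessian_isometry (h : τ.IsAdapted γ (Ioo (-1) 2)) (g : MeanZero 𝔼) :
    h.hessian (h.isometry g) = h.isometry (g + jacobiOp τ.curv g) := by
  change h.isometry ((ContinuousLinearMap.id ℝ (MeanZero 𝔼) + jacobiOp τ.curv)
    (h.isometry.symm (h.isometry g))) = _
  rw [h.isometry.symm_apply_apply]
  rfl

lemma IsAdapted.isActionHessian (h : τ.IsAdapted γ (Ioo (-1) 2)) : IsActionHessian γ h.hessian := by
  intro X Y α hα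
  obtain ⟨f, rfl⟩ := h.isometry.surjective X
  obtain ⟨g, rfl⟩ := h.isometry.surjective Y
  rw [h.hessian_isometry, h.isometry.inner_map_map]
  exact (h.hasDerivAt_of_isVariation hα).2

/-- Uniqueness: the Hessian is determined on smooth fields, which are dense. -/
lemma IsAdapted.eq_hessian (h : τ.IsAdapted γ (Ioo (-1) 2)) {T : PathTangent γ →L[ℝ] PathTangent γ}
    (hT : IsActionHessian γ T) : T = h.hessian := by
  let V := h.isometry.toContinuousLinearEquiv
  let T₁ : MeanZero 𝔼 →L[ℝ] MeanZero 𝔼 := V.symm.toContinuousLinearMap ∘L T ∘L V.toContinuousLinearMap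
  let T₂ : MeanZero 𝔼 →L[ℝ] MeanZero 𝔼 := ContinuousLinearMap.id ℝ (MeanZero 𝔼) + jacobiOp τ.curv
  have h1 : ∀ f ∈ smoothFields 𝔼, ∀ g ∈ smoothFields 𝔼, inner ℝ f (T₁ g) = (inner ℝ f (T₂ g) : ℝ) := by
    intro f hf g hg
    obtain ⟨α, hα⟩ := h.exists_isVariation hf hg
    have h2 := (hT _ _ α hα).unique (h.hasDerivAt_of_isVariation hα).2
    rw [← h.isometry.inner_map_map f (T₁ g)]
    refine Eq.trans ?_ h2
    congr 1
    exact h.isometry.apply_symm_apply _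
  have h2 : ∀ f, ∀ g ∈ smoothFields 𝔼, inner ℝ f (T₁ g) = (inner ℝ f (T₂ g) : ℝ) := fun f g hg =>
    congrFun (Continuous.ext_on dense_smoothFields (f := fun f => (inner ℝ f (T₁ g) : ℝ))
      (g := fun f => inner ℝ f (T₂ g)) (by fun_prop) (by fun_prop) fun f hf => h1 f hf g hg) f
  have h3 : T₁ = T₂ := ContinuousLinearMap.ext fun g =>
    congrFun (Continuous.ext_on dense_smoothFields T₁.continuous T₂.continuous fun g hg =>
      ext_inner_left ℝ fun f => h2 f g hg) g
  ext1 X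
  obtain ⟨g, rfl⟩ := h.isometry.surjective X
  rw [h.hessian_isometry]
  have h4 : h.isometry (T₁ g) = T (h.isometry g) := h.isometry.apply_symm_apply _
  rw [← h4, h3]
  rfl

/-- The Hessian of the action at a minimizer is nonnegative. -/
lemma IsAdapted.inner_jacobiOp_nonneg (h : τ.IsAdapted γ (Ioo (-1) 2))
    (hmin : ∀ c : SmoothCurve n M, c 0 = γ 0 → c 1 = γ 1 → action n γ ≤ action n c) (f : MeanZero 𝔼) :
    0 ≤ inner ℝ f (f + jacobiOp τ.curv f) := by
  have hcl : IsClosed {f : MeanZero 𝔼 | 0 ≤ inner ℝ f (f + jacobiOp τ.curv f)} :=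
    isClosed_le continuous_const (by fun_prop)
  refine closure_minimal (s := (smoothFields 𝔼 : Set (MeanZero 𝔼))) (fun f hf => ?_) hcl
    (dense_smoothFields f)
  obtain ⟨α, hα⟩ := h.exists_isVariation hf hf
  have hα' := hα.diag
  obtain ⟨hdiff, hder⟩ := h.hasDerivAt_of_isVariation hα'
  set q : ℝ := inner ℝ f (f + jacobiOp τ.curv f) with hq
  change 0 ≤ q
  set g : ℝ → ℝ := fun t => action n (α t 0) with hg
  have hγ : action n (α 0 0) = action n γ := by
    unfold action
    congr 1
    rw [intervalIntegral.integral_of_le zero_le_one, intervalIntegral.integral_of_le zero_le_one,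
      integral_Ioc_eq_integral_Ioo, integral_Ioc_eq_integral_Ioo]
    refine setIntegral_congr_fun measurableSet_Ioo fun s hs => ?_
    have he : α 0 0 =ᶠ[𝓝 s] γ := by
      filter_upwards [Ioo_mem_nhds hs.1 hs.2] with t ht using hα.base t (Ioo_subset_Icc_self ht)
    have key : ∀ (p q : M) (v w : 𝔼), p = q → v = w → metricAt n p v v = metricAt n q w w := by
      rintro p q v w rfl rfl
      rfl
    have hnorm : ∀ c : ℝ → M, ‖velocity n c s‖ ^ 2 =
        metricAt n (c s) (velocity n c s) (velocity n c s) := fun c =>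
      (real_inner_self_eq_norm_sq (F := TangentSpace (𝓡 n) (c s)) (velocity n c s)).symm
    exact (hnorm _).trans ((key _ _ _ _ he.self_of_nhds (velocity_congr he)).trans (hnorm γ).symm)
  have hsm : ∀ t, ContMDiff 𝓘(ℝ, ℝ) (𝓡 n) ∞ (α t 0) := fun t =>
    hα.smooth.comp (contMDiff_iff_contDiff.2
      (by fun_prop : ContDiff ℝ ∞ fun s : ℝ => ((t, 0, s) : ℝ × ℝ × ℝ)))
  have hle : ∀ t, g 0 ≤ g t := fun t => by
    rw [hg]
    simp only
    rw [hγ]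
    exact hmin ⟨α t 0, hsm t⟩ (hα.source t 0) (hα.target t 0)
  -- Along the diagonal family, the mixed second derivative is the second derivative of `t ↦ S(α t)`,
  -- which has a minimum at `0`.
  have h1 : (fun u => deriv (fun v => action n (α (u + v) 0)) 0) = deriv g := by
    ext u
    have := deriv_comp_const_add (f := g) u 0
    rw [add_zero] at this
    exact this
  simp only [h1] at hder
  have hgd : DifferentiableAt ℝ g 0 := by
    simpa only [zero_add] using hdiff
  have hd0 : deriv g 0 = 0 := IsLocalMin.deriv_eq_zero (.of_forall hle)
  by_contra hneg
  -- With a negative second derivative, `0` would also be a maximum and `g` would be locally constant.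
  have h2 : IsLocalMax g 0 :=
    isLocalMax_of_deriv_deriv_neg (by rw [hder.deriv]; exact not_le.1 hneg) hd0 hgd.continuousAt
  have h3 : g =ᶠ[𝓝 0] fun _ => g 0 := by
    filter_upwards [h2] with t ht using le_antisymm ht (hle t)
  have h4 := h3.deriv.deriv_eq
  rw [hder.deriv] at h4
  simp only [deriv_const'] at h4
  exact hneg h4.ge

end Tube

end Uniqueness

/-! ### Length and action -/

section Minimizing

variable {n : ℕ} {M : Type*} [EMetricSpace M] [ChartedSpace (EuclideanSpace ℝ (Fin n)) M]
  [IsManifold (𝓡 n) ∞ M] [RiemannianBundle (fun x : M => TangentSpace (𝓡 n) x)]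
  [IsContMDiffRiemannianBundle (𝓡 n) ∞ (EuclideanSpace ℝ (Fin n))
    (fun x : M => TangentSpace (𝓡 n) x)]

local notation "𝔼" => EuclideanSpace ℝ (Fin n)

lemma continuous_norm_velocity (c : SmoothCurve n M) : Continuous fun s => ‖velocity n c s‖ := by
  have h1 : Continuous fun s => pullMetric n c s 1 1 := continuous_iff_continuousAt.2 fun s =>
    (((contDiffAt_pullMetric c.contMDiff.contMDiffAt).continuousAt.clm_apply
      continuousAt_const).clm_apply continuousAt_const)
  have h2 : (fun s => ‖velocity n c s‖) = fun s => √(pullMetric n c s 1 1) := by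
    ext s
    have : pullMetric n c s 1 1 = ‖velocity n c s‖ ^ 2 := (norm_velocity_sq c s).symm
    rw [this, Real.sqrt_sq (norm_nonneg _)]
  rw [h2]
  exact h1.sqrt

lemma pathELength_eq_ofReal (c : SmoothCurve n M) :
    pathELength (𝓡 n) c 0 1 = ENNReal.ofReal (∫ s in (0 : ℝ)..1, ‖velocity n c s‖) := by
  rw [pathELength_eq_lintegral_mfderiv_Icc, intervalIntegral.integral_of_le zero_le_one,
    ← integral_Icc_eq_integral_Ioc, ofReal_integral_eq_lintegral_ofReal
      ((continuous_norm_velocity c).continuousOn.integrableOn_compact isCompact_Icc)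
      (.of_forall fun s => norm_nonneg _)]
  refine lintegral_congr fun s => ?_
  exact (ofReal_norm (E := TangentSpace (𝓡 n) (c s)) _).symm

/-- A length minimizing geodesic minimizes the action. -/
lemma IsMinimizingGeodesic.action_le {x y : M} {γ : SmoothCurve n M}
    (hγ : IsMinimizingGeodesic n x y γ) (c : SmoothCurve n M) (h0 : c 0 = γ 0) (h1 : c 1 = γ 1) :
    action n γ ≤ action n c := by
  obtain ⟨C, hC⟩ := exists_norm_velocity_eq (c := γ) (a := -1) (b := 2) fun t _ =>
    hγ.geodesic.isGeodesicAt t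
  have hC' : ∀ s ∈ uIcc (0 : ℝ) 1, ‖velocity n γ s‖ = C := fun s hs => by
    rw [uIcc_of_le zero_le_one] at hs
    exact hC s ⟨by linarith [hs.1], by linarith [hs.2]⟩
  have hC0 : 0 ≤ C := (norm_nonneg _).trans_eq (hC' 0 (by simp))
  have hcont := continuous_norm_velocity c
  have hlen : C ≤ ∫ s in (0 : ℝ)..1, ‖velocity n c s‖ := by
    have h2 : pathELength (𝓡 n) γ 0 1 ≤ pathELength (𝓡 n) c 0 1 := by
      rw [hγ.minimizing]
      exact riemannianEDist_le_pathELength (c.contMDiff.of_le (by simp)).contMDiffOn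
        (h0.trans hγ.source) (h1.trans hγ.target) zero_le_one
    rw [pathELength_eq_ofReal, pathELength_eq_ofReal, intervalIntegral.integral_congr hC'] at h2
    simp only [intervalIntegral.integral_const, sub_zero, one_smul] at h2
    exact (ENNReal.ofReal_le_ofReal_iff
      (intervalIntegral.integral_nonneg zero_le_one fun s _ => norm_nonneg _)).1 h2
  have h3 : ∫ s in (0 : ℝ)..1, ‖velocity n γ s‖ ^ 2 = C ^ 2 := by
    rw [intervalIntegral.integral_congr (g := fun _ => C ^ 2) fun s hs => by simp only [hC' s hs]]
    simp
  -- The speed `C` of `γ` is its length, hence `C² ≤ (∫ |c'|)² ≤ ∫ |c'|²`; the last step is the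
  -- nonnegativity of this integral.
  have h4 : 0 ≤ ∫ s in (0 : ℝ)..1, (‖velocity n c s‖ - C) ^ 2 :=
    intervalIntegral.integral_nonneg zero_le_one fun s _ => sq_nonneg _
  have h5 : ∫ s in (0 : ℝ)..1, (‖velocity n c s‖ - C) ^ 2 =
      (∫ s in (0 : ℝ)..1, ‖velocity n c s‖ ^ 2) - 2 * C * (∫ s in (0 : ℝ)..1, ‖velocity n c s‖) +
        C ^ 2 := by
    have e : ∀ s, (‖velocity n c s‖ - C) ^ 2 =
        ‖velocity n c s‖ ^ 2 - 2 * C * ‖velocity n c s‖ + C ^ 2 := fun s => by ring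
    simp only [e]
    rw [intervalIntegral.integral_add, intervalIntegral.integral_sub,
      intervalIntegral.integral_const_mul]
    · simp
    · exact (hcont.pow 2).intervalIntegrable _ _
    · exact (hcont.const_mul _).intervalIntegrable _ _
    · exact ((hcont.pow 2).sub (hcont.const_mul _)).intervalIntegrable _ _
    · exact intervalIntegrable_const
  rw [action, action, h3]
  nlinarith

end Minimizing

/-! ### Differentiability in the initial value -/

section DependenceOnInitialData

open scoped NNReal

variable {V : Type*} [NormedAddCommGroup V] [NormedSpace ℝ V] [FiniteDimensional ℝ V]
  {f : ℝ × V → V} {U : Set (ℝ × V)} {a b : ℝ}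

/-- The derivative of a time dependent vector field in space. -/
noncomputable def spaceDeriv (f : ℝ × V → V) (p : ℝ × V) : V →L[ℝ] V :=
  fderiv ℝ f p ∘L ContinuousLinearMap.inr ℝ ℝ V

lemma hasFDerivAt_space {p : ℝ × V} (hf : ContDiffAt ℝ ∞ f p) :
    HasFDerivAt (fun z => f (p.1, z)) (spaceDeriv f p) p.2 :=
  (hf.differentiableAt (by simp)).hasFDerivAt.comp p.2
    ((hasFDerivAt_const p.1 p.2).prodMk (hasFDerivAt_id p.2))

lemma continuousAt_spaceDeriv {p : ℝ × V} (hf : ContDiffAt ℝ ∞ f p) : ContinuousAt (spaceDeriv f) p :=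
  (hf.fderiv_right (m := ∞) (by simp)).continuousAt.clm_comp continuousAt_const

/-- If the zero section solves an equation, then so does, on a given compact interval, a curve through
any small initial value. -/
lemma exists_solution_near_zero (hU : IsOpen U) (hf : ∀ p ∈ U, ContDiffAt ℝ ∞ f p)
    (hU0 : ∀ t ∈ Icc a b, (t, (0 : V)) ∈ U) (hf0 : ∀ t ∈ Icc a b, f (t, 0) = 0) {t₀ : ℝ}
    (ht₀ : t₀ ∈ Icc a b) : ∃ r > (0 : ℝ), ∃ C : ℝ, 0 ≤ C ∧ ∀ w : V, ‖w‖ ≤ r → ∃ z : ℝ → V, z t₀ = w ∧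
      ∀ t ∈ Icc a b, (t, z t) ∈ U ∧ HasDerivWithinAt z (f (t, z t)) (Icc a b) t ∧
        ‖z t‖ ≤ C * ‖w‖ := by
  have hcomplete : CompleteSpace V := FiniteDimensional.complete ℝ V
  have hproper : ProperSpace V := FiniteDimensional.proper_real V
  have hab : a ≤ b := ht₀.1.trans ht₀.2
  obtain ⟨ρ, hρ, hball⟩ : ∃ ρ > (0 : ℝ), ∀ t ∈ Icc a b, ∀ z : V, ‖z‖ ≤ ρ → (t, z) ∈ U := by
    have hev : ∀ᶠ z in 𝓝 (0 : V), ∀ t ∈ Icc a b, (t, z) ∈ U :=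
      isCompact_Icc.eventually_forall_of_forall_eventually fun t ht =>
        (ContinuousAt.preimage_mem_nhds (f := fun p : V × ℝ => (p.2, p.1)) (by fun_prop)
          (hU.mem_nhds (hU0 t ht)))
    obtain ⟨ρ, hρ, h⟩ := Metric.nhds_basis_closedBall.eventually_iff.1 hev
    exact ⟨ρ, hρ, fun t ht z hz => h (by simpa using hz) t ht⟩
  obtain ⟨K, hK⟩ := (isCompact_Icc (a := a) (b := b)).prod (isCompact_closedBall (0 : V) ρ)
    |>.exists_bound_of_continuousOn (f := spaceDeriv f) fun p hp =>
      (continuousAt_spaceDeriv (hf _ (hball p.1 hp.1 p.2 (by simpa using hp.2)))).continuousWithinAt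
  have hK0 : 0 ≤ K := (norm_nonneg _).trans (hK (t₀, 0) ⟨ht₀, by simpa using hρ.le⟩)
  have hlip : ∀ t ∈ Icc a b, LipschitzOnWith K.toNNReal (fun z => f (t, z)) (Metric.closedBall 0 ρ) := by
    intro t ht
    refine (convex_closedBall _ _).lipschitzOnWith_of_nnnorm_hasFDerivWithin_le
      (f' := fun z => spaceDeriv f (t, z)) (fun z hz => ?_) fun z hz => ?_
    · exact (hasFDerivAt_space (hf _ (hball t ht z (by simpa using hz)))).hasFDerivWithinAt
    · rw [← NNReal.coe_le_coe, Real.coe_toNNReal _ hK0]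
      exact hK (t, z) ⟨ht, hz⟩
  have hle : ∀ t ∈ Icc a b, ∀ z ∈ Metric.closedBall (0 : V) ρ, ‖f (t, z)‖ ≤ K * ‖z‖ := by
    intro t ht z hz
    have := (hlip t ht).dist_le_mul z hz 0 (by simpa using hρ.le)
    rwa [hf0 t ht, dist_zero_right, dist_zero_right, Real.coe_toNNReal _ hK0] at this
  -- The equation is cut off outside a small ball.
  let χ : ContDiffBump (0 : V) := ⟨ρ / 2, ρ, by linarith, by linarith⟩
  let φ : V → V := fun y => χ y • y
  have hφ : ContDiff ℝ 1 φ := χ.contDiff.smul contDiff_id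
  have hφs : HasCompactSupport φ := χ.hasCompactSupport.smul_right
  obtain ⟨L, hL⟩ := hφ.lipschitzWith_of_hasCompactSupport hφs one_ne_zero
  have hφle : ∀ y, ‖φ y‖ ≤ ‖y‖ := fun y => by
    simp only [φ, norm_smul]
    refine mul_le_of_le_one_left (norm_nonneg _) ?_
    rw [Real.norm_of_nonneg χ.nonneg]
    exact χ.le_one
  have hφb : ∀ y, φ y ∈ Metric.closedBall (0 : V) ρ := fun y => by
    rw [mem_closedBall_zero_iff]
    by_cases hy : ‖y‖ ≤ ρ
    · exact (hφle y).trans hy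
    · have : χ y = 0 := χ.zero_of_le_dist (by simpa using (not_le.1 hy).le)
      simp only [φ, this, zero_smul, norm_zero]
      exact hρ.le
  set C := Real.exp (K * (b - a)) with hC
  have hC0 : 0 < C := Real.exp_pos _
  refine ⟨ρ / 2 / C, by positivity, C, hC0.le, fun w hw => ?_⟩
  obtain ⟨z, hz0, hz⟩ := exists_solution_of_bounded_lipschitz (f := fun t y => f (t, φ y)) ht₀ w
    (L := (K * ρ).toNNReal) (K := K.toNNReal * L)
    (fun t ht => by
      have := (hlip t ht).comp (hL.lipschitzOnWith (s := univ)) fun y _ => hφb y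
      rwa [lipschitzOnWith_univ] at this)
    (fun y t ht => (ContinuousAt.comp (f := fun t => (t, φ y))
      (hf _ (hball t ht _ (by simpa using hφb y))).continuousAt (by fun_prop)).continuousWithinAt)
    (fun t ht y => by
      rw [Real.coe_toNNReal _ (by positivity)]
      refine (hle t ht _ (hφb y)).trans ?_
      gcongr
      simpa using hφb y)
  have hzle : ∀ t ∈ Icc a b, ‖z t‖ ≤ C * ‖w‖ := by
    intro t ht
    have := norm_le_mul_exp_of_norm_deriv_le hK0 ht₀ hz (fun t ht =>
      (hle t ht _ (hφb _)).trans (mul_le_mul_of_nonneg_left (hφle _) hK0)) ht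
    rw [hz0] at this
    linarith
  have hzρ : ∀ t ∈ Icc a b, ‖z t‖ ≤ ρ / 2 := fun t ht => by
    refine (hzle t ht).trans ?_
    rw [le_div_iff₀ hC0] at hw
    linarith
  refine ⟨z, hz0, fun t ht => ⟨hball t ht _ ((hzρ t ht).trans (by linarith)), ?_, hzle t ht⟩⟩
  have h1 : φ (z t) = z t := by
    have : χ (z t) = 1 := χ.one_of_mem_closedBall (by
      rw [mem_closedBall_zero_iff]
      exact hzρ t ht)
    simp [φ, this]
  have h2 := hz t ht
  rwa [h1] at h2

/-- The solutions near zero are differentiable in the initial value, and the derivative solves the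
linearized equation. -/
lemma hasFDerivAt_solution (hU : IsOpen U) (hf : ∀ p ∈ U, ContDiffAt ℝ ∞ f p)
    (hU0 : ∀ t ∈ Icc a b, (t, (0 : V)) ∈ U) (hf0 : ∀ t ∈ Icc a b, f (t, 0) = 0) {t₀ t₁ : ℝ}
    (ht₀ : t₀ ∈ Icc a b) (ht₁ : t₁ ∈ Icc t₀ b) {r C : ℝ} (hr : 0 < r) (hC : 0 ≤ C) {z : V → ℝ → V}
    (hz0 : ∀ w, ‖w‖ ≤ r → z w t₀ = w)
    (hz : ∀ w, ‖w‖ ≤ r → ∀ t ∈ Icc a b, HasDerivWithinAt (z w) (f (t, z w t)) (Icc a b) t ∧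
      ‖z w t‖ ≤ C * ‖w‖) {ℓ : ℝ → V →L[ℝ] V} (hℓ0 : ℓ t₀ = ContinuousLinearMap.id ℝ V)
    (hℓ : ∀ t ∈ Icc t₀ t₁, HasDerivWithinAt ℓ (spaceDeriv f (t, 0) ∘L ℓ t) (Icc t₀ t₁) t) :
    HasFDerivAt (fun w => z w t₁) (ℓ t₁) 0 := by
  have hsub : Icc t₀ t₁ ⊆ Icc a b := Icc_subset_Icc ht₀.1 ht₁.2
  obtain ⟨K, hK⟩ := (isCompact_Icc (a := t₀) (b := t₁)).exists_bound_of_continuousOn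
    (f := fun t => spaceDeriv f (t, 0)) fun t ht =>
      (ContinuousAt.comp (f := fun t : ℝ => (t, (0 : V)))
        (continuousAt_spaceDeriv (hf _ (hU0 t (hsub ht)))) (by fun_prop)).continuousWithinAt
  have hK0 : 0 ≤ K := (norm_nonneg _).trans (hK t₀ ⟨le_rfl, ht₁.1⟩)
  have hz00 : z 0 t₁ = 0 := by
    have := (hz 0 (by simpa using hr.le) t₁ ⟨ht₀.1.trans ht₁.1, ht₁.2⟩).2
    simpa using this
  set B := (Real.exp ((K + 1) * (t₁ - t₀)) - 1) / (K + 1) with hB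
  have hB0 : 0 ≤ B := div_nonneg (sub_nonneg.2 (Real.one_le_exp
    (mul_nonneg (by linarith) (by linarith [ht₁.1])))) (by linarith)
  rw [hasFDerivAt_iff_isLittleO, Asymptotics.isLittleO_iff]
  intro c hc
  set ε := c / (C * B + 1) with hε
  have hε0 : 0 < ε := by positivity
  -- Near zero, the equation is close to its linearization, uniformly in time.
  obtain ⟨δ, hδ, hlin⟩ : ∃ δ > (0 : ℝ), ∀ t ∈ Icc t₀ t₁, ∀ y : V, ‖y‖ ≤ δ →
      ‖f (t, y) - spaceDeriv f (t, 0) y‖ ≤ ε * ‖y‖ := by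
    have hev : ∀ᶠ y in 𝓝 (0 : V), ∀ t ∈ Icc t₀ t₁,
        (t, y) ∈ U ∧ ‖spaceDeriv f (t, y) - spaceDeriv f (t, 0)‖ < ε := by
      refine isCompact_Icc.eventually_forall_of_forall_eventually fun t ht => ?_
      have h1 := continuousAt_spaceDeriv (hf _ (hU0 t (hsub ht)))
      have h2 : ContinuousAt (fun p : V × ℝ => spaceDeriv f (p.2, p.1)) (0, t) :=
        ContinuousAt.comp (g := spaceDeriv f) (f := fun p : V × ℝ => (p.2, p.1)) (x := (0, t)) h1
          (by fun_prop)
      have h3 : ContinuousAt (fun p : V × ℝ => spaceDeriv f (p.2, 0)) (0, t) :=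
        ContinuousAt.comp (g := spaceDeriv f) (f := fun p : V × ℝ => (p.2, (0 : V))) (x := (0, t)) h1
          (by fun_prop)
      have h4 := (h2.sub h3).norm
      refine Filter.Eventually.and (ContinuousAt.preimage_mem_nhds (f := fun p : V × ℝ => (p.2, p.1))
        (by fun_prop) (hU.mem_nhds (hU0 t (hsub ht)))) (h4.eventually_lt_const ?_)
      simpa using hε0
    obtain ⟨δ, hδ, h⟩ := Metric.nhds_basis_closedBall.eventually_iff.1 hev
    refine ⟨δ, hδ, fun t ht y hy => ?_⟩
    have h1 := (convex_closedBall (0 : V) δ).norm_image_sub_le_of_norm_hasFDerivWithin_le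
      (f := fun y => f (t, y) - spaceDeriv f (t, 0) y) (C := ε)
      (f' := fun y => spaceDeriv f (t, y) - spaceDeriv f (t, 0)) (x := 0) (y := y)
      (fun y hy => ((hasFDerivAt_space (hf _ (h hy t ht).1)).sub
        (spaceDeriv f (t, 0)).hasFDerivAt).hasFDerivWithinAt)
      (fun y hy => (h hy t ht).2.le) (by simpa using hδ.le) (by simpa using hy)
    simpa [hf0 t (hsub ht)] using h1
  have hδ' : 0 < δ / (C + 1) := by positivity
  filter_upwards [Metric.closedBall_mem_nhds (0 : V) (lt_min hr hδ')] with w hw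
  rw [mem_closedBall_zero_iff] at hw
  have hwr : ‖w‖ ≤ r := hw.trans (min_le_left _ _)
  have hwδ : C * ‖w‖ ≤ δ := by
    have := (le_div_iff₀ (by positivity)).1 (hw.trans (min_le_right _ _))
    nlinarith [norm_nonneg w]
  have hd : ∀ t ∈ Icc t₀ t₁, HasDerivWithinAt (fun t => z w t - ℓ t w)
      (f (t, z w t) - spaceDeriv f (t, 0) (ℓ t w)) (Icc t₀ t₁) t := fun t ht => by
    have h1 : HasDerivWithinAt (fun t => ℓ t w) (spaceDeriv f (t, 0) (ℓ t w)) (Icc t₀ t₁) t := by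
      simpa using (hℓ t ht).clm_apply (hasDerivWithinAt_const t _ w)
    exact ((hz w hwr t (hsub ht)).1.mono hsub).sub h1
  -- The error `z w t - ℓ t w` solves the linearized equation up to a term of size `ε ‖w‖`.
  have hg := norm_le_gronwallBound_of_norm_deriv_right_le (f := fun t => z w t - ℓ t w)
    (f' := fun t => f (t, z w t) - spaceDeriv f (t, 0) (ℓ t w)) (δ := 0) (K := K + 1)
    (ε := ε * (C * ‖w‖)) (a := t₀) (b := t₁) (fun t ht => (hd t ht).continuousWithinAt)
    (fun t ht => (hd t ⟨ht.1, ht.2.le⟩).mono_of_mem_nhdsWithin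
        (mem_of_superset (Icc_mem_nhdsGE ht.2) (Icc_subset_Icc_left ht.1)))
    (by simp [hz0 w hwr, hℓ0])
    (fun t ht => by
      have ht' : t ∈ Icc t₀ t₁ := ⟨ht.1, ht.2.le⟩
      have h1 := hlin t ht' (z w t) (((hz w hwr t (hsub ht')).2).trans hwδ)
      have h2 : ‖spaceDeriv f (t, 0) (z w t - ℓ t w)‖ ≤ K * ‖z w t - ℓ t w‖ :=
        ((spaceDeriv f (t, 0)).le_opNorm _).trans
          (mul_le_mul_of_nonneg_right (hK t ht') (norm_nonneg _))
      have h3 : ε * ‖z w t‖ ≤ ε * (C * ‖w‖) :=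
        mul_le_mul_of_nonneg_left (hz w hwr t (hsub ht')).2 hε0.le
      have h4 : f (t, z w t) - spaceDeriv f (t, 0) (ℓ t w) =
          (f (t, z w t) - spaceDeriv f (t, 0) (z w t)) + spaceDeriv f (t, 0) (z w t - ℓ t w) := by
        rw [map_sub]
        abel
      rw [h4]
      refine (norm_add_le _ _).trans ?_
      nlinarith [norm_nonneg (z w t - ℓ t w)]) t₁ ⟨ht₁.1, le_rfl⟩
  rw [gronwallBound_of_K_ne_0 (by linarith)] at hg
  beta_reduce at hg
  rw [hz00, sub_zero, sub_zero]
  refine hg.trans ?_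
  have e1 : 0 * Real.exp ((K + 1) * (t₁ - t₀)) +
      ε * (C * ‖w‖) / (K + 1) * (Real.exp ((K + 1) * (t₁ - t₀)) - 1) = ε * (C * B) * ‖w‖ := by
    rw [hB]
    ring
  rw [e1]
  refine mul_le_mul_of_nonneg_right ?_ (norm_nonneg _)
  have e2 : ε * (C * B + 1) = c := by rw [hε]; field_simp
  linarith

end DependenceOnInitialData

/-! ### Determinants in orthonormal frames -/

section NormDet

variable {U V W : Type*} [NormedAddCommGroup U] [InnerProductSpace ℝ U] [FiniteDimensional ℝ U]
  [NormedAddCommGroup V] [InnerProductSpace ℝ V] [NormedAddCommGroup W] [InnerProductSpace ℝ W]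
  [FiniteDimensional ℝ W]

/-- The determinant of `f`, formed with the metrics, if the metric pulled back by `f` has in the
orthonormal frame `P` the same Gram matrix as `Y`. -/
lemma normDet_eq_abs_det (f : U →ₗ[ℝ] V) (P : W →ₗ[ℝ] U) (hP : Function.Surjective P)
    (hPi : ∀ x y, (inner ℝ (P x) (P y) : ℝ) = inner ℝ x y) (Y : W →ₗ[ℝ] W)
    (h : ∀ x y, (inner ℝ (f (P x)) (f (P y)) : ℝ) = inner ℝ (Y x) (Y y)) :
    f.normDet = |LinearMap.det Y| := by
  let e : W ≃ₗᵢ[ℝ] U := LinearIsometryEquiv.ofSurjective (P.isometryOfInner hPi) hP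
  let b := stdOrthonormalBasis ℝ W
  have h1 := f.normDet_sq_eq_det_gram (b.map e)
  have h2 := Y.normDet_sq_eq_det_gram b
  have h3 : f.normDet ^ 2 = Y.normDet ^ 2 := by
    refine h1.trans (Eq.trans ?_ h2.symm)
    congr 1
    ext i j
    exact h (b i) (b j)
  rw [← Real.norm_eq_abs, ← LinearMap.normDet_eq_norm_det]
  exact (sq_eq_sq₀ f.normDet_nonneg Y.normDet_nonneg).1 h3

end NormDet

/-! ### The differential of the exponential map -/

section ExponentialMap

variable {n : ℕ} {M : Type*} [EMetricSpace M] [ChartedSpace (EuclideanSpace ℝ (Fin n)) M]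
  [IsManifold (𝓡 n) ∞ M] [RiemannianBundle (fun x : M => TangentSpace (𝓡 n) x)]
  [IsContMDiffRiemannianBundle (𝓡 n) ∞ (EuclideanSpace ℝ (Fin n))
    (fun x : M => TangentSpace (𝓡 n) x)]

local notation "𝔼" => EuclideanSpace ℝ (Fin n)

namespace Tube

variable {τ : Tube n M} {γ : ℝ → M}

/-- The geodesic equation in the coordinates of a tube, as a first order equation for the position
and the velocity. -/
noncomputable def phaseField (τ : Tube n M) (q : ℝ × (𝔼 × 𝔼)) : 𝔼 × 𝔼 :=
  (q.2.2, τ.rhs ((q.1, q.2.1), q.2.2))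

/-- The domain of `phaseField`. -/
def phaseDom (τ : Tube n M) : Set (ℝ × (𝔼 × 𝔼)) := {q | (q.1, q.2.1) ∈ τ.dom}

lemma isOpen_phaseDom : IsOpen τ.phaseDom :=
  τ.isOpen_dom.preimage (f := fun q : ℝ × (𝔼 × 𝔼) => (q.1, q.2.1)) (by fun_prop)

lemma contDiffAt_phaseField {q : ℝ × (𝔼 × 𝔼)} (hq : q ∈ τ.phaseDom) :
    ContDiffAt ℝ ∞ τ.phaseField q := by
  have h1 : ContDiffAt ℝ ∞ (fun q : ℝ × (𝔼 × 𝔼) => τ.rhs ((q.1, q.2.1), q.2.2)) q :=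
    ContDiffAt.comp (g := τ.rhs) (f := fun q : ℝ × (𝔼 × 𝔼) => ((q.1, q.2.1), q.2.2)) q
      (contDiffAt_rhs hq) (by fun_prop)
  exact ContDiffAt.prodMk (by fun_prop) h1

/-- Linearizing the geodesic equation at the zero section, which is the geodesic `γ`, gives the Jacobi
equation. -/
lemma IsAdapted.spaceDeriv_phaseField {J : Set ℝ} (h : τ.IsAdapted γ J) {s : ℝ} (hs : s ∈ J)
    (z : 𝔼 × 𝔼) : spaceDeriv τ.phaseField (s, 0) z = (z.2, -τ.curv s z.1) := by
  have hm : ((s, 0) : ℝ × (𝔼 × 𝔼)) ∈ τ.phaseDom := h.mem s hs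
  have h1 : HasFDerivAt (fun q : ℝ × (𝔼 × 𝔼) => ((q.1, q.2.1), q.2.2))
      (((ContinuousLinearMap.fst ℝ ℝ (𝔼 × 𝔼)).prod
        (ContinuousLinearMap.fst ℝ 𝔼 𝔼 ∘L ContinuousLinearMap.snd ℝ ℝ (𝔼 × 𝔼))).prod
        (ContinuousLinearMap.snd ℝ 𝔼 𝔼 ∘L ContinuousLinearMap.snd ℝ ℝ (𝔼 × 𝔼))) (s, 0) :=
    (((ContinuousLinearMap.fst ℝ ℝ (𝔼 × 𝔼)).prod
        (ContinuousLinearMap.fst ℝ 𝔼 𝔼 ∘L ContinuousLinearMap.snd ℝ ℝ (𝔼 × 𝔼))).prod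
        (ContinuousLinearMap.snd ℝ 𝔼 𝔼 ∘L ContinuousLinearMap.snd ℝ ℝ (𝔼 × 𝔼))).hasFDerivAt
  have h2 := HasFDerivAt.comp (g := τ.rhs) ((s, 0) : ℝ × (𝔼 × 𝔼))
    ((contDiffAt_rhs (p := ((s, 0), 0)) (h.mem s hs)).differentiableAt (by simp)).hasFDerivAt h1
  have h3 : HasFDerivAt (fun q : ℝ × (𝔼 × 𝔼) => q.2.2)
      (ContinuousLinearMap.snd ℝ 𝔼 𝔼 ∘L ContinuousLinearMap.snd ℝ ℝ (𝔼 × 𝔼)) (s, 0) :=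
    (ContinuousLinearMap.snd ℝ 𝔼 𝔼 ∘L ContinuousLinearMap.snd ℝ ℝ (𝔼 × 𝔼)).hasFDerivAt
  have h4 : fderiv ℝ τ.phaseField (s, 0) = _ := (h3.prodMk h2).fderiv
  rw [spaceDeriv, h4]
  exact Prod.ext rfl (h.fderiv_rhs hs z.1 z.2)

/-- The coordinates of `exp (γ'(0) + w)` depend differentiably on `w` at `w = 0`, and the derivative is
given by the Jacobi fields that vanish at `0`. -/
lemma IsAdapted.exists_exp_coords [IsRiemannianManifold (𝓡 n) M] [CompleteSpace M]
    (h : τ.IsAdapted γ (Ioo (-1) 2)) : ∃ Y Y' : ℝ → 𝔼 →L[ℝ] 𝔼, IsJacobi τ.curv 1 Y Y' ∧ Y 0 = 0 ∧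
      Y' 0 = ContinuousLinearMap.id ℝ 𝔼 ∧ ∃ e : 𝔼 → 𝔼, e 0 = 0 ∧ HasFDerivAt e (Y 1) 0 ∧
        ∀ᶠ w : 𝔼 in 𝓝 0, riemannianExp n (γ 0) (tder n γ 0 1 + τ.frame 0 w) =
          τ.Φ (1, e w) := by
  have hI : Icc (-(1 / 2) : ℝ) (3 / 2) ⊆ Ioo (-1 : ℝ) 2 :=
    Icc_subset_Ioo (by norm_num) (by norm_num)
  have hJ : Icc (0 : ℝ) 1 ⊆ Ioo (-1 : ℝ) 2 := Icc_subset_Ioo (by norm_num) (by norm_num)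
  have hU0 : ∀ t ∈ Icc (-(1 / 2) : ℝ) (3 / 2), (t, (0 : 𝔼 × 𝔼)) ∈ τ.phaseDom :=
    fun t ht => h.mem t (hI ht)
  have hf0 : ∀ t ∈ Icc (-(1 / 2) : ℝ) (3 / 2), τ.phaseField (t, 0) = 0 :=
    fun t ht => Prod.ext rfl (h.rhs_eq_zero (hI ht))
  have h0 : (0 : ℝ) ∈ Icc (-(1 / 2) : ℝ) (3 / 2) := ⟨by norm_num, by norm_num⟩
  obtain ⟨r, hr, C, hC, hz⟩ := exists_solution_near_zero isOpen_phaseDom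
    (fun _ => contDiffAt_phaseField) hU0 hf0 h0
  choose! z hz0 hz using hz
  have hcont : ContinuousOn (fun t => spaceDeriv τ.phaseField (t, 0)) (Icc 0 1) := fun t ht =>
    (ContinuousAt.comp (g := spaceDeriv τ.phaseField) (f := fun t : ℝ => (t, (0 : 𝔼 × 𝔼)))
      (continuousAt_spaceDeriv (contDiffAt_phaseField (h.mem t (hJ ht))))
      (by fun_prop)).continuousWithinAt
  obtain ⟨ℓ, hℓ0, hℓ⟩ := exists_solution_linear
    (L := fun t => ContinuousLinearMap.compL ℝ (𝔼 × 𝔼) (𝔼 × 𝔼) (𝔼 × 𝔼) (spaceDeriv τ.phaseField (t, 0)))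
    ((ContinuousLinearMap.compL ℝ (𝔼 × 𝔼) (𝔼 × 𝔼) (𝔼 × 𝔼)).continuous.comp_continuousOn hcont)
    (left_mem_Icc.2 zero_le_one) (ContinuousLinearMap.id ℝ (𝔼 × 𝔼))
  have hD := hasFDerivAt_solution isOpen_phaseDom (fun _ => contDiffAt_phaseField) hU0 hf0 h0
    (t₁ := 1) ⟨zero_le_one, by norm_num⟩ hr hC hz0 (fun w hw t ht => (hz w hw t ht).2) hℓ0 hℓ
  let i := ContinuousLinearMap.inr ℝ 𝔼 𝔼
  let Y : ℝ → 𝔼 →L[ℝ] 𝔼 := fun t => ContinuousLinearMap.fst ℝ 𝔼 𝔼 ∘L ℓ t ∘L i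
  let Y' : ℝ → 𝔼 →L[ℝ] 𝔼 := fun t => ContinuousLinearMap.snd ℝ 𝔼 𝔼 ∘L ℓ t ∘L i
  have hd : ∀ t ∈ Icc (0 : ℝ) 1, HasDerivWithinAt (fun t => ℓ t ∘L i)
      ((spaceDeriv τ.phaseField (t, 0) ∘L ℓ t) ∘L i) (Icc 0 1) t := fun t ht =>
    ((hℓ t ht).clm_comp (hasDerivWithinAt_const t _ i)).congr_deriv (by simp)
  refine ⟨Y, Y', ⟨fun t ht => ?_, fun t ht => ?_⟩, ?_, ?_, fun w => (z (0, w) 1).1, ?_, ?_, ?_⟩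
  · refine ((hasDerivWithinAt_const t _ (ContinuousLinearMap.fst ℝ 𝔼 𝔼)).clm_comp
      (hd t ht)).congr_deriv ?_
    ext1 w
    simp [h.spaceDeriv_phaseField (hJ ht), Y']
  · refine ((hasDerivWithinAt_const t _ (ContinuousLinearMap.snd ℝ 𝔼 𝔼)).clm_comp
      (hd t ht)).congr_deriv ?_
    ext1 w
    simp [h.spaceDeriv_phaseField (hJ ht), Y]
  · ext1 w
    simp [Y, hℓ0, i]
  · ext1 w
    simp [Y', hℓ0, i]
  · have := (hz 0 (by simpa using hr.le) 1 ⟨by norm_num, by norm_num⟩).2.2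
    rw [norm_zero, mul_zero, norm_le_zero_iff] at this
    exact congrArg Prod.fst this
  · have h1 : HasFDerivAt (fun w : 𝔼 => ((0 : 𝔼), w)) i 0 := i.hasFDerivAt
    exact (ContinuousLinearMap.fst ℝ 𝔼 𝔼).hasFDerivAt.comp (0 : 𝔼)
      (HasFDerivAt.comp (g := fun w => z w 1) (0 : 𝔼) hD h1)
  · filter_upwards [Metric.closedBall_mem_nhds (0 : 𝔼) hr] with w hw
    have hw' : ‖((0, w) : 𝔼 × 𝔼)‖ ≤ r := by
      rw [Prod.norm_mk, norm_zero]
      exact max_le hr.le (by simpa using hw)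
    set y := z (0, w) with hy
    have hy0 : y 0 = (0, w) := hz0 _ hw'
    let p : ℝ → (ℝ × 𝔼) × 𝔼 := fun t => ((t, (y t).1), (y t).2)
    have hp : ∀ t ∈ Ioo (-(1 / 2) : ℝ) (3 / 2), HasDerivAt p (τ.field (p t)) t := fun t ht => by
      have h1 := (hz _ hw' t (Ioo_subset_Icc_self ht)).2.1.hasDerivAt (Icc_mem_nhds ht.1 ht.2)
      exact ((hasDerivAt_id t).prodMk h1.fst).prodMk h1.snd
    have hgeo := fun t (ht : t ∈ Ioo (-(1 / 2) : ℝ) (3 / 2)) =>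
      τ.isGeodesicAt_of_solution (p := p) (hz _ hw' t (Ioo_subset_Icc_self ht)).1
        (.of_forall fun t => rfl)
        (by filter_upwards [isOpen_Ioo.mem_nhds ht] with t ht using hp t ht)
    have h0' : (0 : ℝ) ∈ Ioo (-(1 / 2) : ℝ) (3 / 2) := ⟨by norm_num, by norm_num⟩
    have hJ0 : (0 : ℝ) ∈ Ioo (-1 : ℝ) 2 := ⟨by norm_num, by norm_num⟩
    have hc0 : τ.Φ (p 0).1 = γ 0 := by
      have : (p 0).1 = (0, 0) := by simp only [p, hy0]
      rw [this]
      exact h.center 0 hJ0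
    have hv : tder n γ 0 1 = tder n τ.Φ (0, 0) (1, 0) := by
      have he : (fun t => τ.Φ (t, (0 : 𝔼))) =ᶠ[𝓝 0] γ := by
        filter_upwards [isOpen_Ioo.mem_nhds hJ0] with t ht using h.center t ht
      exact (velocity_congr he).symm.trans
        (τ.velocity_eq (a := fun _ => 0) (hasDerivAt_const 0 (0 : 𝔼)) (h.mem 0 hJ0))
    have hvel : (velocity n (fun t => τ.Φ (p t).1) 0 : 𝔼) = tder n γ 0 1 + τ.frame 0 w := by
      refine (hgeo 0 h0').2.trans ?_
      have : tder n τ.Φ (p 0).1 (1, (p 0).2) = tder n τ.Φ (0, 0) (1, w) := by simp only [p, hy0]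
      rw [this]
      refine Eq.trans ?_ (congrArg (· + τ.frame 0 w) hv).symm
      have e : ((1, w) : ℝ × 𝔼) = (1, 0) + (0, w) := by simp
      exact (congrArg (tder n τ.Φ (0, 0)) e).trans (map_add (tder n τ.Φ (0, 0)) (1, 0) (0, w))
    have key : ∀ (q q' : M) (v : 𝔼), q = q' → riemannianExp n q v = riemannianExp n q' v := by
      rintro q _ v rfl
      rfl
    refine (key _ _ _ hc0.symm).trans ?_
    exact riemannianExp_eq (c := fun t => τ.Φ (p t).1) isOpen_Ioo isPreconnected_Ioo h0'
      ⟨by norm_num, by norm_num⟩ (fun t ht => (hgeo t ht).1) _ hvel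

/-- In parallel orthonormal frames, the differential of the exponential map is given by the Jacobi
fields that vanish at `0`. -/
lemma IsAdapted.exists_expJacobian_eq [IsRiemannianManifold (𝓡 n) M] [CompleteSpace M]
    (h : τ.IsAdapted γ (Ioo (-1) 2)) : ∃ Y Y' : ℝ → 𝔼 →L[ℝ] 𝔼, IsJacobi τ.curv 1 Y Y' ∧ Y 0 = 0 ∧
      Y' 0 = ContinuousLinearMap.id ℝ 𝔼 ∧
        expJacobian n (γ 0) (velocity n γ 0) = |LinearMap.det (Y 1 : 𝔼 →ₗ[ℝ] 𝔼)| := by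
  have hJ0 : (0 : ℝ) ∈ Ioo (-1 : ℝ) 2 := ⟨by norm_num, by norm_num⟩
  have hJ1 : (1 : ℝ) ∈ Ioo (-1 : ℝ) 2 := ⟨by norm_num, by norm_num⟩
  obtain ⟨Y, Y', hY, hY0, hY0', e, he0, he, hexp⟩ := h.exists_exp_coords
  refine ⟨Y, Y', hY, hY0, hY0', ?_⟩
  let v₀ : TangentSpace (𝓡 n) (γ 0) := velocity n γ 0
  let P₀ : 𝔼 →ₗ[ℝ] TangentSpace (𝓡 n) (γ 0) := (τ.frame 0 : 𝔼 →ₗ[ℝ] 𝔼)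
  have hbij : Function.Bijective P₀ := h.frame_bijective hJ0
  let P : 𝔼 ≃L[ℝ] TangentSpace (𝓡 n) (γ 0) :=
    (LinearEquiv.ofBijective P₀ hbij).toContinuousLinearEquiv
  let E : TangentSpace (𝓡 n) (γ 0) → M := fun v => riemannianExp n (γ 0) v
  let ψ : TangentSpace (𝓡 n) (γ 0) → ℝ × 𝔼 := fun v => (1, e (P.symm (v - v₀)))
  have hE : ∀ᶠ v in 𝓝 v₀, E v = τ.Φ (ψ v) := by
    have h1 : Tendsto (fun v => P.symm (v - v₀)) (𝓝 v₀) (𝓝 0) := by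
      have : Continuous fun v => P.symm (v - v₀) := by fun_prop
      simpa using this.tendsto v₀
    filter_upwards [h1.eventually hexp] with v hv
    refine Eq.trans ?_ hv
    refine congrArg (riemannianExp n (γ 0)) ?_
    have h2 : P (P.symm (v - v₀)) = v - v₀ := P.apply_symm_apply _
    have h3 : v₀ + P (P.symm (v - v₀)) = v := by rw [h2]; abel
    exact h3.symm
  have hψ : HasFDerivAt ψ ((0 : TangentSpace (𝓡 n) (γ 0) →L[ℝ] ℝ).prod
      (Y 1 ∘L P.symm.toContinuousLinearMap)) v₀ := by
    have h1 : HasFDerivAt (fun v => P.symm (v - v₀)) P.symm.toContinuousLinearMap v₀ :=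
      P.symm.hasFDerivAt.comp v₀ ((hasFDerivAt_id v₀).sub_const v₀)
    have h0 : (0 : 𝔼) = P.symm (v₀ - v₀) := by simp
    exact (hasFDerivAt_const (1 : ℝ) v₀).prodMk (HasFDerivAt.comp v₀ (h0 ▸ he) h1)
  have hψ0 : ψ v₀ = (1, 0) := by simp [ψ, he0]
  have hm : ψ v₀ ∈ τ.dom := by
    rw [hψ0]
    exact h.mem 1 hJ1
  have hder := tder_comp (n := n) (Φ := E) ((τ.smooth_Φ _ hm).mdifferentiableAt (by simp))
    hψ.differentiableAt hE
  have hdE : ∀ x : 𝔼, tder n E v₀ (P x) = τ.frame 1 (Y 1 x) := fun x => by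
    rw [hder, hψ.fderiv, hψ0]
    change tder n τ.Φ (1, 0) (0, Y 1 (P.symm (P x))) = _
    rw [P.symm_apply_apply]
    rfl
  have hE0 : E v₀ = γ 1 := by
    rw [hE.self_of_nhds, hψ0]
    exact h.center 1 hJ1
  -- The frames at both ends are orthonormal, and `d exp` maps `P₀ x` to the frame applied to `Y 1 x`.
  refine normDet_eq_abs_det (dExp n (γ 0) v₀ : TangentSpace (𝓡 n) (γ 0) →ₗ[ℝ]
    TangentSpace (𝓡 n) (riemannianExp n (γ 0) v₀)) P₀ hbij.2 (h.metricAt_frame hJ0) _ fun x y => ?_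
  have key : ∀ (p q : M) (v w v' w' : 𝔼), p = q → v = v' → w = w' →
      metricAt n p v w = metricAt n q v' w' := by
    rintro p _ v w _ _ rfl rfl rfl
    rfl
  exact (key _ _ _ _ _ _ hE0 (hdE x) (hdE y)).trans (h.metricAt_frame hJ1 _ _)

end Tube

end ExponentialMap

/-! ### Transfer of Fredholm determinants -/

section FredholmTransfer

variable {H : Type*} [NormedAddCommGroup H] [InnerProductSpace ℝ H] {T : H →L[ℝ] H} {d : ℝ}

/-- The Fredholm determinant of a nonnegative operator is nonnegative. -/
lemma HasFredholmDet.nonneg (hT : HasFredholmDet T d) (hpos : ∀ x, 0 ≤ (inner ℝ x (T x) : ℝ)) :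
    0 ≤ d := by
  set K := T - ContinuousLinearMap.id ℝ H with hK
  have hs : (K : H →ₗ[ℝ] H).IsSymmetric := fun x y => by
    have := hT.symmetric x y
    simp only [ContinuousLinearMap.coe_coe] at this
    simp [hK, inner_sub_left, inner_sub_right, this]
  refine ge_of_tendsto hT.hasProd (.of_forall fun t => Finset.prod_nonneg fun μ _ => ?_)
  rw [hs.isFinitelySemisimple.maxGenEigenspace_eq_eigenspace]
  rcases le_or_gt 0 (1 + μ) with h | h
  · exact pow_nonneg h _
  · have hbot : Module.End.eigenspace (K : H →ₗ[ℝ] H) μ = ⊥ := by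
      refine (Submodule.eq_bot_iff _).2 fun x hx => ?_
      have h1 : K x = μ • x := Module.End.mem_eigenspace_iff.1 hx
      have h2 : T x = (1 + μ) • x := by
        have h3 : K x = T x - x := rfl
        rw [add_smul, one_smul, ← h1, h3]
        abel
      have h4 := hpos x
      rw [h2, real_inner_smul_right, real_inner_self_eq_norm_sq] at h4
      by_contra hne
      have := norm_pos_iff.2 hne
      nlinarith [sq_pos_of_pos this]
    rw [hbot, finrank_bot, pow_zero]
    exact zero_le_one

/-- The Fredholm determinant is invariant under isometries. -/
lemma HasFredholmDet.of_isometry {H' : Type*} [SeminormedAddCommGroup H'] [InnerProductSpace ℝ H']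
    (hT : HasFredholmDet T d) (V : H ≃ₗᵢ[ℝ] H') {T' : H' →L[ℝ] H'} (h : ∀ x, T' (V x) = V (T x)) :
    HasFredholmDet T' d := by
  set K := T - ContinuousLinearMap.id ℝ H with hK
  set K' := T' - ContinuousLinearMap.id ℝ H' with hK'
  have hKV : ∀ x, K' (V x) = V (K x) := fun x => by
    change T' (V x) - V x = V (T x - x)
    rw [h, map_sub]
  refine ⟨fun x y => ?_, ?_, ?_⟩
  · obtain ⟨x, rfl⟩ := V.surjective x
    obtain ⟨y, rfl⟩ := V.surjective y
    have := hT.symmetric x y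
    simp only [ContinuousLinearMap.coe_coe] at this ⊢
    rw [h, h, V.inner_map_map, V.inner_map_map, this]
  · obtain ⟨a, b, hsum, hab⟩ := hT.traceClass
    refine ⟨fun k => V (a k), fun k => V (b k), by simpa using hsum, fun x => ?_⟩
    obtain ⟨x, rfl⟩ := V.surjective x
    have h1 := (hab x).map V V.continuous
    change HasSum _ (K' (V x))
    rw [hKV]
    have e : (V ∘ fun k => (inner ℝ (a k) x : ℝ) • b k) =
        fun k => (inner ℝ (V (a k)) (V x) : ℝ) • V (b k) := by
      ext1 k
      rw [Function.comp_apply, map_smul, V.inner_map_map]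
    rwa [e] at h1
  · have hpow : ∀ (μ : ℝ) (k : ℕ) (x : H), (((K' : H' →ₗ[ℝ] H') - μ • 1) ^ k) (V x) =
        V ((((K : H →ₗ[ℝ] H) - μ • 1) ^ k) x) := by
      intro μ k
      induction k with
      | zero => exact fun x => rfl
      | succ k ih =>
        intro x
        rw [pow_succ, pow_succ, Module.End.mul_apply, Module.End.mul_apply, ← ih]
        congr 1
        change K' (V x) - μ • V x = V (K x - μ • x)
        rw [hKV, map_sub, map_smul]
    have hmap : ∀ μ, Module.finrank ℝ (Module.End.maxGenEigenspace (K' : H' →ₗ[ℝ] H') μ) =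
        Module.finrank ℝ (Module.End.maxGenEigenspace (K : H →ₗ[ℝ] H) μ) := by
      intro μ
      have : Module.End.maxGenEigenspace (K' : H' →ₗ[ℝ] H') μ =
          (Module.End.maxGenEigenspace (K : H →ₗ[ℝ] H) μ).map
            (V.toLinearEquiv : H →ₗ[ℝ] H') := by
        ext y
        obtain ⟨x, rfl⟩ := V.surjective y
        rw [Submodule.mem_map]
        simp only [Module.End.mem_maxGenEigenspace, hpow]
        constructor
        · rintro ⟨k, hk⟩
          exact ⟨x, ⟨k, V.injective (hk.trans (map_zero V).symm)⟩, rfl⟩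
        · rintro ⟨z, ⟨k, hk⟩, hz⟩
          obtain rfl : z = x := V.injective hz
          exact ⟨k, by rw [hk, map_zero]⟩
      rw [this]
      exact (V.toLinearEquiv.submoduleMap _).finrank_eq.symm
    exact (funext fun μ => congrArg ((1 + μ) ^ ·) (hmap μ) :
      (fun μ : ℝ => (1 + μ) ^ Module.finrank ℝ
        (Module.End.maxGenEigenspace (K' : H' →ₗ[ℝ] H') μ)) = fun μ => _) ▸ hT.hasProd

end FredholmTransfer

end PathGeometry

theorem mainTheorem4 {n : ℕ} {M : Type*} [EMetricSpace M]
    [ChartedSpace (EuclideanSpace ℝ (Fin n)) M] [IsManifold (𝓡 n) ∞ M]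
    [RiemannianBundle (fun x : M => TangentSpace (𝓡 n) x)]
    [IsContMDiffRiemannianBundle (𝓡 n) ∞ (EuclideanSpace ℝ (Fin n))
      (fun x : M => TangentSpace (𝓡 n) x)]
    [IsRiemannianManifold (𝓡 n) M] [CompleteSpace M]
    (x y : M) (γ : PathGeometry.SmoothCurve n M)
    (hγ : PathGeometry.IsMinimizingGeodesic n x y γ)
    (hunique : ∀ c : PathGeometry.SmoothCurve n M,
      PathGeometry.IsMinimizingGeodesic n x y c → EqOn c γ (Icc (0 : ℝ) 1)) :
    ∃ T : PathGeometry.PathTangent γ →L[ℝ] PathGeometry.PathTangent γ,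
      PathGeometry.IsActionHessian γ T ∧
      (∀ T', PathGeometry.IsActionHessian γ T' → T' = T) ∧
      PathGeometry.HasFredholmDet T
        (PathGeometry.expJacobian n (γ 0) (PathGeometry.velocity n γ 0)) := by
  obtain ⟨τ, h⟩ := PathGeometry.exists_adapted_tube hγ.geodesic
  have hJ : Icc (0 : ℝ) 1 ⊆ Ioo (-1 : ℝ) 2 := Icc_subset_Ioo (by norm_num) (by norm_num)
  have hpos := h.inner_jacobiOp_nonneg hγ.action_le
  obtain ⟨Y, Y', hY, hY0, hY0', hexp⟩ := h.exists_expJacobian_eq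
  have hdet := PathGeometry.hasFredholmDet_model (h.continuousOn_curv.mono hJ)
    (fun s hs => h.curv_isSymmetric isOpen_Ioo (hJ hs)) hpos hY hY0 hY0'
  refine ⟨h.hessian, h.isActionHessian, fun T' hT' => h.eq_hessian hT', ?_⟩
  rw [hexp, abs_of_nonneg (hdet.nonneg hpos)]
  exact hdet.of_isometry h.isometry h.hessian_isometry
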